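/- **Setting.** Let $r\in\{1,2,\dots,\infty\}$ and let $h:\mathbb R^2\to\mathbb R$ be a $C^\infty$ function with $0$ as a regular value. Put $\Sigma=\{h=0\}$, $\Sigma^+=\{h>0\}$, $\Sigma^-=\{h<0\}$. For a vector field $V$ write $Vf=\langle V,\nabla f\rangle$; $V$ is transversal to $\Sigma$ at $p\in\Sigma$ if $Vh(p)\ne 0$. Let $\Omega^r$ be the set of pairs $Z=(X,Y)$ of $C^r$ vector fields on $\mathbb R^2$ with the product of the $C^r$ topologies (uniform convergence of all derivatives of order $\le r$ on compact sets); $Z$ is the nonsmooth vector field equal to $X$ on $\Sigma^+$ and to $Y$ on $\Sigma^-$. The crossing region of $Z$ is $\Sigma^c=\{p\in\Sigma: Xh(p)\,Yh(p)>0\}$. A visible fold of $X$ is a point $p\in\Sigma$ with $Xh(p)=0<X(Xh)(p)$. **Hypotheses.** Let $Z_0=(X_0,Y_0)\in\Omega^r$, let $0\in\Sigma$, and assume: - BS(1): $0$ is a hyperbolic saddle of $X_0$, and its stable and unstable manifolds $W^s$, $W^u$ are transversal to $\Sigma$ at $0$; - BS(2): $Y_0$ is transversal to $\Sigma$, $W^u$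 and $W^s$ at $0$; - BS(3): $0$ is a hyperbolic singularity of the normalized sliding vector field $(Y_0h)X_0-(X_0h)Y_0$ on $\Sigma$; - BSC(1): there is $P\in\Sigma$, $P\neq 0$, such that $X_0$ is transversal to $\Sigma$ at $P$ and the backward $X_0$-orbit of $P$ lies in $\Sigma^+$ for all $t<0$ and tends to $0$ as $t\to-\infty$; - BSC(2): $Y_0$ is transversal to $\Sigma$ at $P$, and the $Y_0$-orbit of $P$ reaches $0$ at some time $t_0>0$ and lies in $\Sigma^-$ for $0<t<t_0$. Let $x$ be a smooth coordinate on $\Sigma$ near $0$, vanishing at $0$, such that small $x>0$ corresponds to points of the crossing region of $Z_0$, and let $w$ be a smooth coordinate on $\Sigma$ near $P$, vanishing at $P$, that induces the same orientation as $x$, where $\Sigma$ is oriented by $\nabla h$ turned by a right angle. Points of $\Sigma$ near $0$ are identified with their coordinate $x$, and points near $P$ with their coordinate $w$. **Conclusion.** To $Z\in\Omega^r$ one can assign $a_Z\in\mathbb R$ and $S_Z\in\mathbb R^2$ with $a_Z\to0$ and $S_Z\to 0$ as $Z\to Z_0$, such that for every neighbourhood $U$ of $0$ in $\mathbb R^2$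 there are a smooth embedded arc $\sigma\subset\Sigma^+\cap U$, parametrized by $u\in(-\eta,\eta)$, whose point $u=0$ lies on the $X_0$-orbit that runs in $\Sigma^+$ to $P$, an interval $(-\eta_P,\eta_P)$ of values of $w$, and a neighbourhood $\mathcal V$ of $Z_0$ in $\Omega^r$ with the following property. For every $Z=(X,Y)\in\mathcal V$ the point $S_Z\in U$ is a hyperbolic saddle of $X$, $\sigma$ is transversal to $X$, and there are $\delta_Z>0$ and maps $\pi_Z,\rho_1,\rho_2,\rho_3$ such that: 1. *(First return map.)* The points $x\in[a_Z,a_Z+\delta_Z)$ lie in the coordinate domain and in $U$, with $Yh>0$ there, and those with $x>a_Z$ lie in $\Sigma^c$. The function $\pi_Z$ is continuous on $[a_Z,a_Z+\delta_Z)$. For $x\in(a_Z,a_Z+\delta_Z)$, the trajectory of $Z$ from $x$ runs in $\Sigma^+$ along $X$ to a point of $\Sigma^c$ and then in $\Sigma^-$ along $Y$ until it meets $\Sigma$ again at $\pi_Z(x)$, and $\pi_Z(x)$ is the only point of the coordinate domain with this property. If $h(S_Z)<0$, the trajectory from $a_Z$ returns to $\pi_Z(a_Z)$ in this same way. If $h(S_Z)\ge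 0$, then $\pi_Z(a_Z)$ is reached from $a_Z$ through the saddle: $a_Z$ is $S_Z$ or its forward $X$-orbit lies in $\Sigma^+$ for $t>0$ and tends to $S_Z$, an orbit of the unstable manifold of $S_Z$ runs in $\Sigma^+$ from $S_Z$ to a point of $\Sigma^c$, and from there the $Y$-orbit runs in $\Sigma^-$ to $\pi_Z(a_Z)$. 2. *(Factorization.)* $\pi_Z=\rho_3\circ\rho_2\circ\rho_1$ on $[a_Z,a_Z+\delta_Z)$, where: - $\rho_1:[a_Z,a_Z+\delta_Z)\to(-\eta,\eta)$ is continuous and strictly increasing, and is the transition map from $\Sigma$ to $\sigma$ near a fold or a saddle. For $x>a_Z$, $\rho_1(x)$ is the first point at which the $X$-orbit of $x$ meets $\sigma$, and the orbit lies in $\Sigma^+\cap U$ in between. If $h(S_Z)<0$ (virtual saddle), $a_Z$ is a visible fold of $X$ and $\rho_1(a_Z)$ is obtained in the same way. If $h(S_Z)=0$ (boundary saddle), $a_Z$ is the point $S_Z$; if $h(S_Z)>0$ (real saddle), $a_Z$ is a point of the stable manifold of $S_Z$ whose forward $X$-orbit lies in $(\Sigma^+\cap U)\setminus\sigma$ for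 $t>0$ and tends to $S_Z$; in both cases $\rho_1(a_Z)$ is the point of $\sigma$ from which the backward $X$-orbit lies in $(\Sigma^+\cap U)\setminus\sigma$ for $t<0$ and tends to $S_Z$. - $\rho_2:(-\eta,\eta)\to(-\eta_P,\eta_P)$ is an orientation reversing $C^r$ diffeomorphism onto its image, namely the transition map along $X$, in $\Sigma^+$, from $\sigma$ to $\Sigma$ near $P$. - $\rho_3$ is an orientation reversing $C^r$ diffeomorphism of $(-\eta_P,\eta_P)$ onto its image in the domain of the coordinate $x$, namely the transition map along $Y$, in $\Sigma^-$, from $\Sigma$ near $P$ to $\Sigma$ near $0$. -/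

import Mathlib

open Set Filter Topology
open scoped ContDiff

namespace BoundarySaddle

/-- The phase plane. -/
abbrev Plane : Type := EuclideanSpace ℝ (Fin 2)

/-- The space of vector fields of class `C^r` on the plane. -/
structure VField (r : ℕ∞) where
  toFun : Plane → Plane
  contDiff' : ContDiff ℝ r toFun

instance (r : ℕ∞) : CoeFun (VField r) (fun _ => Plane → Plane) := ⟨VField.toFun⟩

/-- The `k`-th derivative of a `C^r` vector field, `k ≤ r`, as a continuous map. -/
noncomputable def VField.iterDeriv {r : ℕ∞} (k : ℕ) (hk : (k : ℕ∞) ≤ r) (X : VField r) :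
    C(Plane, Plane [×k]→L[ℝ] Plane) :=
  ⟨iteratedFDeriv ℝ k X.toFun, X.contDiff'.continuous_iteratedFDeriv (by exact_mod_cast hk)⟩

/-- The (weak, i.e. compact-open) `C^r` topology: uniform convergence on compact sets of all
derivatives of order at most `r`. It is coarser than the strong (Whitney) topology, so its
neighbourhoods are also neighbourhoods in the latter. -/
noncomputable instance (r : ℕ∞) : TopologicalSpace (VField r) :=
  ⨅ (k : ℕ) (hk : (k : ℕ∞) ≤ r),
    TopologicalSpace.induced (VField.iterDeriv k hk) inferInstance

/-- Nonsmooth vector fields `Z = (X, Y)` of class `C^r`, with the product topology; `X` is used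
where `h ≥ 0` and `Y` where `h ≤ 0`. -/
abbrev NSField (r : ℕ∞) : Type := VField r × VField r

/-! ### The switching manifold -/

/-- The switching manifold `Σ`. -/
def switching (h : Plane → ℝ) : Set Plane := {p | h p = 0}

/-- The region `Σ⁺`. -/
def posRegion (h : Plane → ℝ) : Set Plane := {p | 0 < h p}

/-- The region `Σ⁻`. -/
def negRegion (h : Plane → ℝ) : Set Plane := {p | h p < 0}

/-- The Lie derivative `Xf`. -/
noncomputable def lieD (X : Plane → Plane) (f : Plane → ℝ) (p : Plane) : ℝ :=
  fderiv ℝ f p (X p)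

/-- The crossing region `Σᶜ`. -/
def crossing (h : Plane → ℝ) (X Y : Plane → Plane) : Set Plane :=
  {p | p ∈ switching h ∧ 0 < lieD X h p * lieD Y h p}

/-- A visible fold (visible quadratic tangency) of `X` at `p ∈ Σ`. -/
def IsVisibleFold (h : Plane → ℝ) (X : Plane → Plane) (p : Plane) : Prop :=
  p ∈ switching h ∧ lieD X h p = 0 ∧ 0 < lieD X (lieD X h) p

/-- The normalized sliding vector field `(Yh) X - (Xh) Y`. -/
noncomputable def slidingN (h : Plane → ℝ) (X Y : Plane → Plane) (p : Plane) : Plane :=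
  lieD Y h p • X p - lieD X h p • Y p

/-- The sign of this number is the orientation of a vector `v` tangent to `Σ` at `p`, for the
orientation of `Σ` given by the gradient of `h` turned counterclockwise by a right angle: it is
the determinant of the pair `(∇h(p), v)`. -/
noncomputable def sigmaOrient (h : Plane → ℝ) (p v : Plane) : ℝ :=
  fderiv ℝ h p (EuclideanSpace.single 0 1) * v 1 - fderiv ℝ h p (EuclideanSpace.single 1 1) * v 0

/-- `c`, restricted to `(-ε, ε)`, is (the inverse of) a smooth local chart of `Σ` around
`p = c 0`. -/
structure IsSigmaChart (h : Plane → ℝ) (p : Plane) (c : ℝ → Plane) (ε : ℝ) : Prop where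
  pos : 0 < ε
  center : c 0 = p
  smooth : ContDiffOn ℝ ∞ c (Ioo (-ε) ε)
  inj : InjOn c (Ioo (-ε) ε)
  immersion : ∀ x ∈ Ioo (-ε) ε, deriv c x ≠ 0
  mem : ∀ x ∈ Ioo (-ε) ε, c x ∈ switching h

/-! ### Trajectories -/

/-- The trajectory of `V` through `p` arrives at `q` in positive time, and lies in `D` at all
times strictly in between. -/
def IsTransit (V : Plane → Plane) (D : Set Plane) (p q : Plane) : Prop :=
  ∃ T : ℝ, 0 < T ∧ ∃ γ : ℝ → Plane, IsIntegralCurveOn γ (fun _ => V) (Icc 0 T) ∧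
    γ 0 = p ∧ γ T = q ∧ ∀ t ∈ Ioo 0 T, γ t ∈ D

/-- The trajectory of `V` through `p` lies in `D` at all negative times and tends to `S` as
`t → -∞`. -/
def ComesFrom (V : Plane → Plane) (D : Set Plane) (S p : Plane) : Prop :=
  ∃ γ : ℝ → Plane, IsIntegralCurveOn γ (fun _ => V) (Iic 0) ∧
    γ 0 = p ∧ (∀ t < 0, γ t ∈ D) ∧ Tendsto γ atBot (𝓝 S)

/-- The trajectory of `V` through `p` lies in `D` at all positive times and tends to `S` as
`t → +∞`. -/
def GoesTo (V : Plane → Plane) (D : Set Plane) (S p : Plane) : Prop :=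
  ∃ γ : ℝ → Plane, IsIntegralCurveOn γ (fun _ => V) (Ici 0) ∧
    γ 0 = p ∧ (∀ t > 0, γ t ∈ D) ∧ Tendsto γ atTop (𝓝 S)

/-- Passage from `p` to `q` through the equilibrium `S`: the point `p` is `S` itself or lies on
its stable manifold, `q` lies on its unstable manifold, and the orbits involved lie in `D`. -/
def IsSaddleTransit (V : Plane → Plane) (D : Set Plane) (S p q : Plane) : Prop :=
  (p = S ∨ GoesTo V D S p) ∧ ComesFrom V D S q

/-- The local unstable manifold of `V` at `S` relative to a neighbourhood `U` of `S`. -/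
def localUnstable (V : Plane → Plane) (S : Plane) (U : Set Plane) : Set Plane :=
  {p | p ∈ U ∧ ComesFrom V U S p}

/-- The local stable manifold of `V` at `S` relative to a neighbourhood `U` of `S`. -/
def localStable (V : Plane → Plane) (S : Plane) (U : Set Plane) : Set Plane :=
  {p | p ∈ U ∧ GoesTo V U S p}

/-- Hyperbolic saddle. -/
def IsHyperbolicSaddle (V : Plane → Plane) (S : Plane) : Prop :=
  V S = 0 ∧ ∃ l₁ l₂ : ℝ, l₂ < 0 ∧ 0 < l₁ ∧
    Module.End.HasEigenvalue (fderiv ℝ V S : Plane →ₗ[ℝ] Plane) l₁ ∧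
    Module.End.HasEigenvalue (fderiv ℝ V S : Plane →ₗ[ℝ] Plane) l₂

/-- The first return of `Z = (X, Y)` from `p ∈ Σ`, through `Σ⁺`, a crossing point, and `Σ⁻`, to
`q ∈ Σ`. -/
def IsFirstReturn (h : Plane → ℝ) (X Y : Plane → Plane) (p q : Plane) : Prop :=
  p ∈ switching h ∧ q ∈ switching h ∧ ∃ m ∈ crossing h X Y,
    IsTransit X (posRegion h) p m ∧ IsTransit Y (negRegion h) m q

/-- The same, when the passage through `Σ⁺` is along the invariant manifolds of an equilibrium
`S` of `X`. -/
def IsSaddleReturn (h : Plane → ℝ) (X Y : Plane → Plane) (S p q : Plane) : Prop :=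
  p ∈ switching h ∧ q ∈ switching h ∧ ∃ m ∈ crossing h X Y,
    IsSaddleTransit X (posRegion h) S p m ∧ IsTransit Y (negRegion h) m q

/-! ### The hypotheses on the unperturbed vector field -/

/-- The boundary saddle conditions BS(1)-BS(3) at `S`. Tangent vectors of the invariant manifolds
at `S` are the elements of the tangent cones of the local manifolds. -/
structure BS (h : Plane → ℝ) (X Y : Plane → Plane) (S : Plane) : Prop where
  mem : S ∈ switching h
  saddle : IsHyperbolicSaddle X S
  unstable_transversal : ∃ U ∈ 𝓝 S,
    ∀ v ∈ tangentConeAt ℝ (localUnstable X S U) S, fderiv ℝ h S v = 0 → v = 0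
  stable_transversal : ∃ U ∈ 𝓝 S,
    ∀ v ∈ tangentConeAt ℝ (localStable X S U) S, fderiv ℝ h S v = 0 → v = 0
  Y_transversal : lieD Y h S ≠ 0
  Y_transversal_unstable : ∃ U ∈ 𝓝 S, Y S ∉ tangentConeAt ℝ (localUnstable X S U) S
  Y_transversal_stable : ∃ U ∈ 𝓝 S, Y S ∉ tangentConeAt ℝ (localStable X S U) S
  sliding_zero : slidingN h X Y S = 0
  sliding_hyperbolic : ∃ μ : ℝ, μ ≠ 0 ∧
    ∀ v, fderiv ℝ h S v = 0 → fderiv ℝ (slidingN h X Y) S v = μ • v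

/-- The conditions BSC(1)-BSC(2) on the cycle, with `P` the point where the branch in `Σ⁺` of the
unstable manifold of `S` meets `Σ`. -/
structure BSC (h : Plane → ℝ) (X Y : Plane → Plane) (S P : Plane) : Prop where
  mem : P ∈ switching h
  ne : P ≠ S
  X_transversal : lieD X h P ≠ 0
  unstable : ComesFrom X (posRegion h) S P
  Y_transversal : lieD Y h P ≠ 0
  Y_transit : IsTransit Y (negRegion h) P S

/-! ### Vocabulary of the conclusion -/

/-- `f` is an orientation reversing `C^r` diffeomorphism of `I` onto an open set. -/
def IsOrientationReversingDiffeo (r : ℕ∞) (f : ℝ → ℝ) (I : Set ℝ) : Prop :=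
  ContDiffOn ℝ r f I ∧ StrictAntiOn f I ∧ IsOpen (f '' I) ∧
    ∃ g : ℝ → ℝ, ContDiffOn ℝ r g (f '' I) ∧ ∀ x ∈ I, g (f x) = x

/-- `s`, restricted to `(-η, η)`, parametrizes a smooth embedded arc in `D` that is transversal
to `V`. -/
def IsSection (V : Plane → Plane) (D : Set Plane) (s : ℝ → Plane) (η : ℝ) : Prop :=
  ContDiffOn ℝ ∞ s (Ioo (-η) η) ∧ InjOn s (Ioo (-η) η) ∧
    ∀ u ∈ Ioo (-η) η, s u ∈ D ∧ LinearIndependent ℝ ![V (s u), deriv s u]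

end BoundarySaddle

open BoundarySaddle

/-! Near the saddle everything follows from a linear model. Take eigenvectors `e₁, e₂` of the saddle
of `X₀` as axes; transversality of the invariant manifolds to Σ allows scaling them so that `dh = ℓ₁
+ ℓ₂`. To first order the field is `(α ℓ₁, -β ℓ₂)`, the Lie derivative `Xh` is `α ℓ₁ - β ℓ₂`, and Σ
runs in the direction `e₁ - e₂`, along which `Xh` increases. On one fixed box and for all fields
near `X₀` these relations hold up to a small relative error `κ` (`UniformModel`, `LocalModel`). Only
first derivatives of the field are controlled, so `r = 1` is covered, and no linearization or
invariant manifold theorem is needed: the tool is the cone estimate `SaddlePair.cone` for the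
difference of two orbits. A difference in the cone `|ℓ₂| ≤ M ℓ₁` stays there and grows
exponentially. Consequently two orbits that never leave the box differ by a vector of the stable
cone, and two points of the section `ℓ₁ = v` with long backward orbits in the box are close
(`section_dist_le`).

The base point `a` is the zero of `Xh` on Σ if the saddle `S` is virtual, `S` itself if it lies on
Σ, and a point of its stable manifold if it is real; the last is found as the last point with `h ≤
0` on an orbit that tends to `S`. In all cases its distance from `S` is at most `4 |h S|`, so it
tends to `0` with `S`.

For `ρ₁`, a point of Σ beyond the base point lies in the unstable cone of a reference orbit: the
constant orbit `S` for a virtual saddle, the orbit of the base point otherwise. Hence it reaches the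
section. It stays in Σ⁺ because `X(Xh) > -β Xh` in the cone (virtual case), or because `h` grows
relative to the reference orbit (other cases). Away from the base point `ρ₁` is differentiable with
positive derivative, by a comparison of orientations. At the base point, continuity is that of a
transversal hitting time (virtual case); otherwise the exit times tend to infinity and
`section_dist_le` forces convergence to the unstable manifold. The same contraction, over a time
`T₀` fixed by `X₀`, keeps the value at the base point within `η` of the unstable branch of `X₀`.

The maps `ρ₂` and `ρ₃` are transits between transversal arcs, smooth by the implicit function
theorem (`exists_transit_family`). A flow preserves the orientation of the plane; as the field
enters the region at one end and leaves it at the other, arcs oriented alike are matched with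
reversed orientation (`exists_reversing_transit`).

Fields need not be complete, so each is cut off outside a large ball that contains the orbits
concerned. The flow of the cut off field is global, `C^r`, and jointly continuous in field, time and
point. -/

namespace BoundarySaddle

/-! ### Global flows of bounded Lipschitz fields. -/

section Flow

variable {E : Type*} [NormedAddCommGroup E] [NormedSpace ℝ E]

/-- `φ` is the global flow of the autonomous field `V`. -/
structure IsGlobalFlow (V : E → E) (φ : ℝ → E → E) : Prop where
  zero : ∀ x, φ 0 x = x
  hasDerivAt : ∀ x t, HasDerivAt (fun s => φ s x) (V (φ t x)) t

/-- Picard–Lindelöf gives a solution on each interval `[-(n+1), n+1]`, and uniqueness glues them.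
The global bounds on `V` are harmless because the fields concerned have compact support. -/
theorem exists_isGlobalFlow [CompleteSpace E] {V : E → E} {K M : NNReal} (hK : LipschitzWith K V)
    (hM : ∀ x, ‖V x‖ ≤ M) : ∃ φ, IsGlobalFlow V φ := by
  have key : ∀ x : E, ∃ γ : ℝ → E, γ 0 = x ∧ ∀ t, HasDerivAt γ (V (γ t)) t := by
    intro x
    have h1 : ∀ n : ℕ, ∃ α : ℝ → E, α 0 = x ∧
        ∀ t ∈ Ioo (-(n + 1 : ℝ)) (n + 1), HasDerivAt α (V (α t)) t := by
      intro n
      have hn : (0 : ℝ) ∈ Icc (-(n + 1 : ℝ)) (n + 1) := by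
        constructor <;> linarith [n.cast_nonneg (α := ℝ)]
      -- At speed at most `M`, the ball of radius `M (n + 1)` is not left within time `n + 1`.
      have hp : IsPicardLindelof (fun _ => V) (⟨0, hn⟩ : Icc (-(n + 1 : ℝ)) (n + 1)) x
          (M * (n + 1)) 0 M K := by
        refine IsPicardLindelof.of_time_independent (fun y _ => hM y) hK.lipschitzOnWith ?_
        simp
      obtain ⟨α, h0, hα⟩ := hp.exists_eq_forall_mem_Icc_hasDerivWithinAt₀
      exact ⟨α, h0, fun t ht => (hα t ⟨ht.1.le, ht.2.le⟩).hasDerivAt (Icc_mem_nhds ht.1 ht.2)⟩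
    choose α hα0 hα using h1
    have heq : ∀ m n : ℕ, m ≤ n → EqOn (α m) (α n) (Ioo (-(m + 1 : ℝ)) (m + 1)) := by
      intro m n hmn
      have hmn' : (m : ℝ) ≤ n := by exact_mod_cast hmn
      have hm0 : (0 : ℝ) ≤ m := m.cast_nonneg
      refine ODE_solution_unique_of_mem_Ioo (v := fun _ => V) (s := fun _ => univ) (K := K)
        (t₀ := 0) (fun _ _ => hK.lipschitzOnWith) ⟨by linarith, by linarith⟩
        (fun t ht => ⟨hα m t ht, mem_univ _⟩)
        (fun t ht => ⟨hα n t ⟨by linarith [ht.1], by linarith [ht.2]⟩, mem_univ _⟩) ?_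
      rw [hα0, hα0]
    -- The index varies with `t`; around a given `t` it may be replaced by the fixed index `⌈|t|⌉ +
    -- 1`, whose interval contains a neighbourhood of `t`.
    refine ⟨fun t => α ⌈|t|⌉₊ t, by simp [hα0], fun t => ?_⟩
    set n := ⌈|t|⌉₊ + 1 with hn
    have hcl : ∀ s : ℝ, |s| ≤ (n : ℝ) → α ⌈|s|⌉₊ s = α n s := by
      intro s hs
      refine heq _ _ (Nat.ceil_le.2 hs) ?_
      have := Nat.le_ceil |s|
      constructor <;> linarith [abs_le.1 this]
    have htn : |t| < (n : ℝ) := by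
      have := Nat.le_ceil |t|
      rw [hn]; push_cast; linarith
    have h2 : (fun t : ℝ => α ⌈|t|⌉₊ t) =ᶠ[𝓝 t] α n := by
      have : ∀ᶠ s in 𝓝 t, |s| < (n : ℝ) := continuous_abs.continuousAt.eventually_lt_const htn
      filter_upwards [this] with s hs using hcl s hs.le
    have h3 := hα n t ⟨by linarith [(abs_lt.1 htn).1], by linarith [(abs_lt.1 htn).2]⟩
    have := h3.congr_of_eventuallyEq h2
    rwa [← hcl t htn.le] at this
  choose φ h0 hd using key
  exact ⟨fun t x => φ x t, h0, fun x t => hd x t⟩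

namespace IsGlobalFlow

variable {V : E → E} {φ : ℝ → E → E} {K : NNReal}

theorem eq_of_hasDerivAt (hφ : IsGlobalFlow V φ) (hK : LipschitzWith K V) {γ : ℝ → E}
    (hγ : ∀ t, HasDerivAt γ (V (γ t)) t) (t : ℝ) : γ t = φ t (γ 0) := by
  have := ODE_solution_unique_univ (v := fun _ => V) (s := fun _ => univ) (K := K) (t₀ := 0)
    (f := γ) (g := fun t => φ t (γ 0)) (fun _ => hK.lipschitzOnWith)
    (fun t => ⟨hγ t, mem_univ _⟩) (fun t => ⟨hφ.hasDerivAt _ t, mem_univ _⟩) (by simp [hφ.zero])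
  exact congrFun this t

theorem add (hφ : IsGlobalFlow V φ) (hK : LipschitzWith K V) (s t : ℝ) (x : E) :
    φ (s + t) x = φ s (φ t x) := by
  have := hφ.eq_of_hasDerivAt hK (γ := fun s => φ (s + t) x)
    (fun s => by simpa using (hφ.hasDerivAt x (s + t)).comp_add_const s t) s
  simpa using this

theorem neg_cancel (hφ : IsGlobalFlow V φ) (hK : LipschitzWith K V) (t : ℝ) (x : E) :
    φ (-t) (φ t x) = x := by
  rw [← hφ.add hK, neg_add_cancel, hφ.zero]

theorem fixed (hφ : IsGlobalFlow V φ) (hK : LipschitzWith K V) {S : E} (hS : V S = 0) (t : ℝ) :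
    φ t S = S :=
  (hφ.eq_of_hasDerivAt hK (γ := fun _ => S) (fun t => by simpa [hS] using hasDerivAt_const t S)
    t).symm

theorem reverse (hφ : IsGlobalFlow V φ) : IsGlobalFlow (fun x => -V x) (fun t => φ (-t)) where
  zero x := by simp [hφ.zero]
  hasDerivAt x t := by
    have := (hφ.hasDerivAt x (-t)).scomp t (hasDerivAt_neg t)
    simpa [Function.comp_def] using this

theorem continuous_time (hφ : IsGlobalFlow V φ) (x : E) : Continuous fun t => φ t x :=
  continuous_iff_continuousAt.2 fun t => (hφ.hasDerivAt x t).continuousAt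

/-- Solutions of two fields that are uniformly close, one of them Lipschitz, stay close. -/
theorem dist_le (hφ : IsGlobalFlow V φ) {V' : E → E} {φ' : ℝ → E → E}
    (hφ' : IsGlobalFlow V' φ') (hK : LipschitzWith K V') {ε δ T : ℝ} (hε : ∀ x, dist (V x) (V' x) ≤ ε)
    {x y : E} (hxy : dist x y ≤ δ) (hδ : 0 ≤ δ) {t : ℝ} (ht : |t| ≤ T) :
    dist (φ t x) (φ' t y) ≤ gronwallBound δ K ε T := by
  have hε0 : 0 ≤ ε := dist_nonneg.trans (hε x)
  have main : ∀ {V : E → E} {φ : ℝ → E → E} {V' : E → E} {φ' : ℝ → E → E}, IsGlobalFlow V φ →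
      IsGlobalFlow V' φ' → LipschitzWith K V' → (∀ x, dist (V x) (V' x) ≤ ε) →
      ∀ t : ℝ, 0 ≤ t → dist (φ t x) (φ' t y) ≤ gronwallBound δ K ε t := by
    intro V φ V' φ' hφ hφ' hK hε t ht
    have := dist_le_of_approx_trajectories_ODE (v := fun _ => V') (K := K) (f := fun t => φ t x)
      (g := fun t => φ' t y) (f' := fun t => V (φ t x)) (g' := fun t => V' (φ' t y)) (a := 0)
      (b := t) (εf := ε) (εg := 0) (δ := δ) (fun _ => hK) (hφ.continuous_time x).continuousOn
      (fun s _ => (hφ.hasDerivAt x s).hasDerivWithinAt) (fun s _ => hε _)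
      (hφ'.continuous_time y).continuousOn
      (fun s _ => (hφ'.hasDerivAt y s).hasDerivWithinAt) (fun s _ => by simp)
      (by simpa [hφ.zero, hφ'.zero] using hxy) t ⟨ht, le_rfl⟩
    simpa using this
  have hm : Monotone (gronwallBound δ K ε) := gronwallBound_mono hδ hε0 K.2
  rcases le_total 0 t with h0 | h0
  · exact (main hφ hφ' hK hε t h0).trans (hm ((le_abs_self t).trans ht))
  -- Gronwall's bound runs forward only; negative times are those of the reversed flows, with the
  -- same constants.
  · have := main hφ.reverse hφ'.reverse hK.neg (by simpa using hε) (-t) (by linarith)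
    simp only [neg_neg] at this
    exact this.trans (hm ((neg_le_abs t).trans ht))

theorem continuous (hφ : IsGlobalFlow V φ) (hK : LipschitzWith K V) :
    Continuous fun p : ℝ × E => φ p.1 p.2 := by
  rw [continuous_iff_continuousAt]
  rintro ⟨t, x⟩
  have h1 : Tendsto (fun p : ℝ × E => dist (φ p.1 p.2) (φ p.1 x)) (𝓝 (t, x)) (𝓝 0) := by
    have h2 : Tendsto (fun p : ℝ × E => dist p.2 x * Real.exp (K * (|t| + 1))) (𝓝 (t, x))
        (𝓝 0) := by
      have : Continuous fun p : ℝ × E => dist p.2 x * Real.exp (K * (|t| + 1)) := by fun_prop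
      simpa using this.tendsto (t, x)
    refine squeeze_zero' (Eventually.of_forall fun _ => dist_nonneg) ?_ h2
    have : ∀ᶠ p : ℝ × E in 𝓝 (t, x), |p.1| < |t| + 1 :=
      (continuous_abs.comp continuous_fst).continuousAt.eventually_lt_const (by simp)
    filter_upwards [this] with p hp
    have := hφ.dist_le hφ hK (ε := 0) (δ := dist p.2 x) (T := |t| + 1) (by simp) le_rfl
      dist_nonneg hp.le
    rwa [gronwallBound_ε0] at this
  have h3 : Tendsto (fun p : ℝ × E => φ p.1 x) (𝓝 (t, x)) (𝓝 (φ t x)) :=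
    ((hφ.continuous_time x).comp continuous_fst).tendsto (t, x)
  rw [ContinuousAt, tendsto_iff_dist_tendsto_zero]
  rw [tendsto_iff_dist_tendsto_zero] at h3
  refine squeeze_zero (fun _ => dist_nonneg) (fun p => dist_triangle _ (φ p.1 x) _) ?_
  simpa using h1.add h3

end IsGlobalFlow

end Flow

/-! ### Smoothness of the flow in time and initial point. -/

section SmoothFlow

universe u

variable {I : Type*} [TopologicalSpace I] [CompactSpace I]
  {E F : Type u} [NormedAddCommGroup E] [NormedSpace ℝ E] [NormedAddCommGroup F] [NormedSpace ℝ F]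

/-- Pointwise application of a continuous family of operators. -/
noncomputable def pointwiseApply :
    C(I, E →L[ℝ] F) →L[ℝ] C(I, E) →L[ℝ] C(I, F) :=
  LinearMap.mkContinuous₂ (LinearMap.mk₂ ℝ
    (fun (A : C(I, E →L[ℝ] F)) (δ : C(I, E)) => (⟨fun i => A i (δ i), by fun_prop⟩ : C(I, F)))
    (fun _ _ _ => by ext; simp) (fun _ _ _ => by ext; simp)
    (fun _ _ _ => by ext; simp) (fun _ _ _ => by ext; simp)) 1 (by
      intro A δ
      rw [one_mul]
      refine (ContinuousMap.norm_le _ (by positivity)).2 fun i => ?_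
      exact ((A i).le_opNorm _).trans
        (mul_le_mul (A.norm_coe_le_norm i) (δ.norm_coe_le_norm i) (norm_nonneg _) (norm_nonneg A)))

theorem norm_pointwiseApply_le (A : C(I, E →L[ℝ] F)) : ‖pointwiseApply A‖ ≤ ‖A‖ := by
  refine ContinuousLinearMap.opNorm_le_bound _ (norm_nonneg A) fun δ => ?_
  refine (ContinuousMap.norm_le _ (by positivity)).2 fun i => ?_
  exact ((A i).le_opNorm _).trans
    (mul_le_mul (A.norm_coe_le_norm i) (δ.norm_coe_le_norm i) (norm_nonneg _) (norm_nonneg A))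

/-- The superposition operator of a `C¹` map is differentiable on spaces of continuous maps. -/
theorem hasFDerivAt_continuousMap_comp {f : E → F} (hf : ContDiff ℝ 1 f) (γ : C(I, E)) :
    HasFDerivAt (fun γ : C(I, E) => (⟨f, hf.continuous⟩ : C(E, F)).comp γ)
      (pointwiseApply ((⟨fderiv ℝ f, hf.continuous_fderiv one_ne_zero⟩ :
        C(E, E →L[ℝ] F)).comp γ)) γ := by
  set D : C(E, E →L[ℝ] F) := ⟨fderiv ℝ f, hf.continuous_fderiv one_ne_zero⟩
  rw [hasFDerivAt_iff_isLittleO, Asymptotics.isLittleO_iff]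
  intro ε hε
  have hc : Continuous fun γ : C(I, E) => D.comp γ := ContinuousMap.continuous_postcomp D
  have hm := Metric.continuousAt_iff (f := fun γ : C(I, E) => D.comp γ) (a := γ)
  obtain ⟨ρ, hρ, h⟩ := hm.1 hc.continuousAt ε hε
  filter_upwards [Metric.ball_mem_nhds γ hρ] with γ' hγ'
  refine (ContinuousMap.norm_le _ (by positivity)).2 fun i => ?_
  have := (convex_segment (γ i) (γ' i)).norm_image_sub_le_of_norm_fderiv_le' (f := f)
    (φ := fderiv ℝ f (γ i)) (C := ε)
    (fun x _ => (hf.differentiable one_ne_zero) x) ?_ (left_mem_segment ℝ _ _)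
    (right_mem_segment ℝ _ _)
  · refine this.trans ?_
    gcongr
    exact (γ' - γ).norm_coe_le_norm i
  · intro x hx
    rw [segment_eq_image'] at hx
    obtain ⟨s, hs, rfl⟩ := hx
    -- A point of the segment from `γ i` to `γ' i` is the value at `i` of a curve uniformly close to
    -- `γ`. Continuity of postcomposition with the derivative thus gives the bound uniformly in `i`.
    have h1 : dist (γ + s • (γ' - γ)) γ < ρ := by
      rw [dist_eq_norm, add_sub_cancel_left, norm_smul, Real.norm_eq_abs, abs_of_nonneg hs.1]
      rw [Metric.mem_ball, dist_eq_norm] at hγ'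
      exact (mul_le_of_le_one_left (norm_nonneg _) hs.2).trans_lt hγ'
    have h2 := (h h1).le
    have h3 := (ContinuousMap.dist_apply_le_dist (f := D.comp (γ + s • (γ' - γ)))
      (g := D.comp γ) i).trans h2
    rwa [dist_eq_norm] at h3

/-- The derivative of the superposition operator of `f` is `pointwiseApply` of the superposition
operator of `fderiv ℝ f`. Its values lie in `E →L[ℝ] F`, so the induction generalizes over the
target, and all spaces share one universe. -/
theorem contDiff_continuousMap_comp_nat (n : ℕ) {F : Type u} [NormedAddCommGroup F]
    [NormedSpace ℝ F] {f : E → F} (hf : ContDiff ℝ n f) :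
    ContDiff ℝ n (fun γ : C(I, E) => (⟨f, hf.continuous⟩ : C(E, F)).comp γ) := by
  induction n generalizing F with
  | zero => exact contDiff_zero.2 (ContinuousMap.continuous_postcomp _)
  | succ n ih =>
    have h1 : ContDiff ℝ 1 f := hf.of_le (by exact_mod_cast Nat.le_add_left 1 n)
    have h2 : ContDiff ℝ n (fderiv ℝ f) := hf.fderiv_right (by norm_cast)
    have := contDiff_succ_iff_hasFDerivAt (𝕜 := ℝ) (n := n)
      (f := fun γ : C(I, E) => (⟨f, hf.continuous⟩ : C(E, F)).comp γ)
    push_cast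
    rw [this]
    have hp : ContDiff ℝ n (fun A : C(I, E →L[ℝ] F) => pointwiseApply A) :=
      ContinuousLinearMap.contDiff _
    exact ⟨fun γ => pointwiseApply ((⟨fderiv ℝ f, h2.continuous⟩ : C(E, E →L[ℝ] F)).comp γ),
      hp.comp (ih h2), fun γ => hasFDerivAt_continuousMap_comp h1 γ⟩

/-- Superposition operators of `C^r` maps are `C^r`. -/
theorem contDiff_continuousMap_comp {r : ℕ∞} {f : E → F} (hf : ContDiff ℝ r f) :
    ContDiff ℝ r (fun γ : C(I, E) => (⟨f, hf.continuous⟩ : C(E, F)).comp γ) := by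
  rw [contDiff_iff_forall_nat_le]
  intro m hm
  exact contDiff_continuousMap_comp_nat m (hf.of_le (by exact_mod_cast hm))

/-- The primitive vanishing at `0` of a continuous function on the unit interval. -/
noncomputable def primitive : C(Icc (0 : ℝ) 1, E) →L[ℝ] C(Icc (0 : ℝ) 1, E) :=
  LinearMap.mkContinuous
    { toFun := fun f => ⟨fun s => ∫ τ in (0 : ℝ)..s, f (projIcc 0 1 zero_le_one τ),
        (intervalIntegral.continuous_primitive (fun a b =>
          (f.continuous.comp continuous_projIcc).intervalIntegrable a b) 0).comp
          continuous_subtype_val⟩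
      map_add' := fun f g => by
        ext s
        exact intervalIntegral.integral_add
          ((f.continuous.comp continuous_projIcc).intervalIntegrable _ _)
          ((g.continuous.comp continuous_projIcc).intervalIntegrable _ _)
      map_smul' := fun c f => by
        ext s
        exact intervalIntegral.integral_smul _ _ } 1 (by
      intro f
      refine (ContinuousMap.norm_le _ (by positivity)).2 fun s => ?_
      have := intervalIntegral.norm_integral_le_of_norm_le_const (a := 0) (b := (s : ℝ)) (C := ‖f‖)
        (f := fun τ => f (projIcc 0 1 zero_le_one τ)) (fun τ _ => f.norm_coe_le_norm _)
      refine this.trans ?_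
      rw [sub_zero, abs_of_nonneg s.2.1, one_mul]
      exact mul_le_of_le_one_right (norm_nonneg _) s.2.2)

theorem norm_primitive_le : ‖(primitive : C(Icc (0 : ℝ) 1, E) →L[ℝ] _)‖ ≤ 1 :=
  LinearMap.mkContinuous_norm_le _ zero_le_one _

/-- Neumann series. The norm bound is `max 0 c` because `c` is not assumed to be nonnegative. -/
theorem isInvertible_one_sub {X : Type*} [NormedAddCommGroup X] [NormedSpace ℝ X] [CompleteSpace X]
    {A : X →L[ℝ] X} {c : ℝ} (hc : c < 1) (hA : ∀ x, ‖A x‖ ≤ c * ‖x‖) :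
    (1 - A).IsInvertible := by
  have hn : ‖A‖ < 1 :=
    (A.opNorm_le_bound (le_max_left 0 c) fun x => (hA x).trans
      (mul_le_mul_of_nonneg_right (le_max_right _ _) (norm_nonneg _))).trans_lt
      (max_lt one_pos hc)
  have hu := (Units.oneSub A hn).isUnit
  rw [Units.val_oneSub] at hu
  obtain ⟨w, hw⟩ := hu
  exact ⟨ContinuousLinearEquiv.unitsEquiv ℝ _ w, hw⟩

/-- The implicit function theorem, in existential form. -/
theorem exists_contDiffAt_implicitFunction {E₁ E₂ F : Type*}
    [NormedAddCommGroup E₁] [NormedSpace ℝ E₁] [CompleteSpace E₁]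
    [NormedAddCommGroup E₂] [NormedSpace ℝ E₂] [CompleteSpace E₂]
    [NormedAddCommGroup F] [NormedSpace ℝ F] [CompleteSpace F]
    {n : WithTop ℕ∞} (hn : n ≠ 0) {f : E₁ × E₂ → F} {u : E₁ × E₂} (hf : ContDiffAt ℝ n f u)
    (hinv : (fderiv ℝ f u ∘L .inr ℝ E₁ E₂).IsInvertible) :
    ∃ ψ : E₁ → E₂, ContDiffAt ℝ n ψ u.1 ∧ (∀ᶠ x in 𝓝 u.1, f (x, ψ x) = f u) ∧ ψ u.1 = u.2 :=
  ⟨_, hf.contDiffAt_implicitFunction hn hinv, hf.eventually_apply_implicitFunction hn hinv,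
    hf.implicitFunction_apply_self hn hinv⟩

/-- Solutions of the fixed point equation `y = c x + t • P (N y)` depend smoothly on `(t, x)`. -/
theorem exists_contDiffAt_fixedPoint {X Y : Type*} [NormedAddCommGroup X] [NormedSpace ℝ X]
    [CompleteSpace X] [NormedAddCommGroup Y] [NormedSpace ℝ Y] [CompleteSpace Y]
    {n : WithTop ℕ∞} (hn : n ≠ 0) {N : Y → Y} (hN : ContDiff ℝ n N) {P : Y →L[ℝ] Y} (hP : ‖P‖ ≤ 1)
    (c : X →L[ℝ] Y) {t : ℝ} {x : X} {y : Y} (hy : y = c x + t • P (N y)) {D : Y →L[ℝ] Y}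
    (hD : HasFDerivAt N D y) {K : ℝ} (hK : ‖D‖ ≤ K) (ht : |t| * K < 1) :
    ∃ ψ : ℝ × X → Y, ContDiffAt ℝ n ψ (t, x) ∧
      ∀ᶠ p in 𝓝 (t, x), ψ p = c p.2 + p.1 • P (N (ψ p)) := by
  set G : (ℝ × X) × Y → Y := fun q => q.2 - (c q.1.2 + q.1.1 • P (N q.2)) with hG
  have hGc : ContDiff ℝ n G := by
    refine contDiff_snd.sub (ContDiff.add ?_ ?_)
    · exact c.contDiff.comp (contDiff_snd.comp contDiff_fst)
    · exact (contDiff_fst.comp contDiff_fst).smul (P.contDiff.comp (hN.comp contDiff_snd))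
  have hinr : fderiv ℝ G ((t, x), y) ∘L .inr ℝ (ℝ × X) Y = 1 - t • (P ∘L D) := by
    have h1 : HasFDerivAt (fun γ => G ((t, x), γ))
        (fderiv ℝ G ((t, x), y) ∘L .inr ℝ (ℝ × X) Y) y :=
      ((hGc.differentiable hn).differentiableAt.hasFDerivAt).comp y
        (hasFDerivAt_prodMk_right (t, x) y)
    have h2 : HasFDerivAt (fun γ => G ((t, x), γ)) (1 - t • (P ∘L D)) y :=
      (hasFDerivAt_id y).sub (((P.hasFDerivAt.comp y hD).const_smul t).const_add (c x))
    exact h1.unique h2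
  have hinv : (fderiv ℝ G ((t, x), y) ∘L .inr ℝ (ℝ × X) Y).IsInvertible := by
    rw [hinr]
    refine isInvertible_one_sub ht fun δ => ?_
    change ‖t • P (D δ)‖ ≤ _
    rw [norm_smul, Real.norm_eq_abs, mul_assoc]
    gcongr
    refine (P.le_of_opNorm_le hP _).trans ?_
    rw [one_mul]
    exact D.le_of_opNorm_le hK _
  obtain ⟨ψ, hψ, hev, -⟩ := exists_contDiffAt_implicitFunction hn hGc.contDiffAt hinv
  refine ⟨ψ, hψ, hev.mono fun p hp => ?_⟩
  have hG0 : G ((t, x), y) = 0 := sub_eq_zero.2 hy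
  exact sub_eq_zero.1 (hp.trans hG0)

namespace IsGlobalFlow

variable [CompleteSpace E] {V : E → E} {φ : ℝ → E → E} {K : NNReal}

/-- A solution of the integral equation is differentiable and solves `γ' = t V(γ)` on the unit
interval, as does the orbit run at speed `t`; uniqueness identifies them. -/
theorem eq_of_primitive (hφ : IsGlobalFlow V φ) (hK : LipschitzWith K V) {t : ℝ} {x : E}
    {γ : C(Icc (0 : ℝ) 1, E)}
    (h : γ = ContinuousMap.const _ x + t • primitive ((⟨V, hK.continuous⟩ : C(E, E)).comp γ))
    (s : Icc (0 : ℝ) 1) : γ s = φ (s * t) x := by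
  set γ' : ℝ → E := fun s => x + t • ∫ τ in (0 : ℝ)..s, V (γ (projIcc 0 1 zero_le_one τ))
  have h1 : ∀ s : Icc (0 : ℝ) 1, γ s = γ' s := fun s => by
    conv_lhs => rw [h]
    rfl
  have h2 : ∀ s ∈ Icc (0 : ℝ) 1, HasDerivAt γ' (t • V (γ' s)) s := by
    intro s hs
    have hc : Continuous fun τ => V (γ (projIcc 0 1 zero_le_one τ)) :=
      hK.continuous.comp (γ.continuous.comp continuous_projIcc)
    have := ((intervalIntegral.integral_hasDerivAt_right (hc.intervalIntegrable 0 s)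
      (hc.stronglyMeasurableAtFilter _ _) hc.continuousAt).const_smul t).const_add x
    rw [projIcc_of_mem zero_le_one hs, h1] at this
    exact this
  have h3 := ODE_solution_unique (v := fun _ x => t • V x) (K := ‖t‖₊ * K) (f := γ')
    (g := fun s => φ (s * t) x) (a := 0) (b := 1) (fun _ => (lipschitzWith_smul t).comp hK)
    (fun s hs => (h2 s hs).continuousAt.continuousWithinAt)
    (fun s hs => (h2 s ⟨hs.1, hs.2.le⟩).hasDerivWithinAt)
    ((hφ.continuous_time x).comp (continuous_id.mul continuous_const)).continuousOn
    (fun s _ => by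
      have := (hφ.hasDerivAt x (s * t)).scomp s ((hasDerivAt_id s).mul_const t)
      simpa [Function.comp_def] using this.hasDerivWithinAt)
    (by simp [γ', hφ.zero])
  rw [h1]
  exact h3 s.2

theorem primitive_eq (hφ : IsGlobalFlow V φ) (hK : LipschitzWith K V) (t : ℝ) (x : E) :
    let γ : C(Icc (0 : ℝ) 1, E) := ⟨fun s => φ (s * t) x,
      (hφ.continuous_time x).comp (continuous_subtype_val.mul continuous_const)⟩
    γ = ContinuousMap.const _ x + t • primitive ((⟨V, hK.continuous⟩ : C(E, E)).comp γ) := by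
  intro γ
  ext s
  change φ (s * t) x = x + t • ∫ τ in (0 : ℝ)..s, V (φ (projIcc 0 1 zero_le_one τ * t) x)
  have h0 : ∫ τ in (0 : ℝ)..s, V (φ (projIcc 0 1 zero_le_one τ * t) x) =
      ∫ τ in (0 : ℝ)..s, V (φ (τ * t) x) := by
    refine intervalIntegral.integral_congr fun τ hτ => ?_
    rw [uIcc_of_le s.2.1] at hτ
    simp only [projIcc_of_mem zero_le_one ⟨hτ.1, hτ.2.trans s.2.2⟩]
  have h1 : ∫ τ in (0 : ℝ)..s, t • V (φ (τ * t) x) = φ (s * t) x - φ (0 * t) x := by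
    refine intervalIntegral.integral_eq_sub_of_hasDerivAt (f := fun τ => φ (τ * t) x)
      (fun τ _ => ?_) ?_
    · have := (hφ.hasDerivAt x (τ * t)).scomp τ ((hasDerivAt_id τ).mul_const t)
      simpa [Function.comp_def] using this
    · refine Continuous.intervalIntegrable ?_ _ _
      exact (hK.continuous.comp ((hφ.continuous_time x).comp
        (continuous_id.mul continuous_const))).const_smul t
  rw [h0, ← intervalIntegral.integral_smul, h1, zero_mul, hφ.zero]
  abel

/-- The curve `s ↦ φ (s t) x` solves the fixed point equation `γ = x + t ∫ V(γ)` in the space of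
continuous maps on the unit interval. The derivative of `γ ↦ V ∘ γ` has norm at most `K` and that of
the primitive at most `1`, so the linearized equation is invertible for `|t| K < 1`. The implicit
function theorem applies, and evaluation at `s = 1` returns the flow. -/
theorem contDiffAt_of_small (hφ : IsGlobalFlow V φ) (hK : LipschitzWith K V) {r : ℕ∞} (hr : 1 ≤ r)
    (hV : ContDiff ℝ r V) {t : ℝ} (ht : |t| * K < 1) (x : E) :
    ContDiffAt ℝ r (fun p : ℝ × E => φ p.1 p.2) (t, x) := by
  have hr1 : (1 : WithTop ℕ∞) ≤ r := by exact_mod_cast hr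
  have hV1 : ContDiff ℝ 1 V := hV.of_le hr1
  set N : C(Icc (0 : ℝ) 1, E) → C(Icc (0 : ℝ) 1, E) := fun γ =>
    (⟨V, hV.continuous⟩ : C(E, E)).comp γ
  set γ₀ : C(Icc (0 : ℝ) 1, E) := ⟨fun s => φ (s * t) x,
      (hφ.continuous_time x).comp (continuous_subtype_val.mul continuous_const)⟩ with hγ₀
  have hγ₀' : γ₀ = ContinuousMap.const _ x + t • primitive (N γ₀) := hφ.primitive_eq hK t x
  have hN : ContDiff ℝ r N := contDiff_continuousMap_comp hV
  set D := pointwiseApply ((⟨fderiv ℝ V, hV1.continuous_fderiv one_ne_zero⟩ :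
        C(E, E →L[ℝ] E)).comp γ₀)
  have hNd : HasFDerivAt N D γ₀ := hasFDerivAt_continuousMap_comp hV1 γ₀
  have hD : ‖D‖ ≤ K := by
    refine (norm_pointwiseApply_le _).trans ((ContinuousMap.norm_le _ K.2).2 fun i => ?_)
    exact norm_fderiv_le_of_lipschitz ℝ hK
  have hn0 : (r : WithTop ℕ∞) ≠ 0 := by simpa using (one_pos.trans_le hr).ne'
  obtain ⟨ψ, hψ, hev⟩ := exists_contDiffAt_fixedPoint hn0 hN norm_primitive_le
    (ContinuousLinearMap.const ℝ (Icc (0 : ℝ) 1)) hγ₀' hNd hD ht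
  have heq : (fun p : ℝ × E => φ p.1 p.2) =ᶠ[𝓝 (t, x)] fun p =>
      ContinuousMap.evalCLM ℝ (⟨1, by simp⟩ : Icc (0 : ℝ) 1) (ψ p) := by
    filter_upwards [hev] with p hp
    have := hφ.eq_of_primitive hK (γ := ψ p) hp ⟨1, by simp⟩
    simpa using this.symm
  exact ((ContinuousLinearMap.contDiff _).contDiffAt.comp (t, x) hψ).congr_of_eventuallyEq heq

/-- The flow of a globally Lipschitz `C^r` field is jointly `C^r`. -/
theorem contDiff (hφ : IsGlobalFlow V φ) (hK : LipschitzWith K V) {r : ℕ∞} (hr : 1 ≤ r)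
    (hV : ContDiff ℝ r V) : ContDiff ℝ r (fun p : ℝ × E => φ p.1 p.2) := by
  -- Doubling: the time `t` map is the square of the time `t / 2` map, which removes the smallness
  -- condition on `t`.
  have key : ∀ n : ℕ, ∀ t : ℝ, |t| * K < 2 ^ n → ∀ x,
      ContDiffAt ℝ r (fun p : ℝ × E => φ p.1 p.2) (t, x) := by
    intro n
    induction n with
    | zero => intro t ht x; exact hφ.contDiffAt_of_small hK hr hV (by simpa using ht) x
    | succ n ih =>
      intro t ht x
      have ht' : |t / 2| * K < 2 ^ n := by
        rw [abs_div, abs_two]; rw [pow_succ] at ht; linarith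
      have h1 : (fun p : ℝ × E => φ p.1 p.2) =
          fun p : ℝ × E => φ (p.1 / 2) (φ (p.1 / 2) p.2) := by
        ext p; rw [← hφ.add hK, add_halves]
      rw [h1]
      have h2 : ContDiffAt ℝ r (fun p : ℝ × E => φ (p.1 / 2) p.2) (t, x) :=
        (ih (t / 2) ht' x).comp (t, x) ((contDiffAt_fst.div_const 2).prodMk contDiffAt_snd)
      exact (ih (t / 2) ht' (φ (t / 2) x)).comp (t, x)
        (f := fun p : ℝ × E => (p.1 / 2, φ (p.1 / 2) p.2)) ((contDiffAt_fst.div_const 2).prodMk h2)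
  refine contDiff_iff_contDiffAt.2 fun p => ?_
  obtain ⟨n, hn⟩ := pow_unbounded_of_one_lt (|p.1| * K) (one_lt_two (α := ℝ))
  exact key n p.1 hn p.2

end IsGlobalFlow

end SmoothFlow

/-! ### Differential inequalities, cone estimates and first zeros. -/

section Scalar

/-- `T` is the least element of the compact set where `v ≤ f`. -/
theorem exists_first_hit {f : ℝ → ℝ} {b v : ℝ} (hb : 0 ≤ b) (hf : ContinuousOn f (Icc 0 b))
    (h0 : f 0 < v) (h1 : v ≤ f b) :
    ∃ T ∈ Ioc 0 b, f T = v ∧ ∀ t ∈ Ico 0 T, f t < v := by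
  set A := {t ∈ Icc (0 : ℝ) b | v ≤ f t} with hA
  have hAc : IsCompact A := by
    have : A = Icc 0 b ∩ f ⁻¹' Ici v := rfl
    rw [this]
    exact isCompact_Icc.of_isClosed_subset (hf.preimage_isClosed_of_isClosed isClosed_Icc
      isClosed_Ici) inter_subset_left
  obtain ⟨T, hT, hmin⟩ := hAc.exists_isLeast ⟨b, ⟨hb, le_rfl⟩, h1⟩
  have hlt : ∀ t ∈ Ico 0 T, f t < v := fun t ht => by
    by_contra hcon
    exact absurd (hmin ⟨⟨ht.1, ht.2.le.trans hT.1.2⟩, not_lt.1 hcon⟩) (not_le.2 ht.2)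
  have hT0 : 0 < T := hT.1.1.lt_of_ne (fun h => by rw [← h] at hT; exact absurd hT.2 (not_le.2 h0))
  refine ⟨T, ⟨hT0, hT.1.2⟩, le_antisymm ?_ hT.2, hlt⟩
  have hc : Tendsto f (𝓝[Ico 0 T] T) (𝓝 (f T)) :=
    (hf T hT.1).mono (fun t ht => ⟨ht.1, ht.2.le.trans hT.1.2⟩)
  have : (𝓝[Ico 0 T] T).NeBot := by
    rw [nhdsWithin_Ico_eq_nhdsLT hT0]; infer_instance
  exact le_of_tendsto hc (eventually_nhdsWithin_of_forall fun t ht => (hlt t ht).le)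

theorem le_of_hasDerivAt_nonneg {f f' : ℝ → ℝ} {T : ℝ} (hT : 0 ≤ T)
    (hf : ∀ t ∈ Icc 0 T, HasDerivAt f (f' t) t) (h : ∀ t ∈ Icc 0 T, 0 ≤ f' t) : f 0 ≤ f T :=
  monotoneOn_of_hasDerivWithinAt_nonneg (convex_Icc 0 T)
    (fun t ht => (hf t ht).continuousAt.continuousWithinAt)
    (fun t ht => (hf t (interior_subset ht)).hasDerivWithinAt)
    (fun t ht => h t (interior_subset ht)) ⟨le_rfl, hT⟩ ⟨hT, le_rfl⟩ hT

theorem lt_of_hasDerivAt_pos {f f' : ℝ → ℝ} {T : ℝ} (hT : 0 < T)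
    (hf : ∀ t ∈ Icc 0 T, HasDerivAt f (f' t) t) (h : ∀ t ∈ Ioo 0 T, 0 < f' t) : f 0 < f T :=
  strictMonoOn_of_hasDerivWithinAt_pos (convex_Icc 0 T)
    (fun t ht => (hf t ht).continuousAt.continuousWithinAt)
    (fun t ht => (hf t (interior_subset ht)).hasDerivWithinAt)
    (fun t ht => h t (by rwa [interior_Icc] at ht)) ⟨le_rfl, hT.le⟩ ⟨hT.le, le_rfl⟩ hT

/-- The integrating factor `exp (-(k t))` turns the hypothesis into monotonicity. -/
theorem exp_mul_le {f f' : ℝ → ℝ} {k T : ℝ} (hT : 0 ≤ T)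
    (hf : ∀ t ∈ Icc 0 T, HasDerivAt f (f' t) t) (h : ∀ t ∈ Icc 0 T, k * f t ≤ f' t) :
    Real.exp (k * T) * f 0 ≤ f T := by
  have h1 := le_of_hasDerivAt_nonneg (f := fun t => Real.exp (-(k * t)) * f t) hT
    (fun t ht => (((hasDerivAt_id t).const_mul k).neg.exp).mul (hf t ht)) (fun t ht => by
      have := h t ht
      have := Real.exp_pos (-(k * t))
      simp only [id, mul_one, Pi.neg_apply]
      nlinarith)
  simp only [mul_zero, neg_zero, Real.exp_zero, one_mul] at h1
  calc Real.exp (k * T) * f 0 ≤ Real.exp (k * T) * (Real.exp (-(k * T)) * f T) := by gcongr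
    _ = f T := by rw [← mul_assoc, ← Real.exp_add]; simp

theorem exp_mul_lt {f f' : ℝ → ℝ} {k T : ℝ} (hT : 0 < T)
    (hf : ∀ t ∈ Icc 0 T, HasDerivAt f (f' t) t) (h : ∀ t ∈ Icc 0 T, k * f t < f' t) :
    Real.exp (k * T) * f 0 < f T := by
  have h1 := lt_of_hasDerivAt_pos (f := fun t => Real.exp (-(k * t)) * f t) hT
    (fun t ht => (((hasDerivAt_id t).const_mul k).neg.exp).mul (hf t ht)) (fun t ht => by
      have := h t ⟨ht.1.le, ht.2.le⟩
      have := Real.exp_pos (-(k * t))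
      simp only [id, mul_one, Pi.neg_apply]
      nlinarith)
  simp only [mul_zero, neg_zero, Real.exp_zero, one_mul] at h1
  calc Real.exp (k * T) * f 0 < Real.exp (k * T) * (Real.exp (-(k * T)) * f T) := by gcongr
    _ = f T := by rw [← mul_assoc, ← Real.exp_add]; simp

/-- `(x, y)` solves on `[0, T]` the linear saddle system with rates `α` and `-β` up to an error
of relative size `κ`. -/
structure SaddlePair (α β κ T : ℝ) (x y : ℝ → ℝ) : Prop where
  fst : ∀ t ∈ Icc 0 T, ∃ x', HasDerivAt x x' t ∧ |x' - α * x t| ≤ κ * (|x t| + |y t|)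
  snd : ∀ t ∈ Icc 0 T, ∃ y', HasDerivAt y y' t ∧ |y' + β * y t| ≤ κ * (|x t| + |y t|)

/-- The relative error `κ` is small enough for the invariance of the cone of slope `M`. -/
structure ConeSmall (α β κ M : ℝ) : Prop where
  alpha : 0 < α
  beta : 0 < β
  kappa : 0 ≤ κ
  slope : 0 < M
  one : 2 * κ * (M ^ 2 + 1) ≤ M ^ 2 * α
  two : 2 * κ * (M ^ 2 + 1) ≤ β
  three : κ * (1 + M) ≤ α / 2

namespace SaddlePair

variable {α β κ T M : ℝ} {x y : ℝ → ℝ}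

theorem mono (h : SaddlePair α β κ T x y) {T' : ℝ} (hT : T' ≤ T) : SaddlePair α β κ T' x y :=
  ⟨fun t ht => h.fst t ⟨ht.1, ht.2.trans hT⟩, fun t ht => h.snd t ⟨ht.1, ht.2.trans hT⟩⟩

theorem neg (h : SaddlePair α β κ T x y) :
    SaddlePair α β κ T (fun t => -x t) (fun t => -y t) where
  fst t ht := by
    obtain ⟨x', h1, h2⟩ := h.fst t ht
    refine ⟨-x', h1.neg, ?_⟩
    rw [abs_neg, abs_neg, ← abs_neg]
    convert h2 using 2; ring
  snd t ht := by
    obtain ⟨x', h1, h2⟩ := h.snd t ht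
    refine ⟨-x', h1.neg, ?_⟩
    rw [abs_neg, abs_neg, ← abs_neg]
    convert h2 using 2; ring

theorem reverse (h : SaddlePair α β κ T x y) :
    SaddlePair β α κ T (fun t => y (T - t)) (fun t => x (T - t)) where
  fst t ht := by
    obtain ⟨x', h1, h2⟩ := h.snd (T - t) ⟨by linarith [ht.2], by linarith [ht.1]⟩
    refine ⟨-x', by simpa using h1.comp_const_sub T t, ?_⟩
    rw [add_comm |y _|, ← abs_neg]
    convert h2 using 2; ring
  snd t ht := by
    obtain ⟨x', h1, h2⟩ := h.fst (T - t) ⟨by linarith [ht.2], by linarith [ht.1]⟩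
    refine ⟨-x', by simpa using h1.comp_const_sub T t, ?_⟩
    rw [add_comm |y _|, ← abs_neg]
    convert h2 using 2; ring

/-- The form `M² x² - y²` is nondecreasing along the pair: for the linear system half its derivative
is `M² α x² + β y²`, and the conditions `one` and `two` of `ConeSmall` let this absorb the error,
which is at most `2 κ (M² + 1) (x² + y²)`. -/
theorem abs_le_abs (h : SaddlePair α β κ T x y) (hc : ConeSmall α β κ M) (hT : 0 ≤ T)
    (h0 : |y 0| ≤ M * |x 0|) : |y T| ≤ M * |x T| := by
  choose! x' hx' hx using h.fst
  choose! y' hy' hy using h.snd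
  have key := le_of_hasDerivAt_nonneg (f := fun t => M ^ 2 * x t ^ 2 - y t ^ 2) hT
    (fun t ht => (((hx' t ht).pow 2).const_mul (M ^ 2)).sub ((hy' t ht).pow 2)) (fun t ht => by
      have e1 := hx t ht
      have e2 := hy t ht
      have hM := hc.slope
      have hκ := hc.kappa
      set X := x t; set Y := y t
      have a1 : X * x' t ≥ α * X ^ 2 - |X| * (κ * (|X| + |Y|)) := by
        have : |X * (x' t - α * X)| ≤ |X| * (κ * (|X| + |Y|)) := by
          rw [abs_mul]; gcongr
        nlinarith [(abs_le.1 this).1]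
      have a2 : Y * y' t ≤ -(β * Y ^ 2) + |Y| * (κ * (|X| + |Y|)) := by
        have : |Y * (y' t + β * Y)| ≤ |Y| * (κ * (|X| + |Y|)) := by
          rw [abs_mul]; gcongr
        nlinarith [(abs_le.1 this).2]
      have a3 : M ^ 2 * (|X| * (κ * (|X| + |Y|))) + |Y| * (κ * (|X| + |Y|)) ≤
          2 * κ * (M ^ 2 + 1) * (X ^ 2 + Y ^ 2) := by
        have : (M ^ 2 * |X| + |Y|) * (|X| + |Y|) ≤ (M ^ 2 + 1) * (2 * (X ^ 2 + Y ^ 2)) := by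
          rw [← sq_abs X, ← sq_abs Y]
          have b1 : M ^ 2 * |X| + |Y| ≤ (M ^ 2 + 1) * (|X| + |Y|) := by
            nlinarith [abs_nonneg X, mul_nonneg (sq_nonneg M) (abs_nonneg Y)]
          calc _ ≤ (M ^ 2 + 1) * (|X| + |Y|) * (|X| + |Y|) := by gcongr
            _ = (M ^ 2 + 1) * (|X| + |Y|) ^ 2 := by ring
            _ ≤ _ := by gcongr; nlinarith [sq_nonneg (|X| - |Y|)]
        nlinarith
      have a4 : 2 * κ * (M ^ 2 + 1) * X ^ 2 ≤ M ^ 2 * α * X ^ 2 :=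
        mul_le_mul_of_nonneg_right hc.one (sq_nonneg X)
      have a5 : 2 * κ * (M ^ 2 + 1) * Y ^ 2 ≤ β * Y ^ 2 := by
        gcongr; exact hc.two
      have a6 : M ^ 2 * (X * x' t) ≥ M ^ 2 * (α * X ^ 2 - |X| * (κ * (|X| + |Y|))) := by gcongr
      norm_num
      nlinarith)
  have h1 : y 0 ^ 2 ≤ M ^ 2 * x 0 ^ 2 := by
    rw [← sq_abs (y 0), ← sq_abs (x 0), ← mul_pow]
    gcongr
  rw [← abs_of_pos hc.slope, ← abs_mul]
  refine sq_le_sq.1 ?_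
  rw [mul_pow]
  linarith

/-- Forward invariance of the unstable cone, and expansion inside it. -/
theorem cone (h : SaddlePair α β κ T x y) (hc : ConeSmall α β κ M) (hT : 0 ≤ T)
    (hx0 : 0 < x 0) (h0 : |y 0| ≤ M * x 0) :
    |y T| ≤ M * x T ∧ Real.exp (α / 2 * T) * x 0 ≤ x T ∧ x T ≤ Real.exp (2 * α * T) * x 0 := by
  choose! x' hx' hx using h.fst
  have hc' : ∀ t ∈ Icc 0 T, |y t| ≤ M * |x t| := fun t ht =>
    (h.mono ht.2).abs_le_abs hc ht.1 (by rwa [abs_of_pos hx0])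
  have hest : ∀ t ∈ Icc 0 T, |x' t - α * x t| ≤ α / 2 * |x t| := fun t ht => by
    have h1 := hx t ht
    have h2 := hc' t ht
    have h3 := hc.three
    calc _ ≤ κ * (|x t| + |y t|) := h1
      _ ≤ κ * (|x t| + M * |x t|) := by have := hc.kappa; gcongr
      _ = κ * (1 + M) * |x t| := by ring
      _ ≤ _ := by gcongr
  have hα := hc.alpha
  have hpos : ∀ t ∈ Icc 0 T, 0 < x t := by
    -- Inside the cone `x²` is nondecreasing, so `x` cannot reach zero and keeps its sign.
    have hne : ∀ t ∈ Icc 0 T, x t ≠ 0 := by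
      intro t ht h0
      have := le_of_hasDerivAt_nonneg (f := fun t => x t ^ 2) ht.1
        (fun s hs => (hx' s ⟨hs.1, hs.2.trans ht.2⟩).pow 2) (fun s hs => by
          have := hest s ⟨hs.1, hs.2.trans ht.2⟩
          have h1 : |x s * (x' s - α * x s)| ≤ |x s| * (α / 2 * |x s|) := by
            rw [abs_mul]; gcongr
          have h2 : |x s| * (α / 2 * |x s|) = α / 2 * x s ^ 2 := by
            rw [← sq_abs]; ring
          norm_num
          nlinarith [(abs_le.1 h1).1, sq_nonneg (x s)])
      simp only [h0] at this
      nlinarith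
    intro t ht
    by_contra hcon
    push Not at hcon
    have hcont : ContinuousOn x (Icc 0 t) := fun s hs =>
      (hx' s ⟨hs.1, hs.2.trans ht.2⟩).continuousAt.continuousWithinAt
    obtain ⟨s, hs, hs0⟩ := intermediate_value_Icc' ht.1 hcont ⟨hcon, hx0.le⟩
    exact hne s ⟨hs.1, hs.2.trans ht.2⟩ hs0
  refine ⟨?_, ?_, ?_⟩
  · have := hc' T ⟨hT, le_rfl⟩
    rwa [abs_of_pos (hpos T ⟨hT, le_rfl⟩)] at this
  · refine exp_mul_le hT hx' fun t ht => ?_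
    have h1 := hest t ht
    rw [abs_of_pos (hpos t ht)] at h1
    linarith [(abs_le.1 h1).1]
  · have := exp_mul_le (f := fun t => -x t) (k := 2 * α) hT (fun t ht => (hx' t ht).neg)
      fun t ht => by
        have h1 := hest t ht
        rw [abs_of_pos (hpos t ht)] at h1
        nlinarith [(abs_le.1 h1).2, mul_pos hα (hpos t ht)]
    linarith

/-- Inside the cone `f = m x - y` satisfies `f' ≥ -β f`, so its sign is preserved. With `m = α / (2
β)` this one-sided bound yields `α x - β y ≥ α x / 2`, which the wide cone of slope `M` cannot give.
-/
theorem upper (h : SaddlePair α β κ T x y) (hc : ConeSmall α β κ M) (hT : 0 ≤ T)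
    (hx0 : 0 < x 0) (h0 : |y 0| ≤ M * x 0) {m : ℝ} (hm : 0 < m)
    (hκ : κ * (m + 1) * (1 + M) ≤ m * (α + β)) (h1 : y 0 ≤ m * x 0) : y T ≤ m * x T := by
  choose! x' hx' hx using h.fst
  choose! y' hy' hy using h.snd
  have := exp_mul_le (f := fun t => m * x t - y t) (k := -β) hT
    (fun t ht => ((hx' t ht).const_mul m).sub (hy' t ht)) (fun t ht => by
      have hcone := (h.mono ht.2).cone hc ht.1 hx0 h0
      have hxt : 0 < x t := lt_of_lt_of_le (by positivity) hcone.2.1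
      have e : κ * (|x t| + |y t|) ≤ κ * ((1 + M) * x t) := by
        have := hc.kappa
        gcongr
        rw [abs_of_pos hxt]
        linarith [hcone.1]
      have e1 := (abs_le.1 ((hx t ht).trans e)).1
      have e2 := (abs_le.1 ((hy t ht).trans e)).2
      have e3 : κ * (m + 1) * (1 + M) * x t ≤ m * (α + β) * x t := by gcongr
      have e4 : m * x' t ≥ m * (α * x t - κ * ((1 + M) * x t)) := by gcongr; linarith
      nlinarith)
  have h2 : 0 ≤ Real.exp (-β * T) * (m * x 0 - y 0) := by
    have : 0 ≤ m * x 0 - y 0 := by linarith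
    positivity
  linarith

end SaddlePair

/-- The tube lemma for filters; it turns joint limits in parameter and time into statements uniform
over compact time intervals. -/
theorem eventually_forall_of_isCompact {ι X : Type*} [TopologicalSpace X] {l : Filter ι}
    {K : Set X} (hK : IsCompact K) {p : ι → X → Prop}
    (h : ∀ x ∈ K, ∀ᶠ q : ι × X in l ×ˢ 𝓝 x, p q.1 q.2) : ∀ᶠ i in l, ∀ x ∈ K, p i x := by
  have h1 : {q : ι × X | p q.1 q.2} ∈ l ×ˢ 𝓝ˢ K := hK.mem_prod_nhdsSet_of_forall h
  have h2 : ∀ᶠ q : ι × X in l ×ˢ 𝓝ˢ K, p q.1 q.2 := h1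
  exact h2.curry.mono fun i hi => hi.self_of_nhdsSet

/-- A family of functions that is close to a function which is positive before a transversal zero
at `T₀` shares this property. -/
theorem exists_first_zero {ι : Type*} {l : Filter ι} {f f' : ι → ℝ → ℝ} {g g' : ℝ → ℝ} {T₀ : ℝ}
    (hT₀ : 0 < T₀) (hf : ∀ i t, HasDerivAt (f i) (f' i t) t) (hg : ∀ t, HasDerivAt g (g' t) t)
    (hfg : ∀ t, Tendsto (fun q : ι × ℝ => f q.1 q.2) (l ×ˢ 𝓝 t) (𝓝 (g t)))
    (hfg' : ∀ t, Tendsto (fun q : ι × ℝ => f' q.1 q.2) (l ×ˢ 𝓝 t) (𝓝 (g' t)))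
    (hg'c : Continuous g')
    (hpos : ∀ t ∈ Ioo 0 T₀, 0 < g t) (hz : g T₀ = 0) (hz' : g' T₀ < 0)
    (hstart : 0 < g 0 ∨ g 0 = 0 ∧ 0 < g' 0 ∧ ∀ᶠ i in l, f i 0 = 0) {θ₀ : ℝ} (hθ₀ : 0 < θ₀) :
    ∃ θ > 0, θ ≤ θ₀ ∧ θ < T₀ ∧ ∀ᶠ i in l, (∀ t ∈ Icc (T₀ - θ) (T₀ + θ), f' i t < 0) ∧
      ∃ τ ∈ Ioo (T₀ - θ) (T₀ + θ), f i τ = 0 ∧ ∀ t ∈ Ioo 0 τ, 0 < f i t := by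
  have hev : ∀ t, g' t < 0 → ∀ᶠ q : ι × ℝ in l ×ˢ 𝓝 t, f' q.1 q.2 < 0 := fun t ht =>
    (hfg' t).eventually_lt_const ht
  obtain ⟨θ₁, hθ₁, hg1⟩ := Metric.eventually_nhds_iff.1
    (hg'c.continuousAt.eventually_lt_const hz')
  obtain ⟨θ, hθ, hθ'⟩ : ∃ θ > 0, θ < min (min θ₁ θ₀) T₀ :=
    exists_between (lt_min (lt_min hθ₁ hθ₀) hT₀)
  rw [lt_min_iff, lt_min_iff] at hθ'
  have hneg : ∀ t ∈ Icc (T₀ - θ) (T₀ + θ), g' t < 0 := fun t ht => hg1 (by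
    rw [Real.dist_eq, abs_lt]; constructor <;> linarith [ht.1, ht.2])
  have hpt : ∀ t, Tendsto (fun i => f i t) l (𝓝 (g t)) := fun t =>
    (hfg t).comp (tendsto_id.prodMk (tendsto_const_pure.mono_right (pure_le_nhds t)))
  have hend : g (T₀ + θ) < 0 := by
    have := strictAntiOn_of_hasDerivWithinAt_neg (convex_Icc (T₀ - θ) (T₀ + θ))
      (fun t _ => (hg t).continuousAt.continuousWithinAt)
      (fun t _ => (hg t).hasDerivWithinAt) (fun t ht => hneg t (interior_subset ht))
      (a := T₀) (b := T₀ + θ) ⟨by linarith, by linarith⟩ ⟨by linarith, by linarith⟩ (by linarith)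
    rwa [hz] at this
  have hmid : ∀ a, (∀ t ∈ Icc a (T₀ - θ), 0 < g t) → ∀ᶠ i in l, ∀ t ∈ Icc a (T₀ - θ), 0 < f i t :=
    fun a ha => eventually_forall_of_isCompact isCompact_Icc fun t ht =>
      (hfg t).eventually_const_lt (ha t ht)
  -- Before `T₀ - θ` positivity persists by compactness, except near time `0` if the limit function
  -- vanishes there. In that case `f i 0 = 0` as well, and a positive derivative takes over on a
  -- short initial interval.
  have hinit : ∀ᶠ i in l, ∀ t ∈ Ioc 0 (T₀ - θ), 0 < f i t := by
    rcases hstart with h0 | ⟨h0, h0', hs⟩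
    · refine (hmid 0 fun t ht => ?_).mono fun i hi t ht => hi t ⟨ht.1.le, ht.2⟩
      rcases ht.1.eq_or_lt with rfl | h
      · exact h0
      · exact hpos t ⟨h, by linarith [ht.2]⟩
    · obtain ⟨θ₂, hθ₂, hg2⟩ := Metric.eventually_nhds_iff.1
        (hg'c.continuousAt.eventually_const_lt h0')
      have e1 : ∀ᶠ i in l, ∀ t ∈ Icc 0 (θ₂ / 2), 0 < f' i t :=
        eventually_forall_of_isCompact isCompact_Icc fun t ht =>
          (hfg' t).eventually_const_lt (hg2 (by
            rw [Real.dist_eq, sub_zero, abs_of_nonneg ht.1]; linarith [ht.2]))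
      have e2 := hmid (θ₂ / 2) fun t ht => hpos t ⟨by linarith [ht.1], by linarith [ht.2]⟩
      filter_upwards [e1, e2, hs] with i h1 h2 h3 t ht
      rcases le_total t (θ₂ / 2) with h | h
      · rw [← h3]
        exact lt_of_hasDerivAt_pos ht.1 (fun s _ => hf i s)
          fun s hs => h1 s ⟨hs.1.le, hs.2.le.trans h⟩
      · exact h2 t ⟨h, ht.2⟩
  refine ⟨θ, hθ, hθ'.1.2.le, hθ'.2, ?_⟩
  have e3 : ∀ᶠ i in l, ∀ t ∈ Icc (T₀ - θ) (T₀ + θ), f' i t < 0 :=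
    eventually_forall_of_isCompact isCompact_Icc fun t ht => hev t (hneg t ht)
  filter_upwards [e3, hinit, (hpt (T₀ + θ)).eventually_lt_const hend] with i h1 h2 h3
  have h4 : 0 < f i (T₀ - θ) := h2 _ ⟨by linarith, le_rfl⟩
  have hcont : ContinuousOn (f i) (Icc (T₀ - θ) (T₀ + θ)) := fun t _ =>
    (hf i t).continuousAt.continuousWithinAt
  obtain ⟨τ, hτ, hτ0⟩ := intermediate_value_Ioo' (by linarith) hcont ⟨h3, h4⟩
  refine ⟨h1, τ, hτ, hτ0, fun t ht => ?_⟩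
  rcases le_total t (T₀ - θ) with h | h
  · exact h2 t ⟨ht.1, h⟩
  · have := strictAntiOn_of_hasDerivWithinAt_neg (convex_Icc (T₀ - θ) (T₀ + θ)) hcont
      (fun t _ => (hf i t).hasDerivWithinAt) (fun t ht => h1 t (interior_subset ht))
      (a := t) (b := τ) ⟨h, by linarith [ht.2, hτ.2]⟩ ⟨hτ.1.le, hτ.2.le⟩ ht.2
    rwa [hτ0] at this

end Scalar

/-! ### Determinants and linear coordinates in the plane. -/

section Planar

/-- The determinant of a pair of plane vectors. -/
noncomputable def det2 (a b : Plane) : ℝ := a 0 * b 1 - a 1 * b 0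

theorem det2_add_right (a b c : Plane) : det2 a (b + c) = det2 a b + det2 a c := by
  simp [det2]; ring

theorem det2_smul_right (a b : Plane) (t : ℝ) : det2 a (t • b) = t * det2 a b := by
  simp [det2]; ring

theorem det2_self (a : Plane) : det2 a a = 0 := by simp [det2]; ring

theorem continuous_det2 : Continuous fun p : Plane × Plane => det2 p.1 p.2 := by
  unfold det2; fun_prop

theorem plane_eq (a : Plane) :
    a = a 0 • EuclideanSpace.single 0 (1 : ℝ) + a 1 • EuclideanSpace.single 1 (1 : ℝ) := by
  ext i; fin_cases i <;> simp

theorem det2_map (L : Plane →L[ℝ] Plane) (a b : Plane) :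
    det2 (L a) (L b) = det2 (L (EuclideanSpace.single 0 1)) (L (EuclideanSpace.single 1 1)) *
      det2 a b := by
  rw [plane_eq a, plane_eq b]
  simp only [map_add, map_smul]
  simp [det2]; ring

/-- In the plane, the linear combinations of two independent vectors form linear coordinates. -/
theorem exists_basis_equiv {a b : Plane} (h : det2 a b ≠ 0) :
    ∃ L : (ℝ × ℝ) ≃L[ℝ] Plane, ∀ x, L x = x.1 • a + x.2 • b := by
  set A : ℝ × ℝ →ₗ[ℝ] Plane :=
    (LinearMap.fst ℝ ℝ ℝ).smulRight a + (LinearMap.snd ℝ ℝ ℝ).smulRight b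
  have hA : ∀ x, A x = x.1 • a + x.2 • b := fun x => by simp [A]
  have hinj : Function.Injective A := by
    rw [← LinearMap.ker_eq_bot, LinearMap.ker_eq_bot']
    rintro ⟨x, y⟩ hxy
    rw [hA] at hxy
    have h0 : x * a 0 + y * b 0 = 0 := by simpa using congrArg (fun v : Plane => v 0) hxy
    have h1 : x * a 1 + y * b 1 = 0 := by simpa using congrArg (fun v : Plane => v 1) hxy
    have hx : x * det2 a b = 0 := by unfold det2; linear_combination b 1 * h0 - b 0 * h1
    have hy : y * det2 a b = 0 := by unfold det2; linear_combination a 0 * h1 - a 1 * h0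
    simp [(mul_eq_zero.1 hx).resolve_right h, (mul_eq_zero.1 hy).resolve_right h]
  exact ⟨(LinearEquiv.ofInjectiveOfFinrankEq A hinj (by simp)).toContinuousLinearEquiv,
    fun x => hA x⟩

theorem isInvertible_of_ne_zero {A : ℝ →L[ℝ] ℝ} (h : A 1 ≠ 0) : A.IsInvertible := by
  refine ContinuousLinearMap.IsInvertible.of_inverse
    (g := ContinuousLinearMap.toSpanSingleton ℝ (A 1)⁻¹) ?_ ?_ <;>
  · ext; simp [h]
    try rw [← mul_one (A 1)⁻¹, ← smul_eq_mul, map_smul, smul_eq_mul, inv_mul_cancel₀ h]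

end Planar

/-! ### Smooth inverses of decreasing functions. -/

section Inverse

/-- A function with negative derivative on an open interval is an orientation reversing
diffeomorphism. -/
theorem isOrientationReversingDiffeo_of_deriv_neg {r : ℕ∞} (hr : 1 ≤ r) {f : ℝ → ℝ} {η : ℝ}
    (hf : ∀ x ∈ Ioo (-η) η, ContDiffAt ℝ r f x) (hf' : ∀ x ∈ Ioo (-η) η, deriv f x < 0) :
    IsOrientationReversingDiffeo r f (Ioo (-η) η) := by
  have hr0 : (r : WithTop ℕ∞) ≠ 0 := by simpa using (one_pos.trans_le hr).ne'
  have hanti : StrictAntiOn f (Ioo (-η) η) :=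
    strictAntiOn_of_deriv_neg (convex_Ioo _ _)
      (fun x hx => (hf x hx).continuousAt.continuousWithinAt)
      (fun x hx => hf' x (interior_subset hx))
  refine ⟨fun x hx => (hf x hx).contDiffWithinAt, hanti, ?_, ?_⟩
  · rw [isOpen_iff_mem_nhds]
    rintro _ ⟨x, hx, rfl⟩
    have hs : HasStrictDerivAt f (deriv f x) x := (hf x hx).hasStrictDerivAt hr0
    rw [← hs.map_nhds_eq (hf' x hx).ne]
    exact image_mem_map (isOpen_Ioo.mem_nhds hx)
  · refine ⟨Function.invFunOn f (Ioo (-η) η), ?_, fun x hx => ?_⟩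
    · rintro _ ⟨x, hx, rfl⟩
      refine ContDiffAt.contDiffWithinAt ?_
      -- The inverse is the implicit function of `f y - x = 0`; injectivity of `f` identifies it
      -- with `Function.invFunOn`.
      have hd : ContDiffAt ℝ r (fun p : ℝ × ℝ => f p.2 - p.1) (f x, x) :=
        ((hf x hx).comp (f x, x) contDiffAt_snd).sub contDiffAt_fst
      have hinv : (fderiv ℝ (fun p : ℝ × ℝ => f p.2 - p.1) (f x, x) ∘L
          .inr ℝ ℝ ℝ).IsInvertible := by
        refine isInvertible_of_ne_zero ?_
        have h1 : HasDerivAt (fun y => f y - f x)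
            ((fderiv ℝ (fun p : ℝ × ℝ => f p.2 - p.1) (f x, x) ∘L .inr ℝ ℝ ℝ) 1) x :=
          ((hd.differentiableAt hr0).hasFDerivAt.comp x
            (hasFDerivAt_prodMk_right (f x) x)).hasDerivAt
        have h2 : HasDerivAt (fun y => f y - f x) (deriv f x) x :=
          ((hf x hx).differentiableAt hr0).hasDerivAt.sub_const _
        rw [h1.unique h2]
        exact (hf' x hx).ne
      obtain ⟨ψ, hψ, hev, h0⟩ := exists_contDiffAt_implicitFunction hr0 hd hinv
      refine hψ.congr_of_eventuallyEq ?_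
      have hmem : ∀ᶠ y in 𝓝 (f x), ψ y ∈ Ioo (-η) η :=
        hψ.continuousAt.eventually_mem (by rw [h0]; exact isOpen_Ioo.mem_nhds hx)
      filter_upwards [hev, hmem] with y hy hm
      have hy' : f (ψ y) = y := by simpa [sub_eq_zero] using hy
      have h3 : y ∈ f '' Ioo (-η) η := ⟨_, hm, hy'⟩
      exact hanti.injOn (Function.invFunOn_mem h3) hm ((Function.invFunOn_eq h3).trans hy'.symm)
    · exact hanti.injOn (Function.invFunOn_mem ⟨x, hx, rfl⟩) hx (Function.invFunOn_eq ⟨x, hx, rfl⟩)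

end Inverse

/-! ### Transition maps of planar flows and orientation. -/

section Transition

namespace IsGlobalFlow

variable {V : Plane → Plane} {φ : ℝ → Plane → Plane} {K : NNReal} {r : ℕ∞}

theorem contDiff_space (hφ : IsGlobalFlow V φ) (hK : LipschitzWith K V) (hr : 1 ≤ r)
    (hV : ContDiff ℝ r V) (t : ℝ) : ContDiff ℝ r (φ t) :=
  (hφ.contDiff hK hr hV).comp (contDiff_prodMk_right t)

/-- Obtained by differentiating `φ t (φ s x) = φ s (φ t x)` at `s = 0`. -/
theorem fderiv_apply_field (hφ : IsGlobalFlow V φ) (hK : LipschitzWith K V) (hr : 1 ≤ r)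
    (hV : ContDiff ℝ r V) (t : ℝ) (x : Plane) : fderiv ℝ (φ t) x (V x) = V (φ t x) := by
  have hr0 : (r : WithTop ℕ∞) ≠ 0 := by simpa using (one_pos.trans_le hr).ne'
  have h1 : HasDerivAt (fun s => φ t (φ s x)) (fderiv ℝ (φ t) x (V x)) 0 := by
    have h2 := hφ.hasDerivAt x 0
    rw [hφ.zero] at h2
    have h3 : HasFDerivAt (φ t) (fderiv ℝ (φ t) x) (φ 0 x) := by
      rw [hφ.zero]
      exact ((hφ.contDiff_space hK hr hV t).differentiable hr0 x).hasFDerivAt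
    exact h3.comp_hasDerivAt 0 h2
  have h4 : HasDerivAt (fun s => φ t (φ s x)) (V (φ t x)) 0 := by
    have : (fun s => φ t (φ s x)) = fun s => φ s (φ t x) := by
      ext1 s; rw [← hφ.add hK, add_comm, hφ.add hK]
    rw [this]
    simpa [hφ.zero] using hφ.hasDerivAt (φ t x) 0
  exact h1.unique h4

/-- The flow preserves the orientation of the plane. -/
theorem exists_det_pos (hφ : IsGlobalFlow V φ) (hK : LipschitzWith K V) (hr : 1 ≤ r)
    (hV : ContDiff ℝ r V) (t : ℝ) (x : Plane) :
    ∃ J > 0, ∀ a b, det2 (fderiv ℝ (φ t) x a) (fderiv ℝ (φ t) x b) = J * det2 a b := by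
  have hr0 : (r : WithTop ℕ∞) ≠ 0 := by simpa using (one_pos.trans_le hr).ne'
  have hr1 : (1 : WithTop ℕ∞) ≤ r := by exact_mod_cast hr
  set J : ℝ → ℝ := fun t => det2 (fderiv ℝ (φ t) x (EuclideanSpace.single 0 1))
    (fderiv ℝ (φ t) x (EuclideanSpace.single 1 1)) with hJ
  have hdiff : ∀ t y, HasFDerivAt (φ t) (fderiv ℝ (φ t) y) y := fun t y =>
    ((hφ.contDiff_space hK hr hV t).differentiable hr0 y).hasFDerivAt
  have hcont : Continuous J := by
    have h1 : Continuous fun t => fderiv ℝ (φ t) x := by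
      have hc : ContDiff ℝ 1 (Function.uncurry φ) := (hφ.contDiff hK hr hV).of_le hr1
      exact (ContDiff.fderiv (m := 1) (n := 0) hc contDiff_const (by simp)).continuous
    exact continuous_det2.comp ((h1.clm_apply continuous_const).prodMk
      (h1.clm_apply continuous_const))
  have h0 : J 0 = 1 := by
    have : φ 0 = id := funext hφ.zero
    simp [hJ, this, det2]
  -- The time `-t` map inverts the time `t` map, so the Jacobian determinant never vanishes; it is
  -- continuous in `t` and equals `1` at `t = 0`.
  have hne : ∀ t, J t ≠ 0 := by
    intro t ht
    have h1 : (fderiv ℝ (φ (-t)) (φ t x)).comp (fderiv ℝ (φ t) x) =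
        ContinuousLinearMap.id ℝ Plane := by
      have h2 := (hdiff (-t) (φ t x)).comp x (hdiff t x)
      have h3 : φ (-t) ∘ φ t = id := funext fun y => hφ.neg_cancel hK t y
      rw [h3] at h2
      exact h2.unique (hasFDerivAt_id x)
    have h4 := det2_map (fderiv ℝ (φ (-t)) (φ t x))
      (fderiv ℝ (φ t) x (EuclideanSpace.single 0 1)) (fderiv ℝ (φ t) x (EuclideanSpace.single 1 1))
    rw [← ContinuousLinearMap.comp_apply, ← ContinuousLinearMap.comp_apply, h1] at h4
    change _ = _ * J t at h4
    rw [ht, mul_zero] at h4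
    simp [det2] at h4
  refine ⟨J t, ?_, fun a b => det2_map _ a b⟩
  by_contra hcon
  push Not at hcon
  have : (0 : ℝ) ∈ J '' univ := by
    refine (isPreconnected_univ.image J hcont.continuousOn).ordConnected.out
      (mem_image_of_mem _ (mem_univ t)) (mem_image_of_mem _ (mem_univ 0)) ⟨hcon, ?_⟩
    rw [h0]; exact zero_le_one
  obtain ⟨s, -, hs⟩ := this
  exact hne s hs

/-- The transition time to a transversal level set is smooth. -/
theorem contDiffAt_transit_time (hφ : IsGlobalFlow V φ) (hK : LipschitzWith K V) (hr : 1 ≤ r)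
    (hV : ContDiff ℝ r V) {g : Plane → ℝ} (hg : ContDiff ℝ r g) {s : ℝ → Plane} {u : ℝ}
    (hs : ContDiffAt ℝ r s u) {τ : ℝ → ℝ} {a b : ℝ}
    (hτ : ∀ᶠ v in 𝓝 u, τ v ∈ Ioo a b ∧ g (φ (τ v) (s v)) = 0)
    (hinj : ∀ᶠ v in 𝓝 u, InjOn (fun t => g (φ t (s v))) (Ioo a b))
    (hne : lieD V g (φ (τ u) (s u)) ≠ 0) : ContDiffAt ℝ r τ u := by
  have hr0 : (r : WithTop ℕ∞) ≠ 0 := by simpa using (one_pos.trans_le hr).ne'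
  set F : ℝ × ℝ → ℝ := fun p => g (φ p.2 (s p.1))
  have hF : ContDiffAt ℝ r F (u, τ u) := by
    refine hg.contDiffAt.comp (u, τ u) ?_
    exact (hφ.contDiff hK hr hV).contDiffAt.comp (u, τ u)
      (f := fun p : ℝ × ℝ => (p.2, s p.1)) (contDiffAt_snd.prodMk (hs.comp _ contDiffAt_fst))
  have hinv : (fderiv ℝ F (u, τ u) ∘L .inr ℝ ℝ ℝ).IsInvertible := by
    refine isInvertible_of_ne_zero ?_
    have h1 : HasDerivAt (fun t => g (φ t (s u)))
        ((fderiv ℝ F (u, τ u) ∘L .inr ℝ ℝ ℝ) 1) (τ u) :=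
      ((hF.differentiableAt hr0).hasFDerivAt.comp (τ u)
        (hasFDerivAt_prodMk_right u (τ u))).hasDerivAt
    have h2 : HasDerivAt (fun t => g (φ t (s u))) (lieD V g (φ (τ u) (s u))) (τ u) :=
      ((hg.differentiable hr0) _).hasFDerivAt.comp_hasDerivAt _ (hφ.hasDerivAt (s u) (τ u))
    rwa [h1.unique h2]
  obtain ⟨ψ, hψ, hev, h0⟩ := exists_contDiffAt_implicitFunction hr0 hF hinv
  refine hψ.congr_of_eventuallyEq ?_
  have hmem : ∀ᶠ v in 𝓝 u, ψ v ∈ Ioo a b :=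
    hψ.continuousAt.eventually_mem (by
      rw [h0]; exact isOpen_Ioo.mem_nhds hτ.self_of_nhds.1)
  -- Continuity of `τ` is not assumed: injectivity on the time window leaves `ψ v` as the only zero
  -- available to `τ v`.
  filter_upwards [hev, hmem, hτ, hinj] with v h1 h2 h3 h4
  refine h4 h3.1 h2 ?_
  have h5 : g (φ (τ u) (s u)) = 0 := hτ.self_of_nhds.2
  change g (φ (τ v) (s v)) = g (φ (ψ v) (s v))
  rw [h3.2]
  exact (h1.trans h5).symm

/-- The derivative of a transition map is related to the orientations of the two sections. -/
theorem exists_det_transit (hφ : IsGlobalFlow V φ) (hK : LipschitzWith K V) (hr : 1 ≤ r)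
    (hV : ContDiff ℝ r V) {s : ℝ → Plane} {u : ℝ} (hs : DifferentiableAt ℝ s u) {τ : ℝ → ℝ}
    (hτ : DifferentiableAt ℝ τ u) {e : ℝ → Plane} {ρ : ℝ → ℝ} (hρ : DifferentiableAt ℝ ρ u)
    (he : DifferentiableAt ℝ e (ρ u)) (heq : ∀ᶠ v in 𝓝 u, φ (τ v) (s v) = e (ρ v)) :
    ∃ J > 0, deriv ρ u * det2 (V (e (ρ u))) (deriv e (ρ u)) = J * det2 (V (s u)) (deriv s u) := by
  have hr0 : (r : WithTop ℕ∞) ≠ 0 := by simpa using (one_pos.trans_le hr).ne'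
  obtain ⟨J, hJ, hdet⟩ := hφ.exists_det_pos hK hr hV (τ u) (s u)
  refine ⟨J, hJ, ?_⟩
  have hq : φ (τ u) (s u) = e (ρ u) := heq.self_of_nhds
  have h1 : HasDerivAt (fun v => e (ρ v)) (deriv ρ u • deriv e (ρ u)) u :=
    he.hasDerivAt.scomp u hρ.hasDerivAt
  have h2 : HasDerivAt (fun v => φ (τ v) (s v))
      (deriv τ u • V (φ (τ u) (s u)) + fderiv ℝ (φ (τ u)) (s u) (deriv s u)) u := by
    have hΦ : HasFDerivAt (fun p : ℝ × Plane => φ p.1 p.2)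
        (fderiv ℝ (fun p : ℝ × Plane => φ p.1 p.2) (τ u, s u)) (τ u, s u) :=
      ((hφ.contDiff hK hr hV).differentiable hr0 _).hasFDerivAt
    have h3 := hΦ.comp_hasDerivAt u (hτ.hasDerivAt.prodMk hs.hasDerivAt)
    convert! h3 using 1
    set D := fderiv ℝ (fun p : ℝ × Plane => φ p.1 p.2) (τ u, s u)
    have h4 : HasDerivAt (fun t => φ t (s u)) (D (1, 0)) (τ u) := by
      have h5 := (hΦ.comp (τ u) (hasFDerivAt_prodMk_left (τ u) (s u))).hasDerivAt
      simp only [ContinuousLinearMap.comp_apply, ContinuousLinearMap.inl_apply] at h5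
      exact h5
    have h5 : HasFDerivAt (φ (τ u)) (D ∘L .inr ℝ ℝ Plane) (s u) :=
      hΦ.comp (s u) (hasFDerivAt_prodMk_right (τ u) (s u))
    rw [h5.fderiv, (hφ.hasDerivAt (s u) (τ u)).unique h4]
    have : (deriv τ u, deriv s u) = deriv τ u • ((1 : ℝ), (0 : Plane)) + (0, deriv s u) := by
      simp
    rw [this, map_add, map_smul]
    rfl
  -- This reads `τ' V + Dφ s' = ρ' e'`. Taking the determinant with `V` removes the term in `τ'`,
  -- and `V` at the end point is the image under `Dφ` of `V` at the starting point.
  have h6 := (h2.congr_of_eventuallyEq (heq.mono fun v hv => hv.symm)).unique h1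
  rw [← det2_smul_right, ← h6, ← hq, det2_add_right, det2_smul_right, det2_self, mul_zero, zero_add,
    ← hφ.fderiv_apply_field hK hr hV, hdet]

end IsGlobalFlow

end Transition

/-! ### Charts of the switching manifold. -/

section Chart

theorem IsSigmaChart.contDiffAt {h : Plane → ℝ} {p : Plane} {c : ℝ → Plane} {ε : ℝ}
    (hc : IsSigmaChart h p c ε) {x : ℝ} (hx : x ∈ Ioo (-ε) ε) : ContDiffAt ℝ ∞ c x :=
  (hc.smooth x hx).contDiffAt (isOpen_Ioo.mem_nhds hx)

theorem IsSigmaChart.zero_mem {h : Plane → ℝ} {p : Plane} {c : ℝ → Plane} {ε : ℝ}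
    (hc : IsSigmaChart h p c ε) : (0 : ℝ) ∈ Ioo (-ε) ε := ⟨by linarith [hc.pos], hc.pos⟩

theorem IsSigmaChart.hasDerivAt {h : Plane → ℝ} {p : Plane} {c : ℝ → Plane} {ε : ℝ}
    (hc : IsSigmaChart h p c ε) {x : ℝ} (hx : x ∈ Ioo (-ε) ε) : HasDerivAt c (deriv c x) x :=
  ((hc.contDiffAt hx).differentiableAt (by simp)).hasDerivAt

theorem IsSigmaChart.fderiv_deriv {h : Plane → ℝ} (hh : ContDiff ℝ ∞ h) {p : Plane} {c : ℝ → Plane}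
    {ε : ℝ} (hc : IsSigmaChart h p c ε) {x : ℝ} (hx : x ∈ Ioo (-ε) ε) :
    fderiv ℝ h (c x) (deriv c x) = 0 := by
  have h1 : HasDerivAt (fun y => h (c y)) (fderiv ℝ h (c x) (deriv c x)) x :=
    (hh.differentiable (by simp) (c x)).hasFDerivAt.comp_hasDerivAt x (hc.hasDerivAt hx)
  have h2 : (fun y => h (c y)) =ᶠ[𝓝 x] fun _ => 0 :=
    (isOpen_Ioo.eventually_mem hx).mono fun y hy => hc.mem y hy
  exact (h1.congr_of_eventuallyEq h2.symm).unique (hasDerivAt_const x 0)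

theorem IsSigmaChart.continuousAt_deriv {h : Plane → ℝ} {p : Plane} {c : ℝ → Plane}
    {ε : ℝ} (hc : IsSigmaChart h p c ε) : ContinuousAt (deriv c) 0 := by
  have h1 := hc.smooth.continuousOn_deriv_of_isOpen isOpen_Ioo (by simp)
  exact (h1 0 hc.zero_mem).continuousAt (isOpen_Ioo.mem_nhds hc.zero_mem)

/-- The coordinate defined by a chart of the switching manifold extends to a smooth function. -/
theorem IsSigmaChart.exists_coordinate {h : Plane → ℝ} (hh : ContDiff ℝ ∞ h) {p : Plane}
    (hreg : fderiv ℝ h p ≠ 0) {c : ℝ → Plane} {ε : ℝ} (hc : IsSigmaChart h p c ε) :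
    ∃ W : Plane → ℝ, W p = 0 ∧ ∀ᶠ q in 𝓝 p, ContDiffAt ℝ ∞ W q ∧ (h q = 0 → c (W q) = q) := by
  set v := deriv c 0 with hv
  have hv0 : v ≠ 0 := hc.immersion 0 hc.zero_mem
  -- A normal vector to the chart at `p`; moving along it makes `(x, y) ↦ c x + y • n` a local
  -- diffeomorphism whose inverse provides `W`.
  set n : Plane := !₂[-v 1, v 0] with hn
  have hvn : det2 v n ≠ 0 := by
    have h1 : det2 v n = v 0 ^ 2 + v 1 ^ 2 := by simp [det2, hn]; ring
    rw [h1]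
    intro h2
    refine hv0 ?_
    have a0 : v 0 = 0 := by nlinarith [sq_nonneg (v 0), sq_nonneg (v 1)]
    have a1 : v 1 = 0 := by nlinarith [sq_nonneg (v 0), sq_nonneg (v 1)]
    rw [plane_eq v, a0, a1]; simp
  have hdn : fderiv ℝ h p n ≠ 0 := by
    intro h1
    refine hreg ?_
    obtain ⟨L, hL⟩ := exists_basis_equiv hvn
    ext w
    obtain ⟨y, rfl⟩ := L.surjective w
    have h2 := hc.fderiv_deriv hh hc.zero_mem
    rw [hc.center] at h2
    rw [hL, map_add, map_smul, map_smul, h1, h2]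
    simp
  set F : ℝ × ℝ → Plane := fun q => c q.1 + q.2 • n with hF
  have hFd : ∀ q : ℝ × ℝ, q.1 ∈ Ioo (-ε) ε → det2 (deriv c q.1) n ≠ 0 →
      ContDiffAt ℝ ∞ F q ∧ ∃ L : (ℝ × ℝ) ≃L[ℝ] Plane, HasFDerivAt F (L : ℝ × ℝ →L[ℝ] Plane) q := by
    intro q hq hdet
    refine ⟨((hc.contDiffAt hq).comp q contDiffAt_fst).add
      (contDiffAt_snd.smul contDiffAt_const), ?_⟩
    obtain ⟨L, hL⟩ := exists_basis_equiv hdet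
    refine ⟨L, ?_⟩
    have h1 : HasFDerivAt F _ q :=
      ((hc.hasDerivAt hq).hasFDerivAt.comp q hasFDerivAt_fst).add
        ((hasFDerivAt_snd (𝕜 := ℝ) (p := q)).smul_const n)
    convert! h1 using 1
    ext x <;> simp [hL]
  obtain ⟨hF0, L₀, hL₀⟩ := hFd (0, 0) hc.zero_mem hvn
  set e := hF0.toOpenPartialHomeomorph F hL₀ (by simp) with he
  have hecoe : ∀ q, e q = F q := fun q => rfl
  have h0s : ((0 : ℝ), (0 : ℝ)) ∈ e.source := hF0.mem_toOpenPartialHomeomorph_source hL₀ (by simp)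
  have hFp : F (0, 0) = p := by simp [hF, hc.center]
  have hpt : p ∈ e.target := by rw [← hFp]; exact e.map_source h0s
  have hsymm : e.symm p = (0, 0) := by rw [← hFp]; exact e.left_inv h0s
  have hFc : ContinuousAt F (0, 0) := hF0.continuousAt
  have hev : ∀ᶠ q : ℝ × ℝ in 𝓝 (0, 0), q.1 ∈ Ioo (-ε) ε ∧ det2 (deriv c q.1) n ≠ 0 ∧
      fderiv ℝ h (F q) n ≠ 0 := by
    have e1 : ∀ᶠ q : ℝ × ℝ in 𝓝 (0, 0), q.1 ∈ Ioo (-ε) ε :=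
      continuousAt_fst.eventually_mem (isOpen_Ioo.mem_nhds hc.zero_mem)
    have c2 : ContinuousAt (fun q : ℝ × ℝ => det2 (deriv c q.1) n) (0, 0) :=
      continuous_det2.continuousAt.comp (f := fun q : ℝ × ℝ => (deriv c q.1, n))
        ((hc.continuousAt_deriv.comp (f := Prod.fst) (x := ((0 : ℝ), (0 : ℝ)))
          continuousAt_fst).prodMk continuousAt_const)
    have c3 : ContinuousAt (fun q : ℝ × ℝ => fderiv ℝ h (F q) n) (0, 0) :=
      (((hh.continuous_fderiv (by simp)).continuousAt.comp hFc).clm_apply continuousAt_const)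
    have e3 := c3.eventually_ne (by rw [hFp]; exact hdn)
    filter_upwards [e1, c2.eventually_ne hvn, e3] with q h1 h2 h3 using ⟨h1, h2, h3⟩
  obtain ⟨ρ, hρ, hball⟩ := Metric.eventually_nhds_iff_ball.1 hev
  refine ⟨fun q => (e.symm q).1, by simp [hsymm], ?_⟩
  have hb : ∀ᶠ q in 𝓝 p, e.symm q ∈ Metric.ball ((0 : ℝ), (0 : ℝ)) ρ :=
    (e.continuousAt_symm hpt).eventually_mem (by rw [hsymm]; exact Metric.ball_mem_nhds _ hρ)
  filter_upwards [hb, e.open_target.mem_nhds hpt] with q hq hqt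
  obtain ⟨h1, h2, h3⟩ := hball _ hq
  obtain ⟨hd, L, hL⟩ := hFd _ h1 h2
  refine ⟨contDiffAt_fst.comp q (e.contDiffAt_symm hqt hL hd), fun hq0 => ?_⟩
  have hFq : F (e.symm q) = q := e.right_inv hqt
  set x := (e.symm q).1 with hx
  set y := (e.symm q).2 with hy
  have hxy : e.symm q = (x, y) := rfl
  rw [hxy] at hFq hq
  by_cases hy0 : y = 0
  · rw [hy0] at hFq; simpa [hF] using hFq
  exfalso
  rw [Metric.mem_ball, Prod.dist_eq, max_lt_iff, Real.dist_eq, Real.dist_eq, sub_zero, sub_zero]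
    at hq
  have hder : ∀ t : ℝ, HasDerivAt (fun t => h (c x + (t * y) • n))
      (fderiv ℝ h (c x + (t * y) • n) (y • n)) t := fun t => by
    have h5 : HasDerivAt (fun t : ℝ => c x + (t * y) • n) (y • n) t := by
      simpa using (((hasDerivAt_id t).mul_const y).smul_const n).const_add (c x)
    exact (hh.differentiable (by simp) _).hasFDerivAt.comp_hasDerivAt t h5
  -- Rolle's theorem: `h` vanishes at both ends of the segment from `c x` to `q`, yet its derivative
  -- along `n` has no zero near `p`. So a nearby point of Σ has `y = 0`.
  obtain ⟨t, ht, h6⟩ := exists_hasDerivAt_eq_zero (f := fun t => h (c x + (t * y) • n)) one_pos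
    (fun t _ => (hder t).continuousAt.continuousWithinAt)
    (by
      have h7 : c x + ((1 : ℝ) * y) • n = q := by simpa [hF] using hFq
      have h9 : h (c x) = 0 := hc.mem x h1
      simp only [h7, hq0]
      simp [h9]) (fun t _ => hder t)
  have h8 : (x, t * y) ∈ Metric.ball ((0 : ℝ), (0 : ℝ)) ρ := by
    rw [Metric.mem_ball, Prod.dist_eq, max_lt_iff, Real.dist_eq, Real.dist_eq, sub_zero, sub_zero]
    refine ⟨hq.1, ?_⟩
    simp only [abs_mul, abs_of_pos ht.1]
    exact (mul_le_of_le_one_left (abs_nonneg y) ht.2.le).trans_lt hq.2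
  rw [map_smul, smul_eq_mul] at h6
  exact (hball _ h8).2.2 ((mul_eq_zero.1 h6).resolve_left hy0)

/-- Orientation of a vector tangent to the switching manifold, in terms of a transversal vector. -/
theorem det2_mul_sigmaOrient {h : Plane → ℝ} {p v w : Plane} (hw : fderiv ℝ h p w = 0) :
    det2 v w * ((fderiv ℝ h p (EuclideanSpace.single 0 1)) ^ 2 +
      (fderiv ℝ h p (EuclideanSpace.single 1 1)) ^ 2) = fderiv ℝ h p v * sigmaOrient h p w := by
  have hlin : ∀ a : Plane, fderiv ℝ h p a = a 0 * fderiv ℝ h p (EuclideanSpace.single 0 1) +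
      a 1 * fderiv ℝ h p (EuclideanSpace.single 1 1) := fun a => by
    conv_lhs => rw [plane_eq a, map_add, map_smul, map_smul, smul_eq_mul, smul_eq_mul]
  rw [hlin] at hw
  rw [hlin v]
  unfold sigmaOrient det2
  set A := fderiv ℝ h p (EuclideanSpace.single 0 1)
  set B := fderiv ℝ h p (EuclideanSpace.single 1 1)
  linear_combination (v 1 * A - v 0 * B) * (-1) * hw

theorem gradient_sq_pos {h : Plane → ℝ} {p : Plane} (hreg : fderiv ℝ h p ≠ 0) :
    0 < (fderiv ℝ h p (EuclideanSpace.single 0 1)) ^ 2 +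
      (fderiv ℝ h p (EuclideanSpace.single 1 1)) ^ 2 := by
  rw [lt_iff_le_and_ne]
  refine ⟨by positivity, fun h0 => hreg ?_⟩
  have a0 : fderiv ℝ h p (EuclideanSpace.single 0 1) = 0 := by
    nlinarith [sq_nonneg (fderiv ℝ h p (EuclideanSpace.single 0 1)),
      sq_nonneg (fderiv ℝ h p (EuclideanSpace.single 1 1))]
  have a1 : fderiv ℝ h p (EuclideanSpace.single 1 1) = 0 := by
    nlinarith [sq_nonneg (fderiv ℝ h p (EuclideanSpace.single 0 1)),
      sq_nonneg (fderiv ℝ h p (EuclideanSpace.single 1 1))]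
  ext a
  rw [plane_eq a, map_add, map_smul, map_smul, a0, a1]
  simp

end Chart

/-! ### The topology on fields, cutoffs, and dependence of the flow on the field. -/

section FieldTopology

variable {r : ℕ∞}

theorem VField.continuous_iterDeriv (k : ℕ) (hk : (k : ℕ∞) ≤ r) :
    Continuous (VField.iterDeriv (r := r) k hk) := by
  rw [continuous_iff_le_induced]
  exact (iInf_le _ k).trans (iInf_le _ hk)

/-- The field is its derivative of order zero, and evaluation is jointly continuous in the
compact-open topology because the plane is locally compact. -/
theorem VField.continuous_apply : Continuous fun q : VField r × Plane => q.1 q.2 := by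
  have h1 : Continuous fun q : VField r × Plane =>
      VField.iterDeriv 0 (by simp) q.1 q.2 :=
    ((VField.continuous_iterDeriv 0 (by simp)).comp continuous_fst).eval continuous_snd
  have h2 : (fun q : VField r × Plane => q.1 q.2) = fun q : VField r × Plane =>
      (VField.iterDeriv 0 (by simp) q.1 q.2 : Plane [×0]→L[ℝ] Plane) ![] := by
    ext1 q; simp [VField.iterDeriv]
  rw [h2]
  exact (ContinuousMultilinearMap.apply ℝ (fun _ : Fin 0 => Plane) Plane ![]).continuous.comp h1

theorem VField.continuous_fderiv (hr : 1 ≤ r) :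
    Continuous fun q : VField r × Plane => fderiv ℝ q.1 q.2 := by
  have hr' : ((1 : ℕ) : ℕ∞) ≤ r := by exact_mod_cast hr
  have h1 : Continuous fun q : VField r × Plane => VField.iterDeriv 1 hr' q.1 q.2 :=
    ((VField.continuous_iterDeriv 1 hr').comp continuous_fst).eval continuous_snd
  rw [continuous_clm_apply]
  intro v
  have h2 : (fun q : VField r × Plane => fderiv ℝ q.1 q.2 v) = fun q : VField r × Plane =>
      (VField.iterDeriv 1 hr' q.1 q.2 : Plane [×1]→L[ℝ] Plane) ![v] := by
    ext1 q; simp [VField.iterDeriv]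
  rw [h2]
  exact (ContinuousMultilinearMap.apply ℝ (fun _ : Fin 1 => Plane) Plane ![v]).continuous.comp h1

/-- A smooth function equal to `1` on the ball of radius `R`, with compact support. -/
noncomputable def bump (R : ℝ) : ContDiffBump (0 : Plane) :=
  ⟨|R| + 1, |R| + 2, by positivity, by linarith⟩

/-- The vector field `X` made compactly supported without changing it on the ball of radius `R`. -/
noncomputable def cutoff (R : ℝ) (X : Plane → Plane) (p : Plane) : Plane := bump R p • X p

theorem cutoff_eq {R : ℝ} (X : Plane → Plane) {p : Plane} (hp : ‖p‖ ≤ R) : cutoff R X p = X p := by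
  rw [cutoff, (bump R).one_of_mem_closedBall, one_smul]
  rw [mem_closedBall_zero_iff]
  exact hp.trans ((le_abs_self R).trans (by simp [bump]))

theorem contDiff_cutoff (R : ℝ) (X : VField r) : ContDiff ℝ r (cutoff R X) :=
  (bump R).contDiff.smul X.contDiff'

theorem hasCompactSupport_cutoff (R : ℝ) (X : Plane → Plane) : HasCompactSupport (cutoff R X) :=
  (bump R).hasCompactSupport.smul_right

theorem exists_lipschitzWith_cutoff (hr : 1 ≤ r) (R : ℝ) (X : VField r) :
    ∃ K, LipschitzWith K (cutoff R X) :=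
  (contDiff_cutoff R X).lipschitzWith_of_hasCompactSupport (hasCompactSupport_cutoff R X)
    (by simpa using (one_pos.trans_le hr).ne')

/-- The global flow of the compactly supported modification of a vector field. -/
noncomputable def cutFlow (R : ℝ) (X : Plane → Plane) : ℝ → Plane → Plane :=
  open Classical in if h : ∃ φ, IsGlobalFlow (cutoff R X) φ then h.choose else fun _ x => x

theorem isGlobalFlow_cutFlow (hr : 1 ≤ r) (R : ℝ) (X : VField r) :
    IsGlobalFlow (cutoff R X) (cutFlow R X) := by
  obtain ⟨K, hK⟩ := exists_lipschitzWith_cutoff hr R X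
  obtain ⟨M, hM⟩ := (hasCompactSupport_cutoff R X).exists_bound_of_continuous
    (contDiff_cutoff R X).continuous
  have h : ∃ φ, IsGlobalFlow (cutoff R X) φ :=
    exists_isGlobalFlow (M := M.toNNReal) hK fun x => (hM x).trans (Real.le_coe_toNNReal M)
  rw [cutFlow, dif_pos h]
  exact h.choose_spec

theorem VField.continuous_cutoff (R : ℝ) :
    Continuous fun q : VField r × Plane => cutoff R q.1 q.2 :=
  ((bump R).continuous.comp continuous_snd).smul VField.continuous_apply

/-- Both cutoffs vanish outside the ball of radius `|R| + 2`, and on that compact ball closeness is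
part of the topology. Closeness on the whole plane is what `IsGlobalFlow.dist_le` requires. -/
theorem eventually_dist_cutoff_lt (R : ℝ) (X₀ : VField r) {ε : ℝ} (hε : 0 < ε) :
    ∀ᶠ X : VField r in 𝓝 X₀, ∀ p, dist (cutoff R X p) (cutoff R X₀ p) ≤ ε := by
  have h1 : ∀ᶠ X : VField r in 𝓝 X₀, ∀ p ∈ Metric.closedBall (0 : Plane) (|R| + 2),
      dist (cutoff R X p) (cutoff R X₀ p) < ε := by
    refine (isCompact_closedBall _ _).eventually_forall_of_forall_eventually fun p _ => ?_
    have : Continuous fun q : VField r × Plane => dist (cutoff R q.1 q.2) (cutoff R X₀ q.2) :=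
      (VField.continuous_cutoff R).dist
        ((contDiff_cutoff R X₀).continuous.comp continuous_snd)
    exact this.continuousAt.eventually_lt_const (by simpa using hε)
  filter_upwards [h1] with X hX p
  by_cases hp : p ∈ Metric.closedBall (0 : Plane) (|R| + 2)
  · exact (hX p hp).le
  · have h0 : bump R p = 0 := (bump R).zero_of_le_dist (by
      rw [Metric.mem_closedBall, not_le] at hp; exact hp.le)
    simp [cutoff, h0, hε.le]

/-- The flow depends continuously on the vector field, the time and the starting point. -/
theorem VField.continuous_cutFlow (hr : 1 ≤ r) (R : ℝ) :
    Continuous fun q : VField r × ℝ × Plane => cutFlow R q.1 q.2.1 q.2.2 := by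
  rw [continuous_iff_continuousAt]
  rintro ⟨X₀, t₀, x₀⟩
  obtain ⟨K, hK⟩ := exists_lipschitzWith_cutoff hr R X₀
  have hφ₀ := isGlobalFlow_cutFlow hr R X₀
  have h1 : Tendsto (fun q : VField r × ℝ × Plane => cutFlow R X₀ q.2.1 q.2.2) (𝓝 (X₀, t₀, x₀))
      (𝓝 (cutFlow R X₀ t₀ x₀)) :=
    ((hφ₀.continuous hK).comp continuous_snd).tendsto (X₀, t₀, x₀)
  rw [ContinuousAt, Metric.tendsto_nhds]
  intro ε hε
  have h2 : Tendsto (fun δ => gronwallBound 0 K δ (|t₀| + 1)) (𝓝 0) (𝓝 0) := by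
    have := (gronwallBound_continuous_ε 0 K (|t₀| + 1)).tendsto 0
    rwa [gronwallBound_ε0_δ0] at this
  obtain ⟨δ, hδ, hδ'⟩ := Metric.eventually_nhds_iff.1
    (h2.eventually_lt_const (half_pos hε))
  have h3 : ∀ᶠ q : VField r × ℝ × Plane in 𝓝 (X₀, t₀, x₀),
      ∀ p, dist (cutoff R q.1 p) (cutoff R X₀ p) ≤ δ / 2 :=
    (continuous_fst.tendsto (X₀, t₀, x₀)).eventually (eventually_dist_cutoff_lt R X₀ (half_pos hδ))
  have h4 : ∀ᶠ q : VField r × ℝ × Plane in 𝓝 (X₀, t₀, x₀), |q.2.1| < |t₀| + 1 := by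
    have : Continuous fun q : VField r × ℝ × Plane => |q.2.1| := by fun_prop
    exact this.continuousAt.eventually_lt_const (by simp)
  filter_upwards [h3, h4, Metric.tendsto_nhds.1 h1 (ε / 2) (half_pos hε)] with q a1 a2 a3
  have a4 := (isGlobalFlow_cutFlow hr R q.1).dist_le hφ₀ hK a1 (x := q.2.2) (y := q.2.2)
    (by simp) le_rfl a2.le
  have a5 : gronwallBound 0 K (δ / 2) (|t₀| + 1) < ε / 2 := hδ' (by
    rw [Real.dist_eq, sub_zero, abs_of_pos (half_pos hδ)]; linarith)
  linarith [dist_triangle (cutFlow R q.1 q.2.1 q.2.2) (cutFlow R X₀ q.2.1 q.2.2)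
    (cutFlow R X₀ t₀ x₀)]

end FieldTopology

/-! ### Cone estimates for orbits near a saddle. -/

section NearSaddle

/-- `ℓ₁, ℓ₂` is the basis dual to `e₁, e₂`. -/
structure IsCoord (ℓ₁ ℓ₂ : Plane →L[ℝ] ℝ) (e₁ e₂ : Plane) : Prop where
  l11 : ℓ₁ e₁ = 1
  l12 : ℓ₁ e₂ = 0
  l21 : ℓ₂ e₁ = 0
  l22 : ℓ₂ e₂ = 1
  decomp : ∀ p, p = ℓ₁ p • e₁ + ℓ₂ p • e₂

/-- The closed box of radius `R` in the coordinates `ℓ₁, ℓ₂`. -/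
def box (ℓ₁ ℓ₂ : Plane →L[ℝ] ℝ) (R : ℝ) : Set Plane := {p | |ℓ₁ p| ≤ R ∧ |ℓ₂ p| ≤ R}

/-- On the box of radius `R`, the field `V` differs from the linear saddle with rates `α` and `-β`
by a map with small Lipschitz constant. -/
def NearSaddle (V : Plane → Plane) (ℓ₁ ℓ₂ : Plane →L[ℝ] ℝ) (α β κ R : ℝ) : Prop :=
  ∀ p ∈ box ℓ₁ ℓ₂ R, ∀ q ∈ box ℓ₁ ℓ₂ R,
    |ℓ₁ (V p - V q) - α * ℓ₁ (p - q)| ≤ κ * (|ℓ₁ (p - q)| + |ℓ₂ (p - q)|) ∧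
    |ℓ₂ (V p - V q) + β * ℓ₂ (p - q)| ≤ κ * (|ℓ₁ (p - q)| + |ℓ₂ (p - q)|)

variable {ℓ₁ ℓ₂ : Plane →L[ℝ] ℝ} {e₁ e₂ : Plane} {V : Plane → Plane} {φ : ℝ → Plane → Plane}
  {K : NNReal} {α β κ R M : ℝ}

theorem box_mono {R R' : ℝ} (h : R ≤ R') : box ℓ₁ ℓ₂ R ⊆ box ℓ₁ ℓ₂ R' :=
  fun _ hp => ⟨hp.1.trans h, hp.2.trans h⟩

theorem box_swap (R : ℝ) : box ℓ₂ ℓ₁ R = box ℓ₁ ℓ₂ R := by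
  ext p; exact and_comm

theorem box_neg (R : ℝ) : box (-ℓ₁) ℓ₂ R = box ℓ₁ ℓ₂ R := by
  ext p; simp [box]

theorem isClosed_box (R : ℝ) : IsClosed (box ℓ₁ ℓ₂ R) :=
  IsClosed.inter (isClosed_le (f := fun p => |ℓ₁ p|) (by fun_prop) continuous_const)
    (isClosed_le (f := fun p => |ℓ₂ p|) (by fun_prop) continuous_const)

theorem box_mem_nhds (hR : 0 < R) : box ℓ₁ ℓ₂ R ∈ 𝓝 (0 : Plane) := by
  have h1 : ∀ᶠ p in 𝓝 (0 : Plane), |ℓ₁ p| < R :=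
    (ℓ₁.continuous.abs).continuousAt.eventually_lt_const (by simpa using hR)
  have h2 : ∀ᶠ p in 𝓝 (0 : Plane), |ℓ₂ p| < R :=
    (ℓ₂.continuous.abs).continuousAt.eventually_lt_const (by simpa using hR)
  filter_upwards [h1, h2] with p a b using ⟨a.le, b.le⟩

theorem NearSaddle.mono {R' : ℝ} (h : NearSaddle V ℓ₁ ℓ₂ α β κ R) (hR : R' ≤ R) :
    NearSaddle V ℓ₁ ℓ₂ α β κ R' :=
  fun p hp q hq => h p (box_mono hR hp) q (box_mono hR hq)

/-- Time reversal exchanges the two directions and their rates, so constructions for the unstable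
manifold also serve for the stable one; `NearSaddle.neg` selects the opposite branch. -/
theorem NearSaddle.reverse (h : NearSaddle V ℓ₁ ℓ₂ α β κ R) :
    NearSaddle (fun x => -V x) ℓ₂ ℓ₁ β α κ R := by
  intro p hp q hq
  rw [box_swap] at hp hq
  obtain ⟨h1, h2⟩ := h p hp q hq
  rw [add_comm |ℓ₂ _|]
  constructor
  · rw [← abs_neg]; convert h2 using 2; simp; ring
  · rw [← abs_neg]; convert h1 using 2; simp; ring

theorem NearSaddle.neg (h : NearSaddle V ℓ₁ ℓ₂ α β κ R) :
    NearSaddle V (-ℓ₁) ℓ₂ α β κ R := by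
  intro p hp q hq
  rw [box_neg] at hp hq
  obtain ⟨h1, h2⟩ := h p hp q hq
  simp only [neg_apply, abs_neg]
  refine ⟨?_, h2⟩
  rw [← abs_neg]; convert h1 using 2; ring

theorem IsCoord.swap (h : IsCoord ℓ₁ ℓ₂ e₁ e₂) : IsCoord ℓ₂ ℓ₁ e₂ e₁ :=
  ⟨h.l22, h.l21, h.l12, h.l11, fun p => by rw [add_comm]; exact h.decomp p⟩

theorem IsCoord.neg (h : IsCoord ℓ₁ ℓ₂ e₁ e₂) : IsCoord (-ℓ₁) ℓ₂ (-e₁) e₂ :=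
  ⟨by simp [h.l11], by simp [h.l12], by simp [h.l21], h.l22, fun p => by
    simpa using h.decomp p⟩

theorem IsCoord.ext (h : IsCoord ℓ₁ ℓ₂ e₁ e₂) {p q : Plane} (h1 : ℓ₁ p = ℓ₁ q) (h2 : ℓ₂ p = ℓ₂ q) :
    p = q := by
  rw [h.decomp p, h.decomp q, h1, h2]

theorem IsCoord.isCompact_box (h : IsCoord ℓ₁ ℓ₂ e₁ e₂) (R : ℝ) : IsCompact (box ℓ₁ ℓ₂ R) := by
  refine Metric.isCompact_of_isClosed_isBounded (isClosed_box R) ?_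
  refine isBounded_iff_forall_norm_le.2 ⟨R * ‖e₁‖ + R * ‖e₂‖, fun p hp => ?_⟩
  rw [h.decomp p]
  refine (norm_add_le _ _).trans ?_
  rw [norm_smul, norm_smul]
  gcongr
  · exact hp.1
  · exact hp.2

/-- The link between the flow and the scalar estimates. It holds for any two orbits in the box, not
only for an orbit and the saddle, because `NearSaddle` bounds increments of the field. -/
theorem saddlePair (hφ : IsGlobalFlow V φ) (hV : NearSaddle V ℓ₁ ℓ₂ α β κ R) {T : ℝ} {p q : Plane}
    (hp : ∀ t ∈ Icc 0 T, φ t p ∈ box ℓ₁ ℓ₂ R) (hq : ∀ t ∈ Icc 0 T, φ t q ∈ box ℓ₁ ℓ₂ R) :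
    SaddlePair α β κ T (fun t => ℓ₁ (φ t p - φ t q)) (fun t => ℓ₂ (φ t p - φ t q)) where
  fst t ht := ⟨_, ℓ₁.hasFDerivAt.comp_hasDerivAt t ((hφ.hasDerivAt p t).sub (hφ.hasDerivAt q t)),
    (hV _ (hp t ht) _ (hq t ht)).1⟩
  snd t ht := ⟨_, ℓ₂.hasFDerivAt.comp_hasDerivAt t ((hφ.hasDerivAt p t).sub (hφ.hasDerivAt q t)),
    (hV _ (hp t ht) _ (hq t ht)).2⟩

/-- An orbit starting in the unstable cone of a reference orbit stays in the box as long as it is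
behind the section `ℓ₁ = v`. -/
theorem mem_box_of_le (hφ : IsGlobalFlow V φ) (hV : NearSaddle V ℓ₁ ℓ₂ α β κ R)
    (hc : ConeSmall α β κ M) {T v r : ℝ} {p q : Plane} (hq : ∀ t ∈ Icc 0 T, φ t q ∈ box ℓ₁ ℓ₂ r)
    (hv : v < R) (hr : r + M * (v + r) < R) (hrR : r < R) (hx0 : 0 < ℓ₁ (p - q))
    (h0 : |ℓ₂ (p - q)| ≤ M * ℓ₁ (p - q)) (hp : ∀ t ∈ Icc 0 T, ℓ₁ (φ t p) ≤ v) :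
    ∀ t ∈ Icc 0 T, φ t p ∈ box ℓ₁ ℓ₂ R := by
  set f : ℝ → ℝ := fun t => max |ℓ₁ (φ t p)| |ℓ₂ (φ t p)| with hf
  have hfc : Continuous f :=
    (ℓ₁.continuous.comp (hφ.continuous_time p)).abs.max
      (ℓ₂.continuous.comp (hφ.continuous_time p)).abs
  have hM := hc.slope
  have key : ∀ t ∈ Icc 0 T, (∀ s ∈ Icc 0 t, φ s p ∈ box ℓ₁ ℓ₂ R) → f t < R := by
    intro t ht hs
    have hpair := saddlePair hφ hV (T := t) hs
      (fun s hs => box_mono hrR.le (hq s ⟨hs.1, hs.2.trans ht.2⟩))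
    obtain ⟨h1, h2, -⟩ := hpair.cone hc ht.1 (by simpa [hφ.zero] using hx0)
      (by simpa [hφ.zero] using h0)
    have h3 : 0 < ℓ₁ (φ t p - φ t q) := by
      refine lt_of_lt_of_le ?_ h2
      simp only [hφ.zero]; positivity
    obtain ⟨h4, h5⟩ := hq t ht
    have h6 := hp t ht
    rw [map_sub] at h1 h3
    rw [map_sub] at h1
    have h7 : ℓ₁ (φ t p) - ℓ₁ (φ t q) ≤ v + r := by linarith [(abs_le.1 h4).1]
    have h8 : M * (ℓ₁ (φ t p) - ℓ₁ (φ t q)) ≤ M * (v + r) := by gcongr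
    have h9 := abs_le.1 (h1.trans h8)
    refine max_lt (abs_lt.2 ⟨?_, ?_⟩) (abs_lt.2 ⟨?_, ?_⟩) <;>
    linarith [(abs_le.1 h4).1, (abs_le.1 h4).2, (abs_le.1 h5).1, (abs_le.1 h5).2]
  intro t ht
  have h0R : f 0 < R := by
    have h0T : (0 : ℝ) ∈ Icc 0 T := ⟨le_rfl, ht.1.trans ht.2⟩
    have a1 := hq 0 h0T
    have a2 := hp 0 h0T
    simp only [hφ.zero] at a1 a2
    simp only [hf, hφ.zero]
    rw [map_sub] at hx0 h0
    rw [map_sub] at h0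
    have h8 : M * (ℓ₁ p - ℓ₁ q) ≤ M * (v + r) := by gcongr; linarith [(abs_le.1 a1.1).1]
    have h9 := abs_le.1 (h0.trans h8)
    refine max_lt (abs_lt.2 ⟨?_, ?_⟩) (abs_lt.2 ⟨?_, ?_⟩) <;>
    linarith [(abs_le.1 a1.1).1, (abs_le.1 a1.1).2, (abs_le.1 a1.2).1, (abs_le.1 a1.2).2]
  have hlt : f t < R := by
    by_contra hcon
    push Not at hcon
    obtain ⟨T', hT', h1, h2⟩ := exists_first_hit ht.1 hfc.continuousOn h0R hcon
    have := key T' ⟨hT'.1.le, hT'.2.trans ht.2⟩ fun s hs => by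
      rcases hs.2.eq_or_lt with rfl | h
      · exact ⟨(le_max_left _ _).trans h1.le, (le_max_right _ _).trans h1.le⟩
      · have := h2 s ⟨hs.1, h⟩
        exact ⟨(le_max_left _ _).trans this.le, (le_max_right _ _).trans this.le⟩
    linarith
  exact ⟨(le_max_left _ _).trans hlt.le, (le_max_right _ _).trans hlt.le⟩

/-- An orbit starting in the unstable cone of an orbit that remains close to the saddle reaches the
section `ℓ₁ = v`. -/
theorem exists_exit (hφ : IsGlobalFlow V φ) (hV : NearSaddle V ℓ₁ ℓ₂ α β κ R)
    (hc : ConeSmall α β κ M) {v r : ℝ} {p q : Plane} (hq : ∀ t ≥ 0, φ t q ∈ box ℓ₁ ℓ₂ r)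
    (hv : v < R) (hr : r + M * (v + r) < R) (hrR : r < R) (hx0 : 0 < ℓ₁ (p - q))
    (h0 : |ℓ₂ (p - q)| ≤ M * ℓ₁ (p - q)) (hp : ℓ₁ p < v) :
    ∃ T > 0, ℓ₁ (φ T p) = v ∧ (∀ t ∈ Ico 0 T, ℓ₁ (φ t p) < v) ∧
      ∀ t ∈ Icc 0 T, φ t p ∈ box ℓ₁ ℓ₂ R := by
  have hcont : Continuous fun t => ℓ₁ (φ t p) := ℓ₁.continuous.comp (hφ.continuous_time p)
  have hα := hc.alpha
  -- Otherwise the difference from the reference orbit grows at least like `exp (α t / 2)`, while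
  -- its `ℓ₁` component stays below `v + r`.
  have hex : ∃ b ≥ 0, v ≤ ℓ₁ (φ b p) := by
    by_contra hcon
    push Not at hcon
    obtain ⟨b, hb⟩ : ∃ b : ℝ, 0 ≤ b ∧ v + r < Real.exp (α / 2 * b) * ℓ₁ (p - q) := by
      have h1 : Tendsto (fun b => Real.exp (α / 2 * b) * ℓ₁ (p - q)) atTop atTop :=
        (Real.tendsto_exp_atTop.comp (tendsto_id.const_mul_atTop (half_pos hα))).atTop_mul_const hx0
      exact ((eventually_ge_atTop 0).and (h1.eventually_gt_atTop _)).exists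
    have hbox := mem_box_of_le hφ hV hc (T := b) (fun t ht => hq t ht.1) hv hr hrR hx0 h0
      (fun t ht => (hcon t ht.1).le)
    have hpair := saddlePair hφ hV hbox (fun s hs => box_mono hrR.le (hq s hs.1))
    obtain ⟨-, h2, -⟩ := hpair.cone hc hb.1 (by simpa [hφ.zero] using hx0)
      (by simpa [hφ.zero] using h0)
    have h3 := hcon b hb.1
    have h4 := (abs_le.1 (hq b hb.1).1).1
    simp only [hφ.zero, map_sub] at h2
    rw [map_sub] at hb
    linarith [hb.2]
  obtain ⟨b, hb, hvb⟩ := hex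
  obtain ⟨T, hT, h1, h2⟩ := exists_first_hit hb hcont.continuousOn (by simpa [hφ.zero] using hp) hvb
  refine ⟨T, hT.1, h1, h2, ?_⟩
  refine mem_box_of_le hφ hV hc (fun t ht => hq t ht.1) hv hr hrR hx0 h0 fun t ht => ?_
  rcases ht.2.eq_or_lt with rfl | h
  · exact h1.le
  · exact (h2 t ⟨ht.1, h⟩).le

/-- Two orbits that remain in the box forever differ by a vector of the stable cone. -/
theorem abs_le_of_forall_mem_box (hφ : IsGlobalFlow V φ)
    (hV : NearSaddle V ℓ₁ ℓ₂ α β κ R) {m : ℝ} (hc : ConeSmall α β κ m⁻¹)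
    {p q : Plane} (hp : ∀ t ≥ 0, φ t p ∈ box ℓ₁ ℓ₂ R) (hq : ∀ t ≥ 0, φ t q ∈ box ℓ₁ ℓ₂ R) :
    |ℓ₁ (p - q)| ≤ m * |ℓ₂ (p - q)| := by
  have hm : 0 < m := inv_pos.1 hc.slope
  by_contra hcon
  push Not at hcon
  -- A difference outside the stable cone lies, up to sign, in the unstable cone of slope `m⁻¹` and
  -- would outgrow the width `2 R` of the box.
  have main : ∀ p q : Plane, (∀ t ≥ 0, φ t p ∈ box ℓ₁ ℓ₂ R) → (∀ t ≥ 0, φ t q ∈ box ℓ₁ ℓ₂ R) →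
      m * |ℓ₂ (p - q)| < |ℓ₁ (p - q)| → 0 < ℓ₁ (p - q) → False := by
    intro p q hp hq h0 hx
    rw [abs_of_pos hx] at h0
    have h1 : Tendsto (fun b => Real.exp (α / 2 * b) * ℓ₁ (p - q)) atTop atTop :=
      (Real.tendsto_exp_atTop.comp
        (tendsto_id.const_mul_atTop (half_pos hc.alpha))).atTop_mul_const hx
    obtain ⟨b, hb, hb'⟩ := ((eventually_ge_atTop 0).and (h1.eventually_gt_atTop (2 * R))).exists
    obtain ⟨-, h2, -⟩ := (saddlePair hφ hV (T := b) (fun t ht => hp t ht.1)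
      (fun t ht => hq t ht.1)).cone hc hb (by simpa [hφ.zero] using hx)
      (by simp only [hφ.zero]; rw [inv_mul_eq_div, le_div_iff₀ hm]; linarith)
    have h3 := abs_le.1 (hp b hb).1
    have h4 := abs_le.1 (hq b hb).1
    simp only [hφ.zero] at h2
    rw [map_sub ℓ₁ (φ b p)] at h2
    linarith
  have hne : ℓ₁ (p - q) ≠ 0 := by
    intro h
    rw [h, abs_zero] at hcon
    have := mul_nonneg hm.le (abs_nonneg (ℓ₂ (p - q)))
    linarith
  rcases hne.lt_or_gt with h | h
  · refine main q p hq hp ?_ ?_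
    · rwa [← neg_sub p q, map_neg, map_neg, abs_neg, abs_neg]
    · rw [← neg_sub p q, map_neg]; linarith
  · exact main p q hp hq hcon h

/-- Contraction of the stable component of the difference of two orbits that end in the stable
cone of each other. -/
theorem abs_mul_exp_le (hφ : IsGlobalFlow V φ) (hV : NearSaddle V ℓ₁ ℓ₂ α β κ R) {m T : ℝ}
    (hc : ConeSmall β α κ m) (hT : 0 ≤ T) {p q : Plane} (hp : ∀ t ∈ Icc 0 T, φ t p ∈ box ℓ₁ ℓ₂ R)
    (hq : ∀ t ∈ Icc 0 T, φ t q ∈ box ℓ₁ ℓ₂ R)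
    (h0 : |ℓ₁ (φ T p - φ T q)| ≤ m * |ℓ₂ (φ T p - φ T q)|) :
    Real.exp (β / 2 * T) * |ℓ₂ (φ T p - φ T q)| ≤ |ℓ₂ (p - q)| := by
  -- Read backwards, the difference starts in the cone around the stable axis and expands there.
  have hpair := (saddlePair hφ hV hp hq).reverse
  rcases lt_trichotomy (ℓ₂ (φ T p - φ T q)) 0 with h | h | h
  · have := (hpair.neg.cone hc hT (by simpa using h)
      (by rw [abs_of_neg h] at h0; simpa [abs_sub_comm] using h0)).2.1
    simp only [sub_zero, sub_self, hφ.zero] at this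
    rw [abs_of_neg h]
    exact this.trans (neg_le_abs _)
  · rw [h]; simp
  · have := (hpair.cone hc hT (by simpa using h)
      (by rw [abs_of_pos h] at h0; simpa using h0)).2.1
    simp only [sub_zero, sub_self, hφ.zero] at this
    rw [abs_of_pos h]
    exact this.trans (le_abs_self _)

/-- An orbit that remains in the box tends to the saddle exponentially. -/
theorem abs_le_exp_of_forall_mem_box (hφ : IsGlobalFlow V φ) (hK : LipschitzWith K V)
    (hV : NearSaddle V ℓ₁ ℓ₂ α β κ R) {m : ℝ} (hc : ConeSmall α β κ m⁻¹) (hc' : ConeSmall β α κ m)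
    {p S : Plane} (hp : ∀ t ≥ 0, φ t p ∈ box ℓ₁ ℓ₂ R) (hS : V S = 0) (hSR : S ∈ box ℓ₁ ℓ₂ R)
    {t : ℝ} (ht : 0 ≤ t) :
    |ℓ₁ (φ t p - S)| ≤ m * |ℓ₂ (φ t p - S)| ∧
      |ℓ₂ (φ t p - S)| ≤ Real.exp (-(β / 2 * t)) * |ℓ₂ (p - S)| := by
  have hfix := fun t => hφ.fixed hK hS t
  have hS' : ∀ t ≥ 0, φ t S ∈ box ℓ₁ ℓ₂ R := fun t _ => by rwa [hfix]
  have h1 : |ℓ₁ (φ t p - S)| ≤ m * |ℓ₂ (φ t p - S)| :=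
    abs_le_of_forall_mem_box hφ hV hc (p := φ t p) (q := S)
      (fun s hs => by rw [← hφ.add hK]; exact hp _ (add_nonneg hs ht)) hS'
  refine ⟨h1, ?_⟩
  have h2 := abs_mul_exp_le hφ hV hc' ht (p := p) (q := S) (fun t ht => hp t ht.1)
    (fun t ht => hS' t ht.1) (by rwa [hfix])
  rw [hfix] at h2
  rw [Real.exp_neg, inv_mul_eq_div, le_div_iff₀ (Real.exp_pos _), mul_comm]
  exact h2

theorem IsCoord.tendsto_of_abs_le (h : IsCoord ℓ₁ ℓ₂ e₁ e₂) {f : ℝ → Plane} {S : Plane} {l : Filter ℝ}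
    (h1 : Tendsto (fun t => ℓ₁ (f t - S)) l (𝓝 0)) (h2 : Tendsto (fun t => ℓ₂ (f t - S)) l (𝓝 0)) :
    Tendsto f l (𝓝 S) := by
  have h3 : f = fun t => (ℓ₁ (f t - S) • e₁ + ℓ₂ (f t - S) • e₂) + S := by
    ext1 t; rw [← h.decomp]; abel
  rw [h3]
  simpa using ((h1.smul_const e₁).add (h2.smul_const e₂)).add_const S

theorem tendsto_of_forall_mem_box (hcoord : IsCoord ℓ₁ ℓ₂ e₁ e₂) (hφ : IsGlobalFlow V φ)
    (hK : LipschitzWith K V) (hV : NearSaddle V ℓ₁ ℓ₂ α β κ R) {m : ℝ} (hc : ConeSmall α β κ m⁻¹)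
    (hc' : ConeSmall β α κ m)
    {p S : Plane} (hp : ∀ t ≥ 0, φ t p ∈ box ℓ₁ ℓ₂ R) (hS : V S = 0) (hSR : S ∈ box ℓ₁ ℓ₂ R) :
    Tendsto (fun t => φ t p) atTop (𝓝 S) := by
  have h0 : Tendsto (fun t => Real.exp (-(β / 2 * t)) * |ℓ₂ (p - S)|) atTop (𝓝 0) := by
    rw [← zero_mul |ℓ₂ (p - S)|]
    exact (Real.tendsto_exp_neg_atTop_nhds_zero.comp
      (tendsto_id.const_mul_atTop (half_pos hc.beta))).mul_const _
  have h2 : Tendsto (fun t => ℓ₂ (φ t p - S)) atTop (𝓝 0) :=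
    squeeze_zero_norm' ((eventually_ge_atTop 0).mono fun t ht =>
      (abs_le_exp_of_forall_mem_box hφ hK hV hc hc' hp hS hSR ht).2) h0
  have h1 : Tendsto (fun t => ℓ₁ (φ t p - S)) atTop (𝓝 0) := by
    refine squeeze_zero_norm' (a := fun t => m * |ℓ₂ (φ t p - S)|)
      ((eventually_ge_atTop 0).mono fun t ht =>
      (abs_le_exp_of_forall_mem_box hφ hK hV hc hc' hp hS hSR ht).1) ?_
    simpa using h2.abs.const_mul m
  exact hcoord.tendsto_of_abs_le h1 h2

/-- Points of the same section whose backward orbits remain in the box for a long time are close. -/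
theorem section_dist_le (hφ : IsGlobalFlow V φ) (hK : LipschitzWith K V)
    (hV : NearSaddle V ℓ₁ ℓ₂ α β κ R) {m T : ℝ}
    (hc : ConeSmall β α κ m) (hT : 0 ≤ T) {p q : Plane}
    (hp : ∀ t ∈ Icc 0 T, φ (-t) p ∈ box ℓ₁ ℓ₂ R)
    (hq : ∀ t ∈ Icc 0 T, φ (-t) q ∈ box ℓ₁ ℓ₂ R) (h : ℓ₁ p = ℓ₁ q) :
    Real.exp (β / 2 * T) * |ℓ₂ (p - q)| ≤ 2 * R := by
  have hcancel : ∀ p, φ T (φ (-T) p) = p := fun p => by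
    have := hφ.neg_cancel hK (-T) p
    rwa [neg_neg] at this
  have htr : ∀ p, (∀ t ∈ Icc 0 T, φ (-t) p ∈ box ℓ₁ ℓ₂ R) →
      ∀ t ∈ Icc 0 T, φ t (φ (-T) p) ∈ box ℓ₁ ℓ₂ R := fun p hp t ht => by
    rw [← hφ.add hK]
    have := hp (T - t) ⟨by linarith [ht.2], by linarith [ht.1]⟩
    rwa [neg_sub, sub_eq_add_neg] at this
  -- Points of one section have zero `ℓ₁`-difference, so they lie in each other's stable cone for
  -- every slope.
  have h1 := abs_mul_exp_le hφ hV hc hT (htr p hp) (htr q hq) (by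
    rw [hcancel, hcancel, map_sub, h, sub_self, abs_zero]
    exact mul_nonneg hc.slope.le (abs_nonneg _))
  rw [hcancel, hcancel] at h1
  refine h1.trans ?_
  have h2 := abs_le.1 (hp T ⟨hT, le_rfl⟩).2
  have h3 := abs_le.1 (hq T ⟨hT, le_rfl⟩).2
  rw [map_sub]
  exact abs_le.2 ⟨by linarith, by linarith⟩

/-- Existence of a point of the unstable manifold on the section `ℓ₁ = v`. -/
theorem exists_unstable_point (hcoord : IsCoord ℓ₁ ℓ₂ e₁ e₂) (hφ : IsGlobalFlow V φ)
    (hK : LipschitzWith K V) (hV : NearSaddle V ℓ₁ ℓ₂ α β κ R) (hc : ConeSmall α β κ M) {S : Plane}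
    (hS : V S = 0) {v r : ℝ} (hSr : S ∈ box ℓ₁ ℓ₂ r) (hv : v < R) (hr : r + M * (v + r) < R)
    (hrR : r < R) (hvr : r < v) :
    ∃ w, ℓ₁ w = v ∧ ∀ t ≥ 0, |ℓ₂ (φ (-t) w - S)| ≤ M * ℓ₁ (φ (-t) w - S) ∧
      0 < ℓ₁ (φ (-t) w - S) ∧
      ℓ₁ (φ (-t) w - S) ≤ Real.exp (-(α / 2 * t)) * (v - ℓ₁ S) := by
  have hfix := fun t => hφ.fixed hK hS t
  have hM := hc.slope
  set L := v - ℓ₁ S with hL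
  have hL0 : 0 < L := by have := (abs_le.1 hSr.1).2; linarith
  -- The point is a limit of the first exit points of the orbits started at `S + ε n • e₁`. The
  -- denominator `n + 2` keeps every starting point strictly before the section.
  set ε : ℕ → ℝ := fun n => L / (n + 2) with hε
  have hε0 : ∀ n, 0 < ε n := fun n => by positivity
  have hεL : ∀ n, ε n < L := fun n => by
    rw [hε]; simp only
    rw [div_lt_iff₀ (by positivity)]
    nlinarith [n.cast_nonneg (α := ℝ)]
  have hεlim : Tendsto ε atTop (𝓝 0) :=
    tendsto_const_nhds.div_atTop
      (tendsto_atTop_add_const_right _ _ tendsto_natCast_atTop_atTop)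
  have hstart : ∀ n, ℓ₁ (S + ε n • e₁ - S) = ε n ∧ ℓ₂ (S + ε n • e₁ - S) = 0 := fun n => by
    rw [add_sub_cancel_left, map_smul, map_smul, hcoord.l11, hcoord.l21]; simp
  have hrest : ∀ t ≥ 0, φ t S ∈ box ℓ₁ ℓ₂ r := fun t _ => by rwa [hfix]
  have hexit : ∀ n, ∃ T > 0, ℓ₁ (φ T (S + ε n • e₁)) = v ∧
      (∀ t ∈ Ico 0 T, ℓ₁ (φ t (S + ε n • e₁)) < v) ∧
      ∀ t ∈ Icc 0 T, φ t (S + ε n • e₁) ∈ box ℓ₁ ℓ₂ R := fun n => by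
    refine exists_exit hφ hV hc hrest hv hr hrR (by rw [(hstart n).1]; exact hε0 n)
      (by rw [(hstart n).1, (hstart n).2, abs_zero]; exact (mul_pos hM (hε0 n)).le) ?_
    have := hεL n
    rw [map_add, map_smul, hcoord.l11, smul_eq_mul, mul_one]
    linarith
  choose T hT hTv hTlt hTbox using hexit
  have hcone : ∀ n, ∀ t ∈ Icc 0 (T n), |ℓ₂ (φ t (S + ε n • e₁) - S)| ≤
      M * ℓ₁ (φ t (S + ε n • e₁) - S) ∧ Real.exp (α / 2 * t) * ε n ≤ ℓ₁ (φ t (S + ε n • e₁) - S) ∧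
      ℓ₁ (φ t (S + ε n • e₁) - S) ≤ Real.exp (2 * α * t) * ε n := fun n t ht => by
    have := (saddlePair hφ hV (T := t) (p := S + ε n • e₁) (q := S)
      (fun s hs => hTbox n s ⟨hs.1, hs.2.trans ht.2⟩)
      (fun s hs => box_mono hrR.le (hrest s hs.1))).cone hc ht.1
      (by simp only [hφ.zero]; rw [(hstart n).1]; exact hε0 n)
      (by simp only [hφ.zero]; rw [(hstart n).1, (hstart n).2, abs_zero]
          exact (mul_pos hM (hε0 n)).le)
    simp only [hφ.zero, hfix, (hstart n).1] at this
    exact this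
  set w : ℕ → Plane := fun n => φ (T n) (S + ε n • e₁) with hw
  obtain ⟨w₀, -, σ, hσ, hlim⟩ := (hcoord.isCompact_box R).tendsto_subseq
    (x := w) (fun n => hTbox n _ ⟨(hT n).le, le_rfl⟩)
  -- Since expansion is at most `exp (2 α t)`, the exit times tend to infinity; every backward time
  -- of the limit orbit is thus eventually covered by the approximating orbits.
  have hTlarge : ∀ t : ℝ, ∀ᶠ n in atTop, t ≤ T n := by
    intro t
    have h1 : Tendsto (fun n => Real.exp (2 * α * t) * ε n) atTop (𝓝 0) := by
      simpa using hεlim.const_mul (Real.exp (2 * α * t))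
    filter_upwards [h1.eventually_lt_const hL0] with n hn
    by_contra hcon
    push Not at hcon
    have h2 := (hcone n (T n) ⟨(hT n).le, le_rfl⟩).2.2
    rw [map_sub, hTv n] at h2
    have h3 : Real.exp (2 * α * T n) * ε n ≤ Real.exp (2 * α * t) * ε n := by
      have := hc.alpha
      have := (hε0 n).le
      gcongr
    linarith
  have hback : ∀ n t, φ (-t) (w n) = φ (T n - t) (S + ε n • e₁) := fun n t => by
    rw [hw]; simp only; rw [← hφ.add hK]; congr 1; ring
  refine ⟨w₀, ?_, fun t ht => ?_⟩
  · have h1 : Tendsto (fun n => ℓ₁ (w (σ n))) atTop (𝓝 (ℓ₁ w₀)) :=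
      (ℓ₁.continuous.tendsto w₀).comp hlim
    have h2 : (fun n => ℓ₁ (w (σ n))) = fun _ => v := funext fun n => hTv _
    rw [h2] at h1
    exact tendsto_nhds_unique h1 tendsto_const_nhds
  · have hφc : Continuous (φ (-t)) := (hφ.continuous hK).comp (Continuous.prodMk_right (-t))
    have h1 : Tendsto (fun n => φ (-t) (w (σ n)) - S) atTop (𝓝 (φ (-t) w₀ - S)) :=
      ((hφc.tendsto w₀).comp hlim).sub_const S
    have h2 : Tendsto (fun n => ℓ₁ (φ (-t) (w (σ n)) - S)) atTop (𝓝 (ℓ₁ (φ (-t) w₀ - S))) :=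
      (ℓ₁.continuous.tendsto _).comp h1
    have h3 : Tendsto (fun n => ℓ₂ (φ (-t) (w (σ n)) - S)) atTop (𝓝 (ℓ₂ (φ (-t) w₀ - S))) :=
      (ℓ₂.continuous.tendsto _).comp h1
    have hlarge := hσ.tendsto_atTop.eventually (hTlarge t)
    have h4 : |ℓ₂ (φ (-t) w₀ - S)| ≤ M * ℓ₁ (φ (-t) w₀ - S) := by
      refine le_of_tendsto_of_tendsto h3.abs (h2.const_mul M) (hlarge.mono fun n hn => ?_)
      simp only [hback]
      exact (hcone (σ n) (T (σ n) - t) ⟨by linarith, by linarith⟩).1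
    refine ⟨h4, ?_, ?_⟩
    · have h5 : 0 ≤ ℓ₁ (φ (-t) w₀ - S) := by
        have := (abs_nonneg _).trans h4
        exact (mul_nonneg_iff_of_pos_left hM).1 this
      -- Only the weak inequality passes to the limit. Equality would put the backward orbit at `S`
      -- by the cone condition, hence `w₀ = S`, although `ℓ₁ S ≤ r < v`.
      refine h5.lt_of_ne fun h6 => ?_
      rw [← h6, mul_zero, abs_nonpos_iff] at h4
      have h7 : φ (-t) w₀ = S := by
        refine hcoord.ext ?_ ?_
        · rw [map_sub] at h6; linarith
        · rw [map_sub] at h4; linarith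
      have h8 : w₀ = S := by
        have := hφ.neg_cancel hK (-t) w₀
        rw [h7, neg_neg, hfix] at this
        exact this.symm
      have h9 : Tendsto (fun n => ℓ₁ (w (σ n))) atTop (𝓝 (ℓ₁ w₀)) :=
        (ℓ₁.continuous.tendsto w₀).comp hlim
      have h10 : (fun n => ℓ₁ (w (σ n))) = fun _ => v := funext fun n => hTv _
      rw [h10] at h9
      have := tendsto_nhds_unique h9 tendsto_const_nhds
      rw [h8] at this
      linarith
    · refine le_of_tendsto h2 (hlarge.mono fun n hn => ?_)
      rw [hback]
      set x := S + ε (σ n) • e₁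
      have hmid := hcone (σ n) (T (σ n) - t) ⟨by linarith, by linarith⟩
      have hpos : 0 < ℓ₁ (φ (T (σ n) - t) x - S) :=
        lt_of_lt_of_le (mul_pos (Real.exp_pos _) (hε0 _)) hmid.2.1
      have h5 := ((saddlePair hφ hV (T := t) (p := φ (T (σ n) - t) x) (q := S)
        (fun s hs => by
          rw [← hφ.add hK]
          exact hTbox _ _ ⟨by linarith [hs.1], by linarith [hs.2]⟩)
        (fun s hs => box_mono hrR.le (hrest s hs.1))).cone hc ht
        (by simpa only [hφ.zero] using hpos) (by simpa only [hφ.zero] using hmid.1)).2.1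
      simp only [hφ.zero, hfix, ← hφ.add hK] at h5
      have h6 : t + (T (σ n) - t) = T (σ n) := by ring
      rw [h6, map_sub ℓ₁ (φ (T (σ n)) x), hTv] at h5
      rw [Real.exp_neg, inv_mul_eq_div, le_div_iff₀ (Real.exp_pos _), mul_comm]
      exact h5

end NearSaddle

/-! ### The quantitative model of the field and of `h` near the saddle. -/

section LocalModel

theorem convex_box (ℓ₁ ℓ₂ : Plane →L[ℝ] ℝ) (R : ℝ) : Convex ℝ (box ℓ₁ ℓ₂ R) := by
  have h1 : box ℓ₁ ℓ₂ R = ℓ₁ ⁻¹' (Icc (-R) R) ∩ ℓ₂ ⁻¹' (Icc (-R) R) := by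
    ext p; simp [box, abs_le]
  rw [h1]
  exact ((convex_Icc _ _).linear_preimage ℓ₁.toLinearMap).inter
    ((convex_Icc _ _).linear_preimage ℓ₂.toLinearMap)

/-- The mean value theorem evaluates the increment at a single point, where the bound is used for
the vector `p - q` alone; no linearity of `L` or `C` is needed. -/
theorem abs_sub_sub_le_of_fderiv {s : Set Plane} (hs : Convex ℝ s) {f : Plane → ℝ}
    (hf : ∀ p ∈ s, DifferentiableAt ℝ f p) {L C : Plane → ℝ}
    (hL : ∀ p ∈ s, ∀ w, |fderiv ℝ f p w - L w| ≤ C w) {p q : Plane} (hp : p ∈ s) (hq : q ∈ s) :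
    |f p - f q - L (p - q)| ≤ C (p - q) := by
  obtain ⟨z, hz, h1⟩ := domain_mvt (f := f) (fun x hx => (hf x hx).hasFDerivAt.hasFDerivWithinAt)
    hs hq hp
  rw [h1]
  exact hL z (hs.segment_subset hq hp hz) _

/-- The relative error `κ` is small compared with the rates of the saddle. -/
structure SmallError (α β κ : ℝ) : Prop where
  big : ConeSmall α β κ (2 + 2 * α / β)
  half : ConeSmall α β κ (1 / 2)
  two : ConeSmall α β κ 2
  half' : ConeSmall β α κ (1 / 2)
  two' : ConeSmall β α κ 2
  upper : κ * (α / (2 * β) + 1) * (1 + (2 + 2 * α / β)) ≤ α / (2 * β) * (α + β)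
  incr : κ * (1 + (2 + 2 * α / β)) < α / 2
  barrier : κ * (2 * α + 3 * β + 2 * κ) * (1 + (2 + 2 * α / β)) < α ^ 2 + α * β
  tiny : κ ≤ 1 / 12
  fold : κ * (1 + 2 / (α + β)) ≤ 1 / 2
  fold₁ : 2 * κ * (β + 1) ≤ β / 2
  fold₂ : 2 * κ * (α + 1) ≤ α / 2
  fold₃ : κ ≤ β / 2
  exit : κ * (20 * (1 + (2 + 2 * α / β))) ≤ α / 2

/-- Each bound follows from a strict inequality valid at `κ = 0`. The slope `2 + 2 α / β` is wide
enough, with a margin for errors, for both directions that occur: slope `α / β` for the fold seen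
from a virtual saddle and slope `-1` for Σ. -/
theorem exists_smallError {α β : ℝ} (hα : 0 < α) (hβ : 0 < β) : ∃ κ > 0, SmallError α β κ := by
  have lin : ∀ c d : ℝ, 0 < d → ∀ᶠ κ in 𝓝[>] (0 : ℝ), κ * c < d := fun c d hd => by
    have : Continuous fun κ : ℝ => κ * c := by fun_prop
    exact (this.continuousAt.eventually_lt_const (by simpa using hd)).filter_mono
      nhdsWithin_le_nhds
  have cone : ∀ α β M : ℝ, 0 < α → 0 < β → 0 < M → ∀ᶠ κ in 𝓝[>] (0 : ℝ), ConeSmall α β κ M := by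
    intro α β M hα hβ hM
    filter_upwards [self_mem_nhdsWithin, lin (2 * (M ^ 2 + 1)) (M ^ 2 * α) (by positivity),
      lin (2 * (M ^ 2 + 1)) β hβ, lin (1 + M) (α / 2) (by positivity)] with κ h0 h1 h2 h3
    exact ⟨hα, hβ, (mem_Ioi.1 h0).le, hM, by linarith, by linarith, by linarith⟩
  have hbar : ∀ᶠ κ in 𝓝[>] (0 : ℝ),
      κ * (2 * α + 3 * β + 2 * κ) * (1 + (2 + 2 * α / β)) < α ^ 2 + α * β := by
    have : Continuous fun κ : ℝ => κ * (2 * α + 3 * β + 2 * κ) * (1 + (2 + 2 * α / β)) := by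
      fun_prop
    exact (this.continuousAt.eventually_lt_const (by simp; positivity)).filter_mono
      nhdsWithin_le_nhds
  have hM : 0 < 2 + 2 * α / β := by positivity
  have := (cone α β (2 + 2 * α / β) hα hβ hM).and ((cone α β (1 / 2) hα hβ (by norm_num)).and
    ((cone α β 2 hα hβ two_pos).and ((cone β α (1 / 2) hβ hα (by norm_num)).and
    ((cone β α 2 hβ hα two_pos).and (((lin ((α / (2 * β) + 1) * (1 + (2 + 2 * α / β)))
      (α / (2 * β) * (α + β)) (by positivity))).and ((lin (1 + (2 + 2 * α / β)) (α / 2)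
      (by positivity)).and (hbar.and ((lin 1 (1 / 12) (by norm_num)).and
    ((lin (1 + 2 / (α + β)) (1 / 2) (by norm_num)).and ((lin (2 * (β + 1)) (β / 2)
      (by positivity)).and ((lin (2 * (α + 1)) (α / 2) (by positivity)).and
    ((lin 1 (β / 2) (by positivity)).and (lin (20 * (1 + (2 + 2 * α / β))) (α / 2)
      (by positivity))))))))))))))
  obtain ⟨κ, hκ, a1, a2, a3, a4, a5, a6, a7, a8, a9, b1, b2, b3, b4, b5⟩ :=
    (Filter.Eventually.and (eventually_mem_nhdsWithin (a := (0 : ℝ)) (s := Ioi 0)) this).exists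
  exact ⟨κ, hκ, a1, a2, a3, a4, a5, by linarith, a7, a8, by linarith, b1.le, by linarith,
    by linarith, by linarith, b5.le⟩

/-- Quantitative description of a vector field near a saddle lying close to the switching
manifold: on the box of radius `R`, the field, the function `h` and the Lie derivative of `h` are
close to their linear models. -/
structure LocalModel (h : Plane → ℝ) (V : Plane → Plane) (ℓ₁ ℓ₂ : Plane →L[ℝ] ℝ)
    (α β κ R : ℝ) (S : Plane) : Prop where
  near : NearSaddle V ℓ₁ ℓ₂ α β κ R
  zero : V S = 0
  mem : S ∈ box ℓ₁ ℓ₂ R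
  diff_h : ∀ p ∈ box ℓ₁ ℓ₂ R, DifferentiableAt ℝ h p
  fderiv_h : ∀ p ∈ box ℓ₁ ℓ₂ R, ∀ w, |fderiv ℝ h p w - (ℓ₁ w + ℓ₂ w)| ≤ κ * (|ℓ₁ w| + |ℓ₂ w|)
  diff_lie : ∀ p ∈ box ℓ₁ ℓ₂ R, DifferentiableAt ℝ (lieD V h) p
  fderiv_lie : ∀ p ∈ box ℓ₁ ℓ₂ R, ∀ w,
    |fderiv ℝ (lieD V h) p w - (α * ℓ₁ w - β * ℓ₂ w)| ≤ κ * (|ℓ₁ w| + |ℓ₂ w|)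

namespace LocalModel

variable {h : Plane → ℝ} {ℓ₁ ℓ₂ : Plane →L[ℝ] ℝ} {e₁ e₂ : Plane} {V : Plane → Plane}
  {φ : ℝ → Plane → Plane} {K : NNReal} {α β κ R : ℝ} {S : Plane}

theorem mono (H : LocalModel h V ℓ₁ ℓ₂ α β κ R S) {R' : ℝ} (hR : R' ≤ R)
    (hS : S ∈ box ℓ₁ ℓ₂ R') : LocalModel h V ℓ₁ ℓ₂ α β κ R' S :=
  ⟨H.near.mono hR, H.zero, hS, fun p hp => H.diff_h p (box_mono hR hp),
    fun p hp => H.fderiv_h p (box_mono hR hp), fun p hp => H.diff_lie p (box_mono hR hp),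
    fun p hp => H.fderiv_lie p (box_mono hR hp)⟩

theorem abs_h_sub_le (H : LocalModel h V ℓ₁ ℓ₂ α β κ R S) {p q : Plane} (hp : p ∈ box ℓ₁ ℓ₂ R)
    (hq : q ∈ box ℓ₁ ℓ₂ R) :
    |h p - h q - (ℓ₁ (p - q) + ℓ₂ (p - q))| ≤ κ * (|ℓ₁ (p - q)| + |ℓ₂ (p - q)|) :=
  abs_sub_sub_le_of_fderiv (convex_box ℓ₁ ℓ₂ R) H.diff_h (L := fun w => ℓ₁ w + ℓ₂ w)
    (C := fun w => κ * (|ℓ₁ w| + |ℓ₂ w|)) H.fderiv_h hp hq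

theorem abs_lie_sub_le (H : LocalModel h V ℓ₁ ℓ₂ α β κ R S) {p q : Plane} (hp : p ∈ box ℓ₁ ℓ₂ R)
    (hq : q ∈ box ℓ₁ ℓ₂ R) :
    |lieD V h p - lieD V h q - (α * ℓ₁ (p - q) - β * ℓ₂ (p - q))| ≤
      κ * (|ℓ₁ (p - q)| + |ℓ₂ (p - q)|) :=
  abs_sub_sub_le_of_fderiv (convex_box ℓ₁ ℓ₂ R) H.diff_lie (L := fun w => α * ℓ₁ w - β * ℓ₂ w)
    (C := fun w => κ * (|ℓ₁ w| + |ℓ₂ w|)) H.fderiv_lie hp hq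

theorem lieD_zero (H : LocalModel h V ℓ₁ ℓ₂ α β κ R S) : lieD V h S = 0 := by
  simp [lieD, H.zero]

/-- The position, relative to a virtual saddle, of a tangency on the switching manifold. -/
theorem fold_position (H : LocalModel h V ℓ₁ ℓ₂ α β κ R S) (hs : SmallError α β κ) {p : Plane}
    (hp : p ∈ box ℓ₁ ℓ₂ R) (hp0 : h p = 0) (hS : h S < 0) (hG : lieD V h p = 0) :
    0 < ℓ₁ (p - S) ∧ 0 < ℓ₂ (p - S) ∧ ℓ₂ (p - S) ≤ (2 + 2 * α / β) * ℓ₁ (p - S) ∧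
      |ℓ₁ (p - S)| + |ℓ₂ (p - S)| ≤ 2 * |h S| := by
  have hα := hs.big.alpha
  have hβ := hs.big.beta
  have hκ := hs.big.kappa
  have h1 := H.abs_h_sub_le hp H.mem
  have h2 := H.abs_lie_sub_le hp H.mem
  rw [hp0, zero_sub] at h1
  rw [hG, H.lieD_zero, sub_zero, zero_sub, abs_neg] at h2
  set x := ℓ₁ (p - S)
  set y := ℓ₂ (p - S)
  set N := |x| + |y| with hN
  set D := -h S with hD
  have hD0 : 0 < D := by linarith
  have hN0 : 0 ≤ N := by positivity
  obtain ⟨a1, a2⟩ := abs_le.1 h1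
  obtain ⟨a3, a4⟩ := abs_le.1 h2
  -- Perturbation of the linear system `x + y = D`, `α x = β y`, whose solution is `x = β D / (α +
  -- β)`, `y = α D / (α + β)`.
  have hx1 : (α + β) * x ≤ β * D + κ * (β + 1) * N := by nlinarith
  have hx2 : β * D - κ * (β + 1) * N ≤ (α + β) * x := by nlinarith
  have hy1 : (α + β) * y ≤ α * D + κ * (α + 1) * N := by nlinarith
  have hy2 : α * D - κ * (α + 1) * N ≤ (α + β) * y := by nlinarith
  have e0 : 0 ≤ κ * (β + 1) * N := by positivity
  have e0' : 0 ≤ κ * (α + 1) * N := by positivity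
  have hxa : (α + β) * |x| ≤ β * D + κ * (β + 1) * N := by
    rw [← abs_of_pos (add_pos hα hβ), ← abs_mul]
    exact abs_le.2 ⟨by nlinarith, hx1⟩
  have hya : (α + β) * |y| ≤ α * D + κ * (α + 1) * N := by
    rw [← abs_of_pos (add_pos hα hβ), ← abs_mul]
    exact abs_le.2 ⟨by nlinarith, hy1⟩
  have hN2 : N ≤ 2 * D := by
    have e1 : (α + β) * N ≤ (α + β) * D + κ * (α + β + 2) * N := by rw [hN]; linarith
    have e2 : κ * (α + β + 2) = (α + β) * (κ * (1 + 2 / (α + β))) := by field_simp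
    have e3 : κ * (α + β + 2) * N ≤ (α + β) * (1 / 2) * N := by
      rw [e2]; gcongr; exact hs.fold
    have e4 : (α + β) * (N / 2) ≤ (α + β) * D := by linarith
    have := le_of_mul_le_mul_left e4 (add_pos hα hβ)
    linarith
  have hx : 0 < x := by
    have e1 : κ * (β + 1) * N ≤ β / 2 * D := by
      calc κ * (β + 1) * N ≤ κ * (β + 1) * (2 * D) := by gcongr
        _ = 2 * κ * (β + 1) * D := by ring
        _ ≤ β / 2 * D := by gcongr; exact hs.fold₁
    have e2 : 0 < (α + β) * x := by nlinarith [mul_pos hβ hD0]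
    exact (mul_pos_iff_of_pos_left (add_pos hα hβ)).1 e2
  have hy : 0 < y := by
    have e1 : κ * (α + 1) * N ≤ α / 2 * D := by
      calc κ * (α + 1) * N ≤ κ * (α + 1) * (2 * D) := by gcongr
        _ = 2 * κ * (α + 1) * D := by ring
        _ ≤ α / 2 * D := by gcongr; exact hs.fold₂
    have e2 : 0 < (α + β) * y := by nlinarith [mul_pos hα hD0]
    exact (mul_pos_iff_of_pos_left (add_pos hα hβ)).1 e2
  refine ⟨hx, hy, ?_, ?_⟩
  · have e1 : N = x + y := by rw [hN, abs_of_pos hx, abs_of_pos hy]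
    have e2 : κ * N ≤ β / 2 * (x + y) := by
      rw [e1]; exact mul_le_mul_of_nonneg_right hs.fold₃ (by positivity)
    have e3 : β * y ≤ β * ((2 + 2 * α / β) * x) := by
      have : β * ((2 + 2 * α / β) * x) = 2 * β * x + 2 * α * x := by field_simp
      rw [this]; nlinarith
    exact le_of_mul_le_mul_left e3 hβ
  · rw [abs_of_neg hS]; exact hN2

/-- In the unstable cone of the saddle, the second Lie derivative of `h` is positive where the
first one vanishes. -/
theorem neg_mul_lt_lieD_lieD (H : LocalModel h V ℓ₁ ℓ₂ α β κ R S) (hs : SmallError α β κ)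
    {p : Plane} (hp : p ∈ box ℓ₁ ℓ₂ R) (hx : 0 < ℓ₁ (p - S))
    (hc : |ℓ₂ (p - S)| ≤ (2 + 2 * α / β) * ℓ₁ (p - S)) :
    -β * lieD V h p < lieD V (lieD V h) p := by
  have hα := hs.big.alpha
  have hβ := hs.big.beta
  have hκ := hs.big.kappa
  have h2 := H.abs_lie_sub_le hp H.mem
  rw [H.lieD_zero, sub_zero] at h2
  have h3 := H.fderiv_lie p hp (V p)
  obtain ⟨h4, h5⟩ := H.near p hp S H.mem
  rw [H.zero, sub_zero] at h4 h5
  change _ < fderiv ℝ (lieD V h) p (V p)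
  set x := ℓ₁ (p - S)
  set y := ℓ₂ (p - S)
  set G := lieD V h p
  set X := ℓ₁ (V p)
  set Y := ℓ₂ (V p)
  set N := |x| + |y| with hN
  have hN0 : 0 ≤ N := by positivity
  have hNx : N ≤ (1 + (2 + 2 * α / β)) * x := by rw [hN, abs_of_pos hx]; linarith
  obtain ⟨a1, a2⟩ := abs_le.1 h2
  obtain ⟨b1, b2⟩ := abs_le.1 h3
  obtain ⟨c1, c2⟩ := abs_le.1 h4
  obtain ⟨d1, d2⟩ := abs_le.1 h5
  have hXY : |X| + |Y| ≤ (α + β + 2 * κ) * N := by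
    have e1 : |X| ≤ α * |x| + κ * N := by
      have : X = α * x + (X - α * x) := by ring
      rw [this]
      refine (abs_add_le _ _).trans ?_
      rw [abs_mul, abs_of_pos hα]; gcongr
    have e2 : |Y| ≤ β * |y| + κ * N := by
      have : Y = -(β * y) + (Y + β * y) := by ring
      rw [this]
      refine (abs_add_le _ _).trans ?_
      rw [abs_neg, abs_mul, abs_of_pos hβ]; gcongr
    rw [hN] at *
    nlinarith [abs_nonneg x, abs_nonneg y]
  -- In the linear model `Xh = α x - β y` and `X(Xh) = α² x + β² y`, so `X(Xh) + β Xh = (α² + α β)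
  -- x`, which is positive; the condition `barrier` absorbs the errors.
  have e1 : κ * (|X| + |Y|) ≤ κ * ((α + β + 2 * κ) * N) := by gcongr
  have e2 : α * X ≥ α * (α * x - κ * N) := by gcongr; linarith
  have e3 : β * Y ≤ β * (-(β * y) + κ * N) := by gcongr; linarith
  have e4 : β * (β * y) ≥ β * (α * x - G - κ * N) := by gcongr; linarith
  have e5 : κ * (2 * α + 3 * β + 2 * κ) * N ≤
      κ * (2 * α + 3 * β + 2 * κ) * ((1 + (2 + 2 * α / β)) * x) := by gcongr
  have e6 := mul_lt_mul_of_pos_right hs.barrier hx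
  have e7 : 0 ≤ κ * N := by positivity
  nlinarith

theorem hasDerivAt_h (H : LocalModel h V ℓ₁ ℓ₂ α β κ R S) (hφ : IsGlobalFlow V φ) {p : Plane} {t : ℝ}
    (hp : φ t p ∈ box ℓ₁ ℓ₂ R) :
    HasDerivAt (fun t => h (φ t p)) (lieD V h (φ t p)) t :=
  (H.diff_h _ hp).hasFDerivAt.comp_hasDerivAt t (hφ.hasDerivAt p t)

theorem hasDerivAt_lie (H : LocalModel h V ℓ₁ ℓ₂ α β κ R S) (hφ : IsGlobalFlow V φ) {p : Plane}
    {t : ℝ} (hp : φ t p ∈ box ℓ₁ ℓ₂ R) :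
    HasDerivAt (fun t => lieD V h (φ t p)) (lieD V (lieD V h) (φ t p)) t :=
  HasFDerivAt.comp_hasDerivAt (l := lieD V h) t (H.diff_lie (φ t p) hp).hasFDerivAt
    (hφ.hasDerivAt p t)

/-- Orbits that start on the switching manifold in the unstable cone of the saddle, and do not
point into `Σ⁻`, enter `Σ⁺`. -/
theorem pos_of_cone (H : LocalModel h V ℓ₁ ℓ₂ α β κ R S) (hs : SmallError α β κ)
    (hφ : IsGlobalFlow V φ) (hK : LipschitzWith K V) {p : Plane} (hp0 : h p = 0)
    (hG : 0 ≤ lieD V h p) (hx : 0 < ℓ₁ (p - S))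
    (hc : |ℓ₂ (p - S)| ≤ (2 + 2 * α / β) * ℓ₁ (p - S)) {T : ℝ} (hT : 0 < T)
    (hp : ∀ t ∈ Icc 0 T, φ t p ∈ box ℓ₁ ℓ₂ R) : 0 < h (φ T p) := by
  have hcone : ∀ t ∈ Icc 0 T, 0 < ℓ₁ (φ t p - S) ∧
      |ℓ₂ (φ t p - S)| ≤ (2 + 2 * α / β) * ℓ₁ (φ t p - S) := fun t ht => by
    have hpair := saddlePair hφ H.near (T := t) (p := p) (q := S)
      (fun s hs => hp s ⟨hs.1, hs.2.trans ht.2⟩)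
      (fun s _ => by rw [hφ.fixed hK H.zero]; exact H.mem)
    have := hpair.cone hs.big ht.1 (by simpa [hφ.zero] using hx) (by simpa [hφ.zero] using hc)
    simp only [hφ.zero, hφ.fixed hK H.zero] at this
    exact ⟨(mul_pos (Real.exp_pos _) hx).trans_le this.2.1, this.1⟩
  -- By `X(Xh) > -β Xh` the product of `exp (β t)` and `Xh` is strictly increasing, so `Xh` is
  -- positive at once even if it vanishes initially, as at a fold.
  have hGpos : ∀ t ∈ Ioo 0 T, 0 < lieD V h (φ t p) := fun t ht => by
    have h1 := exp_mul_lt (k := -β) ht.1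
      (fun s hs => H.hasDerivAt_lie hφ (hp s ⟨hs.1, hs.2.trans ht.2.le⟩))
      (fun s hs' => H.neg_mul_lt_lieD_lieD hs (hp s ⟨hs'.1, hs'.2.trans ht.2.le⟩)
        (hcone s ⟨hs'.1, hs'.2.trans ht.2.le⟩).1 (hcone s ⟨hs'.1, hs'.2.trans ht.2.le⟩).2)
    simp only [hφ.zero] at h1
    exact (mul_nonneg (Real.exp_pos _).le hG).trans_lt h1
  have h2 := lt_of_hasDerivAt_pos hT (fun t ht => H.hasDerivAt_h hφ (hp t ht)) hGpos
  simpa [hφ.zero, hp0] using h2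

/-- Comparison of the values of `h` along two orbits. -/
theorem h_lt_h_of_cone (H : LocalModel h V ℓ₁ ℓ₂ α β κ R S) (hs : SmallError α β κ)
    (hφ : IsGlobalFlow V φ) {p q : Plane} (hpq : h p = h q) (hx : 0 < ℓ₁ (p - q))
    (hy : ℓ₂ (p - q) ≤ 0)
    (hc : |ℓ₂ (p - q)| ≤ (2 + 2 * α / β) * ℓ₁ (p - q)) {T : ℝ} (hT : 0 < T)
    (hp : ∀ t ∈ Icc 0 T, φ t p ∈ box ℓ₁ ℓ₂ R) (hq : ∀ t ∈ Icc 0 T, φ t q ∈ box ℓ₁ ℓ₂ R) :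
    h (φ T q) < h (φ T p) := by
  have hα := hs.big.alpha
  have hβ := hs.big.beta
  have hκ := hs.big.kappa
  have h2 := lt_of_hasDerivAt_pos (f := fun t => h (φ t p) - h (φ t q)) hT
    (fun t ht => (H.hasDerivAt_h hφ (hp t ht)).sub (H.hasDerivAt_h hφ (hq t ht)))
    (fun t ht => by
      have hpair := saddlePair hφ H.near (T := t) (p := p) (q := q)
        (fun s hs => hp s ⟨hs.1, hs.2.trans ht.2.le⟩) (fun s hs => hq s ⟨hs.1, hs.2.trans ht.2.le⟩)
      have h3 := hpair.cone hs.big ht.1.le (by simpa [hφ.zero] using hx)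
        (by simpa [hφ.zero] using hc)
      -- With this `m` the growth rate `α x - β y` of the difference of the two values of `h` is at
      -- least `α x / 2`, up to the error in the model.
      have h4 := hpair.upper hs.big ht.1.le (by simpa [hφ.zero] using hx)
        (by simpa [hφ.zero] using hc) (m := α / (2 * β)) (by positivity) hs.upper
        (by simp only [hφ.zero]; exact hy.trans (by positivity))
      simp only [hφ.zero] at h3
      have hxt : 0 < ℓ₁ (φ t p - φ t q) := (mul_pos (Real.exp_pos _) hx).trans_le h3.2.1
      have h5 := H.abs_lie_sub_le (hp t ⟨ht.1.le, ht.2.le⟩) (hq t ⟨ht.1.le, ht.2.le⟩)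
      set x := ℓ₁ (φ t p - φ t q)
      set y := ℓ₂ (φ t p - φ t q)
      have e1 : β * y ≤ α / 2 * x := by
        calc β * y ≤ β * (α / (2 * β) * x) := by gcongr
          _ = α / 2 * x := by field_simp
      have e2 : κ * (|x| + |y|) ≤ κ * ((1 + (2 + 2 * α / β)) * x) := by
        gcongr
        rw [abs_of_pos hxt]; linarith [h3.1]
      have e3 := mul_lt_mul_of_pos_right hs.incr hxt
      linarith [(abs_le.1 h5).1])
  simp only [hφ.zero] at h2
  linarith

/-- A lower bound for `h` in the unstable cone of slope `1/2`. -/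
theorem h_pos_of_unstable (H : LocalModel h V ℓ₁ ℓ₂ α β κ R S) (hs : SmallError α β κ)
    (hS : 0 ≤ h S) {p : Plane} (hp : p ∈ box ℓ₁ ℓ₂ R) (hx : 0 < ℓ₁ (p - S))
    (hc : |ℓ₂ (p - S)| ≤ 1 / 2 * ℓ₁ (p - S)) : 0 < h p := by
  have h1 := H.abs_h_sub_le hp H.mem
  rw [abs_of_pos hx] at h1
  have h2 : κ * (ℓ₁ (p - S) + |ℓ₂ (p - S)|) ≤ 1 / 12 * (3 / 2 * ℓ₁ (p - S)) := by
    have := hs.tiny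
    gcongr
    linarith
  linarith [(abs_le.1 h1).1, (abs_le.1 hc).1]

/-- The distance from the saddle of a point of the switching manifold in the stable cone. -/
theorem stable_position (H : LocalModel h V ℓ₁ ℓ₂ α β κ R S) (hs : SmallError α β κ)
    {p : Plane} (hp : p ∈ box ℓ₁ ℓ₂ R) (hp0 : h p = 0)
    (hc : |ℓ₁ (p - S)| ≤ 1 / 2 * |ℓ₂ (p - S)|) :
    |ℓ₁ (p - S)| + |ℓ₂ (p - S)| ≤ 4 * |h S| := by
  have h1 := H.abs_h_sub_le hp H.mem
  rw [hp0, zero_sub] at h1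
  set x := ℓ₁ (p - S)
  set y := ℓ₂ (p - S)
  have h2 : κ * (|x| + |y|) ≤ 1 / 12 * (3 / 2 * |y|) := by
    have := hs.tiny
    gcongr
    linarith
  have h3 : |y| ≤ |h S| + |x| + 1 / 12 * (3 / 2 * |y|) := by
    have : y = -h S + -x + -(-h S - (x + y)) := by ring
    calc |y| = |-h S + -x + -(-h S - (x + y))| := by rw [← this]
      _ ≤ |-h S| + |-x| + |-(-h S - (x + y))| := abs_add_three _ _ _
      _ ≤ _ := by rw [abs_neg, abs_neg, abs_neg]; linarith
  linarith

/-- The stable manifold of a real saddle meets the switching manifold. -/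
theorem exists_stable_point (H : LocalModel h V ℓ₁ ℓ₂ α β κ R S) (hs : SmallError α β κ)
    (hcoord : IsCoord ℓ₁ ℓ₂ e₁ e₂) (hφ : IsGlobalFlow V φ) (hK : LipschitzWith K V) {v r : ℝ}
    (hSr : S ∈ box ℓ₁ ℓ₂ r) (hvr : r < v) (hr : 2 * v + 2 * r < R)
    (hS : 0 < h S) (hSv : h S < 1 / 4 * (v - r)) :
    ∃ q, h q = 0 ∧ (∀ t ≥ 0, φ t q ∈ box ℓ₁ ℓ₂ (v + 2 * r)) ∧ ∀ t > 0, 0 < h (φ t q) := by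
  have hr0 : 0 ≤ r := (abs_nonneg _).trans hSr.1
  have hrev : NearSaddle (fun x => -V x) (-ℓ₂) ℓ₁ β α κ R := H.near.reverse.neg
  have hKr : LipschitzWith K fun x => -V x := hK.neg
  -- For the reversed field in the coordinates `-ℓ₂, ℓ₁`, the stable branch on the side of Σ⁻ is an
  -- unstable branch. Its point at `-ℓ₂ = v` has `h < 0` since `h S` is small compared with `v - r`.
  obtain ⟨w, hw, hw'⟩ := exists_unstable_point (hcoord.swap.neg) hφ.reverse hKr hrev hs.half'
    (S := S) (by simp [H.zero]) (v := v) (r := r) (by rwa [box_neg, box_swap])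
    (by linarith) (by linarith) (by linarith) hvr
  simp only [neg_neg, neg_apply] at hw hw'
  have hSb := abs_le.1 hSr.1
  have hSb2 := abs_le.1 hSr.2
  have hb : ∀ t ≥ 0, φ t w ∈ box ℓ₁ ℓ₂ (v + 2 * r) := fun t ht => by
    obtain ⟨h1, h2, h3⟩ := hw' t ht
    have h4 : Real.exp (-(β / 2 * t)) * (v - -ℓ₂ S) ≤ v - -ℓ₂ S := by
      refine mul_le_of_le_one_left (by linarith) (Real.exp_le_one_iff.2 ?_)
      have := hs.big.beta
      have : 0 ≤ β / 2 * t := by positivity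
      linarith
    rw [map_sub] at h1 h2 h3
    rw [map_sub] at h1
    have h5 := abs_le.1 h1
    exact ⟨abs_le.2 ⟨by linarith, by linarith⟩, abs_le.2 ⟨by linarith, by linarith⟩⟩
  have hcont : ContinuousOn (fun t => h (φ t w)) (Ici 0) := fun t ht =>
    (H.hasDerivAt_h hφ (box_mono (by linarith) (hb t ht))).continuousAt.continuousWithinAt
  have hw0 : h w < 0 := by
    obtain ⟨h1, h2, -⟩ := hw' 0 le_rfl
    rw [hφ.zero] at h1 h2
    have hwb := hb 0 le_rfl
    rw [hφ.zero] at hwb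
    have h3 := H.abs_h_sub_le (box_mono (by linarith) hwb) H.mem
    have h4 : κ * (|ℓ₁ (w - S)| + |ℓ₂ (w - S)|) ≤ 1 / 12 * (3 / 2 * -ℓ₂ (w - S)) := by
      have := hs.tiny
      have e : |ℓ₂ (w - S)| = -ℓ₂ (w - S) := abs_of_neg (by linarith)
      rw [e]
      gcongr
      linarith
    have h5 : -ℓ₂ (w - S) = v + ℓ₂ S := by rw [map_sub]; linarith
    linarith [(abs_le.1 h3).2, (abs_le.1 h1).2]
  have htend : Tendsto (fun t => φ t w) atTop (𝓝 S) :=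
    tendsto_of_forall_mem_box hcoord hφ hK H.near (m := 1 / 2) (by norm_num; exact hs.two)
      hs.half' (fun t ht => box_mono (by linarith) (hb t ht)) H.zero H.mem
  have hev : ∀ᶠ t in atTop, 0 < h (φ t w) :=
    ((H.diff_h S H.mem).continuousAt.tendsto.comp htend).eventually_const_lt hS
  obtain ⟨B, hB⟩ := eventually_atTop.1 hev
  -- The orbit tends to `S` with `h S > 0`; its last point with `h ≤ 0` lies on Σ and everything
  -- after it is in Σ⁺.
  set A := {t : ℝ | t ∈ Ici (0 : ℝ) ∧ h (φ t w) ≤ 0} with hA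
  have hAne : A.Nonempty := ⟨0, mem_Ici.2 le_rfl, by rw [hφ.zero]; exact hw0.le⟩
  have hAb : BddAbove A := ⟨B, fun t ht => by
    by_contra hcon
    exact absurd ht.2 (not_le.2 (hB t (not_le.1 hcon).le))⟩
  have hAc : IsClosed A := hcont.preimage_isClosed_of_isClosed isClosed_Ici isClosed_Iic
  have hmem : sSup A ∈ A := hAc.csSup_mem hAne hAb
  set s := sSup A
  have hs0 : 0 ≤ s := hmem.1
  have hpos : ∀ t > s, 0 < h (φ t w) := fun t ht => by
    by_contra hcon
    exact absurd (le_csSup hAb ⟨hs0.trans ht.le, not_lt.1 hcon⟩) (not_le.2 ht)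
  refine ⟨φ s w, ?_, fun t ht => ?_, fun t ht => ?_⟩
  · refine le_antisymm hmem.2 ?_
    have h1 : Tendsto (fun t => h (φ t w)) (𝓝[>] s) (𝓝 (h (φ s w))) :=
      (hcont s hs0).mono fun t ht => hs0.trans (mem_Ioi.1 ht).le
    exact ge_of_tendsto h1 (eventually_nhdsWithin_of_forall fun t ht => (hpos t ht).le)
  · rw [← hφ.add hK]; exact hb _ (add_nonneg ht hs0)
  · rw [← hφ.add hK]; exact hpos _ (by linarith)

end LocalModel

end LocalModel

/-! ### Hitting times of the section and the sign of the derivative. -/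

section Exit

/-- The forms `det2 · w` and `L` both kill `w`, hence are proportional; this converts orientations
into signs of `L`. -/
theorem det2_mul_apply (L : Plane →L[ℝ] ℝ) {v w u : Plane} (hw : L w = 0) :
    det2 v w * L u = L v * det2 u w := by
  have hlin : ∀ a : Plane, L a = a 0 * L (EuclideanSpace.single 0 1) +
      a 1 * L (EuclideanSpace.single 1 1) := fun a => by
    conv_lhs => rw [plane_eq a, map_add, map_smul, map_smul, smul_eq_mul, smul_eq_mul]
  rw [hlin] at hw
  rw [hlin v, hlin u]
  unfold det2
  linear_combination (v 0 * u 1 - v 1 * u 0) * hw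

theorem IsCoord.det_ne_zero {ℓ₁ ℓ₂ : Plane →L[ℝ] ℝ} {e₁ e₂ : Plane} (h : IsCoord ℓ₁ ℓ₂ e₁ e₂) :
    det2 e₁ e₂ ≠ 0 := by
  intro h0
  have h1 : ∀ a b : Plane, det2 a b = 0 := fun a b => by
    have e : ∀ a b : Plane, det2 a b = (ℓ₁ a * ℓ₂ b - ℓ₂ a * ℓ₁ b) * det2 e₁ e₂ := fun a b => by
      conv_lhs => rw [h.decomp a, h.decomp b]
      simp [det2]; ring
    rw [e, h0, mul_zero]
  have := h1 (EuclideanSpace.single 0 1) (EuclideanSpace.single 1 1)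
  simp [det2] at this

variable {h : Plane → ℝ} {ℓ₁ ℓ₂ : Plane →L[ℝ] ℝ} {e₁ e₂ : Plane} {V : Plane → Plane}
  {φ : ℝ → Plane → Plane} {K : NNReal} {α β κ R : ℝ} {S : Plane} {c : ℝ → Plane} {v : ℝ}

/-- The orbit of `p` reaches the line `ℓ₁ = v` for the first time at time `T`. -/
structure IsHit (φ : ℝ → Plane → Plane) (ℓ₁ : Plane →L[ℝ] ℝ) (v : ℝ) (p : Plane) (T : ℝ) :
    Prop where
  pos : 0 < T
  hit : ℓ₁ (φ T p) = v
  before : ∀ t ∈ Ico 0 T, ℓ₁ (φ t p) < v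

/-- `exists_first_zero` for `v - ℓ₁ (φ t (c x))` with parameter `x`; the zero it supplies must be `T
x`, both being first hits. Since `A` need not be a neighbourhood of `x₁`, the lemma also serves at
the left end of a domain. -/
theorem exists_hitting_window (hφ : IsGlobalFlow V φ) (hK : LipschitzWith K V) {x₁ : ℝ}
    (hc : ContinuousAt c x₁) {A : Set ℝ} {T : ℝ → ℝ} (hT : ∀ x ∈ A, IsHit φ ℓ₁ v (c x) (T x))
    (hx₁ : x₁ ∈ A) (hq : 0 < ℓ₁ (V (φ (T x₁) (c x₁)))) {θ₀ : ℝ} (hθ₀ : 0 < θ₀) :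
    ∃ θ > 0, θ ≤ θ₀ ∧ ∀ᶠ x in 𝓝 x₁, (x ∈ A → T x ∈ Ioo (T x₁ - θ) (T x₁ + θ)) ∧
      InjOn (fun t => ℓ₁ (φ t (c x)) - v) (Ioo (T x₁ - θ) (T x₁ + θ)) := by
  have hder : ∀ x t, HasDerivAt (fun t => v - ℓ₁ (φ t (c x))) (-ℓ₁ (V (φ t (c x)))) t :=
    fun x t => (ℓ₁.hasFDerivAt.comp_hasDerivAt t (hφ.hasDerivAt (c x) t)).const_sub v
  have hcont : ∀ t, Tendsto (fun q : ℝ × ℝ => φ q.2 (c q.1)) (𝓝 x₁ ×ˢ 𝓝 t)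
      (𝓝 (φ t (c x₁))) := fun t =>
    ((hφ.continuous hK).tendsto (t, c x₁)).comp
      (tendsto_snd.prodMk_nhds (hc.tendsto.comp tendsto_fst))
  have h1 := hT x₁ hx₁
  obtain ⟨θ, hθ, hθ1, hθ2, hev⟩ := exists_first_zero (l := 𝓝 x₁)
    (f := fun x t => v - ℓ₁ (φ t (c x))) (f' := fun x t => -ℓ₁ (V (φ t (c x))))
    (g := fun t => v - ℓ₁ (φ t (c x₁))) (g' := fun t => -ℓ₁ (V (φ t (c x₁)))) h1.pos
    hder (hder x₁) (fun t => ((ℓ₁.continuous.tendsto _).comp (hcont t)).const_sub v)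
    (fun t => ((ℓ₁.continuous.comp hK.continuous).tendsto _ |>.comp (hcont t)).neg)
    (ℓ₁.continuous.comp (hK.continuous.comp (hφ.continuous_time _))).neg
    (fun t ht => sub_pos.2 (h1.before t ⟨ht.1.le, ht.2⟩)) (by simp [h1.hit]) (by simpa using hq)
    (Or.inl (sub_pos.2 (h1.before 0 ⟨le_rfl, h1.pos⟩))) hθ₀
  refine ⟨θ, hθ, hθ1, hev.mono fun x hx => ⟨fun hxA => ?_, ?_⟩⟩
  · obtain ⟨-, τ, hτ, hτ0, hτ1⟩ := hx
    have h2 := hT x hxA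
    have h3 : T x = τ := by
      rcases lt_trichotomy (T x) τ with h4 | h4 | h4
      · have := hτ1 _ ⟨h2.pos, h4⟩
        rw [h2.hit] at this; linarith
      · exact h4
      · have := h2.before τ ⟨by linarith [hτ.1], h4⟩
        linarith
    rwa [h3]
  · have hanti : StrictAntiOn (fun t => v - ℓ₁ (φ t (c x))) (Icc (T x₁ - θ) (T x₁ + θ)) :=
      strictAntiOn_of_hasDerivWithinAt_neg (convex_Icc _ _)
        (fun t _ => (hder x t).continuousAt.continuousWithinAt)
        (fun t _ => (hder x t).hasDerivWithinAt) (fun t ht => hx.1 t (interior_subset ht))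
    intro t ht s hs hts
    refine hanti.injOn (Ioo_subset_Icc_self ht) (Ioo_subset_Icc_self hs) ?_
    simp only at hts ⊢
    linarith

theorem continuousWithinAt_hitting_time (hφ : IsGlobalFlow V φ) (hK : LipschitzWith K V) {x₁ : ℝ}
    (hc : ContinuousAt c x₁) {A : Set ℝ} {T : ℝ → ℝ} (hT : ∀ x ∈ A, IsHit φ ℓ₁ v (c x) (T x))
    (hx₁ : x₁ ∈ A) (hq : 0 < ℓ₁ (V (φ (T x₁) (c x₁)))) : ContinuousWithinAt T A x₁ := by
  rw [ContinuousWithinAt, Metric.tendsto_nhds]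
  intro θ₀ hθ₀
  obtain ⟨θ, hθ, hθ1, hev⟩ := exists_hitting_window hφ hK hc hT hx₁ hq hθ₀
  filter_upwards [hev.filter_mono nhdsWithin_le_nhds, self_mem_nhdsWithin] with x hx hxA
  obtain ⟨h1, h2⟩ := hx.1 hxA
  rw [Real.dist_eq, abs_lt]
  constructor <;> linarith

theorem contDiffAt_hitting_time {r : ℕ∞} (hφ : IsGlobalFlow V φ) (hK : LipschitzWith K V)
    (hr : 1 ≤ r) (hV : ContDiff ℝ r V) {x₁ : ℝ}
    (hc : ContDiffAt ℝ r c x₁) {A : Set ℝ} {T : ℝ → ℝ} (hT : ∀ x ∈ A, IsHit φ ℓ₁ v (c x) (T x))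
    (hA : A ∈ 𝓝 x₁) (hq : 0 < ℓ₁ (V (φ (T x₁) (c x₁)))) : ContDiffAt ℝ r T x₁ := by
  obtain ⟨θ, hθ, hθ1, hev⟩ := exists_hitting_window hφ hK hc.continuousAt hT (mem_of_mem_nhds hA)
    hq one_pos
  have hfd : ∀ p, fderiv ℝ (fun p => ℓ₁ p - v) p = ℓ₁ := fun p =>
    (ℓ₁.hasFDerivAt.sub_const v).fderiv
  refine hφ.contDiffAt_transit_time hK hr hV (g := fun p => ℓ₁ p - v)
    (ℓ₁.contDiff.sub contDiff_const) hc (a := T x₁ - θ) (b := T x₁ + θ) ?_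
    (hev.mono fun x hx => hx.2) ?_
  · filter_upwards [hev, hA] with x hx hxA
    exact ⟨hx.1 hxA, by rw [(hT x hxA).hit, sub_self]⟩
  · rw [lieD, hfd]; exact hq.ne'

/-- Near the saddle, the chart of the switching manifold is close to an affine map with direction
`k (e₁ - e₂)`. -/
structure ChartModel (h : Plane → ℝ) (ℓ₁ ℓ₂ : Plane →L[ℝ] ℝ) (c : ℝ → Plane) (k b : ℝ) :
    Prop where
  pos : 0 < k
  mem : ∀ x ∈ Icc (-b) b, h (c x) = 0
  smooth : ∀ x ∈ Icc (-b) b, ContDiffAt ℝ ∞ c x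
  near : ∀ x ∈ Icc (-b) b, |ℓ₁ (deriv c x) - k| ≤ 1 / 12 * k ∧ |ℓ₂ (deriv c x) + k| ≤ 1 / 12 * k

namespace ChartModel

variable {k b : ℝ}

theorem hasDerivAt (C : ChartModel h ℓ₁ ℓ₂ c k b) {x : ℝ} (hx : x ∈ Icc (-b) b) :
    HasDerivAt c (deriv c x) x := ((C.smooth x hx).differentiableAt (by simp)).hasDerivAt

theorem fst (C : ChartModel h ℓ₁ ℓ₂ c k b) {x y : ℝ} (hx : x ∈ Icc (-b) b) (hy : y ∈ Icc (-b) b)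
    (hxy : x < y) :
    11 / 12 * k * (y - x) ≤ ℓ₁ (c y - c x) ∧ ℓ₁ (c y - c x) ≤ 13 / 12 * k * (y - x) := by
  obtain ⟨z, hz, h1⟩ := exists_hasDerivAt_eq_slope (fun x => ℓ₁ (c x)) (fun x => ℓ₁ (deriv c x)) hxy
    (fun z hz => (ℓ₁.continuous.continuousAt.comp
      (C.smooth z ⟨hx.1.trans hz.1, hz.2.trans hy.2⟩).continuousAt).continuousWithinAt)
    (fun z hz => ℓ₁.hasFDerivAt.comp_hasDerivAt z
      (C.hasDerivAt ⟨hx.1.trans hz.1.le, hz.2.le.trans hy.2⟩))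
  have h2 := abs_le.1 (C.near z ⟨hx.1.trans hz.1.le, hz.2.le.trans hy.2⟩).1
  have h3 : 0 < y - x := sub_pos.2 hxy
  rw [eq_div_iff h3.ne', ← map_sub] at h1
  rw [← h1]
  constructor <;> gcongr <;> linarith

theorem snd (C : ChartModel h ℓ₁ ℓ₂ c k b) {x y : ℝ} (hx : x ∈ Icc (-b) b) (hy : y ∈ Icc (-b) b)
    (hxy : x < y) :
    11 / 12 * k * (y - x) ≤ -ℓ₂ (c y - c x) ∧ -ℓ₂ (c y - c x) ≤ 13 / 12 * k * (y - x) := by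
  obtain ⟨z, hz, h1⟩ := exists_hasDerivAt_eq_slope (fun x => ℓ₂ (c x)) (fun x => ℓ₂ (deriv c x)) hxy
    (fun z hz => (ℓ₂.continuous.continuousAt.comp
      (C.smooth z ⟨hx.1.trans hz.1, hz.2.trans hy.2⟩).continuousAt).continuousWithinAt)
    (fun z hz => ℓ₂.hasFDerivAt.comp_hasDerivAt z
      (C.hasDerivAt ⟨hx.1.trans hz.1.le, hz.2.le.trans hy.2⟩))
  have h2 := abs_le.1 (C.near z ⟨hx.1.trans hz.1.le, hz.2.le.trans hy.2⟩).2
  have h3 : 0 < y - x := sub_pos.2 hxy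
  rw [eq_div_iff h3.ne', ← map_sub] at h1
  rw [← h1, ← neg_mul]
  constructor <;> gcongr <;> linarith

/-- Puts later points of Σ in the unstable cone of earlier ones, which is why points beyond the base
point exit through the section. -/
theorem direction (C : ChartModel h ℓ₁ ℓ₂ c k b) {x y : ℝ} (hx : x ∈ Icc (-b) b)
    (hy : y ∈ Icc (-b) b) (hxy : x < y) :
    0 < ℓ₁ (c y - c x) ∧ ℓ₂ (c y - c x) < 0 ∧ |ℓ₂ (c y - c x)| ≤ 2 * ℓ₁ (c y - c x) := by
  obtain ⟨h1, h2⟩ := C.fst hx hy hxy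
  obtain ⟨h3, h4⟩ := C.snd hx hy hxy
  have h5 : 0 < k * (y - x) := mul_pos C.pos (sub_pos.2 hxy)
  have h6 : ℓ₂ (c y - c x) < 0 := by linarith
  exact ⟨by linarith, h6, by rw [abs_of_neg h6]; linarith⟩

/-- On the direction `e₁ - e₂` the model `α ℓ₁ - β ℓ₂` of `Xh` has slope `α + β`, and the errors are
smaller than this. -/
theorem lie_lt_lie (C : ChartModel h ℓ₁ ℓ₂ c k b) (H : LocalModel h V ℓ₁ ℓ₂ α β κ R S)
    (hs : SmallError α β κ) {x y : ℝ} (hx : x ∈ Icc (-b) b) (hy : y ∈ Icc (-b) b) (hxy : x < y)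
    (hcx : c x ∈ box ℓ₁ ℓ₂ R) (hcy : c y ∈ box ℓ₁ ℓ₂ R) : lieD V h (c x) < lieD V h (c y) := by
  obtain ⟨h1, h2, -⟩ := C.direction hx hy hxy
  have h3 := (abs_le.1 (H.abs_lie_sub_le hcy hcx)).1
  rw [abs_of_pos h1, abs_of_neg h2] at h3
  have h4 : κ ≤ α / 2 := by
    have := hs.incr
    have hα := hs.big.alpha
    have hβ := hs.big.beta
    have hκ := hs.big.kappa
    have : κ * 1 ≤ κ * (1 + (2 + 2 * α / β)) := by
      gcongr
      have : 0 ≤ 2 * α / β := by positivity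
      linarith
    linarith
  have h5 := hs.fold₃
  have h6 : 0 < α * ℓ₁ (c y - c x) := mul_pos hs.big.alpha h1
  have h7 : κ * ℓ₁ (c y - c x) ≤ α / 2 * ℓ₁ (c y - c x) := by gcongr
  have h8 : κ * -ℓ₂ (c y - c x) ≤ β / 2 * -ℓ₂ (c y - c x) := by gcongr; linarith
  have h9 : 0 < β * -ℓ₂ (c y - c x) := mul_pos hs.big.beta (by linarith)
  linarith

end ChartModel

/-- On the section `ℓ₁ (V q)` is about `α (v - ℓ₁ S)`, at least `7 α v / 8`. As `R` is a fixed
multiple of `v`, the error is at most `α v / 2` by the condition `exit`. -/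
theorem LocalModel.exit_speed (H : LocalModel h V ℓ₁ ℓ₂ α β κ R S) (hs : SmallError α β κ)
    (hv : 0 < v) (hR : R = 8 * (1 + (2 + 2 * α / β)) * v) (hS : S ∈ box ℓ₁ ℓ₂ (v / 8)) {q : Plane}
    (hq : q ∈ box ℓ₁ ℓ₂ R) (hqv : ℓ₁ q = v) : 0 < ℓ₁ (V q) := by
  have hα := hs.big.alpha
  have hβ := hs.big.beta
  have h1 := (H.near q hq S H.mem).1
  rw [H.zero, sub_zero] at h1
  obtain ⟨a1, a2⟩ := abs_le.1 hS.1
  obtain ⟨a3, a4⟩ := abs_le.1 hS.2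
  obtain ⟨a5, a6⟩ := abs_le.1 hq.2
  set M := 2 + 2 * α / β with hM
  have hM0 : 0 < M := by positivity
  have h2 : |ℓ₁ (q - S)| ≤ 2 * v := by rw [map_sub, hqv]; exact abs_le.2 ⟨by linarith, by linarith⟩
  have h3 : |ℓ₂ (q - S)| ≤ R + v / 8 := by
    rw [map_sub]; exact abs_le.2 ⟨by linarith, by linarith⟩
  have h4 : κ * (|ℓ₁ (q - S)| + |ℓ₂ (q - S)|) ≤ κ * (20 * (1 + M) * v) := by
    have := hs.big.kappa
    gcongr
    nlinarith [mul_pos hM0 hv]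
  have h5 : κ * (20 * (1 + M) * v) ≤ α / 2 * v := by
    have := mul_le_mul_of_nonneg_right hs.exit hv.le
    linarith
  have h6 : α * (7 / 8 * v) ≤ α * ℓ₁ (q - S) := by
    gcongr; rw [map_sub, hqv]; linarith
  have := mul_pos hα hv
  linarith [(abs_le.1 h1).1]

/-- The transition map to the section `ℓ₁ = v` is increasing where the field points into `Σ⁺`. -/
theorem deriv_transition_pos {r : ℕ∞} {k b : ℝ} (H : LocalModel h V ℓ₁ ℓ₂ α β κ R S)
    (hs : SmallError α β κ) (hcoord : IsCoord ℓ₁ ℓ₂ e₁ e₂) (hφ : IsGlobalFlow V φ)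
    (hK : LipschitzWith K V) (hr : 1 ≤ r) (hV : ContDiff ℝ r V)
    (C : ChartModel h ℓ₁ ℓ₂ c k b) {w₀ : Plane} {T : ℝ → ℝ} {x₁ : ℝ}
    {A : Set ℝ} (hA : A ∈ 𝓝 x₁) (hAb : A ⊆ Icc (-b) b)
    (hT : ∀ x ∈ A, IsHit φ ℓ₁ v (c x) (T x)) (hw₀ : ℓ₁ w₀ = v)
    (hq : 0 < ℓ₁ (V (φ (T x₁) (c x₁)))) (hcR : c x₁ ∈ box ℓ₁ ℓ₂ R)
    (hG : 0 < lieD V h (c x₁)) :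
    DifferentiableAt ℝ (fun x => -ℓ₂ (φ (T x) (c x) - w₀)) x₁ ∧
      0 < deriv (fun x => -ℓ₂ (φ (T x) (c x) - w₀)) x₁ := by
  have hr0 : (r : WithTop ℕ∞) ≠ 0 := by simpa using (one_pos.trans_le hr).ne'
  have hx₁ := hAb (mem_of_mem_nhds hA)
  have hcr : ContDiffAt ℝ r c x₁ := (C.smooth x₁ hx₁).of_le (by exact_mod_cast le_top)
  have hTd := contDiffAt_hitting_time hφ hK hr hV hcr hT hA hq
  have hqd : ContDiffAt ℝ r (fun x => φ (T x) (c x)) x₁ :=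
    (hφ.contDiff hK hr hV).contDiffAt.comp x₁ (hTd.prodMk hcr)
  have hρ : DifferentiableAt ℝ (fun x => -ℓ₂ (φ (T x) (c x) - w₀)) x₁ :=
    (ℓ₂.contDiff.contDiffAt.comp x₁ (hqd.sub contDiffAt_const)).neg.differentiableAt hr0
  refine ⟨hρ, ?_⟩
  set ρ : ℝ → ℝ := fun x => -ℓ₂ (φ (T x) (c x) - w₀) with hρdef
  have hsec : ∀ x ∈ A, φ (T x) (c x) = w₀ - ρ x • e₂ := fun x hx => by
    refine hcoord.ext ?_ ?_
    · rw [(hT x hx).hit, map_sub, map_smul, hcoord.l12, hw₀]; simp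
    · rw [map_sub, map_smul, hcoord.l22, hρdef]; simp
  have he : ∀ u, HasDerivAt (fun u : ℝ => w₀ - u • e₂) (-e₂) u := fun u => by
    simpa using ((hasDerivAt_id u).smul_const e₂).const_sub w₀
  obtain ⟨J, hJ, h1⟩ := hφ.exists_det_transit hK hr hV (hcr.differentiableAt hr0)
    (hTd.differentiableAt hr0) (e := fun u : ℝ => w₀ - u • e₂) hρ (he _).differentiableAt
    (eventually_of_mem hA hsec)
  rw [(he _).deriv] at h1
  simp only [← hsec x₁ (mem_of_mem_nhds hA)] at h1
  set q := φ (T x₁) (c x₁)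
  have hD := hcoord.det_ne_zero
  have h2 := det2_mul_apply ℓ₁ (v := V q) (w := -e₂) (u := e₁) (by rw [map_neg, hcoord.l12, neg_zero])
  have hneg : ∀ a b : Plane, det2 a (-b) = -det2 a b := fun a b => by simp [det2]; ring
  rw [hcoord.l11, mul_one, hneg e₁] at h2
  have hdh0 : fderiv ℝ h (c x₁) (deriv c x₁) = 0 := by
    have h1 : HasDerivAt (fun y => h (c y)) (fderiv ℝ h (c x₁) (deriv c x₁)) x₁ :=
      (H.diff_h _ hcR).hasFDerivAt.comp_hasDerivAt x₁ (C.hasDerivAt hx₁)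
    have h2 : (fun y => h (c y)) =ᶠ[𝓝 x₁] fun _ => 0 :=
      eventually_of_mem hA fun y hy => C.mem y (hAb hy)
    exact (h1.congr_of_eventuallyEq h2.symm).unique (hasDerivAt_const x₁ 0)
  have h3 := det2_mul_apply (fderiv ℝ h (c x₁)) (v := V (c x₁)) (w := deriv c x₁) (u := e₁) hdh0
  have h4 : det2 e₁ (deriv c x₁) = ℓ₂ (deriv c x₁) * det2 e₁ e₂ := by
    conv_lhs => rw [hcoord.decomp (deriv c x₁)]
    rw [det2_add_right, det2_smul_right, det2_smul_right, det2_self]; ring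
  have h5 : 0 < fderiv ℝ h (c x₁) e₁ := by
    have := H.fderiv_h _ hcR e₁
    rw [hcoord.l11, hcoord.l21] at this
    have h6 := hs.tiny
    norm_num at this
    linarith [(abs_le.1 this).1]
  have h6 : 0 < -ℓ₂ (deriv c x₁) := by
    have := abs_le.1 (C.near x₁ hx₁).2
    linarith [C.pos]
  change _ = lieD V h (c x₁) * _ at h3
  rw [h4] at h3
  rw [h2] at h1
  -- Combines the orientation relation of the flow with the proportionalities of determinants at the
  -- section and at Σ; every factor besides `deriv ρ x₁` is positive.
  have h7 : deriv ρ x₁ * (ℓ₁ (V q) * fderiv ℝ h (c x₁) e₁) =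
      J * (lieD V h (c x₁) * -ℓ₂ (deriv c x₁)) := by
    refine mul_right_cancel₀ hD ?_
    linear_combination (-fderiv ℝ h (c x₁) e₁) * h1 - J * h3
  have h8 : 0 < deriv ρ x₁ * (ℓ₁ (V q) * fderiv ℝ h (c x₁) e₁) := by rw [h7]; positivity
  exact (mul_pos_iff_of_pos_right (by positivity)).1 h8

end Exit

/-! ### Construction of the first transition map near the base point. -/

section Transition

variable {h : Plane → ℝ} {ℓ₁ ℓ₂ : Plane →L[ℝ] ℝ} {e₁ e₂ : Plane} {V : Plane → Plane}
  {φ : ℝ → Plane → Plane} {K : NNReal} {α β κ R : ℝ} {S : Plane} {c : ℝ → Plane} {v : ℝ}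
  {r : ℕ∞} {k b η T₀ a δ : ℝ} {w₀ : Plane}

/-- The orbit of `p` goes through `Σ⁺`, inside the box of radius `R`, to the section `ℓ₁ = v`. -/
structure IsExit (h : Plane → ℝ) (φ : ℝ → Plane → Plane) (ℓ₁ ℓ₂ : Plane →L[ℝ] ℝ) (v R : ℝ)
    (p : Plane) (T : ℝ) : Prop extends IsHit φ ℓ₁ v p T where
  box : ∀ t ∈ Icc 0 T, φ t p ∈ box ℓ₁ ℓ₂ R
  h_pos : ∀ t ∈ Ioc 0 T, 0 < h (φ t p)

/-- The conditions under which a transition map from the switching manifold to the section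
`ℓ₁ = v` is constructed. -/
structure TransitionSetup (h : Plane → ℝ) (V : Plane → Plane) (φ : ℝ → Plane → Plane)
    (ℓ₁ ℓ₂ : Plane →L[ℝ] ℝ) (e₁ e₂ : Plane) (K : NNReal) (α β κ R : ℝ) (S : Plane)
    (c : ℝ → Plane) (v : ℝ) (r : ℕ∞) (k b : ℝ) : Prop where
  model : LocalModel h V ℓ₁ ℓ₂ α β κ R S
  small : SmallError α β κ
  coord : IsCoord ℓ₁ ℓ₂ e₁ e₂
  flow : IsGlobalFlow V φ
  lipschitz : LipschitzWith K V
  one_le : 1 ≤ r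
  contDiff : ContDiff ℝ r V
  chart : ChartModel h ℓ₁ ℓ₂ c k b
  v_pos : 0 < v
  R_eq : R = 8 * (1 + (2 + 2 * α / β)) * v
  mem : S ∈ box ℓ₁ ℓ₂ (v / 8)

namespace TransitionSetup

theorem radius (D : TransitionSetup h V φ ℓ₁ ℓ₂ e₁ e₂ K α β κ R S c v r k b) :
    2 < 2 + 2 * α / β ∧ 8 * v < R ∧ v / 8 + (2 + 2 * α / β) * (v + v / 8) < R := by
  have hα := D.small.big.alpha
  have hβ := D.small.big.beta
  have hv := D.v_pos
  have hM : 0 < 2 * α / β := by positivity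
  rw [D.R_eq]
  set M := 2 + 2 * α / β with hMdef
  have : 0 < M * v := by positivity
  refine ⟨by linarith, by nlinarith, by nlinarith⟩

/-- The reference orbit is the saddle. Seen from `S`, the point `c x` is the fold position, with
positive coordinates and slope at most `2 + 2 α / β`, plus a chord of Σ of slope between `-2` and
`0`; the sum stays in the cone. Moreover `Xh` at `c x` is at least its value zero at the fold. -/
theorem exists_isExit_virtual (D : TransitionSetup h V φ ℓ₁ ℓ₂ e₁ e₂ K α β κ R S c v r k b)
    (hS : h S < 0) (ha : a ∈ Icc (-b) b) (hca : c a ∈ box ℓ₁ ℓ₂ R) (hG : lieD V h (c a) = 0)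
    {x : ℝ} (hx : x ∈ Icc (-b) b) (hax : a ≤ x) (hcx : c x ∈ box ℓ₁ ℓ₂ R) (hxv : ℓ₁ (c x) < v) :
    ∃ T, IsExit h φ ℓ₁ ℓ₂ v R (c x) T := by
  obtain ⟨hM, hvR, hr⟩ := D.radius
  have hv := D.v_pos
  obtain ⟨h1, h2, h3, -⟩ := D.model.fold_position D.small hca (D.chart.mem a ha) hS hG
  have hcone : 0 < ℓ₁ (c x - S) ∧ |ℓ₂ (c x - S)| ≤ (2 + 2 * α / β) * ℓ₁ (c x - S) ∧
      0 ≤ lieD V h (c x) := by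
    rcases hax.eq_or_lt with rfl | hax
    · exact ⟨h1, by rwa [abs_of_pos h2], hG.ge⟩
    · obtain ⟨d1, d2, d3⟩ := D.chart.direction ha hx hax
      have e1 : c x - S = (c x - c a) + (c a - S) := by abel
      rw [e1, map_add, map_add]
      refine ⟨by linarith, ?_, ?_⟩
      · rw [abs_of_neg d2] at d3
        have : 0 < (2 + 2 * α / β - 2) * ℓ₁ (c x - c a) := mul_pos (by linarith) d1
        have : 0 < (2 + 2 * α / β) * ℓ₁ (c a - S) := mul_pos (by linarith) h1
        exact abs_le.2 ⟨by linarith, by linarith⟩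
      · rw [← hG]; exact (D.chart.lie_lt_lie D.model D.small ha hx hax hca hcx).le
  obtain ⟨T, hT, hT1, hT2, hT3⟩ := exists_exit D.flow D.model.near D.small.big (v := v) (r := v / 8)
    (q := S) (fun t _ => by rw [D.flow.fixed D.lipschitz D.model.zero]; exact D.mem)
    (by linarith) hr (by linarith) hcone.1 hcone.2.1 hxv
  exact ⟨T, ⟨hT, hT1, hT2⟩, hT3, fun t ht => D.model.pos_of_cone D.small D.flow D.lipschitz
    (D.chart.mem x hx) hcone.2.2 hcone.1 hcone.2.1 ht.1 fun s hs => hT3 s ⟨hs.1, hs.2.trans ht.2⟩⟩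

/-- The reference is the orbit of `c a`, which stays in the small box with `h ≥ 0`. The chord from
`c a` to `c x` lies in the unstable cone, and `h` is larger along the second orbit. -/
theorem exists_isExit_real (D : TransitionSetup h V φ ℓ₁ ℓ₂ e₁ e₂ K α β κ R S c v r k b)
    (ha : a ∈ Icc (-b) b)
    (hreal : ∀ t ≥ 0, φ t (c a) ∈ box ℓ₁ ℓ₂ (v / 8) ∧ 0 ≤ h (φ t (c a)))
    {x : ℝ} (hx : x ∈ Icc (-b) b) (hax : a < x) (hxv : ℓ₁ (c x) < v) :
    ∃ T, IsExit h φ ℓ₁ ℓ₂ v R (c x) T := by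
  obtain ⟨hM, hvR, hr⟩ := D.radius
  have hv := D.v_pos
  obtain ⟨d1, d2, d3⟩ := D.chart.direction ha hx hax
  have d4 : |ℓ₂ (c x - c a)| ≤ (2 + 2 * α / β) * ℓ₁ (c x - c a) :=
    d3.trans (by gcongr)
  obtain ⟨T, hT, hT1, hT2, hT3⟩ := exists_exit D.flow D.model.near D.small.big (v := v) (r := v / 8)
    (q := c a) (fun t ht => (hreal t ht).1) (by linarith) hr (by linarith) d1 d4 hxv
  refine ⟨T, ⟨hT, hT1, hT2⟩, hT3, fun t ht => (hreal t ht.1.le).2.trans_lt ?_⟩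
  exact D.model.h_lt_h_of_cone D.small D.flow
    ((D.chart.mem x hx).trans (D.chart.mem a ha).symm) d1 d2.le d4 ht.1
    (fun s hs => hT3 s ⟨hs.1, hs.2.trans ht.2⟩)
    fun s hs => box_mono (by linarith) (hreal s hs.1).1

/-- Continuity at the left end point of the domain determines the regularity of the transition
map. -/
theorem transition_of_continuousWithinAt
    (D : TransitionSetup h V φ ℓ₁ ℓ₂ e₁ e₂ K α β κ R S c v r k b) (hw₀ : ℓ₁ w₀ = v)
    (ha : -b ≤ a) (hδ : 0 < δ) (hδb : a + δ ≤ b) {T ρ : ℝ → ℝ}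
    (hcR : ∀ x ∈ Ioo a (a + δ), c x ∈ box ℓ₁ ℓ₂ R)
    (hG : ∀ x ∈ Ioo a (a + δ), 0 < lieD V h (c x))
    (hT : ∀ x ∈ Ioo a (a + δ), IsExit h φ ℓ₁ ℓ₂ v R (c x) (T x))
    (hρ : ∀ x ∈ Ioo a (a + δ), ρ x = -ℓ₂ (φ (T x) (c x) - w₀))
    (hρa : ContinuousWithinAt ρ (Ioi a) a) (hρη : |ρ a| < η) :
    ∃ δ' > 0, δ' ≤ δ ∧ (∀ x ∈ Ico a (a + δ'), |ρ x| < η) ∧ ContinuousOn ρ (Ico a (a + δ')) ∧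
      StrictMonoOn ρ (Ico a (a + δ')) := by
  have hder : ∀ x ∈ Ioo a (a + δ), DifferentiableAt ℝ ρ x ∧ 0 < deriv ρ x := fun x hx => by
    have hev : ρ =ᶠ[𝓝 x] fun x => -ℓ₂ (φ (T x) (c x) - w₀) :=
      eventually_of_mem (isOpen_Ioo.mem_nhds hx) hρ
    have h1 := deriv_transition_pos D.model D.small D.coord D.flow D.lipschitz D.one_le D.contDiff
      D.chart (isOpen_Ioo.mem_nhds hx) (fun y hy => ⟨ha.trans hy.1.le, hy.2.le.trans hδb⟩)
      (fun y hy => (hT y hy).toIsHit) hw₀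
      (D.model.exit_speed D.small D.v_pos D.R_eq D.mem
        ((hT x hx).box _ ⟨(hT x hx).pos.le, le_rfl⟩) (hT x hx).hit) (hcR x hx) (hG x hx)
    rw [hev.deriv_eq]
    exact ⟨hev.differentiableAt_iff.2 h1.1, h1.2⟩
  have hcont : ContinuousOn ρ (Ico a (a + δ)) := fun x hx => by
    rcases hx.1.eq_or_lt with rfl | h1
    · have h2 : ContinuousWithinAt ρ (insert a (Ioi a)) a := continuousWithinAt_insert_self.2 hρa
      exact h2.mono fun y hy => by
        rcases hy.1.eq_or_lt with rfl | h
        · exact mem_insert _ _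
        · exact mem_insert_of_mem _ h
    · exact (hder x ⟨h1, hx.2⟩).1.continuousAt.continuousWithinAt
  obtain ⟨δ₁, hδ₁, h1⟩ := Metric.mem_nhdsWithin_iff.1
    ((hcont a ⟨le_rfl, by linarith⟩).abs.eventually_lt_const hρη)
  refine ⟨min δ δ₁, lt_min hδ hδ₁, min_le_left _ _, fun x hx => ?_, ?_, ?_⟩
  · have h2 := lt_min_iff.1 (show x - a < min δ δ₁ by linarith [hx.2])
    refine h1 ⟨?_, hx.1, by linarith⟩
    rw [Metric.mem_ball, Real.dist_eq, abs_of_nonneg (by linarith [hx.1])]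
    exact h2.2
  · exact hcont.mono (Ico_subset_Ico_right (by linarith [min_le_left δ δ₁]))
  · refine strictMonoOn_of_deriv_pos (convex_Ico _ _)
      (hcont.mono (Ico_subset_Ico_right (by linarith [min_le_left δ δ₁]))) fun x hx => ?_
    rw [interior_Ico] at hx
    exact (hder x ⟨hx.1, hx.2.trans_le (by linarith [min_le_left δ δ₁])⟩).2

/-- The transition map to the section near a virtual saddle. -/
theorem exists_transition_virtual
    (D : TransitionSetup h V φ ℓ₁ ℓ₂ e₁ e₂ K α β κ R S c v r k b) (hw₀ : ℓ₁ w₀ = v)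
    (hloc : ∀ q, ℓ₁ q = v → (∀ t ∈ Icc 0 T₀, φ (-t) q ∈ box ℓ₁ ℓ₂ R) → |ℓ₂ (q - w₀)| < η)
    (hexp : Real.exp (2 * α * T₀) * (2 * |h S|) < 7 / 8 * v) (hS : h S < 0)
    (ha : a ∈ Icc (-b) b) (hδ : 0 < δ) (hδb : a + δ ≤ b)
    (hc : ∀ x ∈ Ico a (a + δ), c x ∈ box ℓ₁ ℓ₂ R ∧ ℓ₁ (c x) < v) (hG : lieD V h (c a) = 0) :
    ∃ δ' > 0, δ' ≤ δ ∧ ∃ T ρ : ℝ → ℝ,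
      ((∀ x ∈ Ico a (a + δ'), |ρ x| < η) ∧ ContinuousOn ρ (Ico a (a + δ')) ∧
      StrictMonoOn ρ (Ico a (a + δ'))) ∧ (∀ x ∈ Ico a (a + δ'),
        IsExit h φ ℓ₁ ℓ₂ v R (c x) (T x) ∧ φ (T x) (c x) = w₀ - ρ x • e₂) ∧
      (∀ x ∈ Ioo a (a + δ'), 0 < lieD V h (c x)) := by
  have hsub : ∀ x ∈ Ico a (a + δ), x ∈ Icc (-b) b := fun x hx =>
    ⟨ha.1.trans hx.1, hx.2.le.trans hδb⟩
  have haI : a ∈ Ico a (a + δ) := ⟨le_rfl, by linarith⟩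
  have key : ∀ x ∈ Ico a (a + δ), ∃ T, IsExit h φ ℓ₁ ℓ₂ v R (c x) T := fun x hx =>
    D.exists_isExit_virtual hS ha (hc a haI).1 hG (hsub x hx) hx.1 (hc x hx).1 (hc x hx).2
  choose! T hT using key
  have hGpos : ∀ x ∈ Ioo a (a + δ), 0 < lieD V h (c x) := fun x hx => by
    rw [← hG]
    exact D.chart.lie_lt_lie D.model D.small ha (hsub x (Ioo_subset_Ico_self hx)) hx.1
      (hc a haI).1 (hc x (Ioo_subset_Ico_self hx)).1
  set ρ : ℝ → ℝ := fun x => -ℓ₂ (φ (T x) (c x) - w₀) with hρ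
  have hcc : ContinuousAt c a := (D.chart.smooth a ha).continuousAt
  have hTc : ContinuousWithinAt T (Ico a (a + δ)) a :=
    continuousWithinAt_hitting_time D.flow D.lipschitz hcc (fun x hx => (hT x hx).toIsHit) haI
      (D.model.exit_speed D.small D.v_pos D.R_eq D.mem
        ((hT a haI).box _ ⟨(hT a haI).pos.le, le_rfl⟩) (hT a haI).hit)
  have hρc : ContinuousWithinAt ρ (Ico a (a + δ)) a := by
    have h1 : ContinuousWithinAt (fun x => φ (T x) (c x)) (Ico a (a + δ)) a :=
      (D.flow.continuous D.lipschitz).continuousAt.comp_continuousWithinAt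
        (f := fun x => (T x, c x)) (hTc.prodMk hcc.continuousWithinAt)
    exact (ℓ₂.continuous.continuousAt.comp_continuousWithinAt
      (h1.sub continuousWithinAt_const)).neg
  have hρη : |ρ a| < η := by
    rw [hρ]
    simp only [abs_neg]
    refine hloc _ (hT a haI).hit fun t ht => ?_
    -- The fold is within `2 |h S|` of `S` and expansion is at most `exp (2 α t)`, so `hexp`
    -- excludes an exit before `T₀`. A stay of length `T₀` in the box then brings the exit point
    -- close to `w₀` by `hloc`.
    have h1 : T₀ ≤ T a := by
      by_contra hcon
      push Not at hcon
      obtain ⟨h1, h2, h3, h4⟩ := D.model.fold_position D.small (hc a haI).1 (D.chart.mem a ha) hS hG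
      have hvR : v / 8 ≤ R := by linarith [D.radius.2.1, D.v_pos]
      have h5 := ((saddlePair D.flow D.model.near (T := T a) (p := c a) (q := S) (hT a haI).box
        (fun t _ => by rw [D.flow.fixed D.lipschitz D.model.zero]; exact box_mono hvR D.mem)).cone
        D.small.big (hT a haI).pos.le (by simpa [D.flow.zero] using h1)
        (by simp only [D.flow.zero]; rwa [abs_of_pos h2])).2.2
      simp only [D.flow.zero, D.flow.fixed D.lipschitz D.model.zero] at h5
      rw [map_sub ℓ₁ (φ (T a) (c a)), (hT a haI).hit] at h5
      have h6 : Real.exp (2 * α * T a) * ℓ₁ (c a - S) ≤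
          Real.exp (2 * α * T₀) * (2 * |h S|) := by
        have := D.small.big.alpha
        gcongr
        rw [abs_of_pos h1, abs_of_pos h2] at h4
        linarith
      linarith [(abs_le.1 D.mem.1).2]
    rw [← D.flow.add D.lipschitz]
    exact (hT a haI).box _ ⟨by linarith [ht.2], by linarith [ht.1]⟩
  have hρa : ContinuousWithinAt ρ (Ioi a) a :=
    hρc.mono_of_mem_nhdsWithin (mem_of_superset (Ioo_mem_nhdsGT (by linarith : a < a + δ))
      Ioo_subset_Ico_self)
  obtain ⟨δ', h1, h2, h3⟩ := D.transition_of_continuousWithinAt hw₀ ha.1 hδ hδb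
    (fun x hx => (hc x (Ioo_subset_Ico_self hx)).1) hGpos
    (fun x hx => hT x (Ioo_subset_Ico_self hx)) (fun x _ => rfl) hρa hρη
  refine ⟨δ', h1, h2, T, ρ, h3, fun x hx => ⟨hT x ⟨hx.1, hx.2.trans_le (by linarith)⟩, ?_⟩,
    fun x hx => hGpos x ⟨hx.1, hx.2.trans_le (by linarith)⟩⟩
  refine D.coord.ext ?_ ?_
  · rw [(hT x ⟨hx.1, hx.2.trans_le (by linarith)⟩).hit, map_sub, map_smul, D.coord.l12, hw₀]; simp
  · rw [map_sub, map_smul, D.coord.l22, hρ]; simp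

/-- The transition map to the section near a real saddle or a boundary saddle. -/
theorem exists_transition_real
    (D : TransitionSetup h V φ ℓ₁ ℓ₂ e₁ e₂ K α β κ R S c v r k b) (hw₀ : ℓ₁ w₀ = v)
    (hloc : ∀ q, ℓ₁ q = v → (∀ t ∈ Icc 0 T₀, φ (-t) q ∈ box ℓ₁ ℓ₂ R) → |ℓ₂ (q - w₀)| < η)
    (hS : 0 ≤ h S) (ha : a ∈ Icc (-b) b) (hδ : 0 < δ) (hδb : a + δ ≤ b)
    (hc : ∀ x ∈ Ico a (a + δ), c x ∈ box ℓ₁ ℓ₂ R ∧ ℓ₁ (c x) < v)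
    (hreal : ∀ t ≥ 0, φ t (c a) ∈ box ℓ₁ ℓ₂ (v / 8) ∧ 0 ≤ h (φ t (c a))) :
    ∃ δ' > 0, δ' ≤ δ ∧ ∃ T ρ : ℝ → ℝ,
      ((∀ x ∈ Ico a (a + δ'), |ρ x| < η) ∧ ContinuousOn ρ (Ico a (a + δ')) ∧
      StrictMonoOn ρ (Ico a (a + δ'))) ∧ (∀ x ∈ Ioo a (a + δ'),
        IsExit h φ ℓ₁ ℓ₂ v R (c x) (T x) ∧ φ (T x) (c x) = w₀ - ρ x • e₂) ∧
      (∀ x ∈ Ioo a (a + δ'), 0 < lieD V h (c x)) ∧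
      (∀ t ≥ 0, φ (-t) (w₀ - ρ a • e₂) ∈ box ℓ₁ ℓ₂ R ∧ 0 < h (φ (-t) (w₀ - ρ a • e₂)) ∧
        (0 < t → ℓ₁ (φ (-t) (w₀ - ρ a • e₂)) < v)) ∧
      Tendsto (fun t => φ (-t) (w₀ - ρ a • e₂)) atTop (𝓝 S) := by
  obtain ⟨hM, hvR, hr⟩ := D.radius
  have hv := D.v_pos
  have hα := D.small.big.alpha
  have hβ := D.small.big.beta
  have hsub : ∀ x ∈ Ico a (a + δ), x ∈ Icc (-b) b := fun x hx =>
    ⟨ha.1.trans hx.1, hx.2.le.trans hδb⟩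
  have haI : a ∈ Ico a (a + δ) := ⟨le_rfl, by linarith⟩
  have key : ∀ x ∈ Ioo a (a + δ), ∃ T, IsExit h φ ℓ₁ ℓ₂ v R (c x) T := fun x hx =>
    D.exists_isExit_real ha hreal (hsub x (Ioo_subset_Ico_self hx)) hx.1
      (hc x (Ioo_subset_Ico_self hx)).2
  choose! T hT using key
  -- `h` vanishes at `c a` and is nonnegative on its forward orbit.
  have hGa : 0 ≤ lieD V h (c a) := by
    have hd := D.model.hasDerivAt_h D.flow (p := c a) (t := 0)
      (by rw [D.flow.zero]; exact (hc a haI).1)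
    rw [D.flow.zero] at hd
    have h1 : Tendsto (slope (fun t => h (φ t (c a))) 0) (𝓝[>] 0) (𝓝 (lieD V h (c a))) :=
      (hasDerivAt_iff_tendsto_slope.1 hd).mono_left (nhdsWithin_mono _ fun t ht => ht.ne')
    refine ge_of_tendsto h1 (eventually_nhdsWithin_of_forall fun t ht => ?_)
    rw [slope_def_field]
    simp only [D.flow.zero, D.chart.mem a ha, sub_zero]
    exact div_nonneg (hreal t (mem_Ioi.1 ht).le).2 (mem_Ioi.1 ht).le
  have hGpos : ∀ x ∈ Ioo a (a + δ), 0 < lieD V h (c x) := fun x hx =>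
    hGa.trans_lt (D.chart.lie_lt_lie D.model D.small ha (hsub x (Ioo_subset_Ico_self hx)) hx.1
      (hc a haI).1 (hc x (Ioo_subset_Ico_self hx)).1)
  obtain ⟨w, hwv, hw⟩ := exists_unstable_point D.coord D.flow D.lipschitz D.model.near D.small.half
    D.model.zero D.mem (v := v) (by linarith) (by linarith) (by linarith) (by linarith)
  obtain ⟨s1, s2⟩ := abs_le.1 D.mem.1
  obtain ⟨s3, s4⟩ := abs_le.1 D.mem.2
  have hwle : ∀ t ≥ 0, ℓ₁ (φ (-t) w - S) ≤ v - ℓ₁ S ∧ (0 < t → ℓ₁ (φ (-t) w - S) < v - ℓ₁ S) :=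
    fun t ht => by
      have hL : 0 < v - ℓ₁ S := by linarith
      refine ⟨(hw t ht).2.2.trans (mul_le_of_le_one_left hL.le (Real.exp_le_one_iff.2 ?_)),
        fun ht' => (hw t ht).2.2.trans_lt (mul_lt_of_lt_one_left hL (Real.exp_lt_one_iff.2 ?_))⟩
      · have : 0 ≤ α / 2 * t := by positivity
        linarith
      · have : 0 < α / 2 * t := by positivity
        linarith
  have hwbox : ∀ t ≥ 0, φ (-t) w ∈ box ℓ₁ ℓ₂ R := fun t ht => by
    obtain ⟨b1, b2, b3⟩ := hw t ht
    have b4 := (hwle t ht).1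
    rw [map_sub] at b2 b4
    rw [map_sub, map_sub] at b1
    obtain ⟨b5, b6⟩ := abs_le.1 b1
    exact ⟨abs_le.2 ⟨by linarith, by linarith⟩, abs_le.2 ⟨by linarith, by linarith⟩⟩
  have hwtend : Tendsto (fun t => φ (-t) w) atTop (𝓝 S) := by
    have h0 : Tendsto (fun t => Real.exp (-(α / 2 * t)) * (v - ℓ₁ S)) atTop (𝓝 0) := by
      rw [← zero_mul (v - ℓ₁ S)]
      exact (Real.tendsto_exp_neg_atTop_nhds_zero.comp
        (tendsto_id.const_mul_atTop (half_pos hα))).mul_const _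
    have h1 : Tendsto (fun t => ℓ₁ (φ (-t) w - S)) atTop (𝓝 0) :=
      squeeze_zero' ((eventually_ge_atTop 0).mono fun t ht => (hw t ht).2.1.le)
        ((eventually_ge_atTop 0).mono fun t ht => (hw t ht).2.2) h0
    refine D.coord.tendsto_of_abs_le h1 (squeeze_zero_norm' (a := fun t => 1 / 2 *
      ℓ₁ (φ (-t) w - S)) ((eventually_ge_atTop 0).mono fun t ht => (hw t ht).1) ?_)
    simpa only [mul_zero] using h1.const_mul (1 / 2)
  classical
  -- The orbit of `c a` never reaches the section; the value at `a` is read off from the point `w`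
  -- of the unstable manifold.
  set ρ : ℝ → ℝ := fun x => if x = a then -ℓ₂ (w - w₀) else -ℓ₂ (φ (T x) (c x) - w₀) with hρ
  have hρa : ρ a = -ℓ₂ (w - w₀) := by rw [hρ]; simp
  have hρx : ∀ x ∈ Ioo a (a + δ), ρ x = -ℓ₂ (φ (T x) (c x) - w₀) := fun x hx => by
    rw [hρ]; simp [hx.1.ne']
  have hcc : ContinuousAt c a := (D.chart.smooth a ha).continuousAt
  -- The orbit of `c a` remains in the box of radius `v / 8`, so nearby orbits stay before the
  -- section for arbitrarily long.
  have hTlarge : ∀ B : ℝ, ∀ᶠ x in 𝓝[>] a, B ≤ T x := by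
    intro B
    have h1 : ∀ᶠ x in 𝓝 a, ∀ t ∈ Icc 0 B, ℓ₁ (φ t (c x)) < v :=
      eventually_forall_of_isCompact isCompact_Icc fun t ht => by
        have h2 : Tendsto (fun q : ℝ × ℝ => ℓ₁ (φ q.2 (c q.1))) (𝓝 a ×ˢ 𝓝 t)
            (𝓝 (ℓ₁ (φ t (c a)))) :=
          ((ℓ₁.continuous.comp (D.flow.continuous D.lipschitz)).tendsto (t, c a)).comp
            (tendsto_snd.prodMk_nhds (hcc.tendsto.comp tendsto_fst))
        exact h2.eventually_lt_const (by linarith [(abs_le.1 (hreal t ht.1).1.1).2])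
    filter_upwards [h1.filter_mono nhdsWithin_le_nhds,
      Ioo_mem_nhdsGT (by linarith : a < a + δ)] with x hx hxI
    by_contra hcon
    push Not at hcon
    have := hx (T x) ⟨(hT x hxI).pos.le, hcon.le⟩
    rw [(hT x hxI).hit] at this
    exact lt_irrefl _ this
  -- The exit point and `w` lie on the same section with backward orbits in the box for a time `B`,
  -- so they differ by at most `2 R exp (-β B / 2)`.
  have hρc : ContinuousWithinAt ρ (Ioi a) a := by
    rw [ContinuousWithinAt, Metric.tendsto_nhds]
    intro ε hε
    have h1 : Tendsto (fun B => Real.exp (β / 2 * B) * ε) atTop atTop :=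
      (Real.tendsto_exp_atTop.comp (tendsto_id.const_mul_atTop (half_pos hβ))).atTop_mul_const hε
    obtain ⟨B, hB, hB'⟩ := ((eventually_ge_atTop 0).and (h1.eventually_gt_atTop (2 * R))).exists
    filter_upwards [hTlarge B, Ioo_mem_nhdsGT (by linarith : a < a + δ)] with x hx hxI
    have h2 := section_dist_le D.flow D.lipschitz D.model.near D.small.half' hB
      (p := φ (T x) (c x)) (q := w) (fun t ht => by
        rw [← D.flow.add D.lipschitz]
        exact (hT x hxI).box _ ⟨by linarith [ht.2], by linarith [ht.1]⟩)
      (fun t ht => hwbox t ht.1) ((hT x hxI).hit.trans hwv.symm)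
    rw [hρx x hxI, hρa, Real.dist_eq]
    have h3 : -ℓ₂ (φ (T x) (c x) - w₀) - -ℓ₂ (w - w₀) = -ℓ₂ (φ (T x) (c x) - w) := by
      simp only [map_sub]; ring
    rw [h3, abs_neg]
    exact lt_of_mul_lt_mul_left (h2.trans_lt hB') (Real.exp_pos _).le
  have hwsec : w = w₀ - ρ a • e₂ := by
    refine D.coord.ext ?_ ?_
    · rw [map_sub, map_smul, D.coord.l12, hw₀, hwv]; simp
    · rw [map_sub, map_smul, D.coord.l22, hρa]; simp
  obtain ⟨δ', h1, h2, h3⟩ := D.transition_of_continuousWithinAt hw₀ ha.1 hδ hδb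
    (fun x hx => (hc x (Ioo_subset_Ico_self hx)).1) hGpos hT hρx hρc (η := η)
    (by rw [hρa, abs_neg]; exact hloc w hwv fun t ht => hwbox t ht.1)
  have hsub' : ∀ x ∈ Ioo a (a + δ'), x ∈ Ioo a (a + δ) := fun x hx =>
    ⟨hx.1, hx.2.trans_le (by linarith)⟩
  refine ⟨δ', h1, h2, T, ρ, h3, fun x hx => ⟨hT x (hsub' x hx), ?_⟩,
    fun x hx => hGpos x (hsub' x hx), ?_, ?_⟩
  · refine D.coord.ext ?_ ?_
    · rw [(hT x (hsub' x hx)).hit, map_sub, map_smul, D.coord.l12, hw₀]; simp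
    · rw [map_sub, map_smul, D.coord.l22, hρx x (hsub' x hx)]; simp
  · rw [← hwsec]
    intro t ht
    refine ⟨hwbox t ht, D.model.h_pos_of_unstable D.small hS (hwbox t ht) (hw t ht).2.1
      (hw t ht).1, fun ht' => ?_⟩
    have := (hwle t ht).2 ht'
    rw [map_sub] at this
    linarith
  · rw [← hwsec]; exact hwtend

end TransitionSetup

end Transition

/-! ### Transits under perturbation of the field and of the starting point. -/

section TransitFamily

variable {r : ℕ∞}

/-- Data of a transit along the flow of the field `V`, starting at the points of the curve `s` and
ending at the points of the curve `e`, with transition map `ρ`. -/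
structure IsTransitMap (V : Plane → Plane) (φ : ℝ → Plane → Plane) (g : Plane → ℝ)
    (s e : ℝ → Plane) (R : ℝ) (N : Set ℝ) (r : ℕ∞) (ρ τ : ℝ → ℝ) (u : ℝ) : Prop where
  smooth : ContDiffAt ℝ r ρ u
  pos : 0 < τ u
  eq : φ (τ u) (s u) = e (ρ u)
  mem : ρ u ∈ N
  region : ∀ t ∈ Ioo 0 (τ u), 0 < g (φ t (s u))
  norm_lt : ∀ t ∈ Icc 0 (τ u), ‖φ t (s u)‖ < R
  orient : ∃ J > 0, deriv ρ u * det2 (V (e (ρ u))) (deriv e (ρ u)) = J * det2 (V (s u)) (deriv s u)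
  lie_neg : lieD V g (e (ρ u)) < 0

-- Field and starting parameter are perturbed together: `exists_first_zero` is applied with the pair
-- `(X, u)` as index. Thus `η₀` depends on `X₀` only. The transition map is the coordinate `W` of
-- the arrival point.
set_option maxHeartbeats 1000000 in
theorem exists_transit_family (hr : 1 ≤ r) {R : ℝ} {X₀ : VField r} {g : Plane → ℝ}
    (hg : ContDiff ℝ ∞ g) {s e : ℝ → Plane} (hs : ∀ᶠ u in 𝓝 0, ContDiffAt ℝ ∞ s u) {T₀ : ℝ}
    (hT₀ : 0 < T₀) {Q : Plane} (hQ : cutFlow R X₀ T₀ (s 0) = Q) (hQ0 : g Q = 0)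
    (hQ' : lieD (cutoff R X₀) g Q < 0)
    (hpos : ∀ t ∈ Ioo 0 T₀, 0 < g (cutFlow R X₀ t (s 0)))
    (hR : ∀ t ∈ Icc 0 T₀, ‖cutFlow R X₀ t (s 0)‖ < R)
    (hstart : 0 < g (s 0) ∨ 0 < lieD (cutoff R X₀) g (s 0) ∧ ∀ᶠ u in 𝓝 0, g (s u) = 0)
    {W : Plane → ℝ} (hWQ : W Q = 0)
    (hW : ∀ᶠ q in 𝓝 Q, ContDiffAt ℝ ∞ W q ∧ (g q = 0 → e (W q) = q))
    (he : ∀ᶠ x in 𝓝 0, DifferentiableAt ℝ e x) {N : Set ℝ} (hN : N ∈ 𝓝 0) :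
    ∃ η₀ > 0, ∀ᶠ X : VField r in 𝓝 X₀, ∃ ρ τ : ℝ → ℝ, ∀ u ∈ Ioo (-η₀) η₀,
      IsTransitMap (cutoff R X) (cutFlow R X) g s e R N r ρ τ u := by
  have hr0 : (r : WithTop ℕ∞) ≠ 0 := by simpa using (one_pos.trans_le hr).ne'
  have hgd : ∀ p, HasFDerivAt g (fderiv ℝ g p) p := fun p =>
    (hg.differentiable (by simp) p).hasFDerivAt
  have hgdc : Continuous (fderiv ℝ g) := hg.continuous_fderiv (by simp)
  set l : Filter (VField r × ℝ) := 𝓝 X₀ ×ˢ 𝓝 0 with hl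
  have hsc : ContinuousAt s 0 := hs.self_of_nhds.continuousAt
  have hflow : ∀ t, Tendsto (fun q : (VField r × ℝ) × ℝ => cutFlow R q.1.1 q.2 (s q.1.2))
      (l ×ˢ 𝓝 t) (𝓝 (cutFlow R X₀ t (s 0))) := fun t => by
    have h0 : Tendsto (fun q : VField r × ℝ × Plane => cutFlow R q.1 q.2.1 q.2.2)
        (𝓝 (X₀, t, s 0)) (𝓝 (cutFlow R X₀ t (s 0))) :=
      (VField.continuous_cutFlow hr R).tendsto (X₀, t, s 0)
    have h1 : Tendsto (fun q : (VField r × ℝ) × ℝ => q.1.1) (l ×ˢ 𝓝 t) (𝓝 X₀) :=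
      tendsto_fst.comp tendsto_fst
    have h2 : Tendsto (fun q : (VField r × ℝ) × ℝ => s q.1.2) (l ×ˢ 𝓝 t) (𝓝 (s 0)) :=
      hsc.tendsto.comp (tendsto_snd.comp tendsto_fst)
    exact h0.comp (h1.prodMk_nhds (tendsto_snd.prodMk_nhds h2))
  have hlie : Continuous fun q : VField r × Plane => lieD (cutoff R q.1) g q.2 :=
    (hgdc.comp continuous_snd).clm_apply (VField.continuous_cutoff R)
  have hflow' : ∀ t, Tendsto (fun q : (VField r × ℝ) × ℝ =>
      lieD (cutoff R q.1.1) g (cutFlow R q.1.1 q.2 (s q.1.2)))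
      (l ×ˢ 𝓝 t) (𝓝 (lieD (cutoff R X₀) g (cutFlow R X₀ t (s 0)))) := fun t => by
    have h0 : Tendsto (fun q : VField r × Plane => lieD (cutoff R q.1) g q.2)
        (𝓝 (X₀, cutFlow R X₀ t (s 0))) (𝓝 (lieD (cutoff R X₀) g (cutFlow R X₀ t (s 0)))) :=
      hlie.tendsto (X₀, cutFlow R X₀ t (s 0))
    have h1 : Tendsto (fun q : (VField r × ℝ) × ℝ => q.1.1) (l ×ˢ 𝓝 t) (𝓝 X₀) :=
      tendsto_fst.comp tendsto_fst
    exact h0.comp (h1.prodMk_nhds (hflow t))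
  have hder : ∀ (X : VField r) p t, HasDerivAt (fun t => g (cutFlow R X t p))
      (lieD (cutoff R X) g (cutFlow R X t p)) t := fun X p t =>
    (hgd _).comp_hasDerivAt t ((isGlobalFlow_cutFlow hr R X).hasDerivAt p t)
  have hφ₀ := isGlobalFlow_cutFlow hr R X₀
  have hWc : ContinuousAt W Q := hW.self_of_nhds.1.continuousAt
  have hgood : ∀ᶠ q in 𝓝 Q, (ContDiffAt ℝ ∞ W q ∧ (g q = 0 → e (W q) = q)) ∧ W q ∈ N ∧
      DifferentiableAt ℝ e (W q) ∧ ‖q‖ < R := by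
    refine hW.and (((hWc.tendsto.eventually (by rwa [hWQ])).and
      ((hWc.tendsto.eventually (by rwa [hWQ])).and ?_)))
    have := hR T₀ ⟨hT₀.le, le_rfl⟩
    rw [hQ] at this
    exact continuous_norm.continuousAt.eventually_lt_const this
  have hnear := (hflow T₀).eventually (by rw [hQ]; exact hgood)
  obtain ⟨pa, hpa, pb, hpb, hab⟩ := eventually_prod_iff.1 hnear
  obtain ⟨θ₀, hθ₀, hθ⟩ := Metric.eventually_nhds_iff.1 hpb
  obtain ⟨θ, hθpos, hθ1, hθ2, hev⟩ := exists_first_zero (l := l) (T₀ := T₀)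
    (f := fun i t => g (cutFlow R i.1 t (s i.2)))
    (f' := fun i t => lieD (cutoff R i.1) g (cutFlow R i.1 t (s i.2)))
    (g := fun t => g (cutFlow R X₀ t (s 0)))
    (g' := fun t => lieD (cutoff R X₀) g (cutFlow R X₀ t (s 0))) hT₀
    (fun i t => hder i.1 (s i.2) t) (fun t => hder X₀ (s 0) t)
    (fun t => (hg.continuous.tendsto _).comp (hflow t)) hflow'
    (hlie.comp (continuous_const.prodMk (hφ₀.continuous_time _))) hpos (by rw [hQ, hQ0])
    (by rw [hQ]; exact hQ') (by
      rcases hstart with h1 | ⟨h1, h2⟩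
      · left; rwa [hφ₀.zero]
      · refine Or.inr ⟨by rw [hφ₀.zero]; exact h2.self_of_nhds, by rwa [hφ₀.zero], ?_⟩
        filter_upwards [tendsto_snd.eventually h2] with i hi
        rwa [(isGlobalFlow_cutFlow hr R i.1).zero]) (half_pos hθ₀)
  have hnorm : ∀ᶠ i in l, ∀ t ∈ Icc 0 T₀, ‖cutFlow R i.1 t (s i.2)‖ < R :=
    eventually_forall_of_isCompact isCompact_Icc fun t ht =>
      (hflow t).norm.eventually_lt_const (hR t ht)
  have hall := (hev.and (hnorm.and hpa)).and (tendsto_snd.eventually hs)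
  obtain ⟨qa, hqa, qb, hqb, hqab⟩ := eventually_prod_iff.1 hall
  obtain ⟨η₀, hη₀, hη⟩ := Metric.eventually_nhds_iff.1 hqb
  refine ⟨η₀, hη₀, hqa.mono fun X hX => ?_⟩
  have hφ := isGlobalFlow_cutFlow hr R X
  obtain ⟨K, hK⟩ := exists_lipschitzWith_cutoff hr R X
  have hV := contDiff_cutoff R X
  have hmem : ∀ u ∈ Ioo (-η₀) η₀, qb u := fun u hu => hη (by
    rw [Real.dist_eq, abs_lt]; exact ⟨by linarith [hu.1], by linarith [hu.2]⟩)
  have hex : ∀ u ∈ Ioo (-η₀) η₀, ∃ τ ∈ Ioo (T₀ - θ) (T₀ + θ), g (cutFlow R X τ (s u)) = 0 ∧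
      ∀ t ∈ Ioo 0 τ, 0 < g (cutFlow R X t (s u)) := fun u hu => (hqab hX (hmem u hu)).1.1.2
  choose! τ hτ hτ0 hτpos using hex
  have hmemθ : ∀ t ∈ Icc (T₀ - θ) (T₀ + θ), pb t := fun t ht => hθ (by
    rw [Real.dist_eq, abs_lt]; constructor <;> linarith [ht.1, ht.2])
  have hgoodu : ∀ u ∈ Ioo (-η₀) η₀, ∀ t ∈ Icc (T₀ - θ) (T₀ + θ), _ := fun u hu t ht =>
    hab (hqab hX (hmem u hu)).1.2.2 (hmemθ t ht)
  have hsmooth : ∀ u ∈ Ioo (-η₀) η₀, ContDiffAt ℝ r s u := fun u hu =>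
    (hqab hX (hmem u hu)).2.of_le (by exact_mod_cast le_top)
  have hτs : ∀ u ∈ Ioo (-η₀) η₀, ContDiffAt ℝ r τ u := fun u hu => by
    refine hφ.contDiffAt_transit_time hK hr hV (hg.of_le (by exact_mod_cast le_top)) (hsmooth u hu)
      (a := T₀ - θ) (b := T₀ + θ) ?_ ?_ ?_
    · filter_upwards [isOpen_Ioo.mem_nhds hu] with w hw using ⟨hτ w hw, hτ0 w hw⟩
    · filter_upwards [isOpen_Ioo.mem_nhds hu] with w hw
      have hanti : StrictAntiOn (fun t => g (cutFlow R X t (s w))) (Icc (T₀ - θ) (T₀ + θ)) :=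
        strictAntiOn_of_hasDerivWithinAt_neg (convex_Icc _ _)
          (fun t _ => (hder X (s w) t).continuousAt.continuousWithinAt)
          (fun t _ => (hder X (s w) t).hasDerivWithinAt)
          (fun t ht => (hqab hX (hmem w hw)).1.1.1 t (interior_subset ht))
      exact hanti.injOn.mono Ioo_subset_Icc_self
    · exact ((hqab hX (hmem u hu)).1.1.1 _ (Ioo_subset_Icc_self (hτ u hu))).ne
  set ρ : ℝ → ℝ := fun u => W (cutFlow R X (τ u) (s u)) with hρ
  have heq : ∀ u ∈ Ioo (-η₀) η₀, cutFlow R X (τ u) (s u) = e (ρ u) := fun u hu =>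
    ((hgoodu u hu _ (Ioo_subset_Icc_self (hτ u hu))).1.2 (hτ0 u hu)).symm
  have hρs : ∀ u ∈ Ioo (-η₀) η₀, ContDiffAt ℝ r ρ u := fun u hu =>
    ContDiffAt.comp u ((hgoodu u hu _ (Ioo_subset_Icc_self (hτ u hu))).1.1.of_le
      (by exact_mod_cast le_top))
      ((hφ.contDiff hK hr hV).contDiffAt.comp u ((hτs u hu).prodMk (hsmooth u hu)))
  refine ⟨ρ, τ, fun u hu => ⟨hρs u hu, by linarith [(hτ u hu).1], heq u hu,
    (hgoodu u hu _ (Ioo_subset_Icc_self (hτ u hu))).2.1, hτpos u hu, fun t ht => ?_, ?_, ?_⟩⟩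
  · rcases le_total t (T₀ - θ) with h1 | h1
    · exact (hqab hX (hmem u hu)).1.2.1 t ⟨ht.1, by linarith⟩
    · exact (hgoodu u hu t ⟨h1, ht.2.trans (hτ u hu).2.le⟩).2.2.2
  · exact hφ.exists_det_transit hK hr hV ((hsmooth u hu).differentiableAt hr0)
      ((hτs u hu).differentiableAt hr0) ((hρs u hu).differentiableAt hr0)
      (hgoodu u hu _ (Ioo_subset_Icc_self (hτ u hu))).2.2.1
      (eventually_of_mem (isOpen_Ioo.mem_nhds hu) heq)
  · rw [← heq u hu]
    exact (hqab hX (hmem u hu)).1.1.1 _ (Ioo_subset_Icc_self (hτ u hu))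

end TransitFamily

/-! ### Integral curves as orbits of cut off flows. -/

section Curves

variable {V : Plane → Plane} {X : Plane → Plane} {φ : ℝ → Plane → Plane} {K : NNReal} {R : ℝ}

theorem IsGlobalFlow.isIntegralCurveOn (hφ : IsGlobalFlow (cutoff R X) φ) {p : Plane} {s : Set ℝ}
    (hs : ∀ t ∈ s, ‖φ t p‖ ≤ R) : IsIntegralCurveOn (fun t => φ t p) (fun _ => X) s := by
  intro t ht
  have := (hφ.hasDerivAt p t).hasDerivWithinAt (s := s)
  rwa [cutoff_eq X (hs t ht)] at this

theorem IsGlobalFlow.isTransit (hφ : IsGlobalFlow (cutoff R X) φ) {p q : Plane} {D : Set Plane}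
    {T : ℝ} (hT : 0 < T) (hs : ∀ t ∈ Icc 0 T, ‖φ t p‖ ≤ R) (hq : φ T p = q)
    (hD : ∀ t ∈ Ioo 0 T, φ t p ∈ D) : IsTransit X D p q :=
  ⟨T, hT, fun t => φ t p, hφ.isIntegralCurveOn hs, hφ.zero p, hq, hD⟩

theorem IsGlobalFlow.goesTo (hφ : IsGlobalFlow (cutoff R X) φ) {p S : Plane} {D : Set Plane}
    (hs : ∀ t ≥ 0, ‖φ t p‖ ≤ R) (hS : Tendsto (fun t => φ t p) atTop (𝓝 S))
    (hD : ∀ t > 0, φ t p ∈ D) : GoesTo X D S p :=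
  ⟨fun t => φ t p, hφ.isIntegralCurveOn hs, hφ.zero p, hD, hS⟩

theorem IsGlobalFlow.comesFrom (hφ : IsGlobalFlow (cutoff R X) φ) {p S : Plane} {D : Set Plane}
    (hs : ∀ t ≥ 0, ‖φ (-t) p‖ ≤ R) (hS : Tendsto (fun t => φ (-t) p) atTop (𝓝 S))
    (hD : ∀ t > 0, φ (-t) p ∈ D) : ComesFrom X D S p := by
  refine ⟨fun t => φ t p, hφ.isIntegralCurveOn fun t ht => ?_, hφ.zero p, fun t ht => ?_, ?_⟩
  · have := hs (-t) (neg_nonneg.2 ht)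
    rwa [neg_neg] at this
  · have := hD (-t) (neg_pos.2 ht)
    rwa [neg_neg] at this
  · have := hS.comp tendsto_neg_atBot_atTop
    simpa [Function.comp_def] using this

/-- A curve that is an integral curve of the cut off field on a half line, as long as it is bounded
by the cut off radius, is an orbit of the flow. -/
theorem IsGlobalFlow.eq_of_isIntegralCurveOn (hφ : IsGlobalFlow (cutoff R X) φ)
    (hK : LipschitzWith K (cutoff R X)) {γ : ℝ → Plane} {T : ℝ}
    (hγ : IsIntegralCurveOn γ (fun _ => X) (Icc 0 T)) (hb : ∀ t ∈ Icc 0 T, ‖γ t‖ ≤ R) :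
    ∀ t ∈ Icc 0 T, γ t = φ t (γ 0) := by
  refine ODE_solution_unique_of_mem_Icc_right (v := fun _ => cutoff R X) (s := fun _ => univ)
    (K := K) (fun t _ => hK.lipschitzOnWith) hγ.continuousOn (fun t ht => ?_) (fun _ _ => trivial)
    (hφ.continuous_time _).continuousOn (fun t ht => (hφ.hasDerivAt _ t).hasDerivWithinAt)
    (fun _ _ => trivial) (hφ.zero _).symm
  have h1 : HasDerivWithinAt γ (X (γ t)) (Icc 0 T) t := hγ t ⟨ht.1, ht.2.le⟩
  rw [← cutoff_eq X (hb t ⟨ht.1, ht.2.le⟩)] at h1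
  exact h1.mono_of_mem_nhdsWithin (mem_of_superset (Icc_mem_nhdsGE ht.2)
    (Icc_subset_Icc_left ht.1))

/-- A transit is a compact arc, unaffected by any cutoff beyond its bound. Having this for all `R ≥
B` allows two transits to be compared within one flow. -/
theorem IsTransit.exists_flow {r : ℕ∞} (hr : 1 ≤ r) {X : VField r} {D : Set Plane} {p q : Plane}
    (h : IsTransit X D p q) : ∃ B T : ℝ, 0 < T ∧ ∀ R ≥ B, (∀ t ∈ Icc 0 T, ‖cutFlow R X t p‖ ≤ B) ∧
      cutFlow R X T p = q ∧ ∀ t ∈ Ioo 0 T, cutFlow R X t p ∈ D := by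
  obtain ⟨T, hT, γ, h1, h2, h3, h4⟩ := h
  obtain ⟨B, hB⟩ := (isCompact_Icc.image_of_continuousOn h1.continuousOn).isBounded.exists_norm_le
  refine ⟨B, T, hT, fun R hR => ?_⟩
  obtain ⟨K, hK⟩ := exists_lipschitzWith_cutoff hr R X
  have e1 := (isGlobalFlow_cutFlow hr R X).eq_of_isIntegralCurveOn hK h1 fun t ht =>
    (hB _ (mem_image_of_mem _ ht)).trans hR
  rw [h2] at e1
  refine ⟨fun t ht => ?_, ?_, fun t ht => ?_⟩
  · rw [← e1 t ht]; exact hB _ (mem_image_of_mem _ ht)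
  · rw [← e1 T ⟨hT.le, le_rfl⟩, h3]
  · rw [← e1 t (Ioo_subset_Icc_self ht)]; exact h4 t ht

/-- The curve is bounded because it converges at `-∞`; each finite backward piece is then compared
with the flow by uniqueness. -/
theorem ComesFrom.exists_flow {r : ℕ∞} (hr : 1 ≤ r) {X : VField r} {D : Set Plane} {S p : Plane}
    (h : ComesFrom X D S p) : ∃ B : ℝ, ∀ R ≥ B, (∀ t ≥ 0, ‖cutFlow R X (-t) p‖ ≤ B) ∧
      (∀ t > 0, cutFlow R X (-t) p ∈ D) ∧ Tendsto (fun t => cutFlow R X (-t) p) atTop (𝓝 S) := by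
  obtain ⟨γ, h1, h2, h3, h4⟩ := h
  obtain ⟨A, hA⟩ := eventually_atBot.1 (h4.norm.eventually_le_const (lt_add_one ‖S‖))
  obtain ⟨B, hB⟩ := ((isCompact_Icc (a := A) (b := 0)).image_of_continuousOn
    (h1.continuousOn.mono Icc_subset_Iic_self)).isBounded.exists_norm_le
  have b1 : ∀ t ≤ 0, ‖γ t‖ ≤ max B (‖S‖ + 1) := fun t ht => by
    rcases le_total t A with h | h
    · exact (hA t h).trans (le_max_right _ _)
    · exact (hB _ (mem_image_of_mem _ ⟨h, ht⟩)).trans (le_max_left _ _)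
  refine ⟨max B (‖S‖ + 1), fun R hR => ?_⟩
  have hφ := isGlobalFlow_cutFlow hr R X
  obtain ⟨K, hK⟩ := exists_lipschitzWith_cutoff hr R X
  have e1 : ∀ t ≥ 0, cutFlow R X (-t) p = γ (-t) := fun t ht => by
    have hsh : IsIntegralCurveOn (fun s => γ (s + -t)) (fun _ => X) (Icc 0 t) := fun s hs => by
      have h5 := h1 (s + -t) (by simpa using hs.2)
      have h6 := HasDerivWithinAt.scomp (h := fun s => s + -t) (s := Icc 0 t) s h5
        ((hasDerivAt_id s).add_const (-t)).hasDerivWithinAt (fun s hs => by simpa using hs.2)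
      simpa [Function.comp_def] using h6
    have h7 := hφ.eq_of_isIntegralCurveOn hK hsh
      (fun s hs => (b1 _ (by linarith [hs.2])).trans hR) t ⟨ht, le_rfl⟩
    simp only [add_neg_cancel, zero_add, h2] at h7
    rw [h7, hφ.neg_cancel hK]
  refine ⟨fun t ht => ?_, fun t ht => ?_, ?_⟩
  · rw [e1 t ht]; exact b1 _ (by linarith)
  · rw [e1 t (le_of_lt ht)]; exact h3 _ (by linarith)
  · exact (h4.comp tendsto_neg_atTop_atBot).congr'
      ((eventually_ge_atTop 0).mono fun t ht => (e1 t ht).symm)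

/-- The end point of a transit is unique, provided that it does not belong to the region. -/
theorem IsTransit.end_unique {r : ℕ∞} (hr : 1 ≤ r) {X : VField r} {D : Set Plane} {p q q' : Plane}
    (h : IsTransit X D p q) (h' : IsTransit X D p q') (hq : q ∉ D) (hq' : q' ∉ D) : q = q' := by
  obtain ⟨B, T, hT, hB⟩ := h.exists_flow hr
  obtain ⟨B', T', hT', hB'⟩ := h'.exists_flow hr
  obtain ⟨-, h2, h3⟩ := hB (max B B') (le_max_left _ _)
  obtain ⟨-, h2', h3'⟩ := hB' (max B B') (le_max_right _ _)
  rcases lt_trichotomy T T' with h | h | h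
  · exact absurd (h2 ▸ h3' T ⟨hT, h⟩) hq
  · rw [← h2, ← h2', h]
  · exact absurd (h2' ▸ h3 T' ⟨hT', h⟩) hq'

/-- Transits can be concatenated. -/
theorem IsTransit.trans {r : ℕ∞} (hr : 1 ≤ r) {X : VField r} {D : Set Plane} {p q q' : Plane}
    (h : IsTransit X D p q) (h' : IsTransit X D q q') (hq : q ∈ D) : IsTransit X D p q' := by
  obtain ⟨B, T, hT, hB⟩ := h.exists_flow hr
  obtain ⟨B', T', hT', hB'⟩ := h'.exists_flow hr
  obtain ⟨h1, h2, h3⟩ := hB (max B B') (le_max_left _ _)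
  obtain ⟨h1', h2', h3'⟩ := hB' (max B B') (le_max_right _ _)
  have hφ := isGlobalFlow_cutFlow hr (max B B') X
  obtain ⟨K, hK⟩ := exists_lipschitzWith_cutoff hr (max B B') X
  have e : ∀ t, cutFlow (max B B') X t p = cutFlow (max B B') X (t - T) q := fun t => by
    rw [← h2, ← hφ.add hK, sub_add_cancel]
  refine hφ.isTransit (T := T + T') (by linarith) (fun t ht => ?_) ?_ fun t ht => ?_
  · rcases le_total t T with h | h
    · exact (h1 t ⟨ht.1, h⟩).trans (le_max_left _ _)
    · rw [e]; exact (h1' _ ⟨by linarith, by linarith [ht.2]⟩).trans (le_max_right _ _)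
  · rw [e, add_sub_cancel_left, h2']
  · rcases lt_trichotomy t T with h | h | h
    · exact h3 t ⟨ht.1, h⟩
    · rw [h, h2]; exact hq
    · rw [e]; exact h3' _ ⟨by linarith, by linarith [ht.2]⟩

theorem IsTransit.mono {X : Plane → Plane} {D D' : Set Plane} {p q : Plane}
    (h : IsTransit X D p q) (hD : D ⊆ D') : IsTransit X D' p q := by
  obtain ⟨T, hT, γ, h1, h2, h3, h4⟩ := h
  exact ⟨T, hT, γ, h1, h2, h3, fun t ht => hD (h4 t ht)⟩

theorem ComesFrom.mono {X : Plane → Plane} {D D' : Set Plane} {S p : Plane}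
    (h : ComesFrom X D S p) (hD : D ⊆ D') : ComesFrom X D' S p := by
  obtain ⟨γ, h1, h2, h3, h4⟩ := h
  exact ⟨γ, h1, h2, fun t ht => hD (h3 t ht), h4⟩

theorem GoesTo.mono {X : Plane → Plane} {D D' : Set Plane} {S p : Plane}
    (h : GoesTo X D S p) (hD : D ⊆ D') : GoesTo X D' S p := by
  obtain ⟨γ, h1, h2, h3, h4⟩ := h
  exact ⟨γ, h1, h2, fun t ht => hD (h3 t ht), h4⟩

/-- An orbit that comes from an equilibrium can be continued by a transit. -/
theorem ComesFrom.trans {r : ℕ∞} (hr : 1 ≤ r) {X : VField r} {D : Set Plane} {S p q : Plane}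
    (h : ComesFrom X D S p) (h' : IsTransit X D p q) (hp : p ∈ D) : ComesFrom X D S q := by
  obtain ⟨B, hB⟩ := h.exists_flow hr
  obtain ⟨B', T', hT', hB'⟩ := h'.exists_flow hr
  obtain ⟨h1, h2, h3⟩ := hB (max B B') (le_max_left _ _)
  obtain ⟨h1', h2', h3'⟩ := hB' (max B B') (le_max_right _ _)
  have hφ := isGlobalFlow_cutFlow hr (max B B') X
  obtain ⟨K, hK⟩ := exists_lipschitzWith_cutoff hr (max B B') X
  have e : ∀ t, cutFlow (max B B') X (-t) q = cutFlow (max B B') X (T' - t) p := fun t => by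
    rw [← h2', ← hφ.add hK, neg_add_eq_sub]
  have e' : ∀ t, cutFlow (max B B') X (-t) q = cutFlow (max B B') X (-(t - T')) p := fun t => by
    rw [e, neg_sub]
  refine hφ.comesFrom (fun t ht => ?_) ?_ fun t ht => ?_
  · rcases le_total t T' with h | h
    · rw [e]; exact (h1' _ ⟨by linarith, by linarith⟩).trans (le_max_right _ _)
    · rw [e']; exact (h1 _ (by linarith)).trans (le_max_left _ _)
  · simp only [e']
    exact h3.comp (tendsto_atTop_add_const_right _ (-T') tendsto_id)
  · rcases lt_trichotomy t T' with h | h | h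
    · rw [e]; exact h3' _ ⟨by linarith, by linarith⟩
    · rw [e, h, sub_self, hφ.zero]; exact hp
    · rw [e']; exact h2 _ (by linarith)

end Curves

/-! ### Eigencoordinates of the saddle. -/

section NormalForm

variable {ℓ₁ ℓ₂ : Plane →L[ℝ] ℝ} {e₁ e₂ : Plane} {α β : ℝ}

theorem exists_isCoord {a b : Plane} (hab : det2 a b ≠ 0) :
    ∃ ℓ₁ ℓ₂ : Plane →L[ℝ] ℝ, IsCoord ℓ₁ ℓ₂ a b := by
  obtain ⟨L, hL⟩ := exists_basis_equiv hab
  have ha : L.symm a = (1, 0) := by rw [L.symm_apply_eq, hL]; simp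
  have hb : L.symm b = (0, 1) := by rw [L.symm_apply_eq, hL]; simp
  refine ⟨(ContinuousLinearMap.fst ℝ ℝ ℝ).comp (L.symm : Plane →L[ℝ] ℝ × ℝ),
    (ContinuousLinearMap.snd ℝ ℝ ℝ).comp (L.symm : Plane →L[ℝ] ℝ × ℝ), ?_, ?_, ?_, ?_, fun p => ?_⟩
  · simp [ha]
  · simp [hb]
  · simp [ha]
  · simp [hb]
  · have := hL (L.symm p)
    rw [L.apply_symm_apply] at this
    exact this

theorem det2_ne_zero_of_eigenvectors {A : Plane →L[ℝ] Plane} {a b : Plane} {s t : ℝ} (hst : s ≠ t)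
    (ha0 : a ≠ 0) (hb0 : b ≠ 0) (ha : A a = s • a) (hb : A b = t • b) : det2 a b ≠ 0 := by
  intro h
  have key : ∀ i, a i • b = b i • a := fun i => by
    have h' : a 0 * b 1 - a 1 * b 0 = 0 := h
    ext j
    fin_cases i <;> fin_cases j <;> simp <;> linarith
  refine ha0 ?_
  ext i
  have h1 : A (a i • b) = A (b i • a) := by rw [key]
  rw [map_smul, map_smul, ha, hb, smul_comm, smul_comm _ s, ← key i, ← sub_eq_zero, ← sub_smul,
    smul_smul, smul_eq_zero] at h1
  rcases h1 with h1 | h1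
  · rcases mul_eq_zero.1 h1 with h2 | h2
    · exact absurd (by linarith) hst
    · simpa using h2
  · exact absurd h1 hb0

theorem IsCoord.norm_le (h : IsCoord ℓ₁ ℓ₂ e₁ e₂) (w : Plane) :
    ‖w‖ ≤ (‖e₁‖ + ‖e₂‖) * (|ℓ₁ w| + |ℓ₂ w|) := by
  conv_lhs => rw [h.decomp w]
  refine (norm_add_le _ _).trans ?_
  rw [norm_smul, norm_smul, Real.norm_eq_abs, Real.norm_eq_abs]
  nlinarith [mul_nonneg (norm_nonneg e₁) (abs_nonneg (ℓ₂ w)),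
    mul_nonneg (norm_nonneg e₂) (abs_nonneg (ℓ₁ w))]

theorem IsCoord.exists_box_subset (h : IsCoord ℓ₁ ℓ₂ e₁ e₂) {U : Set Plane} (hU : U ∈ 𝓝 0) :
    ∃ R > 0, box ℓ₁ ℓ₂ R ⊆ U := by
  obtain ⟨ε, hε, hεU⟩ := Metric.mem_nhds_iff.1 hU
  set C := ‖e₁‖ + ‖e₂‖ with hC
  have hC0 : 0 ≤ C := by positivity
  refine ⟨ε / (2 * C + 1), by positivity, fun p hp => hεU ?_⟩
  rw [mem_ball_zero_iff]
  refine (h.norm_le p).trans_lt ?_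
  calc C * (|ℓ₁ p| + |ℓ₂ p|) ≤ C * (ε / (2 * C + 1) + ε / (2 * C + 1)) := by
        gcongr
        · exact hp.1
        · exact hp.2
    _ = ε * (2 * C / (2 * C + 1)) := by ring
    _ < ε * 1 := by
        gcongr
        rw [div_lt_one (by positivity)]; linarith
    _ = ε := mul_one ε

theorem IsCoord.eventually_abs_le (h : IsCoord ℓ₁ ℓ₂ e₁ e₂) {ι : Type*} {l : Filter ι}
    {L : ι → Plane →L[ℝ] ℝ} {L₀ : Plane →L[ℝ] ℝ} (hL : Tendsto L l (𝓝 L₀)) {κ : ℝ} (hκ : 0 < κ) :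
    ∀ᶠ i in l, ∀ w, |L i w - L₀ w| ≤ κ * (|ℓ₁ w| + |ℓ₂ w|) := by
  set C := ‖e₁‖ + ‖e₂‖ with hC
  have hC0 : 0 ≤ C := by positivity
  filter_upwards [Metric.tendsto_nhds.1 hL (κ / (C + 1)) (by positivity)] with i hi w
  rw [dist_eq_norm] at hi
  calc |L i w - L₀ w| = ‖(L i - L₀) w‖ := by simp
    _ ≤ ‖L i - L₀‖ * ‖w‖ := ContinuousLinearMap.le_opNorm _ _
    _ ≤ κ / (C + 1) * (C * (|ℓ₁ w| + |ℓ₂ w|)) := by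
        gcongr
        exact h.norm_le w
    _ = κ * (C / (C + 1)) * (|ℓ₁ w| + |ℓ₂ w|) := by ring
    _ ≤ κ * 1 * (|ℓ₁ w| + |ℓ₂ w|) := by
        gcongr
        rw [div_le_one (by positivity)]; linarith
    _ = _ := by ring

/-- `A` is diagonal in the coordinates `ℓ₁, ℓ₂`, with eigenvalues `α` and `-β`. -/
def IsDiagonal (A : Plane →L[ℝ] Plane) (ℓ₁ ℓ₂ : Plane →L[ℝ] ℝ) (α β : ℝ) : Prop :=
  ∀ w, ℓ₁ (A w) = α * ℓ₁ w ∧ ℓ₂ (A w) = -β * ℓ₂ w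

/-- The derivative `A` of a field at a point differs little from a linear saddle. -/
def IsAlmostDiagonal (A : Plane →L[ℝ] Plane) (ℓ₁ ℓ₂ : Plane →L[ℝ] ℝ) (α β κ : ℝ) : Prop :=
  ∀ w, |ℓ₁ (A w) - α * ℓ₁ w| ≤ κ * (|ℓ₁ w| + |ℓ₂ w|) ∧
    |ℓ₂ (A w) + β * ℓ₂ w| ≤ κ * (|ℓ₁ w| + |ℓ₂ w|)

theorem IsCoord.eventually_isAlmostDiagonal (h : IsCoord ℓ₁ ℓ₂ e₁ e₂) {ι : Type*} {l : Filter ι}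
    {A : ι → Plane →L[ℝ] Plane} {A₀ : Plane →L[ℝ] Plane} (hA : Tendsto A l (𝓝 A₀))
    (hA₀ : IsDiagonal A₀ ℓ₁ ℓ₂ α β) {κ : ℝ} (hκ : 0 < κ) :
    ∀ᶠ i in l, IsAlmostDiagonal (A i) ℓ₁ ℓ₂ α β κ := by
  have h1 : ∀ ℓ : Plane →L[ℝ] ℝ, Tendsto (fun i => ℓ.comp (A i)) l (𝓝 (ℓ.comp A₀)) := fun ℓ =>
    ((ContinuousLinearMap.compL ℝ Plane Plane ℝ ℓ).continuous.tendsto A₀).comp hA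
  filter_upwards [h.eventually_abs_le (h1 ℓ₁) hκ, h.eventually_abs_le (h1 ℓ₂) hκ] with i a1 a2 w
  obtain ⟨b1, b2⟩ := hA₀ w
  refine ⟨by simpa [b1] using a1 w, ?_⟩
  have := a2 w
  simp only [ContinuousLinearMap.comp_apply, b2] at this
  convert this using 2
  ring

theorem nearSaddle_of_fderiv {V : Plane → Plane} {κ R : ℝ}
    (hV : ∀ p ∈ box ℓ₁ ℓ₂ R, DifferentiableAt ℝ V p)
    (hV' : ∀ p ∈ box ℓ₁ ℓ₂ R, IsAlmostDiagonal (fderiv ℝ V p) ℓ₁ ℓ₂ α β κ) :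
    NearSaddle V ℓ₁ ℓ₂ α β κ R := by
  have hd : ∀ (ℓ : Plane →L[ℝ] ℝ), ∀ p ∈ box ℓ₁ ℓ₂ R,
      HasFDerivAt (fun p => ℓ (V p)) (ℓ.comp (fderiv ℝ V p)) p := fun ℓ p hp =>
    ℓ.hasFDerivAt.comp p (hV p hp).hasFDerivAt
  intro p hp q hq
  constructor
  · have := abs_sub_sub_le_of_fderiv (convex_box ℓ₁ ℓ₂ R) (f := fun p => ℓ₁ (V p))
      (fun p hp => (hd ℓ₁ p hp).differentiableAt) (L := fun w => α * ℓ₁ w)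
      (C := fun w => κ * (|ℓ₁ w| + |ℓ₂ w|))
      (fun p hp w => by rw [(hd ℓ₁ p hp).fderiv]; exact (hV' p hp w).1) hp hq
    rwa [← map_sub] at this
  · have := abs_sub_sub_le_of_fderiv (convex_box ℓ₁ ℓ₂ R) (f := fun p => ℓ₂ (V p))
      (fun p hp => (hd ℓ₂ p hp).differentiableAt) (L := fun w => -β * ℓ₂ w)
      (C := fun w => κ * (|ℓ₁ w| + |ℓ₂ w|))
      (fun p hp w => by
        rw [(hd ℓ₂ p hp).fderiv]
        have := (hV' p hp w).2
        simp only [ContinuousLinearMap.comp_apply]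
        rwa [neg_mul, sub_neg_eq_add]) hp hq
    rwa [← map_sub, neg_mul, sub_neg_eq_add] at this

theorem exists_nearSaddle (h : IsCoord ℓ₁ ℓ₂ e₁ e₂) {V : Plane → Plane} (hV : ContDiffAt ℝ 1 V 0)
    (hA : IsDiagonal (fderiv ℝ V 0) ℓ₁ ℓ₂ α β) {κ : ℝ} (hκ : 0 < κ) :
    ∃ R > 0, NearSaddle V ℓ₁ ℓ₂ α β κ R := by
  have h1 : ∀ᶠ p in 𝓝 (0 : Plane), DifferentiableAt ℝ V p :=
    (hV.eventually (by simp)).mono fun p hp => hp.differentiableAt (by simp)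
  have h2 := h.eventually_isAlmostDiagonal (hV.continuousAt_fderiv (by simp)).tendsto hA hκ
  obtain ⟨R, hR, hsub⟩ := h.exists_box_subset (h1.and h2)
  exact ⟨R, hR, nearSaddle_of_fderiv (fun p hp => (hsub hp).1) fun p hp => (hsub hp).2⟩

theorem exists_coneSmall (hα : 0 < α) (hβ : 0 < β) {M : ℝ} (hM : 0 < M) :
    ∃ κ > 0, ConeSmall α β κ M := by
  have lin : ∀ c d : ℝ, 0 < d → ∀ᶠ κ in 𝓝[>] (0 : ℝ), κ * c < d := fun c d hd => by
    have : Continuous fun κ : ℝ => κ * c := by fun_prop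
    exact (this.continuousAt.eventually_lt_const (by simpa using hd)).filter_mono
      nhdsWithin_le_nhds
  obtain ⟨κ, h0, h1, h2, h3⟩ := ((eventually_mem_nhdsWithin (a := (0 : ℝ)) (s := Ioi 0)).and
    ((lin (2 * (M ^ 2 + 1)) (M ^ 2 * α) (by positivity)).and
    ((lin (2 * (M ^ 2 + 1)) β hβ).and (lin (1 + M) (α / 2) (by positivity))))).exists
  exact ⟨κ, h0, hα, hβ, (mem_Ioi.1 h0).le, hM, by linarith, by linarith, by linarith⟩

/-- Existence of an orbit that tends to the saddle in the stable direction. -/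
theorem exists_stable_orbit (h : IsCoord ℓ₁ ℓ₂ e₁ e₂) {V : Plane → Plane}
    {φ : ℝ → Plane → Plane} {K : NNReal} (hφ : IsGlobalFlow V φ) (hK : LipschitzWith K V)
    (hα : 0 < α) (hβ : 0 < β) (hV : ∀ κ > 0, ∃ R > 0, NearSaddle V ℓ₁ ℓ₂ α β κ R) (h0 : V 0 = 0)
    {U : Set Plane} (hU : U ∈ 𝓝 0) :
    ∃ w, (∀ t ≥ 0, φ t w ∈ U) ∧ Tendsto (fun t => φ t w) atTop (𝓝 0) ∧
      Tendsto (fun t => (ℓ₂ (φ t w))⁻¹ • φ t w) atTop (𝓝 e₂) := by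
  obtain ⟨κ, hκ, hs⟩ := exists_smallError hα hβ
  obtain ⟨R, hR, hnear⟩ := hV κ hκ
  obtain ⟨R', hR', hsub⟩ := h.exists_box_subset hU
  set v := min R R' / 2 with hv
  have hv0 : 0 < v := by positivity
  have hvR : v < R := by linarith [min_le_left R R']
  have hvR' : v < R' := by linarith [min_le_right R R']
  obtain ⟨w, -, hw⟩ := exists_unstable_point h.swap hφ.reverse hK.neg hnear.reverse hs.half'
    (S := 0) (by simp [h0]) (v := v) (r := 0) (by simp [box]) hvR (by linarith) hR hv0
  simp only [neg_neg, sub_zero, map_zero] at hw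
  have hle : ∀ t ≥ 0, ℓ₂ (φ t w) ≤ v := fun t ht =>
    (hw t ht).2.2.trans (mul_le_of_le_one_left hv0.le (Real.exp_le_one_iff.2
      (neg_nonpos.2 (mul_nonneg (by positivity) ht))))
  have hbox : ∀ t ≥ 0, φ t w ∈ box ℓ₁ ℓ₂ v := fun t ht => by
    have h1 := hle t ht
    have h2 := hw t ht
    refine ⟨by linarith, ?_⟩
    rw [abs_of_pos h2.2.1]; exact h1
  have hlim2 : Tendsto (fun t => ℓ₂ (φ t w)) atTop (𝓝 0) := by
    have h0 : Tendsto (fun t => Real.exp (-(β / 2 * t)) * v) atTop (𝓝 0) := by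
      rw [← zero_mul v]
      exact (Real.tendsto_exp_neg_atTop_nhds_zero.comp
        (tendsto_id.const_mul_atTop (half_pos hβ))).mul_const _
    exact squeeze_zero' ((eventually_ge_atTop 0).mono fun t ht => (hw t ht).2.1.le)
      ((eventually_ge_atTop 0).mono fun t ht => (hw t ht).2.2) h0
  have hlim : Tendsto (fun t => φ t w) atTop (𝓝 0) := by
    refine h.tendsto_of_abs_le ?_ (by simpa using hlim2)
    have h1 : Tendsto (fun t => 1 / 2 * ℓ₂ (φ t w)) atTop (𝓝 0) := by
      simpa only [mul_zero] using hlim2.const_mul (1 / 2)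
    refine squeeze_zero_norm' ((eventually_ge_atTop 0).mono fun t ht => ?_) h1
    rw [sub_zero]; exact (hw t ht).1
  refine ⟨w, fun t ht => hsub (box_mono hvR'.le (hbox t ht)), hlim, ?_⟩
  have hratio : Tendsto (fun t => (ℓ₂ (φ t w))⁻¹ * ℓ₁ (φ t w)) atTop (𝓝 0) := by
    rw [Metric.tendsto_nhds]
    intro ε hε
    -- In smaller boxes the relative error, and with it the slope of the stable cone, may be taken
    -- arbitrarily small; hence the orbit becomes tangent to `e₂`.
    obtain ⟨κ', hκ', hc⟩ := exists_coneSmall hα hβ (inv_pos.2 (half_pos hε))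
    obtain ⟨R₂, hR₂, hnear₂⟩ := hV κ' hκ'
    obtain ⟨t₀, ht₀⟩ := eventually_atTop.1 (hlim.eventually (box_mem_nhds (ℓ₁ := ℓ₁) (ℓ₂ := ℓ₂) hR₂))
    filter_upwards [eventually_ge_atTop (max t₀ 0)] with t ht
    have h1 := abs_le_of_forall_mem_box hφ hnear₂ hc (p := φ t w) (q := 0)
      (fun s hs => by
        rw [← hφ.add hK]
        exact ht₀ _ (by linarith [le_max_left t₀ 0]))
      (fun s _ => by rw [hφ.fixed hK h0]; exact mem_of_mem_nhds (box_mem_nhds hR₂))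
    have h2 := (hw t ((le_max_right _ _).trans ht)).2.1
    rw [sub_zero, abs_of_pos h2] at h1
    rw [dist_zero_right, Real.norm_eq_abs, abs_mul, abs_inv, abs_of_pos h2, inv_mul_lt_iff₀ h2]
    nlinarith
  have heq : (fun t => ((ℓ₂ (φ t w))⁻¹ * ℓ₁ (φ t w)) • e₁ + e₂) =ᶠ[atTop]
      fun t => (ℓ₂ (φ t w))⁻¹ • φ t w := by
    filter_upwards [eventually_ge_atTop 0] with t ht
    have h2 := (hw t ht).2.1
    conv_rhs => rw [h.decomp (φ t w)]
    rw [smul_add, smul_smul, smul_smul, map_add, map_smul, map_smul, h.l21, h.l22]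
    simp [inv_mul_cancel₀ h2.ne']
  refine Tendsto.congr' heq ?_
  simpa using (hratio.smul_const e₁).add_const e₂

theorem cutoff_eventuallyEq {R : ℝ} (X : Plane → Plane) {p : Plane} (hp : ‖p‖ < R) :
    cutoff R X =ᶠ[𝓝 p] X := by
  filter_upwards [continuous_norm.continuousAt.eventually_lt_const hp] with q hq
  exact cutoff_eq X hq.le

theorem IsCoord.isDiagonal (h : IsCoord ℓ₁ ℓ₂ e₁ e₂) {A : Plane →L[ℝ] Plane}
    (h1 : A e₁ = α • e₁) (h2 : A e₂ = -β • e₂) : IsDiagonal A ℓ₁ ℓ₂ α β := fun w => by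
  have h3 : A w = ℓ₁ w • α • e₁ + ℓ₂ w • -β • e₂ := by
    conv_lhs => rw [h.decomp w, map_add, map_smul, map_smul, h1, h2]
  rw [h3]
  simp only [map_add, map_smul, h.l11, h.l12, h.l21, h.l22]
  constructor <;> simp <;> ring

/-- The eigenvectors of the linear part belong to the tangent cones of the local invariant
manifolds. -/
theorem eigenvectors_mem_tangentConeAt {r : ℕ∞} (hr : 1 ≤ r) (X : VField r) (hX : X 0 = 0)
    (h : IsCoord ℓ₁ ℓ₂ e₁ e₂) (hα : 0 < α) (hβ : 0 < β)
    (hA : IsDiagonal (fderiv ℝ X 0) ℓ₁ ℓ₂ α β) {U : Set Plane} (hU : U ∈ 𝓝 0) :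
    e₁ ∈ tangentConeAt ℝ (localUnstable X 0 U) 0 ∧
      e₂ ∈ tangentConeAt ℝ (localStable X 0 U) 0 := by
  have hφ := isGlobalFlow_cutFlow hr 1 X
  obtain ⟨K, hK⟩ := exists_lipschitzWith_cutoff hr 1 X
  have heq := cutoff_eventuallyEq (R := 1) X (p := 0) (by simp)
  have hV0 : cutoff 1 X 0 = 0 := by rw [cutoff_eq X (by simp), hX]
  have hnear : ∀ κ > 0, ∃ R > 0, NearSaddle (cutoff 1 X) ℓ₁ ℓ₂ α β κ R := fun κ hκ =>
    exists_nearSaddle h ((contDiff_cutoff 1 X).contDiffAt.of_le (by exact_mod_cast hr))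
      (by rwa [heq.fderiv_eq]) hκ
  have hU' : U ∩ Metric.closedBall 0 1 ∈ 𝓝 (0 : Plane) :=
    inter_mem hU (Metric.closedBall_mem_nhds _ one_pos)
  constructor
  · obtain ⟨w, h1, h2, h3⟩ := exists_stable_orbit h.swap hφ.reverse hK.neg hβ hα
      (fun κ hκ => by
        obtain ⟨R, hR, hn⟩ := hnear κ hκ
        exact ⟨R, hR, hn.reverse⟩) (by simp [hV0]) hU'
    refine mem_tangentConeAt_of_seq atTop _ _ h2 ?_ h3
    filter_upwards [eventually_ge_atTop 0] with t ht
    have hadd : ∀ s, cutFlow 1 X (-s) (cutFlow 1 X (-t) w) = cutFlow 1 X (-(s + t)) w := fun s => by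
      rw [← hφ.add hK]; congr 1; ring
    rw [zero_add]
    refine ⟨(h1 t ht).1, hφ.comesFrom (fun s hs => ?_) ?_ fun s hs => ?_⟩
    · rw [hadd]; simpa using (h1 _ (add_nonneg hs ht)).2
    · simp only [hadd]
      exact h2.comp (tendsto_atTop_add_const_right _ t tendsto_id)
    · rw [hadd]; exact (h1 _ (add_nonneg hs.le ht)).1
  · obtain ⟨w, h1, h2, h3⟩ := exists_stable_orbit h hφ hK hα hβ hnear hV0 hU'
    refine mem_tangentConeAt_of_seq atTop _ _ h2 ?_ h3
    filter_upwards [eventually_ge_atTop 0] with t ht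
    rw [zero_add]
    refine ⟨(h1 t ht).1, hφ.goesTo (fun s hs => ?_) ?_ fun s hs => ?_⟩
    · rw [← hφ.add hK]; simpa using (h1 _ (add_nonneg hs ht)).2
    · simp only [← hφ.add hK]
      exact h2.comp (tendsto_atTop_add_const_right _ t tendsto_id)
    · rw [← hφ.add hK]; exact (h1 _ (add_nonneg hs.le ht)).1

/-- Coordinates in which the saddle is diagonal and the differential of `h` is normalized. -/
theorem exists_normal_form {r : ℕ∞} (hr : 1 ≤ r) {h : Plane → ℝ} (X : VField r)
    (hX : IsHyperbolicSaddle X 0)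
    (hu : ∃ U ∈ 𝓝 (0 : Plane),
      ∀ v ∈ tangentConeAt ℝ (localUnstable X 0 U) 0, fderiv ℝ h 0 v = 0 → v = 0)
    (hs : ∃ U ∈ 𝓝 (0 : Plane),
      ∀ v ∈ tangentConeAt ℝ (localStable X 0 U) 0, fderiv ℝ h 0 v = 0 → v = 0) :
    ∃ (ℓ₁ ℓ₂ : Plane →L[ℝ] ℝ) (e₁ e₂ : Plane) (α β : ℝ), 0 < α ∧ 0 < β ∧
      IsCoord ℓ₁ ℓ₂ e₁ e₂ ∧ IsDiagonal (fderiv ℝ X 0) ℓ₁ ℓ₂ α β ∧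
      ∀ w, fderiv ℝ h 0 w = ℓ₁ w + ℓ₂ w := by
  obtain ⟨hX0, lam, mu, hmu, hlam, hlamE, hmuE⟩ := hX
  obtain ⟨a, ha⟩ := hlamE.exists_hasEigenvector
  obtain ⟨b, hb⟩ := hmuE.exists_hasEigenvector
  have ha1 : fderiv ℝ X 0 a = lam • a := ha.apply_eq_smul
  have hb1 : fderiv ℝ X 0 b = mu • b := hb.apply_eq_smul
  have hne : lam ≠ mu := by intro h; linarith
  obtain ⟨ℓ₁, ℓ₂, hc⟩ := exists_isCoord (det2_ne_zero_of_eigenvectors hne ha.2 hb.2 ha1 hb1)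
  have hd := hc.isDiagonal (β := -mu) ha1 (by rwa [neg_neg])
  have hcone := fun {U : Set Plane} (hU : U ∈ 𝓝 0) =>
    eigenvectors_mem_tangentConeAt hr X hX0 hc hlam (neg_pos.2 hmu) hd hU
  -- Eigenvectors are tangent to the invariant manifolds, so transversality gives `dh ≠ 0` on them
  -- and they can be rescaled to `dh = 1`.
  have hha : fderiv ℝ h 0 a ≠ 0 := fun h0 => by
    obtain ⟨U, hU, hUt⟩ := hu
    exact ha.2 (hUt a (hcone hU).1 h0)
  have hhb : fderiv ℝ h 0 b ≠ 0 := fun h0 => by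
    obtain ⟨U, hU, hUt⟩ := hs
    exact hb.2 (hUt b (hcone hU).2 h0)
  have ha2 : fderiv ℝ X 0 ((fderiv ℝ h 0 a)⁻¹ • a) = lam • (fderiv ℝ h 0 a)⁻¹ • a := by
    rw [map_smul, ha1, smul_comm]
  have hb2 : fderiv ℝ X 0 ((fderiv ℝ h 0 b)⁻¹ • b) = mu • (fderiv ℝ h 0 b)⁻¹ • b := by
    rw [map_smul, hb1, smul_comm]
  obtain ⟨L₁, L₂, hC⟩ := exists_isCoord (det2_ne_zero_of_eigenvectors hne
    (smul_ne_zero (inv_ne_zero hha) ha.2) (smul_ne_zero (inv_ne_zero hhb) hb.2) ha2 hb2)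
  refine ⟨L₁, L₂, _, _, lam, -mu, hlam, neg_pos.2 hmu, hC, hC.isDiagonal ha2 (by rwa [neg_neg]),
    fun w => ?_⟩
  conv_lhs => rw [hC.decomp w]
  simp only [map_add, map_smul, smul_eq_mul]
  rw [inv_mul_cancel₀ hha, inv_mul_cancel₀ hhb, mul_one, mul_one]

end NormalForm

/-! ### Persistence of the saddle and uniformity of the model. -/

section UniformModel

variable {r : ℕ∞} {ℓ₁ ℓ₂ : Plane →L[ℝ] ℝ} {e₁ e₂ : Plane} {α β κ : ℝ} {h : Plane → ℝ}

theorem VField.differentiableAt (hr : 1 ≤ r) (X : VField r) (p : Plane) :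
    DifferentiableAt ℝ X p :=
  X.contDiff'.differentiable (by simpa using (one_pos.trans_le hr).ne') p

/-- Only one derivative of the field enters, so `C¹` closeness of fields already controls `Xh` to
first order. -/
theorem hasFDerivAt_lieD (hr : 1 ≤ r) (hh : ContDiff ℝ ∞ h) (X : VField r) (p : Plane) :
    HasFDerivAt (lieD X h) ((fderiv ℝ h p).comp (fderiv ℝ X p) +
      (fderiv ℝ (fderiv ℝ h) p).flip (X p)) p := by
  have h1 : HasFDerivAt (fderiv ℝ h) (fderiv ℝ (fderiv ℝ h) p) p :=
    (((hh.fderiv_right (m := ∞) (by simp)).differentiable (by simp)) p).hasFDerivAt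
  exact h1.clm_apply (X.differentiableAt hr p).hasFDerivAt

theorem continuous_fderiv_lieD (hr : 1 ≤ r) (hh : ContDiff ℝ ∞ h) :
    Continuous fun q : VField r × Plane => fderiv ℝ (lieD q.1 h) q.2 := by
  have h1 : Continuous (fderiv ℝ h) := hh.continuous_fderiv (by simp)
  have h2 : Continuous (fderiv ℝ (fderiv ℝ h)) :=
    (hh.fderiv_right (m := ∞) (by simp)).continuous_fderiv (by simp)
  have h3 : (fun q : VField r × Plane => fderiv ℝ (lieD q.1 h) q.2) = fun q =>
      (fderiv ℝ h q.2).comp (fderiv ℝ q.1 q.2) +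
      ((ContinuousLinearMap.flipₗᵢ ℝ Plane Plane ℝ) (fderiv ℝ (fderiv ℝ h) q.2)) (q.1 q.2) := by
    ext1 q; exact (hasFDerivAt_lieD hr hh q.1 q.2).fderiv
  rw [h3]
  exact ((h1.comp continuous_snd).clm_comp (VField.continuous_fderiv hr)).add
    (((ContinuousLinearMap.flipₗᵢ ℝ Plane Plane ℝ).continuous.comp
      (h2.comp continuous_snd)).clm_apply VField.continuous_apply)

/-- On the box of radius `R`, the derivatives of the field, of `h` and of the Lie derivative of `h`
are close to their values at the unperturbed saddle. -/
structure UniformModel (h : Plane → ℝ) (X : Plane → Plane) (ℓ₁ ℓ₂ : Plane →L[ℝ] ℝ)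
    (α β κ R : ℝ) : Prop where
  field : ∀ p ∈ box ℓ₁ ℓ₂ R, IsAlmostDiagonal (fderiv ℝ X p) ℓ₁ ℓ₂ α β κ
  fderiv_h : ∀ p ∈ box ℓ₁ ℓ₂ R, ∀ w, |fderiv ℝ h p w - (ℓ₁ w + ℓ₂ w)| ≤ κ * (|ℓ₁ w| + |ℓ₂ w|)
  fderiv_lie : ∀ p ∈ box ℓ₁ ℓ₂ R, ∀ w,
    |fderiv ℝ (lieD X h) p w - (α * ℓ₁ w - β * ℓ₂ w)| ≤ κ * (|ℓ₁ w| + |ℓ₂ w|)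

theorem fderiv_lieD_zero (hr : 1 ≤ r) (hh : ContDiff ℝ ∞ h) {X : VField r} (hX : X 0 = 0)
    (hA : IsDiagonal (fderiv ℝ X 0) ℓ₁ ℓ₂ α β) (hdh : ∀ w, fderiv ℝ h 0 w = ℓ₁ w + ℓ₂ w)
    (w : Plane) : fderiv ℝ (lieD X h) 0 w = α * ℓ₁ w - β * ℓ₂ w := by
  rw [(hasFDerivAt_lieD hr hh X 0).fderiv, hX]
  simp only [ContinuousLinearMap.comp_apply, map_zero, add_zero, hdh, (hA w).1, (hA w).2]
  ring

/-- The derivatives are jointly continuous in the field and the point, so the box is chosen before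
the field. -/
theorem exists_uniformModel (hr : 1 ≤ r) (hh : ContDiff ℝ ∞ h) {X₀ : VField r}
    (hcoord : IsCoord ℓ₁ ℓ₂ e₁ e₂) (hX : X₀ 0 = 0)
    (hA : IsDiagonal (fderiv ℝ X₀ 0) ℓ₁ ℓ₂ α β) (hdh : ∀ w, fderiv ℝ h 0 w = ℓ₁ w + ℓ₂ w)
    (hκ : 0 < κ) {W : Set Plane} (hW : W ∈ 𝓝 0) :
    ∃ R > 0, box ℓ₁ ℓ₂ R ⊆ W ∧ ∀ᶠ X : VField r in 𝓝 X₀, UniformModel h X ℓ₁ ℓ₂ α β κ R := by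
  have h1 : ∀ᶠ q : VField r × Plane in 𝓝 (X₀, 0),
      IsAlmostDiagonal (fderiv ℝ q.1 q.2) ℓ₁ ℓ₂ α β κ :=
    hcoord.eventually_isAlmostDiagonal ((VField.continuous_fderiv hr).tendsto (X₀, 0)) hA hκ
  have h2 : ∀ᶠ q : VField r × Plane in 𝓝 (X₀, 0), ∀ w, |fderiv ℝ h q.2 w - fderiv ℝ h 0 w| ≤
      κ * (|ℓ₁ w| + |ℓ₂ w|) :=
    hcoord.eventually_abs_le
      (((hh.continuous_fderiv (by simp)).comp continuous_snd).tendsto (X₀, 0)) hκ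
  have h3 : ∀ᶠ q : VField r × Plane in 𝓝 (X₀, 0), ∀ w,
      |fderiv ℝ (lieD q.1 h) q.2 w - fderiv ℝ (lieD X₀ h) 0 w| ≤ κ * (|ℓ₁ w| + |ℓ₂ w|) :=
    hcoord.eventually_abs_le ((continuous_fderiv_lieD hr hh).tendsto (X₀, 0)) hκ
  have hall := h1.and (h2.and h3)
  rw [nhds_prod_eq] at hall
  obtain ⟨pa, hpa, pb, hpb, hab⟩ := eventually_prod_iff.1 hall
  obtain ⟨R, hR, hsub⟩ := hcoord.exists_box_subset (inter_mem hW hpb)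
  refine ⟨R, hR, fun p hp => (hsub hp).1, hpa.mono fun X hX' => ⟨fun p hp =>
    (hab hX' (hsub hp).2).1, fun p hp w => ?_, fun p hp w => ?_⟩⟩
  · rw [← hdh]; exact (hab hX' (hsub hp).2).2.1 w
  · rw [← fderiv_lieD_zero hr hh hX hA hdh]; exact (hab hX' (hsub hp).2).2.2 w

theorem UniformModel.localModel (hr : 1 ≤ r) (hh : ContDiff ℝ ∞ h) {X : VField r} {R R₁ : ℝ}
    (H : UniformModel h X ℓ₁ ℓ₂ α β κ R) (hR : ∀ p ∈ box ℓ₁ ℓ₂ R, ‖p‖ < R₁) {S : Plane}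
    (hS : S ∈ box ℓ₁ ℓ₂ R) (hXS : X S = 0) :
    LocalModel h (cutoff R₁ X) ℓ₁ ℓ₂ α β κ R S := by
  have heq : ∀ p ∈ box ℓ₁ ℓ₂ R, cutoff R₁ X =ᶠ[𝓝 p] X := fun p hp =>
    cutoff_eventuallyEq X (hR p hp)
  have hlie : ∀ p ∈ box ℓ₁ ℓ₂ R, lieD (cutoff R₁ X) h =ᶠ[𝓝 p] lieD X h := fun p hp =>
    (heq p hp).mono fun q hq => by rw [lieD, lieD, hq]
  refine ⟨nearSaddle_of_fderiv (fun p hp => ?_) fun p hp => ?_, ?_, hS,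
    fun p _ => hh.differentiable (by simp) p, H.fderiv_h, fun p hp => ?_, fun p hp => ?_⟩
  · exact (heq p hp).differentiableAt_iff.2 (X.differentiableAt hr p)
  · rw [(heq p hp).fderiv_eq]; exact H.field p hp
  · rw [cutoff_eq X (hR S hS).le, hXS]
  · exact (hlie p hp).differentiableAt_iff.2 (hasFDerivAt_lieD hr hh X p).differentiableAt
  · rw [(hlie p hp).fderiv_eq]; exact H.fderiv_lie p hp

theorem SmallError.kappa_le (hs : SmallError α β κ) : κ ≤ α / 6 ∧ κ ≤ β / 2 := by
  refine ⟨?_, hs.fold₃⟩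
  have h1 := hs.incr
  have hα := hs.big.alpha
  have hβ := hs.big.beta
  have hκ := hs.big.kappa
  have : κ * 3 ≤ κ * (1 + (2 + 2 * α / β)) := by
    gcongr
    have : 0 ≤ 2 * α / β := by positivity
    linarith
  linarith

/-- Subtracting the two equations gives `α |x| ≤ κ (|x| + |y|)` and `β |y| ≤ κ (|x| + |y|)` for the
coordinates of `p - q`; with `κ ≤ α / 6` and `κ ≤ β / 2` both vanish. -/
theorem NearSaddle.zero_unique (hcoord : IsCoord ℓ₁ ℓ₂ e₁ e₂) {V : Plane → Plane} {R : ℝ}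
    (hV : NearSaddle V ℓ₁ ℓ₂ α β κ R) (hs : SmallError α β κ) {p q : Plane}
    (hp : p ∈ box ℓ₁ ℓ₂ R) (hq : q ∈ box ℓ₁ ℓ₂ R) (hVp : V p = 0) (hVq : V q = 0) : p = q := by
  obtain ⟨h1, h2⟩ := hV p hp q hq
  obtain ⟨h3, h4⟩ := hs.kappa_le
  have hα := hs.big.alpha
  have hβ := hs.big.beta
  rw [hVp, hVq, sub_zero, map_zero, zero_sub, abs_neg, abs_mul, abs_of_pos hα] at h1
  rw [hVp, hVq, sub_zero, map_zero, zero_add, abs_mul, abs_of_pos hβ] at h2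
  set x := |ℓ₁ (p - q)| with hx
  set y := |ℓ₂ (p - q)| with hy
  have hx0 : 0 ≤ x := abs_nonneg _
  have hy0 : 0 ≤ y := abs_nonneg _
  have h5 : α * x ≤ α * (1 / 6 * (x + y)) := by
    have : κ * (x + y) ≤ α / 6 * (x + y) := by gcongr
    linarith
  have h6 : β * y ≤ β * (1 / 2 * (x + y)) := by
    have : κ * (x + y) ≤ β / 2 * (x + y) := by gcongr
    linarith
  have h7 := le_of_mul_le_mul_left h5 hα
  have h8 := le_of_mul_le_mul_left h6 hβ
  have h9 : x = 0 := by linarith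
  have h10 : y = 0 := by linarith
  rw [hx, abs_eq_zero, map_sub] at h9
  rw [hy, abs_eq_zero, map_sub] at h10
  exact hcoord.ext (by linarith) (by linarith)

/-- A field whose derivative is close to a linear saddle has a hyperbolic saddle. -/
theorem isHyperbolicSaddle_of_isAlmostDiagonal (hcoord : IsCoord ℓ₁ ℓ₂ e₁ e₂)
    (hs : SmallError α β κ) {X : Plane → Plane} {S : Plane} (hX : X S = 0)
    (hA : IsAlmostDiagonal (fderiv ℝ X S) ℓ₁ ℓ₂ α β κ) : IsHyperbolicSaddle X S := by
  refine ⟨hX, ?_⟩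
  obtain ⟨hk1, hk2⟩ := hs.kappa_le
  have hα := hs.big.alpha
  have hβ := hs.big.beta
  have hκ := hs.big.kappa
  set A := fderiv ℝ X S
  have a1 := hA e₁
  have a2 := hA e₂
  rw [hcoord.l11, hcoord.l21] at a1
  rw [hcoord.l12, hcoord.l22] at a2
  set p := ℓ₁ (A e₁) with hp
  set q := ℓ₁ (A e₂) with hq
  set s := ℓ₂ (A e₁) with hsdef
  set t := ℓ₂ (A e₂) with ht
  simp only [mul_one, mul_zero, sub_zero, add_zero, abs_one, abs_zero, zero_add] at a1 a2
  obtain ⟨b1, b2⟩ := abs_le.1 a1.1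
  obtain ⟨b3, b4⟩ := abs_le.1 a2.2
  have hp0 : 5 / 6 * α ≤ p := by linarith
  have ht0 : t ≤ -(β / 2) := by linarith
  have hqs : |q * s| ≤ κ * κ := by
    rw [abs_mul]; exact mul_le_mul a2.1 a1.2 (abs_nonneg _) hκ
  have hκκ : κ * κ ≤ α / 6 * (β / 2) := mul_le_mul hk1 hk2 hκ (by positivity)
  have hpt : 5 / 6 * α * (β / 2) ≤ p * -t :=
    mul_le_mul hp0 (by linarith) (by positivity) (by linarith)
  -- A negative determinant gives real eigenvalues `l` of opposite signs; eigenvectors with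
  -- coordinates `(l - t, s)` and `(q, l - p)` are exhibited below.
  have hdet : p * t - q * s < 0 := by
    have := (abs_le.1 hqs).1
    have := mul_pos hα hβ
    linarith
  have hval : ∀ x y : ℝ, A (x • e₁ + y • e₂) = (x * p + y * q) • e₁ + (x * s + y * t) • e₂ :=
    fun x y => hcoord.ext
      (by simp only [map_add, map_smul, hcoord.l11, hcoord.l12, smul_eq_mul]; ring)
      (by simp only [map_add, map_smul, hcoord.l21, hcoord.l22, smul_eq_mul]; ring)
  have heig : ∀ l x y : ℝ, x ≠ 0 ∨ y ≠ 0 → x * p + y * q = l * x → x * s + y * t = l * y →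
      Module.End.HasEigenvalue (A : Plane →ₗ[ℝ] Plane) l := by
    intro l x y hxy h1 h2
    refine Module.End.hasEigenvalue_of_hasEigenvector (x := x • e₁ + y • e₂)
      ⟨Module.End.mem_eigenspace_iff.2 ?_, ?_⟩
    · change A (x • e₁ + y • e₂) = _
      rw [hval, h1, h2, smul_add, smul_smul, smul_smul]
    · intro h0
      have h3 := congrArg ℓ₁ h0
      have h4 := congrArg ℓ₂ h0
      simp only [map_add, map_smul, hcoord.l11, hcoord.l12, hcoord.l21, hcoord.l22,
        map_zero, smul_eq_mul, mul_one, mul_zero, add_zero, zero_add] at h3 h4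
      rcases hxy with h | h
      · exact h h3
      · exact h h4
  set D := (p + t) ^ 2 - 4 * (p * t - q * s) with hD
  have hDpos : (p + t) ^ 2 < D := by linarith
  have hD0 : 0 ≤ D := (sq_nonneg _).trans hDpos.le
  have hsq := Real.sq_sqrt hD0
  have hlt : |p + t| < √D := by
    rw [← Real.sqrt_sq_eq_abs]; exact Real.sqrt_lt_sqrt (sq_nonneg _) hDpos
  obtain ⟨c1, c2⟩ := abs_lt.1 hlt
  have hroot : ∀ l : ℝ, (2 * l - (p + t)) ^ 2 = D → l ^ 2 - (p + t) * l + (p * t - q * s) = 0 :=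
    fun l hl => by nlinarith
  refine ⟨(p + t + √D) / 2, (p + t - √D) / 2, by linarith, by linarith, ?_, ?_⟩
  · have h1 := hroot ((p + t + √D) / 2) (Eq.trans (by ring) hsq)
    refine heig _ ((p + t + √D) / 2 - t) s (Or.inl ?_) (by linarith) (by ring)
    have : 0 < (p + t + √D) / 2 - t := by linarith
    exact this.ne'
  · have h1 := hroot ((p + t - √D) / 2) (Eq.trans (by ring) hsq)
    refine heig _ q ((p + t - √D) / 2 - p) (Or.inr ?_) (by ring) (by linarith)
    have : (p + t - √D) / 2 - p < 0 := by linarith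
    exact this.ne

/-- The saddle persists under perturbations. -/
theorem eventually_exists_zero (hr : 1 ≤ r) {X₀ : VField r} (hcoord : IsCoord ℓ₁ ℓ₂ e₁ e₂)
    (hα : 0 < α) (hβ : 0 < β) (hX : X₀ 0 = 0) (hA : IsDiagonal (fderiv ℝ X₀ 0) ℓ₁ ℓ₂ α β) {ε : ℝ}
    (hε : 0 < ε) : ∀ᶠ X : VField r in 𝓝 X₀, ∃ S, ‖S‖ ≤ ε ∧ X S = 0 := by
  set A := fderiv ℝ X₀ 0 with hAdef
  set C : ℝ := α⁻¹ * ‖ℓ₁‖ * ‖e₁‖ + β⁻¹ * ‖ℓ₂‖ * ‖e₂‖ + 1 with hC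
  have hC0 : 0 < C := by positivity
  -- The explicit inverse of the diagonal operator, with norm bound `C`. Near `0` the field is
  -- within Lipschitz distance `C⁻¹ / 2` of `A`, so the image of the `δ`-ball contains the ball of
  -- radius `(C⁻¹ / 2) δ` around `X 0`, hence `0`.
  let B : A.NonlinearRightInverse :=
    { toFun := fun y => (α⁻¹ * ℓ₁ y) • e₁ + (-(β⁻¹ * ℓ₂ y)) • e₂
      nnnorm := ⟨C, hC0.le⟩
      bound' := fun y => by
        refine (norm_add_le _ _).trans ?_
        rw [norm_smul, norm_smul, norm_neg, norm_mul, norm_mul,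
          Real.norm_of_nonneg (inv_pos.2 hα).le, Real.norm_of_nonneg (inv_pos.2 hβ).le]
        have h1 := ℓ₁.le_opNorm y
        have h2 := ℓ₂.le_opNorm y
        calc α⁻¹ * ‖ℓ₁ y‖ * ‖e₁‖ + β⁻¹ * ‖ℓ₂ y‖ * ‖e₂‖
            ≤ α⁻¹ * (‖ℓ₁‖ * ‖y‖) * ‖e₁‖ + β⁻¹ * (‖ℓ₂‖ * ‖y‖) * ‖e₂‖ := by gcongr
          _ ≤ C * ‖y‖ := by
            rw [hC]; nlinarith [norm_nonneg y]
      right_inv' := fun y => by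
        refine hcoord.ext ?_ ?_
        · rw [(hA _).1]
          simp [hcoord.l11, hcoord.l12, hα.ne']
        · rw [(hA _).2]
          simp [hcoord.l21, hcoord.l22, hβ.ne'] }
  have hclose : ∀ᶠ q : VField r × Plane in 𝓝 (X₀, 0), ‖fderiv ℝ q.1 q.2 - A‖ < C⁻¹ / 2 := by
    have h1 : Tendsto (fun q : VField r × Plane => ‖fderiv ℝ q.1 q.2 - A‖) (𝓝 (X₀, 0)) (𝓝 0) := by
      have := (((VField.continuous_fderiv hr).sub continuous_const).norm
        (f := fun q : VField r × Plane => fderiv ℝ q.1 q.2 - A)).tendsto (X₀, 0)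
      simpa [hAdef] using this
    exact h1.eventually_lt_const (by positivity)
  rw [nhds_prod_eq] at hclose
  obtain ⟨pa, hpa, pb, hpb, hab⟩ := eventually_prod_iff.1 hclose
  obtain ⟨ε', hε', hball⟩ := Metric.mem_nhds_iff.1 hpb
  set δ := min ε (ε' / 2) with hδ
  have hδ0 : 0 < δ := lt_min hε (by positivity)
  have hsmall : ∀ᶠ X : VField r in 𝓝 X₀, ‖X 0‖ < C⁻¹ / 2 * δ := by
    have h1 : Continuous fun X : VField r => ‖X 0‖ :=
      (VField.continuous_apply.comp (continuous_id.prodMk continuous_const)).norm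
    exact h1.continuousAt.eventually_lt_const (by simp only [hX, norm_zero]; positivity)
  filter_upwards [hpa, hsmall] with X hXa hXs
  have happ : ApproximatesLinearOn X A (Metric.closedBall 0 δ) ⟨C⁻¹ / 2, by positivity⟩ := by
    intro x hx y hy
    exact (convex_closedBall (0 : Plane) δ).norm_image_sub_le_of_norm_hasFDerivWithin_le'
      (f' := fun p => fderiv ℝ X p)
      (fun p _ => (X.differentiableAt hr p).hasFDerivAt.hasFDerivWithinAt)
      (fun p hp => (hab hXa (hball (by
        rw [mem_ball_zero_iff]
        have := mem_closedBall_zero_iff.1 hp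
        linarith [min_le_right ε (ε' / 2)]))).le) hy hx
  obtain ⟨S, hS, hS0⟩ := happ.surjOn_closedBall_of_nonlinearRightInverse B hδ0.le Subset.rfl
    (show (0 : Plane) ∈ _ by
      rw [Metric.mem_closedBall, dist_comm, dist_zero_right]
      refine hXs.le.trans (le_of_eq ?_)
      change _ = (C⁻¹ - C⁻¹ / 2) * δ
      ring)
  exact ⟨S, (mem_closedBall_zero_iff.1 hS).trans (min_le_left _ _), hS0⟩

end UniformModel

/-! ### Signs of Lie derivatives at the ends of a transit. -/

section Signs

theorem nonpos_of_hasDerivWithinAt_of_nonneg_left {f : ℝ → ℝ} {f' a b : ℝ} (hab : a < b)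
    (hf : HasDerivWithinAt f f' (Icc a b) b) (h0 : f b = 0) (hpos : ∀ t ∈ Ioo a b, 0 ≤ f t) :
    f' ≤ 0 := by
  have h1 : Tendsto (slope f b) (𝓝[Ioo a b] b) (𝓝 f') :=
    ((hasDerivWithinAt_iff_tendsto_slope' (by simp)).1 (hf.mono Ioo_subset_Icc_self))
  have : (𝓝[Ioo a b] b).NeBot := by
    rw [nhdsWithin_Ioo_eq_nhdsLT hab]; infer_instance
  refine le_of_tendsto h1 (eventually_nhdsWithin_of_forall fun t ht => ?_)
  rw [slope_def_field, h0, sub_zero]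
  exact div_nonpos_of_nonneg_of_nonpos (hpos t ht) (by linarith [ht.2])

theorem nonneg_of_hasDerivWithinAt_of_nonneg_right {f : ℝ → ℝ} {f' a b : ℝ} (hab : a < b)
    (hf : HasDerivWithinAt f f' (Icc a b) a) (h0 : f a = 0) (hpos : ∀ t ∈ Ioo a b, 0 ≤ f t) :
    0 ≤ f' := by
  have h1 : Tendsto (slope f a) (𝓝[Ioo a b] a) (𝓝 f') :=
    ((hasDerivWithinAt_iff_tendsto_slope' (by simp)).1 (hf.mono Ioo_subset_Icc_self))
  have : (𝓝[Ioo a b] a).NeBot := by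
    rw [nhdsWithin_Ioo_eq_nhdsGT hab]; infer_instance
  refine ge_of_tendsto h1 (eventually_nhdsWithin_of_forall fun t ht => ?_)
  rw [slope_def_field, h0, sub_zero]
  exact div_nonneg (hpos t ht) (by linarith [ht.1])

/-- Signs of the Lie derivative at the end points of a transit in `{g > 0}`. -/
theorem IsTransit.lieD_nonneg {X : Plane → Plane} {g : Plane → ℝ} (hg : Differentiable ℝ g)
    {p q : Plane} (h : IsTransit X {x | 0 < g x} p q) :
    (g p = 0 → 0 ≤ lieD X g p) ∧ (g q = 0 → lieD X g q ≤ 0) := by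
  obtain ⟨T, hT, γ, h1, h2, h3, h4⟩ := h
  have hd : ∀ t ∈ Icc 0 T, HasDerivWithinAt (fun t => g (γ t)) (lieD X g (γ t)) (Icc 0 T) t :=
    fun t ht => (hg (γ t)).hasFDerivAt.comp_hasDerivWithinAt t (h1 t ht)
  refine ⟨fun h0 => ?_, fun h0 => ?_⟩
  · have := hd 0 ⟨le_rfl, hT.le⟩
    rw [h2] at this
    exact nonneg_of_hasDerivWithinAt_of_nonneg_right hT this (by rw [h2, h0])
      fun t ht => (h4 t ht).le
  · have := hd T ⟨hT.le, le_rfl⟩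
    rw [h3] at this
    exact nonpos_of_hasDerivWithinAt_of_nonneg_left hT this (by rw [h3, h0])
      fun t ht => (h4 t ht).le

theorem ComesFrom.lieD_nonpos {X : Plane → Plane} {g : Plane → ℝ} (hg : Differentiable ℝ g)
    {S p : Plane} (h : ComesFrom X {x | 0 < g x} S p) (h0 : g p = 0) : lieD X g p ≤ 0 := by
  obtain ⟨γ, h1, h2, h3, -⟩ := h
  have hd : HasDerivWithinAt (fun t => g (γ t)) (lieD X g (γ 0)) (Icc (-1) 0) 0 :=
    (hg (γ 0)).hasFDerivAt.comp_hasDerivWithinAt 0 ((h1 0 (mem_Iic.2 le_rfl)).mono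
      Icc_subset_Iic_self)
  rw [h2] at hd
  exact nonpos_of_hasDerivWithinAt_of_nonneg_left (by norm_num) hd (by rw [h2, h0])
    fun t ht => (h3 t ht.2).le

end Signs

/-! ### Direction of the chart at the saddle. -/

section ChartDirection

variable {r : ℕ∞} {ℓ₁ ℓ₂ : Plane →L[ℝ] ℝ} {e₁ e₂ : Plane} {α β ε : ℝ} {h : Plane → ℝ}
  {c : ℝ → Plane}

/-- Tangent vectors of Σ satisfy `ℓ₁ + ℓ₂ = 0`, and `Xh` has derivative `(α + β) ℓ₁ (c')` along the
chart. For small `x > 0` the points are crossing points and `Yh > 0`, so `Xh > 0` there, which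
decides the sign. -/
theorem chart_direction (hr : 1 ≤ r) (hh : ContDiff ℝ ∞ h) {X : VField r} {Y : Plane → Plane}
    (hcoord : IsCoord ℓ₁ ℓ₂ e₁ e₂) (hα : 0 < α) (hβ : 0 < β) (hX : X 0 = 0)
    (hA : IsDiagonal (fderiv ℝ X 0) ℓ₁ ℓ₂ α β) (hdh : ∀ w, fderiv ℝ h 0 w = ℓ₁ w + ℓ₂ w)
    (hc : IsSigmaChart h 0 c ε) (hY : 0 < lieD Y h 0) (hYc : Continuous Y)
    (hcross : ∀ᶠ x in 𝓝[>] (0 : ℝ), c x ∈ crossing h X Y) :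
    0 < ℓ₁ (deriv c 0) ∧ ℓ₂ (deriv c 0) = -ℓ₁ (deriv c 0) := by
  have h1 := hc.fderiv_deriv hh hc.zero_mem
  rw [hc.center, hdh] at h1
  have h2 : ℓ₂ (deriv c 0) = -ℓ₁ (deriv c 0) := by linarith
  refine ⟨?_, h2⟩
  have hne : ℓ₁ (deriv c 0) ≠ 0 := fun h0 => by
    refine hc.immersion 0 hc.zero_mem (hcoord.ext ?_ ?_)
    · rw [h0, map_zero]
    · rw [h2, h0, map_zero, neg_zero]
  have hd : HasDerivAt (fun x => lieD X h (c x)) ((α + β) * ℓ₁ (deriv c 0)) 0 := by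
    have h3 : HasFDerivAt (lieD X h) (fderiv ℝ (lieD X h) 0) (c 0) := by
      rw [hc.center]; exact (hasFDerivAt_lieD hr hh X 0).differentiableAt.hasFDerivAt
    have h4 := HasFDerivAt.comp_hasDerivAt (l := lieD X h) 0 h3 (hc.hasDerivAt hc.zero_mem)
    rw [fderiv_lieD_zero hr hh hX hA hdh, h2] at h4
    have h5 : α * ℓ₁ (deriv c 0) - β * -ℓ₁ (deriv c 0) = (α + β) * ℓ₁ (deriv c 0) := by ring
    rw [h5] at h4
    exact h4
  have hcc : ContinuousAt c 0 := (hc.contDiffAt hc.zero_mem).continuousAt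
  have hpos : ∀ᶠ x in 𝓝[>] (0 : ℝ), 0 ≤ lieD X h (c x) := by
    have h3 : ∀ᶠ x in 𝓝 (0 : ℝ), 0 < lieD Y h (c x) := by
      have h5 : Continuous fun p => lieD Y h p := (hh.continuous_fderiv (by simp)).clm_apply hYc
      have h6 : ContinuousAt (fun x => lieD Y h (c x)) 0 :=
        ContinuousAt.comp (g := fun p => lieD Y h p) h5.continuousAt hcc
      exact h6.eventually_const_lt (by simpa only [hc.center] using hY)
    filter_upwards [hcross, h3.filter_mono nhdsWithin_le_nhds] with x hx hxY
    exact ((mul_pos_iff_of_pos_right hxY).1 hx.2).le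
  have h5 : Tendsto (slope (fun x => lieD X h (c x)) 0) (𝓝[>] 0)
      (𝓝 ((α + β) * ℓ₁ (deriv c 0))) :=
    (hasDerivAt_iff_tendsto_slope.1 hd).mono_left (nhdsWithin_mono _ fun t ht => ht.ne')
  have h6 : 0 ≤ (α + β) * ℓ₁ (deriv c 0) := by
    refine ge_of_tendsto h5 ?_
    filter_upwards [hpos, eventually_mem_nhdsWithin] with x hx hx0
    have h7 : lieD X h (c 0) = 0 := by rw [hc.center, lieD, hX, map_zero]
    rw [slope_def_field, h7, sub_zero, sub_zero]
    exact div_nonneg hx (mem_Ioi.1 hx0).le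
  have h7 : 0 ≤ ℓ₁ (deriv c 0) := (mul_nonneg_iff_of_pos_left (by positivity)).1 h6
  exact lt_of_le_of_ne h7 hne.symm

theorem exists_chartModel (hc : IsSigmaChart h 0 c ε) (hk : 0 < ℓ₁ (deriv c 0))
    (hk' : ℓ₂ (deriv c 0) = -ℓ₁ (deriv c 0)) {W : Set Plane} (hW : W ∈ 𝓝 0) :
    ∃ b > 0, b < ε ∧ ChartModel h ℓ₁ ℓ₂ c (ℓ₁ (deriv c 0)) b ∧ ∀ x ∈ Icc (-b) b, c x ∈ W := by
  have hcc : ContinuousAt c 0 := (hc.contDiffAt hc.zero_mem).continuousAt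
  have h1 : ∀ ℓ : Plane →L[ℝ] ℝ, ∀ᶠ x in 𝓝 (0 : ℝ),
      |ℓ (deriv c x) - ℓ (deriv c 0)| < 1 / 12 * ℓ₁ (deriv c 0) := fun ℓ => by
    have h2 : ContinuousAt (fun x => |ℓ (deriv c x) - ℓ (deriv c 0)|) 0 :=
      ((ℓ.continuous.continuousAt.comp hc.continuousAt_deriv).sub continuousAt_const).abs
    exact h2.eventually_lt_const (by simp only [sub_self, abs_zero]; positivity)
  have h2 : ∀ᶠ x in 𝓝 (0 : ℝ), c x ∈ W := hcc.tendsto.eventually (by rwa [hc.center])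
  obtain ⟨b, hb, hball⟩ := Metric.eventually_nhds_iff.1 ((h1 ℓ₁).and ((h1 ℓ₂).and h2))
  have hb' : 0 < min (b / 2) (ε / 2) := lt_min (by positivity) (by linarith [hc.pos])
  have hmem : ∀ x ∈ Icc (-min (b / 2) (ε / 2)) (min (b / 2) (ε / 2)), dist x 0 < b ∧
      x ∈ Ioo (-ε) ε := fun x hx => by
    have e1 := min_le_left (b / 2) (ε / 2)
    have e2 := min_le_right (b / 2) (ε / 2)
    have := hc.pos
    rw [Real.dist_eq, sub_zero, abs_lt]
    exact ⟨⟨by linarith [hx.1], by linarith [hx.2]⟩, by linarith [hx.1], by linarith [hx.2]⟩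
  refine ⟨min (b / 2) (ε / 2), hb', by linarith [min_le_right (b / 2) (ε / 2), hc.pos],
    ⟨hk, fun x hx => hc.mem x (hmem x hx).2, fun x hx => hc.contDiffAt (hmem x hx).2,
      fun x hx => ?_⟩, fun x hx => (hball (hmem x hx).1).2.2⟩
  obtain ⟨a1, a2, -⟩ := hball (hmem x hx).1
  rw [hk', sub_neg_eq_add] at a2
  exact ⟨a1.le, a2.le⟩

end ChartDirection

/-! ### The saddle and the base point of a perturbed field. -/

section BasePoint

variable {r : ℕ∞} {h : Plane → ℝ} {X₀ : VField r} {c : ℝ → Plane} {ℓ₁ ℓ₂ : Plane →L[ℝ] ℝ}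
  {e₁ e₂ : Plane} {α β κ R R₁ R₂ k b : ℝ}

/-- Normalized data near the saddle of the unperturbed field `X₀`. -/
structure SaddleData (r : ℕ∞) (h : Plane → ℝ) (X₀ : VField r) (c : ℝ → Plane)
    (ℓ₁ ℓ₂ : Plane →L[ℝ] ℝ) (e₁ e₂ : Plane) (α β κ R R₁ R₂ k b : ℝ) : Prop where
  one_le : 1 ≤ r
  smooth : ContDiff ℝ ∞ h
  coord : IsCoord ℓ₁ ℓ₂ e₁ e₂
  small : SmallError α β κ
  zero : X₀ 0 = 0
  R_pos : 0 < R
  norm_lt : ∀ p ∈ box ℓ₁ ℓ₂ R, ‖p‖ < R₁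
  uniform : ∀ᶠ X : VField r in 𝓝 X₀, UniformModel h X ℓ₁ ℓ₂ α β κ R
  b_pos : 0 < b
  chart : ChartModel h ℓ₁ ℓ₂ c k b
  chart_zero : c 0 = 0
  chart_mem : ∀ x ∈ Icc (-b) b, c x ∈ box ℓ₁ ℓ₂ R
  R₂_pos : 0 < R₂
  R₂_le : R₂ ≤ R
  surj : ∀ q ∈ box ℓ₁ ℓ₂ R₂, h q = 0 → ∃ x ∈ Ioo (-b) b, c x = q

/-- The left end point of the domain of the first return map: a fold, the saddle, or a point of the
stable manifold of the saddle. -/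
structure IsBase (h : Plane → ℝ) (V : Plane → Plane) (φ : ℝ → Plane → Plane)
    (ℓ₁ ℓ₂ : Plane →L[ℝ] ℝ) (R : ℝ) (c : ℝ → Plane) (b : ℝ) (S : Plane) (a : ℝ) : Prop where
  mem : a ∈ Ioo (-b) b
  fold : h S < 0 → lieD V h (c a) = 0
  boundary : h S = 0 → c a = S
  real : 0 < h S → (∀ t ≥ 0, φ t (c a) ∈ box ℓ₁ ℓ₂ R) ∧ ∀ t > 0, 0 < h (φ t (c a))

namespace SaddleData

open Classical in
/-- The zero of `X` in the box of radius `R`. -/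
noncomputable def saddle (ℓ₁ ℓ₂ : Plane →L[ℝ] ℝ) (R : ℝ) (X : Plane → Plane) : Plane :=
  if hX : ∃ p ∈ box ℓ₁ ℓ₂ R, X p = 0 then hX.choose else 0

open Classical in
/-- The base point of the domain of the first return map of the field `X`. -/
noncomputable def base (h : Plane → ℝ) (ℓ₁ ℓ₂ : Plane →L[ℝ] ℝ) (R R₁ : ℝ) (c : ℝ → Plane) (b : ℝ)
    (X : Plane → Plane) : ℝ :=
  if hX : ∃ a, IsBase h (cutoff R₁ X) (cutFlow R₁ X) ℓ₁ ℓ₂ R c b (saddle ℓ₁ ℓ₂ R X) a then hX.choose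
  else 0

/-- A zero close to `0` exists by perturbation, and uniqueness of the zero in the box identifies it
with the chosen one. -/
theorem eventually_saddle (D : SaddleData r h X₀ c ℓ₁ ℓ₂ e₁ e₂ α β κ R R₁ R₂ k b)
    (hA : IsDiagonal (fderiv ℝ X₀ 0) ℓ₁ ℓ₂ α β) {N : Set Plane} (hN : N ∈ 𝓝 0) :
    ∀ᶠ X : VField r in 𝓝 X₀, X (saddle ℓ₁ ℓ₂ R X) = 0 ∧ saddle ℓ₁ ℓ₂ R X ∈ N ∩ box ℓ₁ ℓ₂ R := by
  obtain ⟨ε, hε, hball⟩ := Metric.mem_nhds_iff.1 (inter_mem hN (box_mem_nhds D.R_pos))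
  filter_upwards [eventually_exists_zero D.one_le D.coord D.small.big.alpha D.small.big.beta D.zero
    hA (half_pos hε), D.uniform] with X ⟨p, hp, hXp⟩ hU
  have hpN := hball (mem_ball_zero_iff.2 (by linarith : ‖p‖ < ε))
  have hex : ∃ p ∈ box ℓ₁ ℓ₂ R, X p = 0 := ⟨p, hpN.2, hXp⟩
  have hspec := hex.choose_spec
  have hnear : NearSaddle X ℓ₁ ℓ₂ α β κ R :=
    nearSaddle_of_fderiv (fun p _ => X.differentiableAt D.one_le p) hU.field
  have heq : saddle ℓ₁ ℓ₂ R X = p := by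
    rw [saddle, dif_pos hex]
    exact hnear.zero_unique D.coord D.small hspec.1 hpN.2 hspec.2 hXp
  rw [heq]
  exact ⟨hXp, hpN⟩

theorem tendsto_saddle (D : SaddleData r h X₀ c ℓ₁ ℓ₂ e₁ e₂ α β κ R R₁ R₂ k b)
    (hA : IsDiagonal (fderiv ℝ X₀ 0) ℓ₁ ℓ₂ α β) :
    Tendsto (fun X : VField r => saddle ℓ₁ ℓ₂ R X) (𝓝 X₀) (𝓝 0) := fun _ hN =>
  (D.eventually_saddle hA hN).mono fun _ hX => hX.2.1

theorem localModel (D : SaddleData r h X₀ c ℓ₁ ℓ₂ e₁ e₂ α β κ R R₁ R₂ k b) {X : VField r}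
    (hU : UniformModel h X ℓ₁ ℓ₂ α β κ R) {S : Plane} (hS : S ∈ box ℓ₁ ℓ₂ R) (hX : X S = 0) :
    LocalModel h (cutoff R₁ X) ℓ₁ ℓ₂ α β κ R S :=
  hU.localModel D.one_le D.smooth D.norm_lt hS hX

/-- Makes the arbitrary choice in `base` harmless: whichever base point is taken, it tends to `0`
with the saddle. -/
theorem base_dist_le (D : SaddleData r h X₀ c ℓ₁ ℓ₂ e₁ e₂ α β κ R R₁ R₂ k b) {V : Plane → Plane}
    {φ : ℝ → Plane → Plane} {K : NNReal} (hφ : IsGlobalFlow V φ) (hK : LipschitzWith K V) {S : Plane}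
    (H : LocalModel h V ℓ₁ ℓ₂ α β κ R S) {a : ℝ} (ha : IsBase h V φ ℓ₁ ℓ₂ R c b S a) :
    |ℓ₁ (c a - S)| + |ℓ₂ (c a - S)| ≤ 4 * |h S| := by
  have haI := Ioo_subset_Icc_self ha.mem
  have hca := D.chart_mem a haI
  rcases lt_trichotomy (h S) 0 with h0 | h0 | h0
  · have := (H.fold_position D.small hca (D.chart.mem a haI) h0 (ha.fold h0)).2.2.2
    linarith [abs_nonneg (h S)]
  · rw [ha.boundary h0]; simp
  · refine H.stable_position D.small hca (D.chart.mem a haI) ?_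
    have hc2 : ConeSmall α β κ (1 / 2)⁻¹ := by
      have : ((1 : ℝ) / 2)⁻¹ = 2 := by norm_num
      rw [this]; exact D.small.two
    have := abs_le_of_forall_mem_box hφ H.near hc2 (p := c a) (q := S) (ha.real h0).1
      fun t _ => by rw [hφ.fixed hK H.zero]; exact H.mem
    exact this

/-- Virtual saddle: `Xh` changes sign on Σ between `-b / 2` and `b / 2`, as it does for `X₀`.
Boundary saddle: `S` lies in the chart. Real saddle: `LocalModel.exists_stable_point` at the scale
`R₂ / 4`, where points of Σ are covered by the chart. -/
theorem eventually_exists_base (D : SaddleData r h X₀ c ℓ₁ ℓ₂ e₁ e₂ α β κ R R₁ R₂ k b)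
    (hA : IsDiagonal (fderiv ℝ X₀ 0) ℓ₁ ℓ₂ α β) :
    ∀ᶠ X : VField r in 𝓝 X₀, ∃ a,
      IsBase h (cutoff R₁ X) (cutFlow R₁ X) ℓ₁ ℓ₂ R c b (saddle ℓ₁ ℓ₂ R X) a := by
  have hb := D.b_pos
  have hR₂ := D.R₂_pos
  have hR₂R := D.R₂_le
  have hb0 : (0 : ℝ) ∈ Icc (-b) b := ⟨by linarith, hb.le⟩
  have hb1 : b / 2 ∈ Icc (-b) b := ⟨by linarith, by linarith⟩
  have hb2 : -(b / 2) ∈ Icc (-b) b := ⟨by linarith, by linarith⟩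
  have H₀ := D.localModel D.uniform.self_of_nhds (mem_of_mem_nhds (box_mem_nhds D.R_pos)) D.zero
  have hG0 : lieD (cutoff R₁ X₀) h (c 0) = 0 := by rw [D.chart_zero]; exact H₀.lieD_zero
  have hlie : Continuous fun q : VField r × Plane => lieD (cutoff R₁ q.1) h q.2 :=
    ((D.smooth.continuous_fderiv (by simp)).comp continuous_snd).clm_apply
      (VField.continuous_cutoff R₁)
  have hGp : ∀ᶠ X : VField r in 𝓝 X₀, 0 < lieD (cutoff R₁ X) h (c (b / 2)) := by
    have h1 : Continuous fun X : VField r => lieD (cutoff R₁ X) h (c (b / 2)) :=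
      hlie.comp (continuous_id.prodMk continuous_const)
    refine h1.continuousAt.eventually_const_lt ?_
    have := D.chart.lie_lt_lie H₀ D.small hb0 hb1 (half_pos hb) (D.chart_mem _ hb0)
      (D.chart_mem _ hb1)
    rwa [hG0] at this
  have hGn : ∀ᶠ X : VField r in 𝓝 X₀, lieD (cutoff R₁ X) h (c (-(b / 2))) < 0 := by
    have h1 : Continuous fun X : VField r => lieD (cutoff R₁ X) h (c (-(b / 2))) :=
      hlie.comp (continuous_id.prodMk continuous_const)
    refine h1.continuousAt.eventually_lt_const ?_
    have := D.chart.lie_lt_lie H₀ D.small hb2 hb0 (by linarith) (D.chart_mem _ hb2)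
      (D.chart_mem _ hb0)
    rwa [hG0] at this
  have h00 : h 0 = 0 := by
    have := D.chart.mem 0 hb0
    rwa [D.chart_zero] at this
  have hNear : box ℓ₁ ℓ₂ (R₂ / 16) ∩ {p | h p < 1 / 4 * (R₂ / 4 - R₂ / 16)} ∈ 𝓝 (0 : Plane) :=
    inter_mem (box_mem_nhds (by positivity))
      (D.smooth.continuous.continuousAt.eventually_lt_const (by rw [h00]; linarith))
  filter_upwards [hGp, hGn, D.uniform, D.eventually_saddle hA hNear] with X hXp hXn hU hXS
  obtain ⟨hX0, ⟨hSr, hSv⟩, hSR⟩ := hXS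
  set S := saddle ℓ₁ ℓ₂ R X
  have H := D.localModel hU hSR hX0
  have hφ := isGlobalFlow_cutFlow D.one_le R₁ X
  obtain ⟨K, hK⟩ := exists_lipschitzWith_cutoff D.one_le R₁ X
  rcases lt_trichotomy (h S) 0 with h0 | h0 | h0
  · have hcont : ContinuousOn (fun x => lieD (cutoff R₁ X) h (c x)) (Icc (-(b / 2)) (b / 2)) :=
      fun x hx => by
        have hx' : x ∈ Icc (-b) b := ⟨by linarith [hx.1], by linarith [hx.2]⟩
        exact (ContinuousAt.comp (g := lieD (cutoff R₁ X) h)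
          (H.diff_lie _ (D.chart_mem x hx')).continuousAt
          (D.chart.smooth x hx').continuousAt).continuousWithinAt
    obtain ⟨a, ha, ha0⟩ := intermediate_value_Icc (by linarith) hcont ⟨hXn.le, hXp.le⟩
    exact ⟨a, ⟨by linarith [ha.1], by linarith [ha.2]⟩, fun _ => ha0, fun h1 => absurd h1 h0.ne,
      fun h1 => absurd h1 h0.not_gt⟩
  · obtain ⟨a, ha, ha0⟩ := D.surj S (box_mono (by linarith) hSr) h0
    exact ⟨a, ha, fun h1 => absurd h0 h1.ne, fun _ => ha0, fun h1 => absurd h0 h1.ne'⟩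
  · obtain ⟨q, hq0, hq1, hq2⟩ := H.exists_stable_point D.small D.coord hφ hK (v := R₂ / 4)
      (r := R₂ / 16) hSr (by linarith) (by linarith) h0 hSv
    have hqb := hq1 0 le_rfl
    rw [hφ.zero] at hqb
    obtain ⟨a, ha, rfl⟩ := D.surj q (box_mono (by linarith) hqb) hq0
    exact ⟨a, ha, fun h1 => absurd h0 h1.not_gt, fun h1 => absurd h1 h0.ne',
      fun _ => ⟨fun t ht => box_mono (by linarith) (hq1 t ht), hq2⟩⟩

theorem eventually_isBase (D : SaddleData r h X₀ c ℓ₁ ℓ₂ e₁ e₂ α β κ R R₁ R₂ k b)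
    (hA : IsDiagonal (fderiv ℝ X₀ 0) ℓ₁ ℓ₂ α β) :
    ∀ᶠ X : VField r in 𝓝 X₀, IsBase h (cutoff R₁ X) (cutFlow R₁ X) ℓ₁ ℓ₂ R c b
      (saddle ℓ₁ ℓ₂ R X) (base h ℓ₁ ℓ₂ R R₁ c b X) := by
  filter_upwards [D.eventually_exists_base hA] with X hX
  rw [base, dif_pos hX]
  exact hX.choose_spec

theorem tendsto_base (D : SaddleData r h X₀ c ℓ₁ ℓ₂ e₁ e₂ α β κ R R₁ R₂ k b)
    (hA : IsDiagonal (fderiv ℝ X₀ 0) ℓ₁ ℓ₂ α β) :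
    Tendsto (fun X : VField r => base h ℓ₁ ℓ₂ R R₁ c b X) (𝓝 X₀) (𝓝 0) := by
  have hb0 : (0 : ℝ) ∈ Icc (-b) b := ⟨by linarith [D.b_pos], D.b_pos.le⟩
  have hk := D.chart.pos
  have h00 : h 0 = 0 := by
    have := D.chart.mem 0 hb0
    rwa [D.chart_zero] at this
  -- The factor `12 / (11 k)` is the inverse of the lower bound for the slope of `ℓ₁ ∘ c`.
  have hlim : Tendsto (fun X : VField r => 12 / (11 * k) *
      (4 * |h (saddle ℓ₁ ℓ₂ R X)| + |ℓ₁ (saddle ℓ₁ ℓ₂ R X)|)) (𝓝 X₀) (𝓝 0) := by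
    have h1 : Continuous fun p : Plane => 12 / (11 * k) * (4 * |h p| + |ℓ₁ p|) := by
      have := D.smooth.continuous
      fun_prop
    have h2 := (h1.tendsto 0).comp (D.tendsto_saddle hA)
    simpa [h00, Function.comp_def] using h2
  refine squeeze_zero_norm' ?_ hlim
  filter_upwards [D.eventually_isBase hA, D.uniform, D.eventually_saddle hA univ_mem] with X hX hU hS
  obtain ⟨K, hK⟩ := exists_lipschitzWith_cutoff D.one_le R₁ X
  have h1 := D.base_dist_le (isGlobalFlow_cutFlow D.one_le R₁ X) hK
    (D.localModel hU hS.2.2 hS.1) hX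
  set a := base h ℓ₁ ℓ₂ R R₁ c b X
  set S := saddle ℓ₁ ℓ₂ R X
  have haI := Ioo_subset_Icc_self hX.mem
  have h2 : 11 / 12 * k * |a| ≤ |ℓ₁ (c a)| := by
    rcases lt_trichotomy a 0 with h0 | h0 | h0
    · have := (D.chart.fst haI hb0 h0).1
      simp only [D.chart_zero, zero_sub, map_neg] at this
      rw [abs_of_neg h0]
      linarith [neg_abs_le (ℓ₁ (c a))]
    · rw [h0]; simp
    · have := (D.chart.fst hb0 haI h0).1
      simp only [D.chart_zero, sub_zero] at this
      rw [abs_of_pos h0]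
      linarith [le_abs_self (ℓ₁ (c a))]
  have h3 : |ℓ₁ (c a)| ≤ |ℓ₁ (c a - S)| + |ℓ₁ S| := by
    have := abs_add_le (ℓ₁ (c a - S)) (ℓ₁ S)
    rwa [← map_add, sub_add_cancel] at this
  rw [Real.norm_eq_abs, div_mul_eq_mul_div, le_div_iff₀ (by positivity)]
  linarith [abs_nonneg (ℓ₂ (c a - S))]

end SaddleData

end BasePoint

/-! ### The unstable branch of the unperturbed saddle. -/

section SectionPoint

variable {r : ℕ∞} {h : Plane → ℝ} {X₀ : VField r} {c : ℝ → Plane} {ℓ₁ ℓ₂ : Plane →L[ℝ] ℝ}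
  {e₁ e₂ : Plane} {α β κ R R₁ R₂ k b : ℝ}

/-- The branch of the unstable manifold contained in `Σ⁺` crosses the lines `ℓ₁ = v`. -/
theorem SaddleData.exists_section_point
    (D : SaddleData r h X₀ c ℓ₁ ℓ₂ e₁ e₂ α β κ R R₁ R₂ k b) {P : Plane}
    (hpos : ∀ t > 0, 0 < h (cutFlow R₁ X₀ (-t) P))
    (hlim : Tendsto (fun t => cutFlow R₁ X₀ (-t) P) atTop (𝓝 0)) :
    ∃ v₁ > 0, ∀ v ∈ Ioo 0 v₁, ∃ t₀ > 0, ℓ₁ (cutFlow R₁ X₀ (-t₀) P) = v ∧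
      ∀ t ≥ t₀, cutFlow R₁ X₀ (-t) P ∈ box ℓ₁ ℓ₂ v := by
  have hR := D.R_pos
  have h0R : (0 : Plane) ∈ box ℓ₁ ℓ₂ R := mem_of_mem_nhds (box_mem_nhds hR)
  have H := D.localModel D.uniform.self_of_nhds h0R D.zero
  have hφ := isGlobalFlow_cutFlow D.one_le R₁ X₀
  obtain ⟨K, hK⟩ := exists_lipschitzWith_cutoff D.one_le R₁ X₀
  have h00 : h 0 = 0 := by
    have := D.chart.mem 0 ⟨by linarith [D.b_pos], D.b_pos.le⟩
    rwa [D.chart_zero] at this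
  obtain ⟨t₁, ht₁⟩ := eventually_atTop.1 ((hlim.eventually (box_mem_nhds (ℓ₁ := ℓ₁) (ℓ₂ := ℓ₂)
    hR)).and (eventually_gt_atTop 0))
  have hadd : ∀ s t, cutFlow R₁ X₀ s (cutFlow R₁ X₀ (-t) P) = cutFlow R₁ X₀ (-(t - s)) P :=
    fun s t => by rw [← hφ.add hK]; congr 1; ring
  -- Confinement in backward time puts these points in the cone `|ℓ₂| ≤ |ℓ₁| / 2`, where `h` has the
  -- sign of `ℓ₁`; so `h > 0` selects the branch `ℓ₁ > 0`.
  have hcone : ∀ t ≥ t₁, 0 < ℓ₁ (cutFlow R₁ X₀ (-t) P) ∧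
      |ℓ₂ (cutFlow R₁ X₀ (-t) P)| ≤ 1 / 2 * ℓ₁ (cutFlow R₁ X₀ (-t) P) := fun t ht => by
    have hc2 : ConeSmall β α κ (1 / 2)⁻¹ := by
      have : ((1 : ℝ) / 2)⁻¹ = 2 := by norm_num
      rw [this]; exact D.small.two'
    have h1 := abs_le_of_forall_mem_box hφ.reverse H.near.reverse hc2
      (p := cutFlow R₁ X₀ (-t) P) (q := 0)
      (fun s hs => by
        rw [hadd, box_swap]
        exact (ht₁ _ (by linarith)).1)
      (fun s _ => by rw [hφ.fixed hK H.zero, box_swap]; exact h0R)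
    rw [sub_zero] at h1
    have h2 := H.abs_h_sub_le (ht₁ t ht).1 h0R
    rw [h00, sub_zero, sub_zero] at h2
    have h3 := hpos t (ht₁ t ht).2
    set x := ℓ₁ (cutFlow R₁ X₀ (-t) P)
    set y := ℓ₂ (cutFlow R₁ X₀ (-t) P)
    have h4 : κ * (|x| + |y|) ≤ 1 / 12 * (3 / 2 * |x|) := by
      have := D.small.tiny
      gcongr
      linarith
    have h5 : 0 < x := by
      by_contra hcon
      rw [abs_of_nonpos (not_lt.1 hcon)] at h1 h2 h4
      linarith [(abs_le.1 h2).2, (abs_le.1 h1).2]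
    rw [abs_of_pos h5] at h1
    exact ⟨h5, h1⟩
  refine ⟨ℓ₁ (cutFlow R₁ X₀ (-t₁) P), (hcone t₁ le_rfl).1, fun v hv => ?_⟩
  have hlim1 : Tendsto (fun t => ℓ₁ (cutFlow R₁ X₀ (-t) P)) atTop (𝓝 0) := by
    simpa [Function.comp_def] using (ℓ₁.continuous.tendsto 0).comp hlim
  obtain ⟨t₂, ht₂, ht₂'⟩ := ((eventually_ge_atTop t₁).and (hlim1.eventually_lt_const hv.1)).exists
  have hcont : Continuous fun t => ℓ₁ (cutFlow R₁ X₀ (-t) P) :=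
    ℓ₁.continuous.comp ((hφ.continuous_time P).comp continuous_neg)
  obtain ⟨t₀, ht₀, ht₀v⟩ := intermediate_value_Icc' ht₂ hcont.continuousOn ⟨ht₂'.le, hv.2.le⟩
  refine ⟨t₀, (ht₁ t₀ ht₀.1).2, ht₀v, fun t ht => ?_⟩
  obtain ⟨a1, a2⟩ := hcone t (ht₀.1.trans ht)
  have hexp := ((saddlePair hφ H.near (T := t - t₀) (p := cutFlow R₁ X₀ (-t) P) (q := 0)
    (fun s hs => by rw [hadd]; exact (ht₁ _ (by linarith [hs.2, ht₀.1])).1)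
    (fun s _ => by rw [hφ.fixed hK H.zero]; exact h0R)).cone D.small.half (by linarith)
    (by simpa only [hφ.zero, sub_zero] using a1) (by simpa only [hφ.zero, sub_zero] using a2)).2.1
  simp only [hφ.zero, sub_zero, hφ.fixed hK H.zero, hadd, sub_sub_cancel, ht₀v] at hexp
  have h1 : ℓ₁ (cutFlow R₁ X₀ (-t) P) ≤ v := by
    refine le_trans (le_mul_of_one_le_left a1.le (Real.one_le_exp ?_)) hexp
    have := D.small.big.alpha
    exact mul_nonneg (by linarith) (by linarith)
  have hv0 := hv.1
  exact ⟨by rw [abs_of_pos a1]; exact h1, by linarith⟩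

/-- Points of the section with a long backward orbit in the box are close to the unstable manifold
of the unperturbed saddle. -/
theorem SaddleData.eventually_section_dist_lt
    (D : SaddleData r h X₀ c ℓ₁ ℓ₂ e₁ e₂ α β κ R R₁ R₂ k b) {R' η : ℝ} (hR' : 0 < R')
    (hR'R : 2 * R' ≤ R) (hη : 0 < η) {w₀ : Plane}
    (hw₀ : ∀ t ≥ 0, cutFlow R₁ X₀ (-t) w₀ ∈ box ℓ₁ ℓ₂ R') :
    ∃ T₀ : ℝ, ∀ᶠ X : VField r in 𝓝 X₀, ∀ q, ℓ₁ q = ℓ₁ w₀ →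
      (∀ t ∈ Icc 0 T₀, cutFlow R₁ X (-t) q ∈ box ℓ₁ ℓ₂ R') → |ℓ₂ (q - w₀)| < η := by
  have h0R : (0 : Plane) ∈ box ℓ₁ ℓ₂ R := mem_of_mem_nhds (box_mem_nhds D.R_pos)
  have H := D.localModel D.uniform.self_of_nhds h0R D.zero
  have hφ := isGlobalFlow_cutFlow D.one_le R₁ X₀
  obtain ⟨K, hK⟩ := exists_lipschitzWith_cutoff D.one_le R₁ X₀
  have hlim : Tendsto (fun T => Real.exp (β / 2 * T) * η) atTop atTop :=
    (Real.tendsto_exp_atTop.comp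
      (tendsto_id.const_mul_atTop (half_pos D.small.big.beta))).atTop_mul_const hη
  obtain ⟨T₀, hT₀, hT₀'⟩ :=
    ((eventually_ge_atTop 0).and (hlim.eventually_gt_atTop (2 * (2 * R')))).exists
  refine ⟨T₀, ?_⟩
  -- With `T₀` fixed, the flows of `X` and `X₀` differ by less than `R'` on a compact set of times
  -- and points. Hence the `X₀`-orbit of `q` stays in the doubled box and the contraction of `X₀`
  -- itself applies.
  have hclose : ∀ ℓ : Plane →L[ℝ] ℝ, ∀ᶠ X : VField r in 𝓝 X₀, ∀ z ∈ Icc 0 T₀ ×ˢ box ℓ₁ ℓ₂ R',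
      |ℓ (cutFlow R₁ X (-z.1) z.2 - cutFlow R₁ X₀ (-z.1) z.2)| < R' := fun ℓ => by
    refine eventually_forall_of_isCompact (isCompact_Icc.prod (D.coord.isCompact_box R'))
      fun z _ => ?_
    rw [← nhds_prod_eq]
    have h1 : Continuous fun q : VField r × (ℝ × Plane) => cutFlow R₁ q.1 (-q.2.1) q.2.2 :=
      (VField.continuous_cutFlow D.one_le R₁).comp (continuous_fst.prodMk
        ((continuous_fst.comp continuous_snd).neg.prodMk (continuous_snd.comp continuous_snd)))
    have h2 : Continuous fun q : VField r × (ℝ × Plane) => cutFlow R₁ X₀ (-q.2.1) q.2.2 :=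
      (hφ.continuous hK).comp
        ((continuous_fst.comp continuous_snd).neg.prodMk (continuous_snd.comp continuous_snd))
    have h3 : Continuous fun q : VField r × (ℝ × Plane) =>
        |ℓ (cutFlow R₁ q.1 (-q.2.1) q.2.2 - cutFlow R₁ X₀ (-q.2.1) q.2.2)| :=
      (ℓ.continuous.comp (h1.sub h2)).abs
    exact h3.continuousAt.eventually_lt_const (by simpa using hR')
  filter_upwards [hclose ℓ₁, hclose ℓ₂] with X hX₁ hX₂ q hq hqbox
  have hq0 := hqbox 0 ⟨le_rfl, hT₀⟩
  rw [neg_zero, (isGlobalFlow_cutFlow D.one_le R₁ X).zero] at hq0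
  have hq2 : ∀ t ∈ Icc 0 T₀, cutFlow R₁ X₀ (-t) q ∈ box ℓ₁ ℓ₂ (2 * R') := fun t ht => by
    have a1 := abs_lt.1 (hX₁ (t, q) ⟨ht, hq0⟩)
    have a2 := abs_lt.1 (hX₂ (t, q) ⟨ht, hq0⟩)
    obtain ⟨a3, a4⟩ := hqbox t ht
    rw [abs_le] at a3 a4
    simp only [map_sub] at a1 a2
    exact ⟨abs_le.2 ⟨by linarith, by linarith⟩, abs_le.2 ⟨by linarith, by linarith⟩⟩
  have hdist := section_dist_le hφ hK (H.near.mono hR'R) D.small.half' hT₀ hq2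
    (fun t ht => box_mono (by linarith) (hw₀ t ht.1)) hq
  exact lt_of_mul_lt_mul_left (hdist.trans_lt hT₀') (Real.exp_pos _).le

end SectionPoint

/-! ### The first transition map for the field itself. -/

section FirstTransition

variable {r : ℕ∞} {h : Plane → ℝ} {X : VField r} {c : ℝ → Plane} {ℓ₁ ℓ₂ : Plane →L[ℝ] ℝ}
  {e₁ e₂ : Plane} {α β κ R R₁ k b v a η T₀ : ℝ} {S w₀ : Plane} {K : NNReal} {U : Set Plane}

/-- `ρ` is the transition map along `X` from the part `[a, a + δ)` of the switching manifold to the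
arc `s`, with `c a` a fold or a point of the stable manifold of the equilibrium `S`. -/
structure IsFirstTransition (h : Plane → ℝ) (X : Plane → Plane) (U : Set Plane) (c s : ℝ → Plane)
    (η : ℝ) (S : Plane) (a δ : ℝ) (ρ : ℝ → ℝ) : Prop where
  maps : MapsTo ρ (Ico a (a + δ)) (Ioo (-η) η)
  continuous : ContinuousOn ρ (Ico a (a + δ))
  strictMono : StrictMonoOn ρ (Ico a (a + δ))
  transit : ∀ x ∈ Ioo a (a + δ),
    IsTransit X ((posRegion h ∩ U) \ s '' Ioo (-η) η) (c x) (s (ρ x))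
  virtual : h S < 0 → IsVisibleFold h X (c a) ∧
    IsTransit X ((posRegion h ∩ U) \ s '' Ioo (-η) η) (c a) (s (ρ a))
  real : 0 ≤ h S →
    IsSaddleTransit X ((posRegion h ∩ U) \ s '' Ioo (-η) η) S (c a) (s (ρ a))

/-- The transition map `ρ` from the switching manifold to the section `ℓ₁ = v`, in terms of the
given field. -/
theorem TransitionSetup.exists_first_transition
    (D : TransitionSetup h (cutoff R₁ X) (cutFlow R₁ X) ℓ₁ ℓ₂ e₁ e₂ K α β κ R S c v r k b)
    (hR₁ : ∀ p ∈ box ℓ₁ ℓ₂ R, ‖p‖ < R₁) (hU : box ℓ₁ ℓ₂ R ⊆ U) (hw₀ : ℓ₁ w₀ = v)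
    (hloc : ∀ q, ℓ₁ q = v → (∀ t ∈ Icc 0 T₀, cutFlow R₁ X (-t) q ∈ box ℓ₁ ℓ₂ R) →
      |ℓ₂ (q - w₀)| < η)
    (hexp : Real.exp (2 * α * T₀) * (2 * |h S|) < 7 / 8 * v)
    (ha : IsBase h (cutoff R₁ X) (cutFlow R₁ X) ℓ₁ ℓ₂ (v / 8) c b S a)
    (hca : c a ∈ box ℓ₁ ℓ₂ (v / 8)) :
    ∃ δ > 0, a + δ ≤ b ∧ (∀ x ∈ Ico a (a + δ), c x ∈ box ℓ₁ ℓ₂ R) ∧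
      (∀ x ∈ Ioo a (a + δ), 0 < lieD X h (c x)) ∧
      ∃ ρ : ℝ → ℝ, IsFirstTransition h X U c (fun u : ℝ => w₀ - u • e₂) η S a δ ρ := by
  have hv := D.v_pos
  have hvR := D.radius.2.1
  have haI := Ioo_subset_Icc_self ha.mem
  -- The arc lies on `ℓ₁ = v`, so an orbit with `ℓ₁ < v` has not met it yet.
  have hsec : ∀ p, ℓ₁ p ≠ v → p ∉ (fun u : ℝ => w₀ - u • e₂) '' Ioo (-η) η := by
    rintro _ hp ⟨u, -, rfl⟩
    refine hp ?_
    simp [D.coord.l12, hw₀]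
  have hlie : ∀ p ∈ box ℓ₁ ℓ₂ R, lieD (cutoff R₁ X) h p = lieD X h p := fun p hp => by
    rw [lieD, lieD, cutoff_eq X (hR₁ p hp).le]
  have hcc : ContinuousAt c a := (D.chart.smooth a haI).continuousAt
  obtain ⟨δ₁, hδ₁, hball⟩ := Metric.eventually_nhds_iff.1
    ((((ℓ₁.continuous.continuousAt.comp hcc).abs.eventually_lt_const
      (show |ℓ₁ (c a)| < v by linarith [hca.1]))).and
    ((ℓ₂.continuous.continuousAt.comp hcc).abs.eventually_lt_const
      (show |ℓ₂ (c a)| < v by linarith [hca.2])))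
  set δ := min δ₁ (b - a)
  have hδ : 0 < δ := lt_min hδ₁ (sub_pos.2 ha.mem.2)
  have hδ1 : δ ≤ δ₁ := min_le_left _ _
  have hδb : a + δ ≤ b := by linarith [min_le_right δ₁ (b - a)]
  have hc : ∀ x ∈ Ico a (a + δ), c x ∈ box ℓ₁ ℓ₂ R ∧ ℓ₁ (c x) < v := fun x hx => by
    obtain ⟨h1, h2⟩ := hball (y := x) (by
      rw [Real.dist_eq, abs_of_nonneg (by linarith [hx.1])]; linarith [hx.2])
    simp only [Function.comp_apply] at h1 h2
    exact ⟨⟨by linarith, by linarith⟩, (le_abs_self _).trans_lt h1⟩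
  have htransit : ∀ x T u : ℝ, IsExit h (cutFlow R₁ X) ℓ₁ ℓ₂ v R (c x) T →
      cutFlow R₁ X T (c x) = w₀ - u • e₂ → IsTransit X
        ((posRegion h ∩ U) \ (fun u : ℝ => w₀ - u • e₂) '' Ioo (-η) η) (c x) (w₀ - u • e₂) :=
    fun x T u hx hq => D.flow.isTransit hx.pos (fun t ht => (hR₁ _ (hx.box t ht)).le) hq
      fun t ht => ⟨⟨hx.h_pos t ⟨ht.1, ht.2.le⟩, hU (hx.box t ⟨ht.1.le, ht.2.le⟩)⟩,
        hsec _ (hx.before t ⟨ht.1.le, ht.2⟩).ne⟩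
  rcases lt_or_ge (h S) 0 with h0 | h0
  · obtain ⟨δ', hδ', hδ'δ, T, ρ, ⟨a1, a2, a3⟩, a4, a5⟩ :=
      D.exists_transition_virtual hw₀ hloc hexp h0 haI hδ hδb hc (ha.fold h0)
    have hsub : ∀ x ∈ Ico a (a + δ'), x ∈ Ico a (a + δ) := fun x hx =>
      ⟨hx.1, hx.2.trans_le (by linarith)⟩
    refine ⟨δ', hδ', by linarith, fun x hx => (hc x (hsub x hx)).1,
      fun x hx => ?_, ρ, fun x hx => abs_lt.1 (a1 x hx), a2, a3, fun x hx => ?_, fun _ => ⟨?_, ?_⟩,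
      fun h1 => absurd h0 h1.not_gt⟩
    · rw [← hlie _ (hc x (hsub x (Ioo_subset_Ico_self hx))).1]; exact a5 x hx
    · obtain ⟨b1, b2⟩ := a4 x (Ioo_subset_Ico_self hx)
      exact htransit x _ _ b1 b2
    · have hcaR := (hc a ⟨le_rfl, by linarith⟩).1
      have hfold := ha.fold h0
      obtain ⟨f1, f2, f3, -⟩ :=
        D.model.fold_position D.small hcaR (D.chart.mem a haI) h0 hfold
      have h1 := D.model.neg_mul_lt_lieD_lieD D.small hcaR f1 (by rwa [abs_of_pos f2])
      rw [hfold, mul_zero] at h1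
      have heq : lieD (cutoff R₁ X) h =ᶠ[𝓝 (c a)] lieD X h :=
        (cutoff_eventuallyEq X (hR₁ _ hcaR)).mono fun q hq => by rw [lieD, lieD, hq]
      refine ⟨D.chart.mem a haI, by rw [← hlie _ hcaR]; exact hfold, ?_⟩
      rw [lieD, heq.fderiv_eq, cutoff_eq X (hR₁ _ hcaR).le] at h1
      exact h1
    · obtain ⟨b1, b2⟩ := a4 a ⟨le_rfl, by linarith⟩
      exact htransit a _ _ b1 b2
  · have hreal : ∀ t ≥ 0, cutFlow R₁ X t (c a) ∈ box ℓ₁ ℓ₂ (v / 8) ∧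
        0 ≤ h (cutFlow R₁ X t (c a)) := fun t ht => by
      rcases h0.eq_or_lt with h1 | h1
      · rw [ha.boundary h1.symm, D.flow.fixed D.lipschitz D.model.zero]
        exact ⟨D.mem, h0⟩
      · refine ⟨(ha.real h1).1 t ht, ?_⟩
        rcases ht.eq_or_lt with rfl | ht
        · rw [D.flow.zero, D.chart.mem a haI]
        · exact ((ha.real h1).2 t ht).le
    obtain ⟨δ', hδ', hδ'δ, T, ρ, ⟨a1, a2, a3⟩, a4, a5, a6, a7⟩ :=
      D.exists_transition_real hw₀ hloc h0 haI hδ hδb hc hreal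
    have hsub : ∀ x ∈ Ico a (a + δ'), x ∈ Ico a (a + δ) := fun x hx =>
      ⟨hx.1, hx.2.trans_le (by linarith)⟩
    refine ⟨δ', hδ', by linarith, fun x hx => (hc x (hsub x hx)).1,
      fun x hx => ?_, ρ, fun x hx => abs_lt.1 (a1 x hx), a2, a3, fun x hx => ?_,
      fun h1 => absurd h1 h0.not_gt, fun _ => ⟨?_, ?_⟩⟩
    · rw [← hlie _ (hc x (hsub x (Ioo_subset_Ico_self hx))).1]; exact a5 x hx
    · obtain ⟨b1, b2⟩ := a4 x hx
      exact htransit x _ _ b1 b2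
    · rcases h0.eq_or_lt with h1 | h1
      · exact Or.inl (ha.boundary h1.symm)
      · right
        have hbox : ∀ t ≥ 0, cutFlow R₁ X t (c a) ∈ box ℓ₁ ℓ₂ R := fun t ht =>
          box_mono (by linarith) (hreal t ht).1
        have hlim := tendsto_of_forall_mem_box D.coord D.flow D.lipschitz D.model.near (m := 1 / 2)
          (by norm_num; exact D.small.two) D.small.half' hbox D.model.zero D.model.mem
        refine D.flow.goesTo (fun t ht => (hR₁ _ (hbox t ht)).le) hlim fun t ht =>
          ⟨⟨(ha.real h1).2 t ht, hU (hbox t (le_of_lt ht))⟩, hsec _ ?_⟩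
        have := (abs_le.1 (hreal t (le_of_lt ht)).1.1).2
        exact (by linarith : ℓ₁ (cutFlow R₁ X t (c a)) < v).ne
    · exact D.flow.comesFrom (fun t ht => (hR₁ _ (a6 t ht).1).le) a7 fun t ht =>
        ⟨⟨(a6 t (le_of_lt ht)).2.1, hU (a6 t (le_of_lt ht)).1⟩,
          hsec _ ((a6 t (le_of_lt ht)).2.2 ht).ne⟩

end FirstTransition

/-! ### Orientation reversing transits. -/

section Reversing

variable {r : ℕ∞} {h g : Plane → ℝ}

theorem continuousAt_det2_comp {X₀ : VField r} {e : ℝ → Plane} (he : ContinuousAt e 0)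
    (he' : ContinuousAt (deriv e) 0) :
    ContinuousAt (fun q : VField r × ℝ => det2 (q.1 (e q.2)) (deriv e q.2)) (X₀, 0) := by
  have h1 : ContinuousAt (fun q : VField r × ℝ => q.1 (e q.2)) (X₀, 0) :=
    ContinuousAt.comp (g := fun q : VField r × Plane => q.1 q.2) (f := fun q : VField r × ℝ => (q.1, e q.2))
      VField.continuous_apply.continuousAt
      (continuousAt_fst.prodMk (ContinuousAt.comp (g := e) (f := Prod.snd) he continuousAt_snd))
  have h2 : ContinuousAt (fun q : VField r × ℝ => deriv e q.2) (X₀, 0) :=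
    ContinuousAt.comp (g := deriv e) (f := Prod.snd) he' continuousAt_snd
  have h3 : ∀ (f : VField r × ℝ → Plane) (i : Fin 2), ContinuousAt f (X₀, 0) →
      ContinuousAt (fun q => f q i) (X₀, 0) := fun f i hf =>
    ((EuclideanSpace.proj i : Plane →L[ℝ] ℝ).continuous.continuousAt).comp hf
  exact ((h3 _ 0 h1).mul (h3 _ 1 h2)).sub ((h3 _ 1 h1).mul (h3 _ 0 h2))

/-- The orbits near an orbit that runs in `{g > 0}` from an arc to a point of transversal
intersection with `{g = 0}` define an orientation reversing transition map, if the arcs have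
opposite orientations. -/
theorem exists_reversing_transit (hr : 1 ≤ r) {X₀ : VField r} (hg : ContDiff ℝ ∞ g)
    {s : ℝ → Plane} (hs : ∀ᶠ u in 𝓝 0, ContDiffAt ℝ ∞ s u) {Q : Plane}
    (htransit : IsTransit X₀ {x | 0 < g x} (s 0) Q) (hQ' : lieD X₀ g Q < 0)
    (hstart : 0 < g (s 0) ∨ 0 < lieD X₀ g (s 0) ∧ ∀ᶠ u in 𝓝 0, g (s u) = 0)
    {e : ℝ → Plane} {ε : ℝ} (he : IsSigmaChart g Q e ε)
    (horient : det2 (X₀ (s 0)) (deriv s 0) * det2 (X₀ Q) (deriv e 0) < 0)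
    {N : Set ℝ} (hN : N ∈ 𝓝 0) :
    ∃ η₀ > 0, ∀ η ≤ η₀, ∀ᶠ X : VField r in 𝓝 X₀, ∃ ρ : ℝ → ℝ,
      MapsTo ρ (Ioo (-η) η) N ∧ IsOrientationReversingDiffeo r ρ (Ioo (-η) η) ∧
      ∀ u ∈ Ioo (-η) η, det2 (X (s u)) (deriv s u) ≠ 0 ∧
        IsTransit X {x | 0 < g x} (s u) (e (ρ u)) ∧ lieD X g (e (ρ u)) < 0 := by
  obtain ⟨B, T₀, hT₀, hB⟩ := htransit.exists_flow hr
  obtain ⟨b1, b2, b3⟩ := hB (B + 1) (by linarith)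
  have b1' : ∀ t ∈ Icc 0 T₀, ‖cutFlow (B + 1) X₀ t (s 0)‖ < B + 1 := fun t ht =>
    (b1 t ht).trans_lt (lt_add_one B)
  have hs0 : ‖s 0‖ ≤ B + 1 := by
    have := (b1' 0 ⟨le_rfl, hT₀.le⟩).le
    rwa [(isGlobalFlow_cutFlow hr (B + 1) X₀).zero] at this
  have hQn : ‖Q‖ ≤ B + 1 := by rw [← b2]; exact (b1' T₀ ⟨hT₀.le, le_rfl⟩).le
  have hlie : ∀ (X : VField r) p, ‖p‖ ≤ B + 1 → lieD (cutoff (B + 1) X) g p = lieD X g p :=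
    fun X p hp => by rw [lieD, lieD, cutoff_eq X hp]
  have hQ0 : g Q = 0 := by
    have := he.mem 0 he.zero_mem
    rwa [he.center] at this
  have hdg : fderiv ℝ g Q ≠ 0 := fun h0 => by simp [lieD, h0] at hQ'
  obtain ⟨W, hWQ, hW⟩ := he.exists_coordinate hg hdg
  -- Multiplied by `σ`, the orientation determinant is negative on the starting arc and positive on
  -- the arriving one, for all nearby fields and parameters; the relation between them then gives a
  -- negative derivative.
  set σ := det2 (X₀ Q) (deriv e 0) with hσ
  have hdets : ∀ᶠ q : VField r × ℝ in 𝓝 X₀ ×ˢ 𝓝 0,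
      det2 (q.1 (s q.2)) (deriv s q.2) * σ < 0 := by
    rw [← nhds_prod_eq]
    have hs' := hs.self_of_nhds
    refine ((continuousAt_det2_comp hs'.continuousAt ?_).mul_const σ).eventually_lt_const horient
    exact (hs'.fderiv_right (m := 0) (by simp)).continuousAt.clm_apply continuousAt_const
  have hdete : ∀ᶠ q : VField r × ℝ in 𝓝 X₀ ×ˢ 𝓝 0,
      0 < det2 (q.1 (e q.2)) (deriv e q.2) * σ := by
    rw [← nhds_prod_eq]
    refine ((continuousAt_det2_comp (he.contDiffAt he.zero_mem).continuousAt
      he.continuousAt_deriv).mul_const σ).eventually_const_lt ?_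
    simp only [he.center]
    refine mul_self_pos.2 fun h0 => ?_
    rw [hσ, h0, mul_zero] at horient
    exact lt_irrefl _ horient
  obtain ⟨A₁, hA₁, B₁, hB₁, hAB₁⟩ := eventually_prod_iff.1 hdets
  obtain ⟨A₂, hA₂, B₂, hB₂, hAB₂⟩ := eventually_prod_iff.1 hdete
  obtain ⟨η₁, hη₁, hfam⟩ := exists_transit_family hr hg hs hT₀ b2 hQ0 (by rwa [hlie _ _ hQn]) b3 b1'
    (by rwa [hlie _ _ hs0]) hWQ hW
    ((Ioo_mem_nhds he.zero_mem.1 he.zero_mem.2 |> Filter.eventually_of_mem <| fun x hx =>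
      (he.contDiffAt hx).differentiableAt (by simp)))
    (inter_mem hN hB₂)
  obtain ⟨η₂, hη₂, hball⟩ := Metric.eventually_nhds_iff.1 hB₁
  refine ⟨min η₁ η₂, lt_min hη₁ hη₂, fun η hη => ?_⟩
  filter_upwards [hA₁, hA₂, hfam] with X hX₁ hX₂ ⟨ρ, τ, hρ⟩
  have hsub : ∀ u ∈ Ioo (-η) η, u ∈ Ioo (-η₁) η₁ ∧ B₁ u := fun u hu => by
    have h1 := min_le_left η₁ η₂
    have h2 := min_le_right η₁ η₂
    refine ⟨⟨by linarith [hu.1], by linarith [hu.2]⟩, hball ?_⟩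
    rw [Real.dist_eq, sub_zero, abs_lt]
    exact ⟨by linarith [hu.1], by linarith [hu.2]⟩
  have key : ∀ u ∈ Ioo (-η) η, det2 (X (s u)) (deriv s u) * σ < 0 := fun u hu =>
    hAB₁ hX₁ (hsub u hu).2
  have hend : ∀ u ∈ Ioo (-η) η, ‖s u‖ ≤ B + 1 ∧ ‖e (ρ u)‖ ≤ B + 1 := fun u hu => by
    have H := hρ u (hsub u hu).1
    have h1 := H.norm_lt 0 ⟨le_rfl, H.pos.le⟩
    have h2 := H.norm_lt (τ u) ⟨H.pos.le, le_rfl⟩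
    rw [(isGlobalFlow_cutFlow hr (B + 1) X).zero] at h1
    rw [H.eq] at h2
    exact ⟨h1.le, h2.le⟩
  refine ⟨ρ, fun u hu => (hρ u (hsub u hu).1).mem.1,
    isOrientationReversingDiffeo_of_deriv_neg hr (fun u hu => (hρ u (hsub u hu).1).smooth)
      fun u hu => ?_, fun u hu => ⟨?_, ?_, ?_⟩⟩
  · have H := hρ u (hsub u hu).1
    obtain ⟨J, hJ, h1⟩ := H.orient
    rw [cutoff_eq X (hend u hu).1, cutoff_eq X (hend u hu).2] at h1
    have h2 := key u hu
    have h3 := hAB₂ hX₂ H.mem.2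
    simp only at h2 h3
    have h4 : deriv ρ u * (det2 (X (e (ρ u))) (deriv e (ρ u)) * σ) < 0 := by
      rw [← mul_assoc, h1, mul_assoc]
      exact mul_neg_of_pos_of_neg hJ h2
    exact neg_of_mul_neg_left h4 h3.le
  · intro h0
    have := key u hu
    rw [h0, zero_mul] at this
    exact lt_irrefl _ this
  · have H := hρ u (hsub u hu).1
    exact (isGlobalFlow_cutFlow hr (B + 1) X).isTransit H.pos (fun t ht => (H.norm_lt t ht).le) H.eq
      H.region
  · have H := hρ u (hsub u hu).1
    rw [← hlie X _ (hend u hu).2]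
    exact H.lie_neg

/-- The transition along `Y` in `Σ⁻` from `Σ` near `P` to `Σ` near `S`. -/
theorem exists_return_transit (hr : 1 ≤ r) {Y₀ : VField r} (hh : ContDiff ℝ ∞ h) {S P : Plane}
    {c cP : ℝ → Plane} {ε εP : ℝ} (hc : IsSigmaChart h S c ε) (hcP : IsSigmaChart h P cP εP)
    (hS : 0 < lieD Y₀ h S) (hP : lieD Y₀ h P < 0)
    (htransit : IsTransit Y₀ (negRegion h) P S)
    (horient : 0 < sigmaOrient h S (deriv c 0) * sigmaOrient h P (deriv cP 0)) :
    ∃ η₀ > 0, ∀ η ≤ η₀, ∀ᶠ Y : VField r in 𝓝 Y₀, ∃ ρ : ℝ → ℝ,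
      MapsTo ρ (Ioo (-η) η) (Ioo (-ε) ε) ∧ IsOrientationReversingDiffeo r ρ (Ioo (-η) η) ∧
      ∀ w ∈ Ioo (-η) η, IsTransit Y (negRegion h) (cP w) (c (ρ w)) := by
  have hneg : {x | 0 < (-h) x} = negRegion h := by
    ext x; simp [negRegion]
  have hlie : ∀ p, lieD Y₀ (-h) p = -lieD Y₀ h p := fun p => by
    simp [lieD, fderiv_neg]
  have hc' : IsSigmaChart (-h) S c ε := ⟨hc.pos, hc.center, hc.smooth, hc.inj, hc.immersion,
    fun x hx => by
      have := hc.mem x hx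
      simpa [switching] using this⟩
  have hIoo : ∀ᶠ u in 𝓝 (0 : ℝ), u ∈ Ioo (-εP) εP := Ioo_mem_nhds hcP.zero_mem.1 hcP.zero_mem.2
  have hdet : ∀ {p v : Plane}, fderiv ℝ h p v = 0 → lieD Y₀ h p ≠ 0 → ∃ A > 0,
      det2 (Y₀ p) v * A = lieD Y₀ h p * sigmaOrient h p v := fun {p v} hv hp =>
    ⟨_, gradient_sq_pos (h := h) (p := p) (fun h0 => hp (by simp [lieD, h0])),
      det2_mul_sigmaOrient hv⟩
  have hv := hc.fderiv_deriv hh hc.zero_mem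
  have hvP := hcP.fderiv_deriv hh hcP.zero_mem
  rw [hc.center] at hv
  rw [hcP.center] at hvP
  obtain ⟨A, hA, hA'⟩ := hdet hv hS.ne'
  obtain ⟨B, hB, hB'⟩ := hdet hvP hP.ne
  -- Σ⁻ is the positive region of `-h`. The field enters it at `P` and leaves it at `S`, so charts
  -- of the same orientation yield determinants of opposite signs.
  obtain ⟨η₀, hη₀, H⟩ := exists_reversing_transit hr (g := -h) (X₀ := Y₀) (s := cP) (Q := S) hh.neg
    (hIoo.mono fun u hu => hcP.contDiffAt hu) (by rwa [hneg, hcP.center])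
    (by rw [hlie]; linarith)
    (Or.inr ⟨by rw [hlie, hcP.center]; linarith, hIoo.mono fun u hu => by
      have := hcP.mem u hu
      simpa [switching] using this⟩) hc' (by
      rw [hcP.center]
      have h1 : det2 (Y₀ P) (deriv cP 0) * det2 (Y₀ S) (deriv c 0) * (A * B) =
          lieD Y₀ h S * lieD Y₀ h P *
            (sigmaOrient h S (deriv c 0) * sigmaOrient h P (deriv cP 0)) := by
        linear_combination (det2 (Y₀ P) (deriv cP 0) * B) * hA' +
          lieD Y₀ h S * sigmaOrient h S (deriv c 0) * hB'
      have h2 := mul_neg_of_neg_of_pos (mul_neg_of_pos_of_neg hS hP) horient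
      rw [← h1] at h2
      exact neg_of_mul_neg_left h2 (mul_pos hA hB).le)
    (Ioo_mem_nhds hc.zero_mem.1 hc.zero_mem.2)
  refine ⟨η₀, hη₀, fun η hη => (H η hη).mono fun Y ⟨ρ, h1, h2, h3⟩ => ⟨ρ, h1, h2, fun w hw => ?_⟩⟩
  have := (h3 w hw).2.1
  rwa [hneg] at this

end Reversing

/-! ### The section and its transition map, uniformly for nearby fields. -/

section Section

variable {r : ℕ∞} {h : Plane → ℝ} {X₀ : VField r} {c : ℝ → Plane} {ℓ₁ ℓ₂ : Plane →L[ℝ] ℝ}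
  {e₁ e₂ : Plane} {α β κ R R₁ R₂ k b : ℝ}

/-- In the real case the stable coordinate of the orbit relative to `S` never exceeds its initial
value, at most `4 |h S|`. A base point chosen in the fixed box thus also serves in smaller ones, so
the base point and the saddle do not depend on the neighbourhood `U`. -/
theorem SaddleData.isBase_of_le (D : SaddleData r h X₀ c ℓ₁ ℓ₂ e₁ e₂ α β κ R R₁ R₂ k b)
    {V : Plane → Plane} {φ : ℝ → Plane → Plane} {K : NNReal} (hφ : IsGlobalFlow V φ)
    (hK : LipschitzWith K V) {S : Plane} (H : LocalModel h V ℓ₁ ℓ₂ α β κ R S) {a : ℝ}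
    (ha : IsBase h V φ ℓ₁ ℓ₂ R c b S a) {R' : ℝ} (hS : S ∈ box ℓ₁ ℓ₂ (R' / 2))
    (hS' : 8 * |h S| ≤ R') : IsBase h V φ ℓ₁ ℓ₂ R' c b S a ∧ c a ∈ box ℓ₁ ℓ₂ R' := by
  have hdist := D.base_dist_le hφ hK H ha
  have hin : ∀ p, |ℓ₁ (p - S)| ≤ R' / 2 → |ℓ₂ (p - S)| ≤ R' / 2 → p ∈ box ℓ₁ ℓ₂ R' :=
    fun p h1 h2 => by
      have a1 := abs_add_le (ℓ₁ (p - S)) (ℓ₁ S)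
      have a2 := abs_add_le (ℓ₂ (p - S)) (ℓ₂ S)
      rw [← map_add, sub_add_cancel] at a1 a2
      exact ⟨by linarith [hS.1], by linarith [hS.2]⟩
  have h1 := abs_nonneg (ℓ₁ (c a - S))
  have h2 := abs_nonneg (ℓ₂ (c a - S))
  refine ⟨⟨ha.mem, ha.fold, ha.boundary, fun h0 => ⟨fun t ht => ?_, (ha.real h0).2⟩⟩,
    hin _ (by linarith) (by linarith)⟩
  have h3 := abs_le_exp_of_forall_mem_box hφ hK H.near (m := 1 / 2)
    (by norm_num; exact D.small.two) D.small.half' (ha.real h0).1 H.zero H.mem ht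
  have h4 : Real.exp (-(β / 2 * t)) * |ℓ₂ (c a - S)| ≤ |ℓ₂ (c a - S)| := by
    refine mul_le_of_le_one_left h2 (Real.exp_le_one_iff.2 ?_)
    have := D.small.big.beta
    have : 0 ≤ β / 2 * t := by positivity
    linarith
  exact hin _ (by linarith [h3.1, h3.2, abs_nonneg (ℓ₂ (φ t (c a) - S))]) (by linarith [h3.2])

/-- A section to the branch of the unstable manifold through `P`, and the transition map from the
switching manifold to it, for all fields close to `X₀`. -/
theorem SaddleData.exists_section (D : SaddleData r h X₀ c ℓ₁ ℓ₂ e₁ e₂ α β κ R R₁ R₂ k b)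
    (hA : IsDiagonal (fderiv ℝ X₀ 0) ℓ₁ ℓ₂ α β) {P : Plane}
    (hpos : ∀ t > 0, 0 < h (cutFlow R₁ X₀ (-t) P))
    (hlim : Tendsto (fun t => cutFlow R₁ X₀ (-t) P) atTop (𝓝 0)) {U : Set Plane} (hU : U ∈ 𝓝 0)
    {N : Set Plane} (hN : N ∈ 𝓝 0) :
    ∃ (t₀ η₁ : ℝ) (w₀ : Plane), 0 < t₀ ∧ 0 < η₁ ∧ cutFlow R₁ X₀ (-t₀) P = w₀ ∧
      0 < ℓ₁ (X₀ w₀) ∧ (∀ u ∈ Ioo (-η₁) η₁, w₀ - u • e₂ ∈ posRegion h ∩ U) ∧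
      ∀ η > 0, ∀ᶠ X : VField r in 𝓝 X₀,
        IsHyperbolicSaddle X (saddle ℓ₁ ℓ₂ R X) ∧ saddle ℓ₁ ℓ₂ R X ∈ U ∧
        base h ℓ₁ ℓ₂ R R₁ c b X ∈ Ioo (-b) b ∧
        (h (saddle ℓ₁ ℓ₂ R X) = 0 → c (base h ℓ₁ ℓ₂ R R₁ c b X) = saddle ℓ₁ ℓ₂ R X) ∧
        ∃ δ > 0, base h ℓ₁ ℓ₂ R R₁ c b X + δ ≤ b ∧
          (∀ x ∈ Ico (base h ℓ₁ ℓ₂ R R₁ c b X) (base h ℓ₁ ℓ₂ R R₁ c b X + δ), c x ∈ U ∩ N) ∧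
          (∀ x ∈ Ioo (base h ℓ₁ ℓ₂ R R₁ c b X) (base h ℓ₁ ℓ₂ R R₁ c b X + δ),
            0 < lieD X h (c x)) ∧
          ∃ ρ : ℝ → ℝ, IsFirstTransition h X U c (fun u : ℝ => w₀ - u • e₂) η
            (saddle ℓ₁ ℓ₂ R X) (base h ℓ₁ ℓ₂ R R₁ c b X) δ ρ := by
  have hα := D.small.big.alpha
  have hβ := D.small.big.beta
  have hM : 0 < 2 * α / β := by positivity
  set C := 8 * (1 + (2 + 2 * α / β)) with hC
  have hC8 : 8 < C := by rw [hC]; linarith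
  obtain ⟨v₁, hv₁, hsec⟩ := D.exists_section_point hpos hlim
  obtain ⟨RU, hRU, hbox⟩ := D.coord.exists_box_subset (inter_mem hU hN)
  -- Three demands: the unstable branch crosses `ℓ₁ = v`, the box of radius `C v` lies in `U ∩ N`,
  -- and its double fits in the box of radius `R`, for the comparison with `X₀`.
  set v := min (v₁ / 2) (min (RU / C) (R / (2 * C))) with hv
  have hv0 : 0 < v := by
    have := D.R_pos
    have : 0 < C := by linarith
    exact lt_min (by linarith) (lt_min (by positivity) (by positivity))
  have hvv₁ : v < v₁ := (min_le_left _ _).trans_lt (by linarith)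
  have hvU : C * v ≤ RU := by
    rw [mul_comm, ← le_div_iff₀ (by linarith)]
    exact (min_le_right _ _).trans (min_le_left _ _)
  have hvR : 2 * (C * v) ≤ R := by
    have : v ≤ R / (2 * C) := (min_le_right _ _).trans (min_le_right _ _)
    rw [le_div_iff₀ (by linarith)] at this
    linarith
  have hCv : 8 * v < C * v := mul_lt_mul_of_pos_right hC8 hv0
  obtain ⟨t₀, ht₀, hv₀, ht₀'⟩ := hsec v ⟨hv0, hvv₁⟩
  set w₀ := cutFlow R₁ X₀ (-t₀) P with hw₀
  have hφ := isGlobalFlow_cutFlow D.one_le R₁ X₀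
  obtain ⟨K, hK⟩ := exists_lipschitzWith_cutoff D.one_le R₁ X₀
  have hw₀v : w₀ ∈ box ℓ₁ ℓ₂ v := ht₀' t₀ le_rfl
  have hw₀R : w₀ ∈ box ℓ₁ ℓ₂ (C * v) := box_mono (by linarith) hw₀v
  have hRR₁ : ∀ p ∈ box ℓ₁ ℓ₂ (C * v), ‖p‖ < R₁ := fun p hp =>
    D.norm_lt p (box_mono (by linarith) hp)
  have h0R : ∀ R > 0, (0 : Plane) ∈ box ℓ₁ ℓ₂ R := fun R hR => mem_of_mem_nhds (box_mem_nhds hR)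
  have H₀ := D.localModel D.uniform.self_of_nhds (h0R R D.R_pos) D.zero
  have hspeed := (H₀.mono (by linarith) (h0R (C * v) (by linarith))).exit_speed D.small hv0 rfl
    (h0R _ (by linarith)) hw₀R hv₀
  rw [cutoff_eq X₀ (hRR₁ _ hw₀R).le] at hspeed
  have hev : ∀ᶠ u in 𝓝 (0 : ℝ), 0 < h (w₀ - u • e₂) := by
    have h1 : Continuous fun u : ℝ => h (w₀ - u • e₂) := D.smooth.continuous.comp (by fun_prop)
    refine h1.continuousAt.eventually_const_lt ?_
    simpa using hpos t₀ ht₀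
  obtain ⟨η₁, hη₁, hball⟩ := Metric.eventually_nhds_iff.1 hev
  refine ⟨t₀, min η₁ v, w₀, ht₀, lt_min hη₁ hv0, rfl, hspeed, fun u hu => ?_, fun η hη => ?_⟩
  · have h1 : |u| < min η₁ v := abs_lt.2 hu
    have h2 := h1.trans_le (min_le_right _ _)
    refine ⟨hball (by rw [Real.dist_eq, sub_zero]; exact h1.trans_le (min_le_left _ _)),
      (hbox ⟨?_, ?_⟩).1⟩
    · simp only [map_sub, map_smul, D.coord.l12, smul_zero, sub_zero]
      linarith [hw₀v.1]
    · simp only [map_sub, map_smul, D.coord.l22, smul_eq_mul, mul_one]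
      have := abs_sub (ℓ₂ w₀) u
      linarith [hw₀v.2]
  obtain ⟨T₀, hT₀⟩ := D.eventually_section_dist_lt (R' := C * v) (by linarith) hvR hη (w₀ := w₀)
    fun t ht => by
      rw [hw₀, ← hφ.add hK, ← neg_add]
      exact box_mono (by linarith) (ht₀' _ (by linarith))
  -- With `v` and `T₀` fixed, the saddle is confined so that the base point falls in the box of
  -- radius `v / 8` and no orbit from the fold exits before `T₀`.
  have hN' : U ∩ box ℓ₁ ℓ₂ (v / 16) ∩ {p | 8 * |h p| ≤ v / 8} ∩
      {p | Real.exp (2 * α * T₀) * (2 * |h p|) < 7 / 8 * v} ∈ 𝓝 (0 : Plane) := by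
    have h0 : h 0 = 0 := by
      have := D.chart.mem 0 ⟨by linarith [D.b_pos], D.b_pos.le⟩
      rwa [D.chart_zero] at this
    have hcont := D.smooth.continuous
    refine inter_mem (inter_mem (inter_mem hU (box_mem_nhds (by linarith))) ?_) ?_
    · have h1 : Continuous fun p => 8 * |h p| := by fun_prop
      exact (h1.continuousAt.eventually_lt_const (u := v / 8)
        (by simp only [h0, abs_zero]; linarith)).mono fun p hp => le_of_lt hp
    · have h1 : Continuous fun p => Real.exp (2 * α * T₀) * (2 * |h p|) := by fun_prop
      exact h1.continuousAt.eventually_lt_const (by simp only [h0, abs_zero, mul_zero]; linarith)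
  filter_upwards [D.uniform, D.eventually_saddle hA hN', D.eventually_isBase hA, hT₀]
    with X hUX ⟨hX0, ⟨⟨⟨hSU, hSv⟩, hSh⟩, hSexp⟩, hSR⟩ ha hloc
  set S := saddle ℓ₁ ℓ₂ R X
  set a := base h ℓ₁ ℓ₂ R R₁ c b X
  have hφX := isGlobalFlow_cutFlow D.one_le R₁ X
  obtain ⟨KX, hKX⟩ := exists_lipschitzWith_cutoff D.one_le R₁ X
  have H := D.localModel hUX hSR hX0
  have hSv8 : S ∈ box ℓ₁ ℓ₂ (v / 8) := box_mono (by linarith) hSv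
  have hSv16 : S ∈ box ℓ₁ ℓ₂ (v / 8 / 2) := box_mono (by linarith) hSv
  obtain ⟨ha', hca⟩ := D.isBase_of_le hφX hKX H ha hSv16 hSh
  have DT : TransitionSetup h (cutoff R₁ X) (cutFlow R₁ X) ℓ₁ ℓ₂ e₁ e₂ KX α β κ (C * v) S c v r
      k b :=
    { model := H.mono (by linarith) (box_mono (by linarith) hSv)
      small := D.small
      coord := D.coord
      flow := hφX
      lipschitz := hKX
      one_le := D.one_le
      contDiff := contDiff_cutoff R₁ X
      chart := D.chart
      v_pos := hv0
      R_eq := rfl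
      mem := hSv8 }
  obtain ⟨δ, hδ, hδb, hδc, hδl, hρ⟩ := DT.exists_first_transition (U := U) hRR₁
    (fun p hp => (hbox (box_mono hvU hp)).1) hv₀ (fun q hq => hloc q (by rw [hq, hv₀])) hSexp ha' hca
  exact ⟨isHyperbolicSaddle_of_isAlmostDiagonal D.coord D.small hX0 (hUX.field S hSR), hSU, ha.mem,
    ha.boundary, δ, hδ, hδb, fun x hx => hbox (box_mono hvU (hδc x hx)), hδl, hρ⟩

end Section

/-! ### Assembly. -/

theorem exists_saddleData {r : ℕ∞} (hr : 1 ≤ r) {h : Plane → ℝ} (hh : ContDiff ℝ ∞ h)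
    (hreg : fderiv ℝ h 0 ≠ 0) {X₀ Y₀ : VField r} (hX : IsHyperbolicSaddle X₀ 0)
    (hu : ∃ U ∈ 𝓝 (0 : Plane),
      ∀ v ∈ tangentConeAt ℝ (localUnstable X₀ 0 U) 0, fderiv ℝ h 0 v = 0 → v = 0)
    (hs : ∃ U ∈ 𝓝 (0 : Plane),
      ∀ v ∈ tangentConeAt ℝ (localStable X₀ 0 U) 0, fderiv ℝ h 0 v = 0 → v = 0)
    (hY : 0 < lieD Y₀ h 0) {c : ℝ → Plane} {ε : ℝ} (hc : IsSigmaChart h 0 c ε)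
    (hcross : ∀ᶠ x in 𝓝[>] (0 : ℝ), c x ∈ crossing h X₀ Y₀) (B : ℝ) :
    ∃ (ℓ₁ ℓ₂ : Plane →L[ℝ] ℝ) (e₁ e₂ : Plane) (α β κ R R₁ R₂ k b : ℝ),
      SaddleData r h X₀ c ℓ₁ ℓ₂ e₁ e₂ α β κ R R₁ R₂ k b ∧ IsDiagonal (fderiv ℝ X₀ 0) ℓ₁ ℓ₂ α β ∧
      B ≤ R₁ ∧ b < ε ∧ 0 < det2 e₁ (-e₂) * sigmaOrient h 0 (deriv c 0) := by
  obtain ⟨ℓ₁, ℓ₂, e₁, e₂, α, β, hα, hβ, hcoord, hA, hdh⟩ := exists_normal_form hr X₀ hX hu hs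
  obtain ⟨κ, hκ, hsmall⟩ := exists_smallError hα hβ
  obtain ⟨R, hR, hRball, hunif⟩ := exists_uniformModel hr hh hcoord hX.1 hA hdh hκ
    (Metric.ball_mem_nhds (0 : Plane) one_pos)
  obtain ⟨hk, hk'⟩ := chart_direction hr hh hcoord hα hβ hX.1 hA hdh hc hY Y₀.contDiff'.continuous
    hcross
  obtain ⟨b, hb, hbε, hchart, hmem⟩ := exists_chartModel hc hk hk'
    (box_mem_nhds (ℓ₁ := ℓ₁) (ℓ₂ := ℓ₂) hR)
  obtain ⟨W, hW0, hW⟩ := hc.exists_coordinate hh hreg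
  have hWb : ∀ᶠ q in 𝓝 (0 : Plane), W q ∈ Ioo (-b) b ∧ (h q = 0 → c (W q) = q) :=
    (hW.self_of_nhds.1.continuousAt.eventually
      (by rw [hW0]; exact Ioo_mem_nhds (by linarith) hb)).and (hW.mono fun q hq => hq.2)
  obtain ⟨R₂, hR₂, hbox⟩ := hcoord.exists_box_subset hWb
  refine ⟨ℓ₁, ℓ₂, e₁, e₂, α, β, κ, R, max 1 B, min R₂ R, ℓ₁ (deriv c 0), b,
    { one_le := hr
      smooth := hh
      coord := hcoord
      small := hsmall
      zero := hX.1
      R_pos := hR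
      norm_lt := fun p hp => (mem_ball_zero_iff.1 (hRball hp)).trans_le (le_max_left _ _)
      uniform := hunif
      b_pos := hb
      chart := hchart
      chart_zero := hc.center
      chart_mem := hmem
      R₂_pos := lt_min hR₂ hR
      R₂_le := min_le_right _ _
      surj := fun q hq hq0 => by
        obtain ⟨h1, h2⟩ := hbox (box_mono (min_le_left _ _) hq)
        exact ⟨W q, h1, h2 hq0⟩ }, hA, le_max_right _ _, hbε, ?_⟩
  -- The chart runs along a positive multiple of `e₁ - e₂`. Together with `dh(e₁) = 1`, this relates
  -- the orientation of the section direction `-e₂` to that of Σ.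
  have hdir : deriv c 0 = ℓ₁ (deriv c 0) • (e₁ + -e₂) := by
    conv_lhs => rw [hcoord.decomp (deriv c 0), hk']
    simp
  have h1 := det2_mul_sigmaOrient (h := h) (p := 0) (v := e₁) (w := deriv c 0)
    (by rw [hdh, hk']; ring)
  rw [hdh e₁, hcoord.l11, hcoord.l21, add_zero, one_mul, hdir, det2_smul_right, det2_add_right,
    det2_self, zero_add, ← hdir] at h1
  rw [← h1]
  have h2 : det2 e₁ (-e₂) ≠ 0 := by
    have : det2 e₁ (-e₂) = -det2 e₁ e₂ := by simp [det2]; ring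
    rw [this]
    exact neg_ne_zero.2 hcoord.det_ne_zero
  have h3 := gradient_sq_pos hreg
  have h4 := mul_pos (mul_pos hk (mul_self_pos.2 h2)) h3
  linarith

end BoundarySaddle

theorem mainTheorem11 (r : ℕ∞) (hr : 1 ≤ r)
    (h : Plane → ℝ) (hh : ContDiff ℝ ∞ h) (hreg : ∀ p ∈ switching h, fderiv ℝ h p ≠ 0)
    (Z₀ : NSField r) (P : Plane)
    (hBS : BS h Z₀.1 Z₀.2 0) (hBSC : BSC h Z₀.1 Z₀.2 0 P)
    -- a chart `x` of the switching manifold near the saddle, with crossing for `x > 0`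
    (c : ℝ → Plane) (ε : ℝ) (hc : IsSigmaChart h 0 c ε)
    (hcross : ∀ᶠ x in 𝓝[>] (0 : ℝ), c x ∈ crossing h Z₀.1 Z₀.2)
    -- a chart of the switching manifold near `P`, with the same orientation
    (cP : ℝ → Plane) (εP : ℝ) (hcP : IsSigmaChart h P cP εP)
    (horient : 0 < sigmaOrient h 0 (deriv c 0) * sigmaOrient h P (deriv cP 0)) :
    ∃ (a : NSField r → ℝ) (S : NSField r → Plane),
      Tendsto a (𝓝 Z₀) (𝓝 0) ∧ Tendsto S (𝓝 Z₀) (𝓝 0) ∧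
      -- the transition `ρ₁` takes place in an arbitrarily small neighbourhood of the saddle
      ∀ U ∈ 𝓝 (0 : Plane),
      ∃ (s : ℝ → Plane) (η ηP : ℝ), 0 < η ∧ 0 < ηP ∧ ηP ≤ εP ∧
        IsTransit Z₀.1 (posRegion h) (s 0) P ∧
      ∃ 𝒱 ∈ 𝓝 Z₀, ∀ Z ∈ 𝒱,
        IsHyperbolicSaddle Z.1 (S Z) ∧ S Z ∈ U ∧ IsSection Z.1 (posRegion h ∩ U) s η ∧
        ∃ (δ : ℝ) (π ρ₁ ρ₂ ρ₃ : ℝ → ℝ), 0 < δ ∧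
          -- the domain of the first return map
          (∀ x ∈ Ico (a Z) (a Z + δ), x ∈ Ioo (-ε) ε ∧ c x ∈ U ∧ 0 < lieD Z.2 h (c x)) ∧
          (∀ x ∈ Ioo (a Z) (a Z + δ), c x ∈ crossing h Z.1 Z.2) ∧
          -- the first return map
          ContinuousOn π (Ico (a Z) (a Z + δ)) ∧
          (∀ x ∈ Ioo (a Z) (a Z + δ), ∀ y ∈ Ioo (-ε) ε,
            IsFirstReturn h Z.1 Z.2 (c x) (c y) ↔ y = π x) ∧
          (h (S Z) < 0 → IsFirstReturn h Z.1 Z.2 (c (a Z)) (c (π (a Z)))) ∧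
          (0 ≤ h (S Z) → IsSaddleReturn h Z.1 Z.2 (S Z) (c (a Z)) (c (π (a Z)))) ∧
          -- the factorization
          EqOn π (ρ₃ ∘ ρ₂ ∘ ρ₁) (Ico (a Z) (a Z + δ)) ∧
          -- `ρ₁` is the transition to the section near a visible fold or a saddle
          MapsTo ρ₁ (Ico (a Z) (a Z + δ)) (Ioo (-η) η) ∧
          ContinuousOn ρ₁ (Ico (a Z) (a Z + δ)) ∧
          StrictMonoOn ρ₁ (Ico (a Z) (a Z + δ)) ∧
          (∀ x ∈ Ioo (a Z) (a Z + δ),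
            IsTransit Z.1 ((posRegion h ∩ U) \ s '' Ioo (-η) η) (c x) (s (ρ₁ x))) ∧
          (h (S Z) < 0 → IsVisibleFold h Z.1 (c (a Z)) ∧
            IsTransit Z.1 ((posRegion h ∩ U) \ s '' Ioo (-η) η) (c (a Z)) (s (ρ₁ (a Z)))) ∧
          (h (S Z) = 0 → c (a Z) = S Z) ∧
          (0 ≤ h (S Z) →
            IsSaddleTransit Z.1 ((posRegion h ∩ U) \ s '' Ioo (-η) η) (S Z)
              (c (a Z)) (s (ρ₁ (a Z)))) ∧
          -- `ρ₂` is the transition along `X` from the section to the switching manifold near `P`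
          MapsTo ρ₂ (Ioo (-η) η) (Ioo (-ηP) ηP) ∧
          IsOrientationReversingDiffeo r ρ₂ (Ioo (-η) η) ∧
          (∀ u ∈ Ioo (-η) η, IsTransit Z.1 (posRegion h) (s u) (cP (ρ₂ u))) ∧
          -- `ρ₃` is the transition along `Y` back to the switching manifold near the origin
          MapsTo ρ₃ (Ioo (-ηP) ηP) (Ioo (-ε) ε) ∧
          IsOrientationReversingDiffeo r ρ₃ (Ioo (-ηP) ηP) ∧
          (∀ w ∈ Ioo (-ηP) ηP, IsTransit Z.2 (negRegion h) (cP w) (c (ρ₃ w))) := by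
  have hhd : Differentiable ℝ h := hh.differentiable (by simp)
  have h0 : h 0 = 0 := hBS.mem
  have hP0 : h P = 0 := hBSC.mem
  have hneg : {x | 0 < (-h) x} = negRegion h := by ext x; simp [negRegion]
  have hlie : ∀ p, lieD Z₀.2 (-h) p = -lieD Z₀.2 h p := fun p => by simp [lieD, fderiv_neg]
  -- The transit through Σ⁻ gives weak signs of `Yh` at both ends; transversality makes them strict.
  obtain ⟨hYP, hY0⟩ := IsTransit.lieD_nonneg (g := -h) hhd.neg (by rw [hneg]; exact hBSC.Y_transit)
  rw [hlie] at hYP hY0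
  replace hYP : lieD Z₀.2 h P < 0 :=
    lt_of_le_of_ne (by linarith [hYP (by simp [hP0])]) hBSC.Y_transversal
  replace hY0 : 0 < lieD Z₀.2 h 0 :=
    lt_of_le_of_ne (by linarith [hY0 (by simp [h0])]) hBS.Y_transversal.symm
  have hXP : lieD Z₀.1 h P < 0 :=
    lt_of_le_of_ne (hBSC.unstable.lieD_nonpos hhd hP0) hBSC.X_transversal
  obtain ⟨B, hB⟩ := hBSC.unstable.exists_flow hr
  obtain ⟨ℓ₁, ℓ₂, e₁, e₂, α, β, κ, R, R₁, R₂, k, b, D, hA, hBR, hbε, hsign⟩ :=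
    exists_saddleData hr hh (hreg 0 hBS.mem) hBS.saddle hBS.unstable_transversal
      hBS.stable_transversal hY0 hc hcross B
  obtain ⟨hPn, hPpos, hPlim⟩ := hB R₁ hBR
  refine ⟨fun Z => SaddleData.base h ℓ₁ ℓ₂ R R₁ c b Z.1, fun Z => SaddleData.saddle ℓ₁ ℓ₂ R Z.1,
    (D.tendsto_base hA).comp (continuous_fst.tendsto Z₀),
    (D.tendsto_saddle hA).comp (continuous_fst.tendsto Z₀), fun U hU => ?_⟩
  have hlieY : Continuous fun q : VField r × Plane => lieD q.1 h q.2 :=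
    ((hh.continuous_fderiv (by simp)).comp continuous_snd).clm_apply VField.continuous_apply
  have hYnear0 : ∀ᶠ q : VField r × Plane in 𝓝 Z₀.2 ×ˢ 𝓝 0, 0 < lieD q.1 h q.2 := by
    rw [← nhds_prod_eq]
    exact hlieY.continuousAt.eventually_const_lt hY0
  obtain ⟨A₁, hA₁, N, hN, hAN⟩ := eventually_prod_iff.1 hYnear0
  obtain ⟨t₀, η₁, w₀, ht₀, hη₁, hw₀, hspeed, hsU, hfirst⟩ := D.exists_section hA hPpos hPlim hU hN
  obtain ⟨η₂, hη₂, hreturn⟩ :=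
    exists_return_transit hr hh hc hcP hY0 hYP hBSC.Y_transit horient
  have hYnearP : ∀ᶠ q : VField r × ℝ in 𝓝 Z₀.2 ×ˢ 𝓝 0, lieD q.1 h (cP q.2) < 0 := by
    rw [← nhds_prod_eq]
    have h1 : ContinuousAt (fun q : VField r × ℝ => lieD q.1 h (cP q.2)) (Z₀.2, 0) :=
      ContinuousAt.comp (g := fun q : VField r × Plane => lieD q.1 h q.2)
        (f := fun q : VField r × ℝ => (q.1, cP q.2)) hlieY.continuousAt
        (continuousAt_fst.prodMk (ContinuousAt.comp (g := cP) (f := Prod.snd)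
          (hcP.contDiffAt hcP.zero_mem).continuousAt continuousAt_snd))
    exact h1.eventually_lt_const (by simpa only [hcP.center] using hYP)
  obtain ⟨A₂, hA₂, N₂, hN₂, hAN₂⟩ := eventually_prod_iff.1 hYnearP
  obtain ⟨η₃, hη₃, hball⟩ := Metric.eventually_nhds_iff.1 hN₂
  -- Bounded by the domain of `ρ₃`, by the range where `Yh < 0` near `P`, and by the chart at `P`.
  -- It precedes the choice of `η`, since `ρ₂` has to map into this interval.
  set ηP := min (min η₂ η₃) εP with hηPdef
  have hηP : 0 < ηP := lt_min (lt_min hη₂ hη₃) hcP.pos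
  set s : ℝ → Plane := fun u => w₀ - u • e₂ with hs
  have hs0 : s 0 = w₀ := by simp [hs]
  have hsd : ∀ u, HasDerivAt s (-e₂) u := fun u => by
    have := ((hasDerivAt_id u).smul_const e₂).const_sub w₀
    rwa [one_smul] at this
  have hsmooth : ContDiff ℝ ∞ s := contDiff_const.sub (contDiff_id.smul contDiff_const)
  have htransit : IsTransit Z₀.1 (posRegion h) (s 0) P := by
    have hφ := isGlobalFlow_cutFlow hr R₁ Z₀.1
    obtain ⟨K, hK⟩ := exists_lipschitzWith_cutoff hr R₁ Z₀.1
    have hadd : ∀ t, cutFlow R₁ Z₀.1 t (s 0) = cutFlow R₁ Z₀.1 (-(t₀ - t)) P := fun t => by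
      rw [hs0, ← hw₀, ← hφ.add hK]; congr 1; ring
    refine hφ.isTransit ht₀ (fun t ht => ?_) ?_ fun t ht => ?_
    · rw [hadd]; exact (hPn _ (by linarith [ht.2])).trans hBR
    · rw [hadd, sub_self, neg_zero, hφ.zero]
    · rw [hadd]; exact hPpos _ (by linarith [ht.2])
  obtain ⟨η₄, hη₄, hsecond⟩ := exists_reversing_transit hr (X₀ := Z₀.1) hh
    (Eventually.of_forall fun u => hsmooth.contDiffAt) htransit hXP
    (Or.inl (hsU 0 ⟨by linarith, hη₁⟩).1) hcP
    (by
      rw [hs0, (hsd 0).deriv]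
      have h1 := det2_mul_apply ℓ₁ (v := Z₀.1 w₀) (w := -e₂) (u := e₁)
        (by rw [map_neg, D.coord.l12, neg_zero])
      rw [D.coord.l11, mul_one] at h1
      have h2 := hcP.fderiv_deriv hh hcP.zero_mem
      rw [hcP.center] at h2
      have h3 := det2_mul_sigmaOrient (v := Z₀.1 P) h2
      have h4 := gradient_sq_pos (hreg P hBSC.mem)
      set G := (fderiv ℝ h P (EuclideanSpace.single 0 1)) ^ 2 +
        (fderiv ℝ h P (EuclideanSpace.single 1 1)) ^ 2
      set σ₀ := sigmaOrient h 0 (deriv c 0)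
      set σP := sigmaOrient h P (deriv cP 0)
      -- Orientations are compared through Σ at the saddle: `hsign` relates the section to the chart
      -- `c`, and `horient` relates `c` to `cP`. The factor `G (σ₀ σ₀)` does not affect the sign.
      have h5 : det2 (Z₀.1 w₀) (-e₂) * det2 (Z₀.1 P) (deriv cP 0) * (G * (σ₀ * σ₀)) =
          ℓ₁ (Z₀.1 w₀) * lieD Z₀.1 h P * ((det2 e₁ (-e₂) * σ₀) * (σ₀ * σP)) := by
        rw [h1, lieD]
        linear_combination ℓ₁ (Z₀.1 w₀) * det2 e₁ (-e₂) * σ₀ * σ₀ * h3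
      have h6 := mul_neg_of_neg_of_pos (mul_neg_of_pos_of_neg hspeed hXP) (mul_pos hsign horient)
      rw [← h5] at h6
      exact neg_of_mul_neg_left h6 (mul_nonneg h4.le (mul_self_nonneg _)))
    (Ioo_mem_nhds (neg_lt_zero.2 hηP) hηP)
  set η := min η₁ η₄
  have hη : 0 < η := lt_min hη₁ hη₄
  refine ⟨s, η, ηP, hη, hηP, min_le_right _ _, htransit, Eventually.exists_mem ?_⟩
  filter_upwards [(continuous_fst.tendsto Z₀).eventually (hfirst η hη),
    (continuous_fst.tendsto Z₀).eventually (hsecond η (min_le_right _ _)),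
    (continuous_snd.tendsto Z₀).eventually
      (hreturn ηP ((min_le_left _ _).trans (min_le_left _ _))),
    (continuous_snd.tendsto Z₀).eventually hA₁, (continuous_snd.tendsto Z₀).eventually hA₂]
  rintro Z ⟨hsad, hSU, haI, hbound, δ, hδ, hδb, hcU, hXpos, ρ₁, hρ₁⟩ ⟨ρ₂, h2maps, h2rev, h2⟩
    ⟨ρ₃, h3maps, h3rev, h3⟩ hZ₁ hZ₂
  set S := SaddleData.saddle ℓ₁ ℓ₂ R Z.1
  set a := SaddleData.base h ℓ₁ ℓ₂ R R₁ c b Z.1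
  have hsubη : ∀ u ∈ Ioo (-η) η, s u ∈ posRegion h ∩ U := fun u hu => by
    have := min_le_left η₁ η₄
    exact hsU u ⟨by linarith [hu.1], by linarith [hu.2]⟩
  have hdom : ∀ x ∈ Ico a (a + δ), x ∈ Ioo (-ε) ε := fun x hx =>
    ⟨by linarith [haI.1, hx.1], by linarith [hx.2]⟩
  have hsub : Ioo a (a + δ) ⊆ Ico a (a + δ) := Ioo_subset_Ico_self
  have haδ : a ∈ Ico a (a + δ) := ⟨le_rfl, by linarith⟩
  have hmapsP : ∀ x ∈ Ico a (a + δ), ρ₂ (ρ₁ x) ∈ Ioo (-ηP) ηP := fun x hx =>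
    h2maps (hρ₁.maps hx)
  have hεP : ∀ w ∈ Ioo (-ηP) ηP, w ∈ Ioo (-εP) εP := fun w hw => by
    have := min_le_right (min η₂ η₃) εP
    exact ⟨by linarith [hw.1], by linarith [hw.2]⟩
  have hcrossP : ∀ u ∈ Ioo (-η) η, cP (ρ₂ u) ∈ crossing h Z.1 Z.2 := fun u hu => by
    have hw := h2maps hu
    refine ⟨hcP.mem _ (hεP _ hw), mul_pos_of_neg_of_neg (h2 u hu).2.2 (hAN₂ hZ₂ (hball ?_))⟩
    have := (min_le_left (min η₂ η₃) εP).trans (min_le_right _ _)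
    rw [Real.dist_eq, sub_zero, abs_lt]
    exact ⟨by linarith [hw.1], by linarith [hw.2]⟩
  have hD : (posRegion h ∩ U) \ s '' Ioo (-η) η ⊆ posRegion h := fun p hp => hp.1.1
  have hcomp : ∀ x ∈ Ico a (a + δ),
      IsTransit Z.1 ((posRegion h ∩ U) \ s '' Ioo (-η) η) (c x) (s (ρ₁ x)) →
      IsTransit Z.1 (posRegion h) (c x) (cP (ρ₂ (ρ₁ x))) := fun x hx ht =>
    (ht.mono hD).trans hr (h2 _ (hρ₁.maps hx)).2.1 (hsubη _ (hρ₁.maps hx)).1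
  have hret : ∀ x ∈ Ico a (a + δ),
      IsTransit Z.1 ((posRegion h ∩ U) \ s '' Ioo (-η) η) (c x) (s (ρ₁ x)) →
      IsFirstReturn h Z.1 Z.2 (c x) (c (ρ₃ (ρ₂ (ρ₁ x)))) := fun x hx ht =>
    ⟨hc.mem x (hdom x hx), hc.mem _ (h3maps (hmapsP x hx)), _, hcrossP _ (hρ₁.maps hx),
      hcomp x hx ht, h3 _ (hmapsP x hx)⟩
  have hnotpos : ∀ p ∈ switching h, p ∉ posRegion h := fun p hp hp' =>
    (show 0 < h p from hp').ne' hp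
  have hnotneg : ∀ p ∈ switching h, p ∉ negRegion h := fun p hp hp' =>
    (show h p < 0 from hp').ne hp
  refine ⟨hsad, hSU, ⟨hsmooth.contDiffOn, ?_, fun u hu => ⟨hsubη u hu, ?_⟩⟩, δ,
    ρ₃ ∘ ρ₂ ∘ ρ₁, ρ₁, ρ₂, ρ₃, hδ,
    fun x hx => ⟨hdom x hx, (hcU x hx).1, hAN hZ₁ (hcU x hx).2⟩,
    fun x hx => ⟨hc.mem x (hdom x (hsub hx)),
      mul_pos (hXpos x hx) (hAN hZ₁ (hcU x (hsub hx)).2)⟩, ?_, fun x hx y hy => ⟨?_, ?_⟩,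
    fun hS => hret a haδ (hρ₁.virtual hS).2, fun hS => ?_, fun x _ => rfl, hρ₁.maps,
    hρ₁.continuous, hρ₁.strictMono, hρ₁.transit, hρ₁.virtual, hbound, hρ₁.real, h2maps, h2rev,
    fun u hu => (h2 u hu).2.1, h3maps, h3rev, h3⟩
  · intro u _ u' _ huu
    have h4 := congrArg ℓ₂ huu
    simpa [hs, D.coord.l22] using h4
  · have h4 := (h2 u hu).1
    rw [LinearIndependent.pair_iff]
    intro x y hxy
    have h5 := congrArg (fun p : Plane => p 0) hxy
    have h6 := congrArg (fun p : Plane => p 1) hxy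
    simp only [PiLp.add_apply, PiLp.smul_apply, smul_eq_mul, PiLp.zero_apply] at h5 h6
    unfold det2 at h4
    constructor
    · refine (mul_eq_zero.1 ?_).resolve_right h4
      linear_combination (deriv s u 1) * h5 - (deriv s u 0) * h6
    · refine (mul_eq_zero.1 ?_).resolve_right h4
      linear_combination (Z.1 (s u) 0) * h6 - (Z.1 (s u) 1) * h5
  · exact h3rev.1.continuousOn.comp (h2rev.1.continuousOn.comp hρ₁.continuous hρ₁.maps)
      fun x hx => hmapsP x hx
  -- Both ends of a transit lie on Σ, outside the open regions, so `IsTransit.end_unique` determines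
  -- first the crossing point and then the return point.
  · rintro ⟨-, hy', m, hm, hm₁, hm₂⟩
    have hmeq := hm₁.end_unique hr (hcomp x (hsub hx) (hρ₁.transit x hx)) (hnotpos _ hm.1)
      (hnotpos _ (hcrossP _ (hρ₁.maps (hsub hx))).1)
    rw [hmeq] at hm₂
    have hz := h3maps (hmapsP x (hsub hx))
    exact hc.inj hy hz (hm₂.end_unique hr (h3 _ (hmapsP x (hsub hx))) (hnotneg _ hy')
      (hnotneg _ (hc.mem _ hz)))
  · rintro rfl
    exact hret x (hsub hx) (hρ₁.transit x hx)
  · obtain ⟨h4, h5⟩ := hρ₁.real hS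
    exact ⟨hc.mem a (hdom a haδ), hc.mem _ (h3maps (hmapsP a haδ)), _, hcrossP _ (hρ₁.maps haδ),
      ⟨h4.imp_right fun h6 => h6.mono hD, (h5.mono hD).trans hr (h2 _ (hρ₁.maps haδ)).2.1
        (hsubη _ (hρ₁.maps haδ)).1⟩, h3 _ (hmapsP a haδ)⟩
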